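/- Let $\bigwedge_\infty=\bigwedge_\infty^0\oplus\bigwedge_\infty^1$ be the Grassmann algebra over $\mathbb C$ on countably many generators (direct limit of the finitely generated ones), $a=a_B+a_S$ the decomposition into body $a_B\in\mathbb C$ and soul. Write $\tilde E(A,M)(x,\varphi)=\exp\bigl(-\sum_{j\ge1}(A_jL_j+M_{j-1/2}G_{j-1/2})\bigr)\cdot(x,\varphi)$ with $L_j=-\bigl(x^{j+1}\partial_x+\tfrac{j+1}2\varphi x^j\partial_\varphi\bigr)$, $G_{j-1/2}=-x^j(\partial_\varphi-\varphi\partial_x)$, and let $\mathcal H$ be the set of all $(A,M)$, $A_j\in\bigwedge_\infty^0$, $M_{j-1/2}\in\bigwedge_\infty^1$ $(j\ge 1)$, for which $\tilde E(A,M)$ converges absolutely in a DeWitt neighborhood of $0$. **Moduli.** $SK(0)$ is the set of $(A,M)\in\mathcal H$ with $A_1=M_{1/2}=0$. For $n\ge1$, $SK(n)$ is the set of tuples $((z_1,\theta_1),\dots,(z_{n-1},\theta_{n-1});(A^{(0)},M^{(0)}),(a^{(1)},A^{(1)},M^{(1)}),\dots,(a^{(n)},A^{(n)},M^{(n)}))$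 with $z_i$ even, $\theta_i$ odd, the bodies $(z_i)_B$ nonzero and distinct, $(A^{(k)},M^{(k)})\in\mathcal H$, and $a^{(k)}$ even and invertible. Such a tuple names the superconformal equivalence class of the super-Riemann sphere with one negatively oriented puncture at $\infty$, with local coordinate $\tilde E(A^{(0)},-iM^{(0)})(1/w,i\rho/w)$, and positively oriented punctures $(z_1,\theta_1),\dots,(z_{n-1},\theta_{n-1}),(z_n,\theta_n)=(0,0)$, with local coordinates $\bigl((a^{(k)})^2\tilde E^0,\ a^{(k)}\tilde E^1\bigr)$, where $(\tilde E^0,\tilde E^1)=\tilde E(A^{(k)},M^{(k)})(w-z_k-\rho\theta_k,\rho-\theta_k)$ (equivalence: a superconformal isomorphism preserving punctures and germs of local coordinates); an element of $SK(0)$ names a sphere with only the puncture at $\infty$. $Q_1\,{}_i\infty_0\,Q_2$ denotes the class obtained by sewing the $i$-th positively oriented puncture of $Q_1$ to the negatively oriented puncture of $Q_2$: a DeWitt ball around each is removed and super-annuli are identified through the local coordinates by $I(w,\rho)=(1/w,i\rho/w)$. A bold $\mathbf 0$ denotes zero data $(A,M)$; $(\mathbf 0,M(\epsilon,3/2))\in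 SK(0)$, $\epsilon\in\bigwedge^1_\infty$, has all components zero except $M_{3/2}=\epsilon$; and $e=(\mathbf 0,(1,\mathbf 0))\in SK(1)$. **Superfunctions.** $SD(1)$ is the algebra of functions $F:SK(1)\to\bigwedge_\infty$ that are polynomials, with coefficients in $\bigwedge_\infty$, in $a^{(1)},(a^{(1)})^{-1},A^{(k)}_j,M^{(k)}_{j-1/2}$ ($k=0,1$, $j\ge1$). An even (respectively odd) supermeromorphic tangent vector at $Q\in SK(1)$ is a linear map $L:SD(1)\to\bigwedge_\infty$ (linear over $\bigwedge_\infty$ acting on the right) with $L(F_1F_2)=L(F_1)F_2(Q)+F_1(Q)L(F_2)$ (respectively, for $F_1$ of homogeneous parity $\eta(F_1)$, $L(F_1F_2)=L(F_1)F_2(Q)+(-1)^{\eta(F_1)}F_1(Q)L(F_2)$); $T_QSK(1)$ is the set of sums of an even and an odd one. Derivatives are left derivatives: for an odd variable $y$, $\Delta y\cdot\partial F/\partial y=F(y+\Delta y)-F(y)$; for an even variable $x$, $\Delta x\cdot\partial F/\partial x=F(x+\Delta x)-F(x)$ up to a multiple of $(\Delta x)^2$. **Proposition.** Let $z\in\bigwedge_\infty^0$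 be invertible and $\theta\in\bigwedge_\infty^1$. For every $\epsilon\in\bigwedge_\infty^1$ the sewing $$Q_\epsilon=\bigl((z,\theta);\mathbf 0,(1,\mathbf 0),(1,\mathbf 0)\bigr)\,{}_1\infty_0\,\bigl(\mathbf 0,M(\epsilon,3/2)\bigr)$$ exists and is a unique element of $SK(1)$; for every $F\in SD(1)$ the derivative $$\mathcal G_e(z,\theta)F=\frac{d}{d\epsilon}F(Q_\epsilon)\Big|_{\epsilon=0}$$ exists and is unique; the functional $\mathcal G_e(z,\theta)$ lies in $T_eSK(1)$; the partial derivatives at $e$ occurring below exist and are unique on $SD(1)$, with only finitely many nonzero on each $F$; and $$\mathcal G_e(z,\theta)=\sum_{k=0}^1\sum_{j\ge1}z^{-(2k-1)j-2+k}\frac{\partial}{\partial M^{(k)}_{j-1/2}}\Big|_e+2\theta\Bigl(z^{-2}\,\frac12\frac{\partial}{\partial a^{(1)}}\Big|_e+\sum_{k=0}^1\sum_{j\ge1}z^{-(2k-1)j-2}\frac{\partial}{\partial A^{(k)}_j}\Big|_e\Bigr).$$ -/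

import Mathlib

noncomputable section

namespace SuperSewing

/-! ## The infinite Grassmann algebra, body, soul, parity -/

/-- The Grassmann algebra over `ℂ` on generators `ζ_0, ζ_1, ζ_2, …` (the direct limit of the
Grassmann algebras on finitely many generators): the exterior algebra of `⨁_ℕ ℂ`. -/
abbrev GInf : Type := ExteriorAlgebra ℂ (ℕ →₀ ℂ)

/-- The even subspace. -/
def gEven : Submodule ℂ GInf := CliffordAlgebra.evenOdd (0 : QuadraticForm ℂ (ℕ →₀ ℂ)) 0

/-- The odd subspace. -/
def gOdd : Submodule ℂ GInf := CliffordAlgebra.evenOdd (0 : QuadraticForm ℂ (ℕ →₀ ℂ)) 1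

/-- The homogeneous subspaces, indexed by parity. -/
def gParity (p : ZMod 2) : Submodule ℂ GInf :=
  CliffordAlgebra.evenOdd (0 : QuadraticForm ℂ (ℕ →₀ ℂ)) p

/-- The body `a_B`: the component on the empty product of generators. -/
def body (a : GInf) : ℂ := ExteriorAlgebra.algebraMapInv a

/-- The soul `a_S = a - a_B`. -/
def soul (a : GInf) : GInf := a - algebraMap ℂ GInf (body a)

/-! ## Superanalytic and superconformal superfunctions in (1,1) variables -/

/-- `f' = df/dz` at `z` for a Grassmann-valued function of a complex variable, coefficientwise:
every linear functional (in particular every coefficient in the basis of products of the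
generators) of `f` is complex differentiable with the corresponding derivative. -/
def HasGDerivAt (f : ℂ → GInf) (f' : GInf) (z : ℂ) : Prop :=
  ∀ l : Module.Dual ℂ GInf, HasDerivAt (fun t => l (f t)) (l f') z

/-- `D` is the sequence of derivatives of the analytic Grassmann-valued function `D 0` on `V`. -/
def IsJetOn (V : Set ℂ) (D : ℕ → ℂ → GInf) : Prop :=
  ∀ n, ∀ z ∈ V, HasGDerivAt (D n) (D (n + 1) z) z

/-- The value at an even `w` of the analytic function with derivatives `D`, i.e. the Taylor
expansion `∑ₙ w_Sⁿ / n! · f⁽ⁿ⁾(w_B)` about the body (a finite sum, as `w_S` is nilpotent). -/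
def jetEval (D : ℕ → ℂ → GInf) (w : GInf) : GInf :=
  ∑ᶠ n : ℕ, ((Nat.factorial n : ℂ)⁻¹) • (soul w ^ n * D n (body w))

/-- The derivative of an analytic function, on the level of sequences of derivatives. -/
def jetDeriv (D : ℕ → ℂ → GInf) : ℕ → ℂ → GInf := fun n => D (n + 1)

/-- A pair `(w, ρ)`; it is a point of (1,1)-superspace if `w` is even and `ρ` is odd. -/
abbrev SPt : Type := GInf × GInf

def superspace : Set SPt := {x | x.1 ∈ gEven ∧ x.2 ∈ gOdd}

/-- The DeWitt open set over an open set `V` of bodies. -/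
def overBody (V : Set ℂ) : Set SPt := {x | x ∈ superspace ∧ body x.1 ∈ V}

/-- `h` is superconformal on the DeWitt open set `U`: there
`h(w,ρ) = (f(w) + ρ ξ(w), ψ(w) + ρ g(w))` with `f, g` even and `ξ, ψ` odd analytic,
`ξ = g ψ`, `g² = f' + ψ ψ'` and `D ρ̃ = g + ρ ψ'` not identically zero. -/
def IsSuperconformalOn (U : Set SPt) (h : SPt → SPt) : Prop :=
  ∃ V : Set ℂ, IsOpen V ∧ U = overBody V ∧
  ∃ f ξ ψ g : ℕ → ℂ → GInf,
    IsJetOn V f ∧ IsJetOn V ξ ∧ IsJetOn V ψ ∧ IsJetOn V g ∧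
    (∀ z ∈ V, f 0 z ∈ gEven ∧ ξ 0 z ∈ gOdd ∧ ψ 0 z ∈ gOdd ∧ g 0 z ∈ gEven) ∧
    (∀ x ∈ U, h x =
      (jetEval f x.1 + x.2 * jetEval ξ x.1, jetEval ψ x.1 + x.2 * jetEval g x.1)) ∧
    (∀ x ∈ U, jetEval ξ x.1 = jetEval g x.1 * jetEval ψ x.1 ∧
      jetEval g x.1 ^ 2 =
        jetEval (jetDeriv f) x.1 + jetEval ψ x.1 * jetEval (jetDeriv ψ) x.1) ∧
    (U.Nonempty → ∃ x ∈ U, jetEval g x.1 + x.2 * jetEval (jetDeriv ψ) x.1 ≠ 0)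

/-- The superconformal inversion `I(w,ρ) = (1/w, iρ/w)`. -/
def inversion (x : SPt) : SPt := (Ring.inverse x.1, Complex.I • (x.2 * Ring.inverse x.1))

/-- Its inverse `I⁻¹(w,ρ) = (1/w, -iρ/w)`. -/
def inversionInv (x : SPt) : SPt := (Ring.inverse x.1, -(Complex.I • (x.2 * Ring.inverse x.1)))

/-- The superconformal shift `s_{(z,θ)}(w,ρ) = (w - z - ρθ, ρ - θ)`. -/
def superShift (z θ : GInf) (x : SPt) : SPt := (x.1 - z - x.2 * θ, x.2 - θ)

/-! ## Surfaces given by charts, tubes, superconformal equivalence, sewing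

A chart with values in superspace is recorded by its graph `c : X → SPt → Prop`:
`c p x` says that `p` lies in the domain of the chart and has coordinate `x`. -/

/-- A set with an atlas of superspace-valued charts. -/
structure SuperSurface where
  Carrier : Type
  atlas : Set (Carrier → SPt → Prop)

/-- `F` is superconformal: in all charts `α`, `β` it is a superconformal superfunction on the
(DeWitt open) set of coordinates where `β ∘ F ∘ α⁻¹` is defined. -/
def IsSuperconformalMap (S T : SuperSurface) (F : S.Carrier → T.Carrier) : Prop :=
  ∀ α ∈ S.atlas, ∀ β ∈ T.atlas, ∃ h : SPt → SPt,
    IsSuperconformalOn {x | ∃ p y, α p x ∧ β (F p) y} h ∧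
    ∀ p x y, α p x → β (F p) y → y = h x

/-- A surface with `1 + n` tubes: local coordinates numbered `0, …, n`, number `0` being the
negatively oriented one. The `k`-th puncture is the point where the `k`-th local coordinate
vanishes. -/
structure TubedSurface (n : ℕ) extends SuperSurface where
  coord : Fin (n + 1) → Carrier → SPt → Prop

/-- `p` is the `k`-th puncture. -/
def TubedSurface.IsPuncture {n : ℕ} (C : TubedSurface n) (k : Fin (n + 1)) (p : C.Carrier) : Prop :=
  C.coord k p (0, 0)

/-- Superconformal equivalence of surfaces with tubes: a superconformal isomorphism carrying
punctures to punctures and germs of local coordinates at the punctures to each other (the two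
local coordinates agree on the preimage of some DeWitt ball about `0`). -/
def SuperconformallyEquivalent {n : ℕ} (C C' : TubedSurface n) : Prop :=
  ∃ F : C.Carrier ≃ C'.Carrier,
    IsSuperconformalMap C.toSuperSurface C'.toSuperSurface F ∧
    IsSuperconformalMap C'.toSuperSurface C.toSuperSurface F.symm ∧
    ∀ k : Fin (n + 1), ∃ s : ℝ, 0 < s ∧ ∀ x ∈ superspace, ‖body x.1‖ < s →
      ∃ p, C.coord k p x ∧ C'.coord k (F p) x

section Sewing

variable {m n : ℕ} (C₁ : TubedSurface (m + 1)) (i : Fin (m + 1)) (C₂ : TubedSurface n)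
  (r r₁ r₂ : ℝ)

/-- The `(i+1)`-st puncture of `C₁` can be sewn with the `0`-th puncture of `C₂` using the radii
`r₂ < r < r₁`: the closed DeWitt balls of radius `r`, `r₁` lie in the image of the local coordinate
of `C₁`, those of radius `1/r`, `1/r₂` in that of `C₂`, and the preimages of the balls of
radius `r` and `1/r` contain no other puncture. -/
def CanSew : Prop :=
  0 < r₂ ∧ r₂ < r ∧ r < r₁ ∧
  (∀ x ∈ superspace, ‖body x.1‖ ≤ r₁ → ∃ p, C₁.coord i.succ p x) ∧
  (∀ y ∈ superspace, ‖body y.1‖ ≤ r₂⁻¹ → ∃ q, C₂.coord 0 q y) ∧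
  (∀ k, k ≠ i.succ → ∀ p, C₁.IsPuncture k p → ¬ ∃ x, C₁.coord i.succ p x ∧ ‖body x.1‖ ≤ r) ∧
  (∀ k, k ≠ 0 → ∀ q, C₂.IsPuncture k q → ¬ ∃ y, C₂.coord 0 q y ∧ ‖body y.1‖ ≤ r⁻¹)

/-- `C₁` without the preimage of the closed ball of radius `r₂`. -/
def sewnPart₁ : Type := {p : C₁.Carrier // ¬ ∃ x, C₁.coord i.succ p x ∧ ‖body x.1‖ ≤ r₂}

/-- `C₂` without the preimage of the closed ball of radius `1/r₁`. -/
def sewnPart₂ : Type := {q : C₂.Carrier // ¬ ∃ y, C₂.coord 0 q y ∧ ‖body y.1‖ ≤ r₁⁻¹}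

/-- Points with local coordinates `x` and `I(x)` in the super-annuli are identified. -/
def sewnRel : sewnPart₁ C₁ i r₂ ⊕ sewnPart₂ C₂ r₁ → sewnPart₁ C₁ i r₂ ⊕ sewnPart₂ C₂ r₁ → Prop
  | Sum.inl p, Sum.inr q => ∃ x, C₁.coord i.succ p.1 x ∧ r₂ < ‖body x.1‖ ∧ ‖body x.1‖ < r₁ ∧
      C₂.coord 0 q.1 (inversion x)
  | _, _ => False

/-- The points of the sewn surface. -/
def SewnCarrier : Type := Quot (sewnRel C₁ i C₂ r₁ r₂)

/-- A chart of `C₁` as a chart on the sewn surface. -/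
def pushChart₁ (c : C₁.Carrier → SPt → Prop) : SewnCarrier C₁ i C₂ r₁ r₂ → SPt → Prop :=
  fun s x => ∃ p : sewnPart₁ C₁ i r₂, s = Quot.mk _ (Sum.inl p) ∧ c p.1 x

/-- A chart of `C₂` as a chart on the sewn surface. -/
def pushChart₂ (c : C₂.Carrier → SPt → Prop) : SewnCarrier C₁ i C₂ r₁ r₂ → SPt → Prop :=
  fun s y => ∃ q : sewnPart₂ C₂ r₁, s = Quot.mk _ (Sum.inr q) ∧ c q.1 y

/-- The sewn surface, with local coordinates numbered as
`p_0, …, p_i, q_1, …, q_n, p_{i+2}, …, p_{m+1}` (the puncture `i + 1` of `C₁` being sewn), each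
restricted to the complement of the preimage of the closed ball of radius `r`, `1/r`. -/
def sewn : TubedSurface (m + n) where
  Carrier := SewnCarrier C₁ i C₂ r₁ r₂
  atlas := {c | (∃ c₁ ∈ C₁.atlas, c = pushChart₁ C₁ i C₂ r₁ r₂ c₁) ∨
    (∃ c₂ ∈ C₂.atlas, c = pushChart₂ C₁ i C₂ r₁ r₂ c₂)}
  coord := fun k =>
    if h₁ : (k : ℕ) < i + 1 then
      pushChart₁ C₁ i C₂ r₁ r₂ fun p x =>
        C₁.coord ⟨k, by omega⟩ p x ∧ ¬ ∃ x', C₁.coord i.succ p x' ∧ ‖body x'.1‖ ≤ r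
    else if h₂ : (k : ℕ) < i + 1 + n then
      pushChart₂ C₁ i C₂ r₁ r₂ fun q y =>
        C₂.coord ⟨k - i, by omega⟩ q y ∧ ¬ ∃ y', C₂.coord 0 q y' ∧ ‖body y'.1‖ ≤ r⁻¹
    else
      pushChart₁ C₁ i C₂ r₁ r₂ fun p x =>
        C₁.coord ⟨k - n + 1, by omega⟩ p x ∧ ¬ ∃ x', C₁.coord i.succ p x' ∧ ‖body x'.1‖ ≤ r

end Sewing

/-! ## The super-Riemann sphere -/

/-- The points of the super-Riemann sphere: `south w ρ` is the point with coordinate `(w,ρ)` in the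
chart about zero; the remaining points are given by their coordinate `(x,φ)`, of body zero, in
the chart about infinity. -/
inductive SSphere : Type
  | south (w ρ : GInf) (hw : w ∈ gEven) (hρ : ρ ∈ gOdd) : SSphere
  | infinity (x φ : GInf) (hx : x ∈ gEven) (hφ : φ ∈ gOdd) (h0 : body x = 0) : SSphere

/-- The chart `Δ` about zero. -/
def southChart (p : SSphere) (x : SPt) : Prop := ∃ hw hρ, p = SSphere.south x.1 x.2 hw hρ

/-- The chart `Υ` about infinity, normalized by `Δ ∘ Υ⁻¹ = I`. -/
def northChart (p : SSphere) (y : SPt) : Prop :=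
  (∃ x, southChart p x ∧ body x.1 ≠ 0 ∧ y = inversionInv x) ∨
  (∃ hx hφ h0, p = SSphere.infinity y.1 y.2 hx hφ h0)

def superSphere : SuperSurface where
  Carrier := SSphere
  atlas := {southChart, northChart}

/-! ## Exponentials of infinitesimal superconformal transformations

An element `p(x) + φ q(x)` of `⋀_∞[[x]][φ]` is recorded as the pair `(p, q)`. The sequences
`A = (A_j)_{j ≥ 1}` and `M = (M_{j - 1/2})_{j ≥ 1}` are indexed by `j`. -/

/-- Formal differentiation of power series. -/
def dX (p : PowerSeries GInf) : PowerSeries GInf :=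
  PowerSeries.mk fun k => ((k + 1 : ℕ) : ℂ) • PowerSeries.coeff (k + 1) p

/-- `α(x) = ∑_{j ≥ 1} A_j x^{j+1}`. -/
def alphaSeries (A : ℕ+ → GInf) : PowerSeries GInf :=
  PowerSeries.mk fun k => if h : 2 ≤ k then A ⟨k - 1, by omega⟩ else 0

/-- `μ(x) = ∑_{j ≥ 1} M_{j-1/2} x^j`. -/
def muSeries (M : ℕ+ → GInf) : PowerSeries GInf :=
  PowerSeries.mk fun k => if h : 0 < k then M ⟨k, h⟩ else 0

/-- The even superderivation
`T = -∑_j (A_j L_j(x,φ) + M_{j-1/2} G_{j-1/2}(x,φ))`, where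
`L_j = -(x^{j+1} ∂_x + (j+1)/2 φ x^j ∂_φ)` and `G_{j-1/2} = -x^j (∂_φ - φ ∂_x)`, so that
`T (p + φ q) = (α p' + μ q) + φ (α q' + α' q / 2 + μ p')`. -/
def superDer (A M : ℕ+ → GInf) (u : PowerSeries GInf × PowerSeries GInf) :
    PowerSeries GInf × PowerSeries GInf :=
  (alphaSeries A * dX u.1 + muSeries M * u.2,
   alphaSeries A * dX u.2 + (1 / 2 : ℂ) • (dX (alphaSeries A) * u.2) + muSeries M * dX u.1)

/-- `exp(T) · u = ∑ₖ Tᵏ u / k!`; each coefficient is a finite sum, as `T` raises the order. -/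
def expSuperDer (A M : ℕ+ → GInf) (u : PowerSeries GInf × PowerSeries GInf) :
    PowerSeries GInf × PowerSeries GInf :=
  (PowerSeries.mk fun d => ∑ᶠ k : ℕ,
      ((Nat.factorial k : ℂ)⁻¹) • PowerSeries.coeff d ((superDer A M)^[k] u).1,
   PowerSeries.mk fun d => ∑ᶠ k : ℕ,
      ((Nat.factorial k : ℂ)⁻¹) • PowerSeries.coeff d ((superDer A M)^[k] u).2)

/-- The even part `exp(T) · x` of `Ẽ(A,M)(x,φ)`. -/
def eTildeEven (A M : ℕ+ → GInf) : PowerSeries GInf × PowerSeries GInf :=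
  expSuperDer A M (PowerSeries.X, 0)

/-- The odd part `exp(T) · φ` of `Ẽ(A,M)(x,φ)`. -/
def eTildeOdd (A M : ℕ+ → GInf) : PowerSeries GInf × PowerSeries GInf :=
  expSuperDer A M (0, 1)

/-- The series `∑ₖ pₖ wᵏ` converges absolutely (coefficientwise) to `S`. -/
def HasSeriesValue (p : PowerSeries GInf) (w S : GInf) : Prop :=
  ∀ l : Module.Dual ℂ GInf, HasSum (fun k : ℕ => l (PowerSeries.coeff k p * w ^ k)) (l S)

/-- `Ẽ(A,M)` converges absolutely at `(w,ρ)`, with value `y`. -/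
def HasETildeValue (A M : ℕ+ → GInf) (x y : SPt) : Prop :=
  ∃ f ξ ψ g : GInf,
    HasSeriesValue (eTildeEven A M).1 x.1 f ∧ HasSeriesValue (eTildeEven A M).2 x.1 ξ ∧
    HasSeriesValue (eTildeOdd A M).1 x.1 ψ ∧ HasSeriesValue (eTildeOdd A M).2 x.1 g ∧
    y = (f + x.2 * ξ, ψ + x.2 * g)

/-- The set `ℋ` of all `(A,M)`, `A_j` even and `M_{j-1/2}` odd, such that `Ẽ(A,M)` converges
absolutely in some DeWitt neighborhood of `0`. -/
def scriptH : Set ((ℕ+ → GInf) × (ℕ+ → GInf)) :=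
  {AM | (∀ j, AM.1 j ∈ gEven) ∧ (∀ j, AM.2 j ∈ gOdd) ∧
    ∃ s : ℝ, 0 < s ∧ ∀ x ∈ superspace, ‖body x.1‖ < s → ∃ y, HasETildeValue AM.1 AM.2 x y}

/-! ## The moduli spaces `SK(n)` and the sewing operation on them -/

/-- `SK(0)`. -/
@[ext] structure SKZero where
  A : ℕ+ → GInf
  M : ℕ+ → GInf
  mem : (A, M) ∈ scriptH
  A_one : A 1 = 0
  M_one : M 1 = 0

/-- `SK(n+1)`: punctures `(z_1,θ_1), …, (z_n,θ_n)` with invertible `z_i` of distinct bodies, data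
`(A⁽⁰⁾,M⁽⁰⁾)` at infinity, and data `(a⁽ᵏ⁾,A⁽ᵏ⁾,M⁽ᵏ⁾)`, `k = 1, …, n+1`, at the positively
oriented punctures, the last of which is at zero. -/
@[ext] structure SKSucc (n : ℕ) where
  z : Fin n → GInf
  θ : Fin n → GInf
  z_even : ∀ i, z i ∈ gEven
  θ_odd : ∀ i, θ i ∈ gOdd
  z_body : ∀ i, body (z i) ≠ 0
  z_inj : ∀ i j, i ≠ j → body (z i) ≠ body (z j)
  A₀ : ℕ+ → GInf
  M₀ : ℕ+ → GInf
  mem₀ : (A₀, M₀) ∈ scriptH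
  a : Fin (n + 1) → GInf
  a_even : ∀ k, a k ∈ gEven
  a_body : ∀ k, body (a k) ≠ 0
  A : Fin (n + 1) → ℕ+ → GInf
  M : Fin (n + 1) → ℕ+ → GInf
  mem : ∀ k, (A k, M k) ∈ scriptH

/-- The moduli space of superspheres with `1 + n` tubes. -/
def SK : ℕ → Type
  | 0 => SKZero
  | n + 1 => SKSucc n

/-- The local coordinate at infinity on the DeWitt ball of radius `1/r` in the chart about
infinity. It is `H₀(w,ρ) = Ẽ(A,-iM)(1/w, iρ/w)` in the chart about zero; in the chart
`(x,φ)` about infinity this reads `Ẽ(A,-iM)(x,-φ)`. -/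
def coordAtInfinity (A M : ℕ+ → GInf) (r : ℝ) (p : SSphere) (y : SPt) : Prop :=
  ∃ x, northChart p x ∧ ‖body x.1‖ < r⁻¹ ∧
    HasETildeValue A (fun j => -(Complex.I • M j)) (x.1, -x.2) y

/-- The local coordinate at `(z,θ)` on the DeWitt ball of radius `r` about it:
`(w,ρ) ↦ Ê(a,A,M)(s_{(z,θ)}(w,ρ))`, where `Ê(a,A,M) = (a² Ẽ⁰(A,M), a Ẽ¹(A,M))`. -/
def coordAtPoint (z θ a : GInf) (A M : ℕ+ → GInf) (r : ℝ) (p : SSphere) (y : SPt) : Prop :=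
  ∃ x, southChart p x ∧ ‖body x.1 - body z‖ < r ∧
    ∃ v, HasETildeValue A M (superShift z θ x) v ∧ y = (a ^ 2 * v.1, a * v.2)

/-- The chart `c` is everywhere defined on `B` and one-to-one. -/
def IsCoordOn (c : SSphere → SPt → Prop) (B : Set SSphere) : Prop :=
  (∀ p ∈ B, ∃ y, c p y) ∧ ∀ p p' y, c p y → c p' y → p = p'

/-- The canonical supersphere with one tube for `Q` and a radius. -/
def SKZero.canonical (Q : SKZero) (r : ℝ) : TubedSurface 0 where
  toSuperSurface := superSphere
  coord := fun _ => coordAtInfinity Q.A Q.M r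

/-- The canonical supersphere with `1 + (n+1)` tubes for `Q` and given radii. -/
def SKSucc.canonical {n : ℕ} (Q : SKSucc n) (r : Fin (n + 2) → ℝ) : TubedSurface (n + 1) where
  toSuperSurface := superSphere
  coord := Fin.cons (coordAtInfinity Q.A₀ Q.M₀ (r 0)) fun k : Fin (n + 1) =>
    coordAtPoint (Fin.snoc (α := fun _ => GInf) Q.z 0 k) (Fin.snoc (α := fun _ => GInf) Q.θ 0 k)
      (Q.a k) (Q.A k) (Q.M k) (r k.succ)

/-- The points with `‖x_B‖ < 1/r` in the chart about infinity. -/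
def ballAtInfinity (r : ℝ) : Set SSphere := {p | ∃ x, northChart p x ∧ ‖body x.1‖ < r⁻¹}

/-- The points with `‖w_B - z_B‖ < r` in the chart about zero. -/
def ballAtPoint (z : GInf) (r : ℝ) : Set SSphere :=
  {p | ∃ x, southChart p x ∧ ‖body x.1 - body z‖ < r}

/-- `C` is a canonical supersphere with tubes given by the data `Q` and by some positive radii
so small that the local coordinates converge and are one-to-one on the respective balls. -/
def SK.Represents : {n : ℕ} → SK n → TubedSurface n → Prop
  | 0, (Q : SKZero), C => ∃ r : ℝ, 0 < r ∧
      IsCoordOn (coordAtInfinity Q.A Q.M r) (ballAtInfinity r) ∧ C = Q.canonical r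
  | n + 1, (Q : SKSucc n), C => ∃ r : Fin (n + 2) → ℝ, (∀ k, 0 < r k) ∧
      IsCoordOn (coordAtInfinity Q.A₀ Q.M₀ (r 0)) (ballAtInfinity (r 0)) ∧
      (∀ k : Fin (n + 1), IsCoordOn ((Q.canonical r).coord k.succ)
        (ballAtPoint (Fin.snoc (α := fun _ => GInf) Q.z 0 k) (r k.succ))) ∧
      C = Q.canonical r

/-- The sewing operation on moduli: `Q₁ _{i+1}∞₀ Q₂` exists and equals `Q₃`, i.e. canonical
superspheres given by `Q₁`, `Q₂` can be sewn and the sewn surface is superconformally equivalent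
to a canonical supersphere given by `Q₃`. -/
def SewsTo {m n : ℕ} (Q₁ : SK (m + 1)) (i : Fin (m + 1)) (Q₂ : SK n) (Q₃ : SK (m + n)) : Prop :=
  ∃ (C₁ : TubedSurface (m + 1)) (C₂ : TubedSurface n) (C₃ : TubedSurface (m + n)),
    SK.Represents Q₁ C₁ ∧ SK.Represents Q₂ C₂ ∧ SK.Represents Q₃ C₃ ∧
    ∃ r r₁ r₂ : ℝ, CanSew C₁ i C₂ r r₁ r₂ ∧
      SuperconformallyEquivalent (sewn C₁ i C₂ r r₁ r₂) C₃

/-! ## Supermeromorphic superfunctions on `SK(1)` and supermeromorphic tangent vectors -/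

abbrev SKOne : Type := SKSucc 0

/-- Names for the coordinates `a⁽¹⁾`, `A_j⁽ᵏ⁾`, `M_{j-1/2}⁽ᵏ⁾` (`k = 0, 1`, `j ≥ 1`) on `SK(1)`. -/
inductive CoordName : Type
  | a : CoordName
  | A (k : Fin 2) (j : ℕ+) : CoordName
  | M (k : Fin 2) (j : ℕ+) : CoordName

/-- The coordinate functions on `SK(1)`. -/
def CoordName.val : CoordName → SKOne → GInf
  | .a, Q => Q.a 0
  | .A 0 j, Q => Q.A₀ j
  | .A 1 j, Q => Q.A 0 j
  | .M 0 j, Q => Q.M₀ j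
  | .M 1 j, Q => Q.M 0 j

/-- `SD(1)`: the polynomials, with coefficients in the Grassmann algebra, in `a⁽¹⁾`, its inverse,
the `A_j⁽ᵏ⁾` and the `M_{j-1/2}⁽ᵏ⁾`, as functions on `SK(1)`. -/
def SDOne : Subalgebra ℂ (SKOne → GInf) :=
  Algebra.adjoin ℂ ({F | ∃ c : GInf, F = fun _ => c} ∪ {F | ∃ c : CoordName, F = c.val} ∪
    {fun Q => Ring.inverse (CoordName.a.val Q)})

/-- The constant functions in `SD(1)`. -/
def SDOne.const (c : GInf) : SDOne :=
  ⟨fun _ => c, Algebra.subset_adjoin (Or.inl (Or.inl ⟨c, rfl⟩))⟩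

/-- `F` is homogeneous of sign `p`. -/
def IsHomogeneousFn (p : ZMod 2) (F : SDOne) : Prop := ∀ Q, F.1 Q ∈ gParity p

/-- Linearity over the Grassmann algebra, scalars acting on the right. -/
def IsSuperLinear (L : SDOne → GInf) : Prop :=
  IsLinearMap ℂ L ∧ ∀ (F : SDOne) (c : GInf), L (F * SDOne.const c) = L F * c

/-- Even supermeromorphic tangent vectors at `Q`. -/
def IsEvenTangentVector (Q : SKOne) (L : SDOne → GInf) : Prop :=
  IsSuperLinear L ∧ ∀ F₁ F₂ : SDOne, L (F₁ * F₂) = L F₁ * F₂.1 Q + F₁.1 Q * L F₂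

/-- Odd supermeromorphic tangent vectors at `Q`. -/
def IsOddTangentVector (Q : SKOne) (L : SDOne → GInf) : Prop :=
  IsSuperLinear L ∧ ∀ (p : ZMod 2) (F₁ F₂ : SDOne), IsHomogeneousFn p F₁ →
    L (F₁ * F₂) = L F₁ * F₂.1 Q + (-1 : GInf) ^ p.val * F₁.1 Q * L F₂

/-- The supermeromorphic tangent space `T_Q SK(1)`: sums of even and odd tangent vectors. -/
def tangentSpace (Q : SKOne) : Set (SDOne → GInf) :=
  {L | ∃ L₀ L₁, IsEvenTangentVector Q L₀ ∧ IsOddTangentVector Q L₁ ∧ L = L₀ + L₁}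

/-- `D` is the (left) partial derivative at `e` of `F` with respect to the even coordinate `c`:
`Δc · D + O((Δc)²) = F(e + Δc) - F(e)` along the points which differ from `e` at most in `c`. -/
def HasEvenPartialAt (e : SKOne) (F : SDOne) (c : CoordName) (D : GInf) : Prop :=
  ∃ R : SKOne → GInf, ∀ Q : SKOne, (∀ c', c' ≠ c → c'.val Q = c'.val e) →
    F.1 Q - F.1 e = (c.val Q - c.val e) * D + (c.val Q - c.val e) ^ 2 * R Q

/-- `D` is the (left) partial derivative at `e` of `F` with respect to the odd coordinate `c`:
`Δc · D = F(e + Δc) - F(e)` along the points which differ from `e` at most in `c`. -/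
def HasOddPartialAt (e : SKOne) (F : SDOne) (c : CoordName) (D : GInf) : Prop :=
  ∀ Q : SKOne, (∀ c', c' ≠ c → c'.val Q = c'.val e) →
    F.1 Q - F.1 e = (c.val Q - c.val e) * D

/-- `∂/∂a⁽¹⁾|_e` -/
def partialA₀ (e : SKOne) (F : SDOne) : GInf :=
  Classical.epsilon (HasEvenPartialAt e F CoordName.a)

/-- `∂/∂A_j⁽ᵏ⁾|_e` -/
def partialA (k : Fin 2) (j : ℕ+) (e : SKOne) (F : SDOne) : GInf :=
  Classical.epsilon (HasEvenPartialAt e F (CoordName.A k j))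

/-- `∂/∂M_{j-1/2}⁽ᵏ⁾|_e` -/
def partialM (k : Fin 2) (j : ℕ+) (e : SKOne) (F : SDOne) : GInf :=
  Classical.epsilon (HasOddPartialAt e F (CoordName.M k j))

/-! ## Membership in `ℋ` of the sequences needed -/

/-- A power series with finitely many nonzero coefficients converges everywhere. -/
theorem hasSeriesValue_of_eventually_zero (p : PowerSeries GInf) (N : ℕ)
    (hp : ∀ k, N ≤ k → PowerSeries.coeff k p = 0) (w : GInf) :
    ∃ S, HasSeriesValue p w S := by
  refine ⟨∑ k ∈ Finset.range N, PowerSeries.coeff k p * w ^ k, fun l => ?_⟩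
  rw [map_sum]
  apply hasSum_sum_of_ne_finset_zero
  intro k hk
  rw [hp k (by simpa using hk)]
  simp

theorem odd_anticomm (x y : GInf) (hx : x ∈ gOdd) (hy : y ∈ gOdd) : x * y = -(y * x) := by
  have hι : ∀ a b : ℕ →₀ ℂ, ExteriorAlgebra.ι ℂ a * ExteriorAlgebra.ι ℂ b =
      -(ExteriorAlgebra.ι ℂ b * ExteriorAlgebra.ι ℂ a) := fun a b =>
    eq_neg_of_add_eq_zero_left (ExteriorAlgebra.ι_add_mul_swap a b)
  have h1 : ∀ (a : ℕ →₀ ℂ), ExteriorAlgebra.ι ℂ a * y = -(y * ExteriorAlgebra.ι ℂ a) := by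
    intro a
    induction y, hy using CliffordAlgebra.odd_induction with
    | ι v => exact hι a v
    | add u v hu hv ihu ihv => rw [mul_add, ihu, ihv]; noncomm_ring
    | ι_mul_ι_mul m₁ m₂ u hu ih =>
      change ExteriorAlgebra.ι ℂ a * (ExteriorAlgebra.ι ℂ m₁ * ExteriorAlgebra.ι ℂ m₂ * u) =
        -(ExteriorAlgebra.ι ℂ m₁ * ExteriorAlgebra.ι ℂ m₂ * u * ExteriorAlgebra.ι ℂ a)
      rw [mul_assoc, ← mul_assoc, hι a m₁, neg_mul, mul_assoc,
        ← mul_assoc (ExteriorAlgebra.ι ℂ a), hι a m₂, neg_mul, mul_assoc, ih]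
      noncomm_ring
  induction x, hx using CliffordAlgebra.odd_induction with
  | ι v => exact h1 v
  | add u v hu hv ihu ihv => rw [add_mul, ihu, ihv]; noncomm_ring
  | ι_mul_ι_mul m₁ m₂ u hu ih =>
    change ExteriorAlgebra.ι ℂ m₁ * ExteriorAlgebra.ι ℂ m₂ * u * y =
      -(y * (ExteriorAlgebra.ι ℂ m₁ * ExteriorAlgebra.ι ℂ m₂ * u))
    have e1 := h1 m₁
    have e2 := h1 m₂
    rw [mul_assoc, ih, ← mul_assoc y, ← mul_assoc y, ← neg_eq_iff_eq_neg.mpr e1, neg_mul, neg_mul,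
      mul_assoc (ExteriorAlgebra.ι ℂ m₁) y, ← neg_eq_iff_eq_neg.mpr e2]
    noncomm_ring

theorem odd_sq (x : GInf) (hx : x ∈ gOdd) : x * x = 0 := by
  have h := odd_anticomm x x hx hx
  have h2 : (2 : ℂ) • (x * x) = 0 := by rw [two_smul]; nth_rewrite 1 [h]; simp
  exact (smul_eq_zero.mp h2).resolve_left two_ne_zero

theorem dX_zero : dX 0 = 0 := by ext k; simp [dX]

theorem dX_one : dX 1 = 0 := by ext k; simp [dX, PowerSeries.coeff_one]

theorem alphaSeries_zero : alphaSeries 0 = 0 := by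
  ext k
  simp only [alphaSeries, PowerSeries.coeff_mk]
  split_ifs <;> rfl

/-- The sequence `M(ε, 3/2)`. -/
def M₃₂ (ε : GInf) : ℕ+ → GInf := Pi.single 2 ε

theorem muSeries_M₃₂ (ε : GInf) : muSeries (M₃₂ ε) = PowerSeries.monomial 2 ε := by
  ext k
  simp only [muSeries, M₃₂, PowerSeries.coeff_mk, PowerSeries.coeff_monomial]
  split_ifs with h h' h'
  · subst h'; exact Pi.single_eq_same _ _
  · refine Pi.single_eq_of_ne (M := fun _ : ℕ+ => GInf) (fun h2 => h' ?_) ε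
    have h3 := congrArg PNat.val h2
    simpa using h3
  · omega
  · rfl

theorem superDer_zero (A M : ℕ+ → GInf) : superDer A M 0 = 0 := by
  simp [superDer, dX_zero]

theorem expSuperDer_coeff_eq_zero (A M : ℕ+ → GInf) (u : PowerSeries GInf × PowerSeries GInf)
    (h2 : superDer A M (superDer A M u) = 0) (d : ℕ)
    (h01 : PowerSeries.coeff d u.1 = 0) (h02 : PowerSeries.coeff d u.2 = 0)
    (h11 : PowerSeries.coeff d (superDer A M u).1 = 0)
    (h12 : PowerSeries.coeff d (superDer A M u).2 = 0) :
    PowerSeries.coeff d (expSuperDer A M u).1 = 0 ∧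
      PowerSeries.coeff d (expSuperDer A M u).2 = 0 := by
  have hk : ∀ k : ℕ, (superDer A M)^[k + 2] u = 0 := by
    intro k
    rw [Function.iterate_add_apply]
    change (superDer A M)^[k] (superDer A M (superDer A M u)) = 0
    rw [h2]
    induction k with
    | zero => rfl
    | succ k ih => rw [Function.iterate_succ_apply, superDer_zero, ih]
  constructor
  · simp only [expSuperDer, PowerSeries.coeff_mk]
    apply finsum_eq_zero_of_forall_eq_zero
    rintro (_ | _ | k)
    · simp [h01]
    · simp [h11]
    · rw [hk]; simp
  · simp only [expSuperDer, PowerSeries.coeff_mk]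
    apply finsum_eq_zero_of_forall_eq_zero
    rintro (_ | _ | k)
    · simp [h02]
    · simp [h12]
    · rw [hk]; simp

theorem mem_scriptH_M₃₂ (ε : GInf) (hε : ε ∈ gOdd) : ((0 : ℕ+ → GInf), M₃₂ ε) ∈ scriptH := by
  have hmu : superDer 0 (M₃₂ ε) (PowerSeries.X, 0) = (0, PowerSeries.monomial 2 ε) := by
    have hX : dX PowerSeries.X = 1 := by
      ext k
      rcases k with _ | k <;> simp [dX, PowerSeries.coeff_X, PowerSeries.coeff_one]
    simp [superDer, alphaSeries_zero, dX_zero, muSeries_M₃₂, hX]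
  have hone : superDer 0 (M₃₂ ε) (0, 1) = (PowerSeries.monomial 2 ε, 0) := by
    simp [superDer, alphaSeries_zero, dX_zero, muSeries_M₃₂]
  have hd : dX (PowerSeries.monomial 2 ε) = PowerSeries.monomial 1 ((2 : ℂ) • ε) := by
    ext k
    simp only [dX, PowerSeries.coeff_mk, PowerSeries.coeff_monomial]
    rcases k with _ | _ | k <;> simp [one_add_one_eq_two, two_smul]
  have hsq : ∀ (n : ℕ) (c : ℂ),
      PowerSeries.monomial 2 ε * PowerSeries.monomial n (c • ε) = 0 := by
    intro n c
    rw [PowerSeries.monomial_mul_monomial, mul_smul_comm, odd_sq ε hε]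
    simp
  have hmu2 : superDer 0 (M₃₂ ε) (superDer 0 (M₃₂ ε) (PowerSeries.X, 0)) = 0 := by
    have h := hsq 2 1
    rw [one_smul] at h
    rw [hmu]
    simp [superDer, alphaSeries_zero, dX_zero, muSeries_M₃₂, h]
  have hone2 : superDer 0 (M₃₂ ε) (superDer 0 (M₃₂ ε) (0, 1)) = 0 := by
    have h := hsq 1 1
    rw [one_smul] at h
    rw [hone]
    simp [superDer, alphaSeries_zero, dX_zero, muSeries_M₃₂, hd, h]
  have c1 : ∀ d, 3 ≤ d → PowerSeries.coeff d (PowerSeries.X : PowerSeries GInf) = 0 := by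
    intro d h
    rw [PowerSeries.coeff_X, if_neg (by omega)]
  have c2 : ∀ d, 3 ≤ d → PowerSeries.coeff d (1 : PowerSeries GInf) = 0 := by
    intro d h
    rw [PowerSeries.coeff_one, if_neg (by omega)]
  have c3 : ∀ d, 3 ≤ d → PowerSeries.coeff d (PowerSeries.monomial 2 ε) = 0 := by
    intro d h
    rw [PowerSeries.coeff_monomial, if_neg (by omega)]
  have hE : ∀ d, 3 ≤ d → PowerSeries.coeff d (eTildeEven 0 (M₃₂ ε)).1 = 0 ∧
      PowerSeries.coeff d (eTildeEven 0 (M₃₂ ε)).2 = 0 := fun d h =>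
    expSuperDer_coeff_eq_zero _ _ _ hmu2 d (c1 d h) (map_zero _) (by rw [hmu]; exact map_zero _)
      (by rw [hmu]; exact c3 d h)
  have hO : ∀ d, 3 ≤ d → PowerSeries.coeff d (eTildeOdd 0 (M₃₂ ε)).1 = 0 ∧
      PowerSeries.coeff d (eTildeOdd 0 (M₃₂ ε)).2 = 0 := fun d h =>
    expSuperDer_coeff_eq_zero _ _ _ hone2 d (map_zero _) (c2 d h) (by rw [hone]; exact c3 d h)
      (by rw [hone]; exact map_zero _)
  refine ⟨fun j => gEven.zero_mem, fun j => ?_, 1, one_pos, fun x _ _ => ?_⟩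
  · change M₃₂ ε j ∈ gOdd
    by_cases h : j = 2
    · subst h; rw [M₃₂, Pi.single_eq_same]; exact hε
    · rw [M₃₂, Pi.single_eq_of_ne h]; exact gOdd.zero_mem
  · obtain ⟨f, hf⟩ := hasSeriesValue_of_eventually_zero _ 3 (fun d h => (hE d h).1) x.1
    obtain ⟨ξ, hξ⟩ := hasSeriesValue_of_eventually_zero _ 3 (fun d h => (hE d h).2) x.1
    obtain ⟨ψ, hψ⟩ := hasSeriesValue_of_eventually_zero _ 3 (fun d h => (hO d h).1) x.1
    obtain ⟨g, hg⟩ := hasSeriesValue_of_eventually_zero _ 3 (fun d h => (hO d h).2) x.1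
    exact ⟨_, f, ξ, ψ, g, hf, hξ, hψ, hg, rfl⟩

theorem M₃₂_zero : M₃₂ 0 = 0 := Pi.single_zero 2

theorem zero_mem_scriptH : ((0 : ℕ+ → GInf), (0 : ℕ+ → GInf)) ∈ scriptH := by
  have h := mem_scriptH_M₃₂ 0 gOdd.zero_mem
  rwa [M₃₂_zero] at h

theorem one_mem_gEven : (1 : GInf) ∈ gEven := SetLike.one_mem_graded (CliffordAlgebra.evenOdd _)

theorem body_one : body 1 = 1 := map_one _

theorem body_unit (z : GInfˣ) : body z ≠ 0 := ((z.isUnit).map ExteriorAlgebra.algebraMapInv).ne_zero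

/-! ## The functional `𝒢_e(z,θ)` -/

/-- The identity `e = (0, (1, 0))` of `SK(1)`. -/
def identitySK : SKOne where
  z := fun _ => 0
  θ := fun _ => 0
  z_even := fun i => i.elim0
  θ_odd := fun i => i.elim0
  z_body := fun i => i.elim0
  z_inj := fun i => i.elim0
  A₀ := 0
  M₀ := 0
  mem₀ := zero_mem_scriptH
  a := fun _ => 1
  a_even := fun _ => one_mem_gEven
  a_body := fun _ => by rw [body_one]; exact one_ne_zero
  A := fun _ => 0
  M := fun _ => 0
  mem := fun _ => zero_mem_scriptH

instance : Nonempty SKOne := ⟨identitySK⟩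

/-- The point `((z,θ); 0, (1,0), (1,0))` of `SK(2)`. -/
def pantsSK (z : GInfˣ) (θ : GInf) (hz : (z : GInf) ∈ gEven) (hθ : θ ∈ gOdd) : SK 2 :=
  SKSucc.mk (n := 1) (z := fun _ => z) (θ := fun _ => θ) (z_even := fun _ => hz)
    (θ_odd := fun _ => hθ) (z_body := fun _ => body_unit z)
    (z_inj := fun i j h => absurd (Subsingleton.elim i j) h)
    (A₀ := 0) (M₀ := 0) (mem₀ := zero_mem_scriptH)
    (a := fun _ => 1) (a_even := fun _ => one_mem_gEven)
    (a_body := fun _ => by rw [body_one]; exact one_ne_zero)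
    (A := fun _ => 0) (M := fun _ => 0) (mem := fun _ => zero_mem_scriptH)

/-- The point `(0, M(ε, 3/2))` of `SK(0)`. -/
def tauSK (ε : gOdd) : SK 0 :=
  SKZero.mk (A := 0) (M := M₃₂ ε) (mem := mem_scriptH_M₃₂ ε ε.2) (A_one := rfl)
    (M_one := Pi.single_eq_of_ne (by decide) _)

/-- `Q` is the result `((z,θ); 0, (1,0), (1,0)) ₁∞₀ (0, M(ε, 3/2))` of the sewing. -/
def IsTauSewing (z : GInfˣ) (θ : GInf) (hz : (z : GInf) ∈ gEven) (hθ : θ ∈ gOdd) (ε : gOdd)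
    (Q : SKOne) : Prop :=
  SewsTo (m := 1) (n := 0) (pantsSK z θ hz hθ) 0 (tauSK ε) Q

/-- `((z,θ); 0, (1,0), (1,0)) ₁∞₀ (0, M(ε, 3/2))` -/
def tauSewing (z : GInfˣ) (θ : GInf) (hz : (z : GInf) ∈ gEven) (hθ : θ ∈ gOdd) (ε : gOdd) :
    SKOne :=
  Classical.epsilon (IsTauSewing z θ hz hθ ε)

/-- `D` is the (left) derivative `dg/dε` at `ε = 0` of a function of an odd variable:
`ε · D = g(ε) - g(0)`. -/
def HasOddDerivAtZero (g : gOdd → GInf) (D : GInf) : Prop :=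
  ∀ ε : gOdd, g ε - g 0 = (ε : GInf) * D

/-- `𝒢_e(z,θ) F = d/dε F(((z,θ); 0, (1,0), (1,0)) ₁∞₀ (0, M(ε, 3/2)))` at `ε = 0`. -/
def calG (z : GInfˣ) (θ : GInf) (hz : (z : GInf) ∈ gEven) (hθ : θ ∈ gOdd) (F : SDOne) : GInf :=
  Classical.epsilon (HasOddDerivAtZero fun ε => F.1 (tauSewing z θ hz hθ ε))

end SuperSewing

end

open SuperSewing

/-! The sewn surface is uniformized explicitly. On the first sphere, away from the body of z, take a
superconformal map C_ε (`corrSouth`, or `corrNorth` in the chart at infinity) which differs from the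
identity by ε times rational expressions with poles only at z. On the cap take a shift. By
`corrSouth_eq_superShift` the two maps agree under the identification of the super-annuli, so they
glue to an isomorphism of the sewn surface with the sphere (`sewnEquiv`). It turns the local
coordinates at infinity and at 0 into the inverse of C_ε, which is C_{-ε}.

On the other side, ε x ε = 0 for every x because ε is odd. If all A_j and M_{j-1/2} are left
multiples of ε, the derivation T in the exponent has square zero and exp(T) = 1 + T. Expanding 1/(w
- z) as a geometric series at 0 and at infinity therefore identifies C_{-ε} with Ẽ of the geometric
data of `sewnPoint`. This is existence, `isTauSewing_sewnPoint`.

For uniqueness, `eq_sewnPoint_of_isTauSewing`, two uniformizations differ by a superconformal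
self-map of the sphere. The germs at infinity make it tangent to the identity there, and it
preserves the finite part. Along a line t ↦ (t, ρ) with t complex, the first component minus t and
the second component are entire with limits at infinity, hence constant by Liouville, and the
puncture at 0 fixes the constants. So the map is the identity at all points (t, ρ) with t complex,
and the values of a local coordinate there determine a, A and M, by the identity theorem for power
series and an induction on weight (`eq_of_eTildeOdd_eq`).

The coordinates of `sewnPoint` are affine in ε: c(Q_ε) - c(e) = ε v_c, with v_c = `coordSpeed`.
Since second-order terms contain ε twice, the chain rule F(Q_ε) - F(e) = ε ∑_c v_c ∂_c F is exact;
it is proved by induction over the generators of SD(1) in `exists_isGradient`, and the v_c are the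
coefficients of the formula. The sign in the Leibniz rule comes from moving ε to the left past F(e).
All derivatives are unique because there are infinitely many generators: an element annihilated by
left multiplication by each of them is zero (`eq_zero_of_gen_mul`).

The analytic basis is a class of functions that are locally finite sums of holomorphic functions
times constants. Taylor evaluation at an even element is multiplicative on it (`gval_mul`), and the
coefficientwise notion used in the definition of superconformality reduces to it
(`IsJetOn.gAnalyticAt`). -/

noncomputable section
namespace SuperSewing

/-! ## Parity, body and soul -/

theorem even_mul_even {x y : GInf} (hx : x ∈ gEven) (hy : y ∈ gEven) : x * y ∈ gEven := by
  have := SetLike.mul_mem_graded (A := CliffordAlgebra.evenOdd (0 : QuadraticForm ℂ (ℕ →₀ ℂ))) hx hy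
  exact this

theorem even_mul_odd {x y : GInf} (hx : x ∈ gEven) (hy : y ∈ gOdd) : x * y ∈ gOdd := by
  have := SetLike.mul_mem_graded (A := CliffordAlgebra.evenOdd (0 : QuadraticForm ℂ (ℕ →₀ ℂ))) hx hy
  exact this

theorem odd_mul_even {x y : GInf} (hx : x ∈ gOdd) (hy : y ∈ gEven) : x * y ∈ gOdd := by
  have := SetLike.mul_mem_graded (A := CliffordAlgebra.evenOdd (0 : QuadraticForm ℂ (ℕ →₀ ℂ))) hx hy
  exact this

theorem odd_mul_odd {x y : GInf} (hx : x ∈ gOdd) (hy : y ∈ gOdd) : x * y ∈ gEven := by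
  have := SetLike.mul_mem_graded (A := CliffordAlgebra.evenOdd (0 : QuadraticForm ℂ (ℕ →₀ ℂ))) hx hy
  exact this

theorem algebraMap_mem_gEven (c : ℂ) : algebraMap ℂ GInf c ∈ gEven := by
  rw [Algebra.algebraMap_eq_smul_one]
  exact gEven.smul_mem c one_mem_gEven

theorem even_pow {x : GInf} (hx : x ∈ gEven) (n : ℕ) : x ^ n ∈ gEven := by
  induction n with
  | zero => simpa using one_mem_gEven
  | succ n ih => rw [pow_succ]; exact even_mul_even ih hx

/-- The parity involution. -/
def parityInv : GInf →ₐ[ℂ] GInf := CliffordAlgebra.involute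

theorem parityInv_even {x : GInf} (hx : x ∈ gEven) : parityInv x = x :=
  CliffordAlgebra.involute_eq_of_mem_even hx

theorem parityInv_odd {x : GInf} (hx : x ∈ gOdd) : parityInv x = -x :=
  CliffordAlgebra.involute_eq_of_mem_odd hx

theorem exists_even_add_odd (x : GInf) : ∃ a ∈ gEven, ∃ b ∈ gOdd, x = a + b := by
  have h := (CliffordAlgebra.evenOdd_isCompl (0 : QuadraticForm ℂ (ℕ →₀ ℂ))).sup_eq_top
  have hx : x ∈ CliffordAlgebra.evenOdd (0 : QuadraticForm ℂ (ℕ →₀ ℂ)) 0 ⊔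
      CliffordAlgebra.evenOdd (0 : QuadraticForm ℂ (ℕ →₀ ℂ)) 1 := by rw [h]; trivial
  obtain ⟨a, ha, b, hb, h⟩ := Submodule.mem_sup.mp hx
  exact ⟨a, ha, b, hb, h.symm⟩

/-- Being fixed by an algebra automorphism passes to inverses; this is how `inverse_even` obtains
parity. -/
theorem mem_gEven_iff {x : GInf} : x ∈ gEven ↔ parityInv x = x := by
  refine ⟨parityInv_even, fun h => ?_⟩
  obtain ⟨a, ha, b, hb, rfl⟩ := exists_even_add_odd x
  rw [map_add, parityInv_even ha, parityInv_odd hb] at h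
  have h2 : (2 : ℂ) • b = 0 := by
    rw [two_smul]
    have h3 : -b = b := add_left_cancel h
    nth_rewrite 1 [← h3]
    simp
  rw [(smul_eq_zero.mp h2).resolve_left two_ne_zero, add_zero]
  exact ha

/-- An odd element moves past any element up to the parity involution. -/
theorem mul_odd (x : GInf) {e : GInf} (he : e ∈ gOdd) : x * e = e * parityInv x := by
  change x * e = e * CliffordAlgebra.involute x
  induction x using CliffordAlgebra.induction with
  | algebraMap r => rw [AlgHom.commutes]; exact Algebra.commutes r e
  | ι v =>
    rw [CliffordAlgebra.involute_ι, mul_neg]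
    exact odd_anticomm _ _ (CliffordAlgebra.ι_mem_evenOdd_one _ v) he
  | add a b ha hb => rw [add_mul, ha, hb, map_add, mul_add]
  | mul a b ha hb => rw [mul_assoc, hb, ← mul_assoc, ha, mul_assoc, ← map_mul]

/-- The odd part of `y` is covered by `mul_odd`. The even part is generated by products of two
vectors, and `x` passes each vector because it is fixed by `parityInv`. -/
theorem even_comm {x : GInf} (hx : x ∈ gEven) (y : GInf) : x * y = y * x := by
  obtain ⟨a, ha, b, hb, rfl⟩ := exists_even_add_odd y
  have hb' : x * b = b * x := by rw [mul_odd x hb, parityInv_even hx]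
  have ha' : x * a = a * x := by
    clear hb hb'
    induction a, ha using CliffordAlgebra.even_induction with
    | algebraMap r => exact (Algebra.commutes r x).symm
    | add u v hu hv ihu ihv => rw [mul_add, add_mul, ihu, ihv]
    | ι_mul_ι_mul m₁ m₂ u hu ih =>
      have h := fun m => mul_odd x (CliffordAlgebra.ι_mem_evenOdd_one
        (0 : QuadraticForm ℂ (ℕ →₀ ℂ)) m)
      rw [parityInv_even hx] at h
      rw [← mul_assoc, ← mul_assoc, h, mul_assoc _ x, h, mul_assoc, mul_assoc, ih]
      simp only [mul_assoc]
  rw [mul_add, add_mul, ha', hb']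

theorem even_commute {x : GInf} (hx : x ∈ gEven) (y : GInf) : Commute x y := even_comm hx y

theorem even_left_comm {x : GInf} (hx : x ∈ gEven) (y u : GInf) : y * (x * u) = x * (y * u) := by
  rw [← mul_assoc, ← even_comm hx y, mul_assoc]

theorem body_add (x y : GInf) : body (x + y) = body x + body y := map_add _ _ _

theorem body_sub (x y : GInf) : body (x - y) = body x - body y := map_sub _ _ _

theorem body_neg (x : GInf) : body (-x) = -body x := map_neg _ _

theorem body_mul (x y : GInf) : body (x * y) = body x * body y := map_mul _ _ _

theorem body_smul (c : ℂ) (x : GInf) : body (c • x) = c * body x := map_smul _ _ _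

theorem body_pow (x : GInf) (n : ℕ) : body (x ^ n) = body x ^ n := map_pow _ _ _

theorem body_zero : body 0 = 0 := map_zero _

theorem body_algebraMap (c : ℂ) : body (algebraMap ℂ GInf c) = c :=
  ExteriorAlgebra.algebraMap_leftInverse _ c

theorem body_ι (v : ℕ →₀ ℂ) : body (ExteriorAlgebra.ι ℂ v) = 0 := by
  simp [body, ExteriorAlgebra.algebraMapInv]

theorem body_odd {x : GInf} (hx : x ∈ gOdd) : body x = 0 := by
  have h : body x * body x = 0 := by rw [← body_mul, odd_sq x hx, body_zero]
  exact mul_self_eq_zero.mp h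

theorem body_soul (x : GInf) : body (soul x) = 0 := by
  rw [soul, body_sub, body_algebraMap, sub_self]

theorem body_add_soul (x : GInf) : algebraMap ℂ GInf (body x) + soul x = x := by
  rw [soul]; abel

theorem soul_even {x : GInf} (hx : x ∈ gEven) : soul x ∈ gEven :=
  gEven.sub_mem hx (algebraMap_mem_gEven _)

theorem soul_eq_self {x : GInf} (hx : body x = 0) : soul x = x := by simp [soul, hx]

theorem soul_add (x y : GInf) : soul (x + y) = soul x + soul y := by
  simp only [soul, body_add, map_add]; abel

theorem soul_algebraMap (c : ℂ) : soul (algebraMap ℂ GInf c) = 0 := by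
  simp [soul, body_algebraMap]

/-- A product of two vectors squares to zero and commutes with everything, so each monomial of
positive degree has square zero; sums of commuting nilpotents are nilpotent. -/
theorem isNilpotent_soul {x : GInf} (hx : x ∈ gEven) : IsNilpotent (soul x) := by
  induction x, hx using CliffordAlgebra.even_induction with
  | algebraMap r => exact ⟨1, by rw [pow_one]; exact soul_algebraMap r⟩
  | add u v hu hv ihu ihv =>
    have h : soul (u + v) = soul u + soul v := soul_add u v
    rw [h]
    exact (even_commute (soul_even hu) _).isNilpotent_add ihu ihv
  | ι_mul_ι_mul m₁ m₂ u hu ih =>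
    refine ⟨2, ?_⟩
    have hb : body (ExteriorAlgebra.ι ℂ m₁ * ExteriorAlgebra.ι ℂ m₂ * u) = 0 := by
      rw [body_mul, body_mul, body_ι]; ring
    change soul (ExteriorAlgebra.ι ℂ m₁ * ExteriorAlgebra.ι ℂ m₂ * u) ^ 2 = 0
    rw [soul_eq_self hb, pow_two]
    have ho := fun m => CliffordAlgebra.ι_mem_evenOdd_one (0 : QuadraticForm ℂ (ℕ →₀ ℂ)) m
    have he : ExteriorAlgebra.ι ℂ m₁ * ExteriorAlgebra.ι ℂ m₂ ∈ gEven := odd_mul_odd (ho m₁) (ho m₂)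
    have h0 : ExteriorAlgebra.ι ℂ m₁ * ExteriorAlgebra.ι ℂ m₂ *
        (ExteriorAlgebra.ι ℂ m₁ * ExteriorAlgebra.ι ℂ m₂) = 0 := by
      rw [← mul_assoc, even_comm he, ← mul_assoc, ExteriorAlgebra.ι_sq_zero]
      simp
    rw [← mul_assoc, mul_assoc _ u, even_comm hu, ← mul_assoc, h0]
    simp

theorem isUnit_iff_body {x : GInf} (hx : x ∈ gEven) : IsUnit x ↔ body x ≠ 0 := by
  refine ⟨fun h => (h.map ExteriorAlgebra.algebraMapInv).ne_zero, fun h => ?_⟩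
  rw [← body_add_soul x]
  refine IsNilpotent.isUnit_add_left_of_commute (isNilpotent_soul hx) ?_ (Algebra.commutes _ _).symm
  exact (isUnit_iff_ne_zero.mpr h).map (algebraMap ℂ GInf)

theorem mul_inverse {x : GInf} (hx : x ∈ gEven) (h : body x ≠ 0) : x * Ring.inverse x = 1 :=
  Ring.mul_inverse_cancel _ ((isUnit_iff_body hx).mpr h)

theorem inverse_mul {x : GInf} (hx : x ∈ gEven) (h : body x ≠ 0) : Ring.inverse x * x = 1 :=
  Ring.inverse_mul_cancel _ ((isUnit_iff_body hx).mpr h)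

theorem inverse_eq {x y : GInf} (hxy : x * y = 1) (hyx : y * x = 1) : Ring.inverse x = y :=
  Ring.inverse_unit ⟨x, y, hxy, hyx⟩

theorem inverse_even {x : GInf} (hx : x ∈ gEven) : Ring.inverse x ∈ gEven := by
  by_cases h : body x = 0
  · rw [Ring.inverse_non_unit _ fun hu => (isUnit_iff_body hx).mp hu h]
    exact gEven.zero_mem
  · rw [mem_gEven_iff]
    refine (inverse_eq ?_ ?_).symm
    · nth_rewrite 1 [← parityInv_even hx]
      rw [← map_mul, mul_inverse hx h, map_one]
    · nth_rewrite 2 [← parityInv_even hx]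
      rw [← map_mul, inverse_mul hx h, map_one]

theorem body_inverse {x : GInf} (hx : x ∈ gEven) : body (Ring.inverse x) = (body x)⁻¹ := by
  by_cases h : body x = 0
  · rw [Ring.inverse_non_unit _ fun hu => (isUnit_iff_body hx).mp hu h, h, body_zero, inv_zero]
  · have := congrArg body (mul_inverse hx h)
    rw [body_mul, body_one] at this
    exact eq_inv_of_mul_eq_one_right this

theorem units_inv_even {z : GInfˣ} (hz : (z : GInf) ∈ gEven) : ((z⁻¹ : GInfˣ) : GInf) ∈ gEven := by
  rw [← Ring.inverse_unit]; exact inverse_even hz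

/-! ## Elements annihilated by all generators -/

/-- The generator `ζ_n`. -/
def gen (n : ℕ) : GInf := ExteriorAlgebra.ι ℂ (Finsupp.single n 1)

theorem gen_odd (n : ℕ) : gen n ∈ gOdd := CliffordAlgebra.ι_mem_evenOdd_one _ _

/-- An element involves only finitely many generators, so contraction with a late enough coordinate
functional kills it. Here the infinite supply of generators enters. -/
theorem exists_contract_eq_zero (x : GInf) : ∃ N : ℕ, ∀ n, N ≤ n →
    CliffordAlgebra.contractLeft (Q := (0 : QuadraticForm ℂ (ℕ →₀ ℂ))) (Finsupp.lapply n) x = 0 := by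
  induction x using CliffordAlgebra.left_induction with
  | algebraMap r => exact ⟨0, fun n _ => CliffordAlgebra.contractLeft_algebraMap _ _ _⟩
  | add a b ha hb =>
    obtain ⟨N, hN⟩ := ha
    obtain ⟨N', hN'⟩ := hb
    refine ⟨max N N', fun n hn => ?_⟩
    rw [map_add, hN n (le_trans (le_max_left _ _) hn), hN' n (le_trans (le_max_right _ _) hn),
      add_zero]
  | ι_mul x m hx =>
    obtain ⟨N, hN⟩ := hx
    obtain ⟨K, hK⟩ := m.support.exists_nat_subset_range
    refine ⟨max N K, fun n hn => ?_⟩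
    rw [CliffordAlgebra.contractLeft_ι_mul, hN n (le_trans (le_max_left _ _) hn)]
    have h0 : m n = 0 := by
      by_contra h
      have := hK (Finsupp.mem_support_iff.mpr h)
      rw [Finset.mem_range] at this
      have := le_trans (le_max_right N K) hn
      omega
    simp [h0]

/-- For a generator ζ_N absent from x, contraction of ζ_N x recovers x. With finitely many
generators the product of all of them would be a counterexample. -/
theorem eq_zero_of_gen_mul {x : GInf} (h : ∀ n, gen n * x = 0) : x = 0 := by
  obtain ⟨N, hN⟩ := exists_contract_eq_zero x
  have h1 := congrArg (CliffordAlgebra.contractLeft (Q := (0 : QuadraticForm ℂ (ℕ →₀ ℂ)))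
    (Finsupp.lapply N)) (h N)
  have h2 := CliffordAlgebra.contractLeft_ι_mul (Q := (0 : QuadraticForm ℂ (ℕ →₀ ℂ)))
    (Finsupp.lapply N) (Finsupp.single N 1) x
  rw [hN N le_rfl, mul_zero, sub_zero] at h2
  have h3 := h2.symm.trans (h1.trans (map_zero _))
  simpa using h3

theorem eq_of_odd_mul {x y : GInf} (h : ∀ e ∈ gOdd, e * x = e * y) : x = y := by
  rw [← sub_eq_zero]
  refine eq_zero_of_gen_mul fun n => ?_
  rw [mul_sub, h _ (gen_odd n), sub_self]

/-- The products ζ_m ζ_n serve as even increments of square zero, so derivatives in even directions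
can be compared without their remainders. -/
theorem eq_of_gen_mul_gen_mul {x y : GInf}
    (h : ∀ m n, gen m * gen n * x = gen m * gen n * y) : x = y := by
  rw [← sub_eq_zero]
  refine eq_zero_of_gen_mul fun n => eq_zero_of_gen_mul fun m => ?_
  rw [← mul_assoc, mul_sub, h m n, sub_self]

theorem gen_mul_gen_even (m n : ℕ) : gen m * gen n ∈ gEven := odd_mul_odd (gen_odd m) (gen_odd n)

theorem gen_mul_gen_sq (m n : ℕ) : gen m * gen n * (gen m * gen n) = 0 := by
  rw [even_comm (gen_mul_gen_even m n), mul_assoc, ← mul_assoc (gen n),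
    odd_anticomm _ _ (gen_odd n) (gen_odd m), neg_mul, mul_assoc (gen m), odd_sq _ (gen_odd n)]
  simp

/-- The reason why everything is exact to first order in ε: two occurrences of the same odd factor
kill a product, whatever stands between them. -/
theorem odd_mul_mul_self {e : GInf} (he : e ∈ gOdd) (x : GInf) : e * x * e = 0 := by
  rw [mul_assoc, mul_odd x he, ← mul_assoc, odd_sq e he, zero_mul]

theorem gen_mul_gen_mul_self (m n : ℕ) (x : GInf) :
    gen m * gen n * x * (gen m * gen n) = 0 := by
  rw [← even_comm (gen_mul_gen_even m n), ← mul_assoc, gen_mul_gen_sq, zero_mul]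

end SuperSewing
end

noncomputable section
namespace SuperSewing

/-! ## Exponentials of square-zero superderivations -/

theorem eq_of_forall_dual {x y : GInf} (h : ∀ l : Module.Dual ℂ GInf, l x = l y) : x = y := by
  rw [← sub_eq_zero, ← Module.forall_dual_apply_eq_zero_iff ℂ]
  intro l
  rw [map_sub, h, sub_self]

theorem dX_C_mul (e : GInf) (p : PowerSeries GInf) :
    dX (PowerSeries.C e * p) = PowerSeries.C e * dX p := by
  ext k
  simp [dX, PowerSeries.coeff_C_mul]

theorem dX_X : dX PowerSeries.X = 1 := by
  ext k
  rcases k with _ | k <;> simp [dX, PowerSeries.coeff_X, PowerSeries.coeff_one]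

/-- One application of the derivation produces left multiples of `e`, and a second one produces
factors `e * x * e`. The condition is put on `e` itself rather than on its parity because it is also
used for the even elements ζ_m ζ_n. -/
theorem superDer_superDer {e : GInf} (he : ∀ x, e * x * e = 0) {A M : ℕ+ → GInf}
    (hA : ∀ j, ∃ x, A j = e * x) (hM : ∀ j, ∃ x, M j = e * x)
    (u : PowerSeries GInf × PowerSeries GInf) : superDer A M (superDer A M u) = 0 := by
  choose A' hA' using hA
  choose M' hM' using hM
  have hα : alphaSeries A = PowerSeries.C e * alphaSeries A' := by
    ext k
    simp only [alphaSeries, PowerSeries.coeff_mk, PowerSeries.coeff_C_mul]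
    split_ifs
    · exact hA' _
    · simp
  have hμ : muSeries M = PowerSeries.C e * muSeries M' := by
    ext k
    simp only [muSeries, PowerSeries.coeff_mk, PowerSeries.coeff_C_mul]
    split_ifs
    · exact hM' _
    · simp
  have h0 : ∀ p q : PowerSeries GInf, PowerSeries.C e * p * (PowerSeries.C e * q) = 0 := by
    intro p q
    have : PowerSeries.C e * p * PowerSeries.C e = 0 := by
      ext k
      rw [PowerSeries.coeff_mul_C, PowerSeries.coeff_C_mul, he, map_zero]
    rw [← mul_assoc, this, zero_mul]
  have h1 : ∀ v, ∃ p q, superDer A M v = (PowerSeries.C e * p, PowerSeries.C e * q) := by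
    intro v
    refine ⟨alphaSeries A' * dX v.1 + muSeries M' * v.2,
      alphaSeries A' * dX v.2 + (1 / 2 : ℂ) • (dX (alphaSeries A') * v.2) + muSeries M' * dX v.1, ?_⟩
    simp only [superDer, hα, hμ, dX_C_mul, mul_add, mul_assoc, mul_smul_comm]
  obtain ⟨p, q, h⟩ := h1 u
  rw [h]
  simp only [superDer, hα, hμ, dX_C_mul, h0]
  simp

theorem expSuperDer_of_sq_zero {A M : ℕ+ → GInf} {u : PowerSeries GInf × PowerSeries GInf}
    (h : superDer A M (superDer A M u) = 0) : expSuperDer A M u = u + superDer A M u := by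
  have hk : ∀ k : ℕ, 2 ≤ k → (superDer A M)^[k] u = 0 := by
    intro k hk
    obtain ⟨k, rfl⟩ := Nat.exists_eq_add_of_le' hk
    rw [Function.iterate_add_apply]
    change (superDer A M)^[k] (superDer A M (superDer A M u)) = 0
    rw [h]
    exact Function.iterate_fixed (superDer_zero A M) k
  have key : ∀ f : ℕ → GInf, (∀ k, 2 ≤ k → f k = 0) → ∑ᶠ k, f k = f 0 + f 1 := by
    intro f hf
    rw [finsum_eq_sum_of_support_subset (s := Finset.range 2)]
    · simp [Finset.sum_range_succ]
    · intro k hk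
      by_contra hk'
      exact hk (hf k (by simpa [Nat.succ_le_iff] using hk'))
  refine Prod.ext ?_ ?_
  all_goals
    ext d
    simp only [expSuperDer, PowerSeries.coeff_mk]
    rw [key _ fun k h2 => by rw [hk k h2]; simp]
    simp

theorem eTildeEven_of_sq_zero {e : GInf} (he : ∀ x, e * x * e = 0) {A M : ℕ+ → GInf}
    (hA : ∀ j, ∃ x, A j = e * x) (hM : ∀ j, ∃ x, M j = e * x) :
    eTildeEven A M = (PowerSeries.X + alphaSeries A, muSeries M) := by
  rw [eTildeEven, expSuperDer_of_sq_zero (superDer_superDer he hA hM _)]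
  simp [superDer, dX_X, dX_zero]

theorem eTildeOdd_of_sq_zero {e : GInf} (he : ∀ x, e * x * e = 0) {A M : ℕ+ → GInf}
    (hA : ∀ j, ∃ x, A j = e * x) (hM : ∀ j, ∃ x, M j = e * x) :
    eTildeOdd A M = (muSeries M, 1 + (1 / 2 : ℂ) • dX (alphaSeries A)) := by
  rw [eTildeOdd, expSuperDer_of_sq_zero (superDer_superDer he hA hM _)]
  simp [superDer, dX_one, dX_zero]

/-! ## Values of power series -/

theorem HasSeriesValue.unique {p : PowerSeries GInf} {w S S' : GInf} (h : HasSeriesValue p w S)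
    (h' : HasSeriesValue p w S') : S = S' :=
  eq_of_forall_dual fun l => (h l).unique (h' l)

theorem HasSeriesValue.add {p q : PowerSeries GInf} {w S S' : GInf} (h : HasSeriesValue p w S)
    (h' : HasSeriesValue q w S') : HasSeriesValue (p + q) w (S + S') := fun l => by
  simpa [add_mul] using (h l).add (h' l)

theorem HasSeriesValue.sub {p q : PowerSeries GInf} {w S S' : GInf} (h : HasSeriesValue p w S)
    (h' : HasSeriesValue q w S') : HasSeriesValue (p - q) w (S - S') := fun l => by
  simpa [sub_mul] using (h l).sub (h' l)

theorem HasSeriesValue.smul {p : PowerSeries GInf} {w S : GInf} (c : ℂ) (h : HasSeriesValue p w S) :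
    HasSeriesValue (c • p) w (c • S) := fun l => by
  simpa using (h l).mul_left c

theorem HasSeriesValue.C_mul {p : PowerSeries GInf} {w S : GInf} (c : GInf)
    (h : HasSeriesValue p w S) : HasSeriesValue (PowerSeries.C c * p) w (c * S) := fun l => by
  simpa [PowerSeries.coeff_C_mul, mul_assoc] using h (l ∘ₗ LinearMap.mulLeft ℂ c)

theorem hasSeriesValue_monomial (n : ℕ) (c w : GInf) :
    HasSeriesValue (PowerSeries.monomial n c) w (c * w ^ n) := fun l => by
  have : (fun k : ℕ => l (PowerSeries.coeff k (PowerSeries.monomial n c) * w ^ k)) =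
      fun k => if k = n then l (c * w ^ n) else 0 := by
    ext k
    rw [PowerSeries.coeff_monomial]
    split_ifs with h
    · rw [h]
    · simp
  rw [this]
  exact hasSum_ite_eq n _

theorem hasSeriesValue_X (w : GInf) : HasSeriesValue PowerSeries.X w w := by
  have := hasSeriesValue_monomial 1 1 w
  rwa [one_mul, pow_one] at this

theorem hasSeriesValue_one (w : GInf) : HasSeriesValue 1 w 1 := by
  have := hasSeriesValue_monomial 0 1 w
  simpa using this

theorem hasSeriesValue_zero (w : GInf) : HasSeriesValue 0 w 0 := fun l => by simp

theorem hasETildeValue_of_sq_zero {e : GInf} (he : ∀ x, e * x * e = 0) {A M : ℕ+ → GInf}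
    (hA : ∀ j, ∃ x, A j = e * x) (hM : ∀ j, ∃ x, M j = e * x) {w a m a' : GInf} (ρ : GInf)
    (h1 : HasSeriesValue (alphaSeries A) w a) (h2 : HasSeriesValue (muSeries M) w m)
    (h3 : HasSeriesValue (dX (alphaSeries A)) w a') :
    HasETildeValue A M (w, ρ) (w + a + ρ * m, m + ρ * (1 + (1 / 2 : ℂ) • a')) := by
  refine ⟨w + a, m, m, 1 + (1 / 2 : ℂ) • a', ?_, ?_, ?_, ?_, rfl⟩
  · rw [eTildeEven_of_sq_zero he hA hM]
    exact (hasSeriesValue_X w).add h1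
  · rw [eTildeEven_of_sq_zero he hA hM]
    exact h2
  · rw [eTildeOdd_of_sq_zero he hA hM]
    exact h2
  · rw [eTildeOdd_of_sq_zero he hA hM]
    exact (hasSeriesValue_one w).add (h3.smul _)

theorem HasETildeValue.unique {A M : ℕ+ → GInf} {x y y' : SPt} (h : HasETildeValue A M x y)
    (h' : HasETildeValue A M x y') : y = y' := by
  obtain ⟨f, ξ, ψ, g, h1, h2, h3, h4, rfl⟩ := h
  obtain ⟨f', ξ', ψ', g', h1', h2', h3', h4', rfl⟩ := h'
  rw [h1.unique h1', h2.unique h2', h3.unique h3', h4.unique h4']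

/-- Expand `y ^ k` binomially about the body. The soul is nilpotent, so only `N` of its powers
occur, each with a convergent scalar series as coefficient. The sum is thus an actual element of the
algebra, which convergence of every functional alone would not give. -/
theorem exists_hasSum_smul_pow {y : GInf} (hy : y ∈ gEven) (hb : ‖body y‖ < 1) (a : ℕ → ℂ)
    (ha : ∀ k, ‖a k‖ ≤ k + 1) :
    ∃ S : GInf, ∀ l : Module.Dual ℂ GInf, HasSum (fun k => l (a k • y ^ k)) (l S) := by
  obtain ⟨N, hN⟩ := isNilpotent_soul hy
  obtain ⟨r, hr, hr1⟩ := exists_between hb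
  have hr0 : 0 < r := lt_of_le_of_lt (norm_nonneg _) hr
  have hexp : ∀ k, y ^ k =
      ∑ m ∈ Finset.range N, ((k.choose m : ℂ) * body y ^ (k - m)) • soul y ^ m := by
    intro k
    have h1 : y ^ k = ∑ m ∈ Finset.range (k + 1),
        ((k.choose m : ℂ) * body y ^ (k - m)) • soul y ^ m := by
      conv_lhs => rw [← body_add_soul y, add_comm]
      rw [(even_commute (soul_even hy) _).add_pow]
      refine Finset.sum_congr rfl fun m _ => ?_
      rw [← map_pow, mul_assoc, ← map_natCast (algebraMap ℂ GInf), ← map_mul, ← Algebra.commutes,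
        ← Algebra.smul_def, mul_comm]
    rw [h1]
    rcases le_total (k + 1) N with h | h
    · refine Finset.sum_subset (Finset.range_subset_range.mpr h) fun m _ hm => ?_
      rw [Nat.choose_eq_zero_of_lt (by simpa using hm)]
      simp
    · refine (Finset.sum_subset (Finset.range_subset_range.mpr h) fun m _ hm => ?_).symm
      have : soul y ^ m = 0 := pow_eq_zero_of_le (by simpa using hm) hN
      rw [this, smul_zero]
  have hsum : ∀ m, Summable fun k => a k * ((k.choose m : ℂ) * body y ^ (k - m)) := by
    intro m
    -- The majorant. The bounds on `a k` and on the binomial coefficient give the power of `k + 1`;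
    -- rewriting `r ^ (k - m)` with inverses needs `r` nonzero, hence a radius strictly above `‖body
    -- y‖`.
    have hs : Summable fun k : ℕ => ((k + 1 : ℕ) : ℝ) ^ (m + 1) * r ^ (k + 1) * (r⁻¹ * (r ^ m)⁻¹) := by
      have h0 := summable_pow_mul_geometric_of_norm_lt_one (m + 1)
        (r := r) (by rwa [Real.norm_of_nonneg hr0.le])
      exact (((summable_nat_add_iff 1).mpr h0).mul_right _)
    refine Summable.of_norm_bounded hs fun k => ?_
    rw [norm_mul, norm_mul, norm_pow, Complex.norm_natCast]
    rcases lt_or_ge k m with h | h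
    · rw [Nat.choose_eq_zero_of_lt h]
      simp only [Nat.cast_zero, zero_mul, mul_zero]
      positivity
    · have h1 : ((k.choose m : ℕ) : ℝ) ≤ ((k + 1 : ℕ) : ℝ) ^ m := by
        have := (Nat.choose_le_pow k m).trans (Nat.pow_le_pow_left (Nat.le_succ k) m)
        exact_mod_cast this
      have h2 : ‖body y‖ ^ (k - m) ≤ r ^ (k - m) := pow_le_pow_left₀ (norm_nonneg _) hr.le _
      have h3 : r ^ (k + 1) * (r⁻¹ * (r ^ m)⁻¹) = r ^ (k - m) := by
        rw [pow_sub₀ _ hr0.ne' h, pow_succ]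
        field_simp
      calc ‖a k‖ * ((k.choose m : ℝ) * ‖body y‖ ^ (k - m))
          ≤ (k + 1) * (((k + 1 : ℕ) : ℝ) ^ m * r ^ (k - m)) := by
            gcongr
            exact ha k
        _ = _ := by rw [mul_assoc (_ ^ (m + 1)), h3, pow_succ]; push_cast; ring
  refine ⟨∑ m ∈ Finset.range N,
    (∑' k, a k * ((k.choose m : ℂ) * body y ^ (k - m))) • soul y ^ m, fun l => ?_⟩
  have h2 : (fun k => l (a k • y ^ k)) = fun k => ∑ m ∈ Finset.range N,
      a k * ((k.choose m : ℂ) * body y ^ (k - m)) * l (soul y ^ m) := by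
    ext k
    rw [hexp k]
    simp only [map_smul, map_sum, smul_eq_mul, Finset.mul_sum, mul_assoc]
  rw [h2, map_sum]
  refine hasSum_sum fun m _ => ?_
  rw [map_smul, smul_eq_mul]
  exact (hsum m).hasSum.mul_right _

/-- Telescoping: applying each functional to `(1 - y) * S` leaves only the first term, so the sum is
the inverse of `1 - y`. -/
theorem hasSum_geometric {y : GInf} (hy : y ∈ gEven) (hb : ‖body y‖ < 1)
    (l : Module.Dual ℂ GInf) : HasSum (fun k => l (y ^ k)) (l (Ring.inverse (1 - y))) := by
  obtain ⟨S, hS⟩ := exists_hasSum_smul_pow hy hb (fun _ => 1) fun k => by simp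
  simp only [one_smul] at hS
  have h1 : (1 - y) * S = 1 := by
    refine eq_of_forall_dual fun l => ?_
    have h2 := hS (l ∘ₗ LinearMap.mulLeft ℂ (1 - y))
    have h3 := (hS l).sub ((hasSum_nat_add_iff 1).mpr
      (show HasSum (fun k => l (y ^ k)) ((l S - l 1) + ∑ i ∈ Finset.range 1, l (y ^ i)) by
        simpa using hS l))
    have h4 := h2.unique (h3.congr_fun fun k => by simp [sub_mul, pow_succ'])
    simpa using h4
  have h5 : Ring.inverse (1 - y) = S := by
    refine inverse_eq h1 ?_
    rwa [← even_comm (gEven.sub_mem one_mem_gEven hy)]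
  rw [h5]
  exact hS l

/-- Multiplying ∑ (k+1) y^k by 1 - y gives the geometric series, so the sum is the square of the
inverse. -/
theorem hasSum_geometric_deriv {y : GInf} (hy : y ∈ gEven) (hb : ‖body y‖ < 1)
    (l : Module.Dual ℂ GInf) :
    HasSum (fun k : ℕ => l ((k + 1 : ℂ) • y ^ k)) (l (Ring.inverse (1 - y) ^ 2)) := by
  obtain ⟨S, hS⟩ := exists_hasSum_smul_pow hy hb (fun k => (k + 1 : ℂ)) fun k => by
    exact_mod_cast (Complex.norm_natCast (k + 1)).le
  have he : 1 - y ∈ gEven := gEven.sub_mem one_mem_gEven hy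
  have hb1 : body (1 - y) ≠ 0 := by
    rw [body_sub, body_one, sub_ne_zero]
    rintro h
    rw [← h] at hb
    simp at hb
  have h1 : (1 - y) * S = Ring.inverse (1 - y) := by
    refine eq_of_forall_dual fun l => ?_
    have h3 : HasSum (fun k : ℕ => l ((k : ℂ) • y ^ k)) (l (y * S)) := by
      rw [← hasSum_nat_add_iff' 1]
      have := hS (l ∘ₗ LinearMap.mulLeft ℂ y)
      simpa [pow_succ'] using this
    have h5 := ((hS l).sub h3).unique ((hasSum_geometric hy hb l).congr_fun fun k => by
      rw [← map_sub, ← sub_smul]; simp)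
    rw [← h5, ← map_sub]
    congr 1
    rw [sub_mul, one_mul]
  have h5 : Ring.inverse (1 - y) ^ 2 = S := by
    rw [pow_two]
    nth_rewrite 2 [← h1]
    rw [← mul_assoc, inverse_mul he hb1, one_mul]
  rw [h5]
  exact hS l

end SuperSewing
end

noncomputable section
namespace SuperSewing

/-! ## Geometric data -/

/-- The data `A_j = c u^{j+1}`. -/
def geomA (c u : GInf) (j : ℕ+) : GInf := c * u ^ ((j : ℕ) + 1)

/-- The data `M_{j-1/2} = d u^j`. -/
def geomM (d u : GInf) (j : ℕ+) : GInf := d * u ^ (j : ℕ)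

/-- The series α starts in degree 2, so the full geometric series has to lose its terms of degrees 0
and 1. -/
theorem alphaSeries_geomA (c u : GInf) : alphaSeries (geomA c u) =
    PowerSeries.C c * PowerSeries.mk (fun k => u ^ k) - PowerSeries.monomial 0 c -
      PowerSeries.monomial 1 (c * u) := by
  ext k
  rcases k with _ | _ | k
  · rw [map_sub, PowerSeries.coeff_monomial, if_neg (by omega)]
    simp [alphaSeries]
  · simp [alphaSeries, PowerSeries.coeff_C_mul]
  · simp [alphaSeries, geomA, PowerSeries.coeff_monomial, PowerSeries.coeff_C_mul]

theorem muSeries_geomM (d u : GInf) : muSeries (geomM d u) =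
    PowerSeries.C d * PowerSeries.mk (fun k => u ^ k) - PowerSeries.monomial 0 d := by
  ext k
  rcases k with _ | k
  · simp [muSeries]
  · simp [muSeries, geomM, PowerSeries.coeff_C_mul]

theorem dX_alphaSeries_geomA (c u : GInf) : dX (alphaSeries (geomA c u)) =
    PowerSeries.C (c * u) * PowerSeries.mk (fun k => ((k + 1 : ℂ) • u ^ k)) -
      PowerSeries.monomial 0 (c * u) := by
  ext k
  rcases k with _ | k
  · simp [dX, alphaSeries]
  · simp only [dX, alphaSeries, geomA, PowerSeries.coeff_mk, PowerSeries.coeff_C_mul, map_sub,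
      PowerSeries.coeff_monomial]
    rw [dif_pos (by omega)]
    simp [pow_succ', mul_assoc]

theorem hasSeriesValue_geom {u w : GInf} (hu : u ∈ gEven) (hw : w ∈ gEven)
    (h : ‖body u * body w‖ < 1) :
    HasSeriesValue (PowerSeries.mk fun k => u ^ k) w (Ring.inverse (1 - u * w)) := fun l => by
  simp only [PowerSeries.coeff_mk]
  refine (hasSum_geometric (even_mul_even hu hw) (by rwa [body_mul]) l).congr_fun fun k => ?_
  rw [(even_commute hu w).mul_pow]

theorem hasSeriesValue_geom_deriv {u w : GInf} (hu : u ∈ gEven) (hw : w ∈ gEven)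
    (h : ‖body u * body w‖ < 1) :
    HasSeriesValue (PowerSeries.mk fun k => ((k + 1 : ℂ) • u ^ k)) w
      (Ring.inverse (1 - u * w) ^ 2) := fun l => by
  simp only [PowerSeries.coeff_mk]
  refine (hasSum_geometric_deriv (even_mul_even hu hw) (by rwa [body_mul]) l).congr_fun
    fun k => ?_
  rw [(even_commute hu w).mul_pow, smul_mul_assoc]

/-- For geometric data the first-order form of Ẽ sums to a rational expression; this is what is
compared with the correction map. -/
theorem hasETildeValue_geom {e c d u w : GInf} (he : ∀ x, e * x * e = 0) (hc : ∃ x, c = e * x)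
    (hd : ∃ x, d = e * x) (hu : u ∈ gEven) (hw : w ∈ gEven) (h : ‖body u * body w‖ < 1)
    (ρ : GInf) :
    HasETildeValue (geomA c u) (geomM d u) (w, ρ)
      (w + (c * Ring.inverse (1 - u * w) - c - c * u * w) +
          ρ * (d * Ring.inverse (1 - u * w) - d),
        d * Ring.inverse (1 - u * w) - d +
          ρ * (1 + (1 / 2 : ℂ) • (c * u * Ring.inverse (1 - u * w) ^ 2 - c * u))) := by
  obtain ⟨c, rfl⟩ := hc
  obtain ⟨d, rfl⟩ := hd
  have h0 : ∀ c, HasSeriesValue (PowerSeries.monomial 0 c) w c := fun c => by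
    have := hasSeriesValue_monomial 0 c w
    rwa [pow_zero, mul_one] at this
  have h1 : ∀ c, HasSeriesValue (PowerSeries.monomial 1 c) w (c * w) := fun c => by
    have := hasSeriesValue_monomial 1 c w
    rwa [pow_one] at this
  have hA : ∀ j, ∃ x, geomA (e * c) u j = e * x := fun j => ⟨c * u ^ ((j : ℕ) + 1), mul_assoc _ _ _⟩
  have hM : ∀ j, ∃ x, geomM (e * d) u j = e * x := fun j => ⟨d * u ^ (j : ℕ), mul_assoc _ _ _⟩
  refine hasETildeValue_of_sq_zero he hA hM ρ ?_ ?_ ?_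
  · rw [alphaSeries_geomA]
    exact (((hasSeriesValue_geom hu hw h).C_mul _).sub (h0 _)).sub (h1 _)
  · rw [muSeries_geomM]
    exact ((hasSeriesValue_geom hu hw h).C_mul _).sub (h0 _)
  · rw [dX_alphaSeries_geomA]
    exact ((hasSeriesValue_geom_deriv hu hw h).C_mul _).sub (h0 _)

theorem geom_mem_scriptH {e c d u : GInf} (he : ∀ x, e * x * e = 0) (hc : ∃ x, c = e * x)
    (hd : ∃ x, d = e * x) (hce : c ∈ gEven) (hdo : d ∈ gOdd) (hu : u ∈ gEven) :
    (geomA c u, geomM d u) ∈ scriptH := by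
  refine ⟨fun j => even_mul_even hce (even_pow hu _), fun j => odd_mul_even hdo (even_pow hu _),
    (‖body u‖ + 1)⁻¹, by positivity, fun x hx hs =>
      ⟨_, hasETildeValue_geom he hc hd hu hx.1 ?_ x.2⟩⟩
  rw [norm_mul]
  have h1 : 0 < ‖body u‖ + 1 := by positivity
  calc ‖body u‖ * ‖body x.1‖ ≤ ‖body u‖ * (‖body u‖ + 1)⁻¹ := by gcongr
    _ < 1 := by
      rw [← div_eq_mul_inv, div_lt_one h1]
      linarith

/-- Supplies points of SK(1) that differ from the identity in one coordinate; without them the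
partial derivatives could not be shown to be unique. -/
theorem single_mem_scriptH {e a m : GInf} (he : ∀ x, e * x * e = 0) (ha : ∃ x, a = e * x)
    (hm : ∃ x, m = e * x) (hae : a ∈ gEven) (hmo : m ∈ gOdd) (i j : ℕ+) :
    ((Pi.single i a : ℕ+ → GInf), (Pi.single j m : ℕ+ → GInf)) ∈ scriptH := by
  have hA : ∀ k, ∃ x, (Pi.single i a : ℕ+ → GInf) k = e * x := fun k => by
    rcases eq_or_ne k i with rfl | hk
    · simpa using ha
    · exact ⟨0, by simp [Pi.single_eq_of_ne hk]⟩
  have hM : ∀ k, ∃ x, (Pi.single j m : ℕ+ → GInf) k = e * x := fun k => by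
    rcases eq_or_ne k j with rfl | hk
    · simpa using hm
    · exact ⟨0, by simp [Pi.single_eq_of_ne hk]⟩
  have hα : ∀ k, (i : ℕ) + 2 ≤ k →
      PowerSeries.coeff k (alphaSeries (Pi.single i a : ℕ+ → GInf)) = 0 := fun k hk => by
    rw [alphaSeries, PowerSeries.coeff_mk, dif_pos (by have := i.pos; omega)]
    refine Pi.single_eq_of_ne (M := fun _ : ℕ+ => GInf) (fun h => ?_) a
    have := congrArg PNat.val h
    simp only [PNat.mk_coe] at this
    omega
  have hμ : ∀ k, (j : ℕ) + 1 ≤ k →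
      PowerSeries.coeff k (muSeries (Pi.single j m : ℕ+ → GInf)) = 0 := fun k hk => by
    rw [muSeries, PowerSeries.coeff_mk, dif_pos (by omega)]
    refine Pi.single_eq_of_ne (M := fun _ : ℕ+ => GInf) (fun h => ?_) m
    have := congrArg PNat.val h
    simp only [PNat.mk_coe] at this
    omega
  refine ⟨fun k => ?_, fun k => ?_, 1, one_pos, fun x _ _ => ?_⟩
  · change (Pi.single i a : ℕ+ → GInf) k ∈ gEven
    rcases eq_or_ne k i with rfl | hk
    · simpa using hae
    · rw [Pi.single_eq_of_ne hk]; exact gEven.zero_mem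
  · change (Pi.single j m : ℕ+ → GInf) k ∈ gOdd
    rcases eq_or_ne k j with rfl | hk
    · simpa using hmo
    · rw [Pi.single_eq_of_ne hk]; exact gOdd.zero_mem
  · obtain ⟨S₁, h₁⟩ := hasSeriesValue_of_eventually_zero _ _ hα x.1
    obtain ⟨S₂, h₂⟩ := hasSeriesValue_of_eventually_zero _ _ hμ x.1
    obtain ⟨S₃, h₃⟩ := hasSeriesValue_of_eventually_zero
      (dX (alphaSeries (Pi.single i a : ℕ+ → GInf))) ((i : ℕ) + 2) (fun k hk => by
        rw [dX, PowerSeries.coeff_mk, hα _ (by omega), smul_zero]) x.1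
    exact ⟨_, hasETildeValue_of_sq_zero he hA hM x.2 h₁ h₂ h₃⟩

/-! ## The result of the sewing -/

/-- The point of `SK(1)` which is the result of the sewing. -/
def sewnPoint (z : GInfˣ) (θ : GInf) (hz : (z : GInf) ∈ gEven) (hθ : θ ∈ gOdd) (ε : gOdd) :
    SKOne where
  z := fun _ => 0
  θ := fun _ => 0
  z_even := fun i => i.elim0
  θ_odd := fun i => i.elim0
  z_body := fun i => i.elim0
  z_inj := fun i => i.elim0
  -- Read off from the inverse correction map in the chart at infinity: at φ = 0 the even part of
  -- `corrNorth z θ (-ε)` is x + 2εθz⁻³ ∑_{k≥2} (zx)^k, and A_j is the coefficient of x^{j+1}. The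
  -- odd part gives M in the same way, up to the factor -i in the coordinate at infinity.
  A₀ := geomA (ε * (2 * θ * (z⁻¹ : GInfˣ) ^ 3)) z
  M₀ := geomM (ε * (z⁻¹ : GInfˣ) ^ 2) z
  mem₀ := geom_mem_scriptH (odd_mul_mul_self ε.2) ⟨_, rfl⟩ ⟨_, rfl⟩
    (odd_mul_odd ε.2 (odd_mul_even (by rw [two_mul]; exact gOdd.add_mem hθ hθ)
      (even_pow (units_inv_even hz) 3)))
    (odd_mul_even ε.2 (even_pow (units_inv_even hz) 2)) hz
  -- At zero the even part of the inverse correction map is w + 2εθ ∑_{k≥1} z^{-k-1} w^k. Its linear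
  -- coefficient 1 + 2εθz⁻² must be a², and (εθz⁻²)² = 0.
  a := fun _ => 1 + ε * (θ * (z⁻¹ : GInfˣ) ^ 2)
  a_even := fun _ => gEven.add_mem one_mem_gEven
    (odd_mul_odd ε.2 (odd_mul_even hθ (even_pow (units_inv_even hz) 2)))
  a_body := fun _ => by
    rw [body_add, body_mul, body_odd ε.2, body_one, zero_mul, add_zero]; exact one_ne_zero
  A := fun _ => geomA (ε * (2 * θ * (z⁻¹ : GInfˣ))) (z⁻¹ : GInfˣ)
  M := fun _ => geomM (ε * (z⁻¹ : GInfˣ)) (z⁻¹ : GInfˣ)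
  mem := fun _ => geom_mem_scriptH (odd_mul_mul_self ε.2) ⟨_, rfl⟩ ⟨_, rfl⟩
    (odd_mul_odd ε.2 (odd_mul_even (by rw [two_mul]; exact gOdd.add_mem hθ hθ)
      (units_inv_even hz)))
    (odd_mul_even ε.2 (units_inv_even hz)) (units_inv_even hz)

/-! ## Partial derivatives -/

/-- The automorphism by which left derivatives with respect to a coordinate pass a factor. -/
def CoordName.twist : CoordName → GInf → GInf
  | .M _ _, x => parityInv x
  | _, x => x

/-- `D` is the partial derivative at `e` with respect to the coordinate `c`. -/
def HasPartialAt (e : SKOne) (F : SDOne) : CoordName → GInf → Prop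
  | .M k j, D => HasOddPartialAt e F (.M k j) D
  | .a, D => HasEvenPartialAt e F .a D
  | .A k j, D => HasEvenPartialAt e F (.A k j) D

/-- Reduces the families of coordinates to an odd and an even case, so that the sum and product
rules need only two arguments each. -/
theorem CoordName.parity_cases : ∀ c : CoordName,
    (∃ k j, c = .M k j ∧ ∀ Q e, c.val Q - c.val e ∈ gOdd) ∨
      ((∀ e F D, HasPartialAt e F c D ↔ HasEvenPartialAt e F c D) ∧ (∀ x, c.twist x = x) ∧
        ∀ Q e, c.val Q - c.val e ∈ gEven)
  | .a => Or.inr ⟨fun _ _ _ => Iff.rfl, fun _ => rfl,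
      fun Q e => gEven.sub_mem (Q.a_even 0) (e.a_even 0)⟩
  | .A 0 j => Or.inr ⟨fun _ _ _ => Iff.rfl, fun _ => rfl,
      fun Q e => gEven.sub_mem (Q.mem₀.1 j) (e.mem₀.1 j)⟩
  | .A 1 j => Or.inr ⟨fun _ _ _ => Iff.rfl, fun _ => rfl,
      fun Q e => gEven.sub_mem ((Q.mem 0).1 j) ((e.mem 0).1 j)⟩
  | .M 0 j => Or.inl ⟨0, j, rfl, fun Q e => gOdd.sub_mem (Q.mem₀.2.1 j) (e.mem₀.2.1 j)⟩
  | .M 1 j => Or.inl ⟨1, j, rfl, fun Q e => gOdd.sub_mem ((Q.mem 0).2.1 j) ((e.mem 0).2.1 j)⟩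

theorem HasPartialAt.add {e : SKOne} {F G : SDOne} {c : CoordName} {D D' : GInf}
    (h : HasPartialAt e F c D) (h' : HasPartialAt e G c D') :
    HasPartialAt e (F + G) c (D + D') := by
  have hadd : ∀ Q, (F + G).1 Q = F.1 Q + G.1 Q := fun _ => rfl
  rcases c.parity_cases with ⟨k, j, rfl, -⟩ | ⟨hc, -, -⟩
  · intro Q hQ
    rw [hadd, hadd, mul_add, ← h Q hQ, ← h' Q hQ]
    abel
  · rw [hc] at *
    obtain ⟨R, hR⟩ := h
    obtain ⟨R', hR'⟩ := h'
    refine ⟨R + R', fun Q hQ => ?_⟩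
    rw [hadd, hadd, add_sub_add_comm, hR Q hQ, hR' Q hQ, Pi.add_apply]
    noncomm_ring

/-- The increment must be brought to the left of F(e). For an odd coordinate this costs the parity
involution and the second-order term vanishes; for an even one it costs nothing and that term goes
into the remainder. -/
theorem HasPartialAt.mul {e : SKOne} {F G : SDOne} {c : CoordName} {D D' : GInf}
    (h : HasPartialAt e F c D) (h' : HasPartialAt e G c D') :
    HasPartialAt e (F * G) c (D * G.1 e + c.twist (F.1 e) * D') := by
  have hmul : ∀ Q, (F * G).1 Q = F.1 Q * G.1 Q := fun _ => rfl
  have hsplit : ∀ Q, F.1 Q * G.1 Q - F.1 e * G.1 e = (F.1 Q - F.1 e) * G.1 e +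
      F.1 e * (G.1 Q - G.1 e) + (F.1 Q - F.1 e) * (G.1 Q - G.1 e) := fun Q => by noncomm_ring
  rcases c.parity_cases with ⟨k, j, rfl, hodd⟩ | ⟨hc, ht, heven⟩
  · intro Q hQ
    specialize hodd Q e
    rw [hmul, hmul, hsplit, h Q hQ, h' Q hQ]
    change _ = _ * (D * G.1 e + parityInv (F.1 e) * D')
    rw [← mul_assoc (F.1 e), mul_odd _ hodd, mul_add, ← mul_assoc (_ * D),
      odd_mul_mul_self hodd, zero_mul, add_zero]
    simp only [mul_assoc]
  · rw [hc] at *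
    obtain ⟨R, hR⟩ := h
    obtain ⟨R', hR'⟩ := h'
    -- The remainder: those of the two factors, and the product of their difference quotients, all
    -- multiplied by the square of the increment.
    refine ⟨fun Q => R Q * G.1 e + F.1 e * R' Q + (D + (c.val Q - c.val e) * R Q) *
      (D' + (c.val Q - c.val e) * R' Q), fun Q hQ => ?_⟩
    specialize heven Q e
    rw [hmul, hmul, hsplit, hR Q hQ, hR' Q hQ, ht]
    dsimp only
    generalize c.val Q - c.val e = Δ at heven ⊢
    have hcomm := fun x y => even_left_comm heven x y
    simp only [pow_two, mul_add, add_mul, mul_assoc, hcomm (F.1 e), hcomm D, hcomm (R Q)]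
    abel

end SuperSewing
end

noncomputable section
namespace SuperSewing

/-! ## Uniqueness of partial derivatives -/

/-- Every odd element occurs as an increment of the coordinate, so the two candidates agree after
left multiplication by any odd element. -/
theorem HasOddPartialAt.unique {F : SDOne} {k : Fin 2} {j : ℕ+} {D D' : GInf}
    (h : HasOddPartialAt identitySK F (.M k j) D) (h' : HasOddPartialAt identitySK F (.M k j) D') :
    D = D' := by
  refine eq_of_odd_mul fun e he => ?_
  have hmem := single_mem_scriptH (odd_mul_mul_self he) ⟨0, (mul_zero e).symm⟩
    ⟨1, (mul_one e).symm⟩ gEven.zero_mem he j j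
  rw [Pi.single_zero] at hmem
  have key : ∃ Q : SKOne, (∀ c' : CoordName, c' ≠ .M k j → c'.val Q = c'.val identitySK) ∧
      (CoordName.M k j).val Q - (CoordName.M k j).val identitySK = e := by
    fin_cases k
    · refine ⟨{ identitySK with A₀ := 0, M₀ := Pi.single j e, mem₀ := hmem }, ?_, ?_⟩
      · rintro (_ | ⟨k', j'⟩ | ⟨k', j'⟩) hc
        · rfl
        · fin_cases k' <;> rfl
        · fin_cases k'
          · exact Pi.single_eq_of_ne (M := fun _ : ℕ+ => GInf) (fun h => hc (by rw [h])) e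
          · rfl
      · change (Pi.single j e : ℕ+ → GInf) j - 0 = e
        simp
    · refine ⟨{ identitySK with A := fun _ => 0, M := fun _ => Pi.single j e,
                                mem := fun _ => hmem }, ?_, ?_⟩
      · rintro (_ | ⟨k', j'⟩ | ⟨k', j'⟩) hc
        · rfl
        · fin_cases k' <;> rfl
        · fin_cases k'
          · rfl
          · exact Pi.single_eq_of_ne (M := fun _ : ℕ+ => GInf) (fun h => hc (by rw [h])) e
      · change (Pi.single j e : ℕ+ → GInf) j - 0 = e
        simp
  obtain ⟨Q, hQ, hΔ⟩ := key
  have h1 := h Q hQ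
  have h2 := h' Q hQ
  rw [hΔ] at h1 h2
  exact h1.symm.trans h2

/-- Along the increments ζ_m ζ_n, whose square is zero, the unknown remainders drop out. -/
theorem HasEvenPartialAt.unique_of_points {e : SKOne} {F : SDOne} {c : CoordName} {D D' : GInf}
    (hc : ∀ m n, ∃ Q : SKOne, (∀ c', c' ≠ c → c'.val Q = c'.val e) ∧
      c.val Q - c.val e = gen m * gen n)
    (h : HasEvenPartialAt e F c D) (h' : HasEvenPartialAt e F c D') : D = D' := by
  refine eq_of_gen_mul_gen_mul fun m n => ?_
  obtain ⟨R, hR⟩ := h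
  obtain ⟨R', hR'⟩ := h'
  obtain ⟨Q, hQ, hΔ⟩ := hc m n
  have h1 := hR Q hQ
  have h2 := hR' Q hQ
  rw [hΔ, pow_two, gen_mul_gen_sq, zero_mul, add_zero] at h1 h2
  exact h1.symm.trans h2

theorem exists_point_a (m n : ℕ) : ∃ Q : SKOne,
    (∀ c' : CoordName, c' ≠ .a → c'.val Q = c'.val identitySK) ∧
      CoordName.a.val Q - CoordName.a.val identitySK = gen m * gen n := by
  refine ⟨{ identitySK with
    a := fun _ => 1 + gen m * gen n
    a_even := fun _ => gEven.add_mem one_mem_gEven (gen_mul_gen_even m n)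
    a_body := fun _ => by
      rw [body_add, body_mul, body_odd (gen_odd m), body_one, zero_mul, add_zero]
      exact one_ne_zero }, ?_, ?_⟩
  · rintro (_ | ⟨k', j'⟩ | ⟨k', j'⟩) hc
    · exact absurd rfl hc
    · fin_cases k' <;> rfl
    · fin_cases k' <;> rfl
  · change 1 + gen m * gen n - 1 = _
    abel

theorem exists_point_A (k : Fin 2) (j : ℕ+) (m n : ℕ) : ∃ Q : SKOne,
    (∀ c' : CoordName, c' ≠ .A k j → c'.val Q = c'.val identitySK) ∧
      (CoordName.A k j).val Q - (CoordName.A k j).val identitySK = gen m * gen n := by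
  have hmem := single_mem_scriptH (gen_mul_gen_mul_self m n) ⟨1, (mul_one _).symm⟩
    ⟨0, (mul_zero _).symm⟩ (gen_mul_gen_even m n) gOdd.zero_mem j j
  rw [Pi.single_zero] at hmem
  fin_cases k
  · refine ⟨{ identitySK with A₀ := Pi.single j (gen m * gen n), M₀ := 0, mem₀ := hmem }, ?_, ?_⟩
    · rintro (_ | ⟨k', j'⟩ | ⟨k', j'⟩) hc
      · rfl
      · fin_cases k'
        · exact Pi.single_eq_of_ne (M := fun _ : ℕ+ => GInf) (fun h => hc (by rw [h])) _
        · rfl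
      · fin_cases k' <;> rfl
    · change (Pi.single j (gen m * gen n) : ℕ+ → GInf) j - 0 = _
      simp
  · refine ⟨{ identitySK with A := fun _ => Pi.single j (gen m * gen n), M := fun _ => 0,
                              mem := fun _ => hmem }, ?_, ?_⟩
    · rintro (_ | ⟨k', j'⟩ | ⟨k', j'⟩) hc
      · rfl
      · fin_cases k'
        · rfl
        · exact Pi.single_eq_of_ne (M := fun _ : ℕ+ => GInf) (fun h => hc (by rw [h])) _
      · fin_cases k' <;> rfl
    · change (Pi.single j (gen m * gen n) : ℕ+ → GInf) j - 0 = _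
      simp

theorem HasPartialAt.unique {F : SDOne} {c : CoordName} {D D' : GInf}
    (h₁ : HasPartialAt identitySK F c D) (h₂ : HasPartialAt identitySK F c D') : D = D' := by
  rcases c with _ | ⟨k, j⟩ | ⟨k, j⟩
  · exact HasEvenPartialAt.unique_of_points exists_point_a h₁ h₂
  · exact HasEvenPartialAt.unique_of_points (exists_point_A k j) h₁ h₂
  · exact HasOddPartialAt.unique h₁ h₂

/-! ## The derivative along the sewing -/

/-- The left derivative at `ε = 0` of the coordinates of the sewn point. -/
def coordSpeed (z : GInfˣ) (θ : GInf) : CoordName → GInf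
  | .a => θ * ((z ^ (-2 : ℤ) : GInfˣ) : GInf)
  | .A k j => 2 * θ * ((z ^ (-(2 * (k : ℤ) - 1) * (j : ℤ) - 2) : GInfˣ) : GInf)
  | .M k j => ((z ^ (-(2 * (k : ℤ) - 1) * (j : ℤ) - 2 + k) : GInfˣ) : GInf)

theorem units_zpow_even {z : GInfˣ} (hz : (z : GInf) ∈ gEven) (n : ℤ) :
    ((z ^ n : GInfˣ) : GInf) ∈ gEven := by
  cases n with
  | ofNat n => rw [Int.ofNat_eq_natCast, zpow_natCast, Units.val_pow_eq_pow_val]; exact even_pow hz n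
  | negSucc n =>
    rw [zpow_negSucc, ← inv_pow, Units.val_pow_eq_pow_val]
    exact even_pow (units_inv_even hz) _

theorem val_sewnPoint_sub {z : GInfˣ} {θ : GInf} (hz : (z : GInf) ∈ gEven) (hθ : θ ∈ gOdd)
    (ε : gOdd) (c : CoordName) :
    c.val (sewnPoint z θ hz hθ ε) - c.val identitySK = ε * coordSpeed z θ c := by
  have hpow : ∀ n : ℕ, ((z⁻¹ : GInfˣ) : GInf) ^ n = ((z ^ (-(n : ℤ)) : GInfˣ) : GInf) := fun n => by
    rw [zpow_neg, zpow_natCast, ← inv_pow, Units.val_pow_eq_pow_val]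
  have hpow' : ∀ n : ℕ, (z : GInf) ^ n = ((z ^ (n : ℤ) : GInfˣ) : GInf) := fun n => by
    rw [zpow_natCast, Units.val_pow_eq_pow_val]
  rcases c with _ | ⟨k, j⟩ | ⟨k, j⟩
  · change 1 + (ε : GInf) * (θ * (z⁻¹ : GInfˣ) ^ 2) - 1 = ε * (θ * _)
    rw [hpow, add_sub_cancel_left]
    rfl
  · fin_cases k
    · change (ε : GInf) * (2 * θ * (z⁻¹ : GInfˣ) ^ 3) * (z : GInf) ^ ((j : ℕ) + 1) - 0 =
        ε * (2 * θ * _)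
      rw [hpow, hpow', sub_zero, mul_assoc, mul_assoc (2 * θ), ← Units.val_mul, ← zpow_add]
      refine congrArg (fun n : ℤ => (ε : GInf) * (2 * θ * ((z ^ n : GInfˣ) : GInf))) ?_
      push_cast
      ring
    · change (ε : GInf) * (2 * θ * (z⁻¹ : GInfˣ)) * ((z⁻¹ : GInfˣ) : GInf) ^ ((j : ℕ) + 1) - 0 =
        ε * (2 * θ * _)
      rw [hpow, ← zpow_neg_one, sub_zero, mul_assoc, mul_assoc (2 * θ), ← Units.val_mul, ← zpow_add]
      refine congrArg (fun n : ℤ => (ε : GInf) * (2 * θ * ((z ^ n : GInfˣ) : GInf))) ?_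
      push_cast
      ring
  · fin_cases k
    · change (ε : GInf) * (z⁻¹ : GInfˣ) ^ 2 * (z : GInf) ^ (j : ℕ) - 0 = ε * _
      rw [hpow, hpow', sub_zero, mul_assoc, ← Units.val_mul, ← zpow_add]
      refine congrArg (fun n : ℤ => (ε : GInf) * ((z ^ n : GInfˣ) : GInf)) ?_
      push_cast
      ring
    · change (ε : GInf) * (z⁻¹ : GInfˣ) * ((z⁻¹ : GInfˣ) : GInf) ^ (j : ℕ) - 0 = ε * _
      rw [hpow, ← zpow_neg_one, sub_zero, mul_assoc, ← Units.val_mul, ← zpow_add]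
      refine congrArg (fun n : ℤ => (ε : GInf) * ((z ^ n : GInfˣ) : GInf)) ?_
      push_cast
      ring

/-- Coordinate and speed have opposite parities, since their ratio is the odd parameter ε. An even
coordinate has an odd speed, which produces the involution; an odd coordinate has an even speed, and
its twist already contains the involution. Hence the product rules for partial derivatives and for
the sewing derivative match. -/
theorem coordSpeed_mul_twist {z : GInfˣ} {θ : GInf} (hz : (z : GInf) ∈ gEven) (hθ : θ ∈ gOdd)
    (c : CoordName) (x : GInf) : coordSpeed z θ c * c.twist x = parityInv x * coordSpeed z θ c := by
  have hodd : ∀ e ∈ gOdd, e * x = parityInv x * e := fun e he => by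
    rw [mul_odd _ he]
    congr 1
    exact (CliffordAlgebra.involute_involute x).symm
  rcases c with _ | ⟨k, j⟩ | ⟨k, j⟩
  · exact hodd _ (odd_mul_even hθ (units_zpow_even hz _))
  · exact hodd _ (odd_mul_even (by rw [two_mul]; exact gOdd.add_mem hθ hθ) (units_zpow_even hz _))
  · exact even_comm (units_zpow_even hz _) _

/-- The coordinate derivatives at `e` of `F` and its derivative along the sewing. -/
structure IsGradient (z : GInfˣ) (θ : GInf) (hz : (z : GInf) ∈ gEven) (hθ : θ ∈ gOdd)
    (F : SDOne) (D : CoordName → GInf) : Prop where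
  finite : (Function.support D).Finite
  partial_at : ∀ c, HasPartialAt identitySK F c (D c)
  deriv : ∀ ε : gOdd, F.1 (sewnPoint z θ hz hθ ε) - F.1 identitySK =
    ε * ∑ᶠ c, coordSpeed z θ c * D c

variable {z : GInfˣ} {θ : GInf} {hz : (z : GInf) ∈ gEven} {hθ : θ ∈ gOdd}

theorem support_mul_finite {D : CoordName → GInf} (h : (Function.support D).Finite)
    (f : CoordName → GInf) : (Function.support fun c => f c * D c).Finite :=
  h.subset fun c hc hc' => hc (by simp [hc'])

theorem IsGradient.add {F G : SDOne} {D D' : CoordName → GInf}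
    (h : IsGradient z θ hz hθ F D) (h' : IsGradient z θ hz hθ G D') :
    IsGradient z θ hz hθ (F + G) (D + D') where
  finite := (h.finite.union h'.finite).subset (Function.support_add _ _)
  partial_at c := (h.partial_at c).add (h'.partial_at c)
  deriv ε := by
    have hadd : ∀ Q, (F + G).1 Q = F.1 Q + G.1 Q := fun _ => rfl
    rw [hadd, hadd, add_sub_add_comm, h.deriv, h'.deriv, ← mul_add,
      ← finsum_add_distrib (support_mul_finite h.finite _) (support_mul_finite h'.finite _)]
    simp [mul_add]

theorem IsGradient.mul {F G : SDOne} {D D' : CoordName → GInf}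
    (h : IsGradient z θ hz hθ F D) (h' : IsGradient z θ hz hθ G D') :
    IsGradient z θ hz hθ (F * G)
      fun c => D c * G.1 identitySK + c.twist (F.1 identitySK) * D' c where
  finite := by
    refine (h.finite.union h'.finite).subset fun c hc => ?_
    by_contra hcon
    simp only [Set.mem_union, Function.mem_support, not_or, not_not] at hcon
    exact hc (by simp [hcon.1, hcon.2])
  partial_at c := (h.partial_at c).mul (h'.partial_at c)
  deriv ε := by
    have hmul : ∀ Q, (F * G).1 Q = F.1 Q * G.1 Q := fun _ => rfl
    have hsplit : ∀ a b c d : GInf, a * b - c * d = (a - c) * d + c * (b - d) + (a - c) * (b - d) :=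
      fun a b c d => by noncomm_ring
    rw [hmul, hmul, hsplit, h.deriv, h'.deriv, ← mul_assoc (_ * _) (ε : GInf),
      odd_mul_mul_self ε.2, zero_mul, add_zero, ← mul_assoc (F.1 identitySK), mul_odd _ ε.2]
    have h1 : ∀ c, coordSpeed z θ c * (D c * G.1 identitySK + c.twist (F.1 identitySK) * D' c) =
        coordSpeed z θ c * D c * G.1 identitySK +
          parityInv (F.1 identitySK) * (coordSpeed z θ c * D' c) := fun c => by
      rw [mul_add, ← mul_assoc, ← mul_assoc, coordSpeed_mul_twist hz hθ, mul_assoc (parityInv _)]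
    simp only [h1]
    have h2 : (Function.support fun c => coordSpeed z θ c * D c * G.1 identitySK).Finite :=
      (support_mul_finite h.finite (coordSpeed z θ)).subset fun c hc hc' => hc (by simp_all)
    have h3 : (Function.support fun c =>
        parityInv (F.1 identitySK) * (coordSpeed z θ c * D' c)).Finite :=
      (support_mul_finite h'.finite (coordSpeed z θ)).subset fun c hc hc' => hc (by simp_all)
    rw [finsum_add_distrib h2 h3, ← finsum_mul' (fun c => coordSpeed z θ c * D c) _ (support_mul_finite h.finite _),
      ← mul_finsum' (fun c => coordSpeed z θ c * D' c) _ (support_mul_finite h'.finite _)]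
    noncomm_ring

/-- Induction over the generators of SD(1). The gradient of a coordinate is the corresponding unit
vector, that of 1/a at a = 1 is -1 in the direction of a, and sums and products follow the rules
above. -/
theorem exists_isGradient (F : SDOne) : ∃ D, IsGradient z θ hz hθ F D := by
  classical
  obtain ⟨F, hF⟩ := F
  induction hF using Algebra.adjoin_induction with
  | mem F hF =>
    rcases hF with (⟨c, rfl⟩ | ⟨c, rfl⟩) | hF
    · refine ⟨0, by simp, fun c' => ?_, fun ε => by simp⟩
      rcases c' with _ | ⟨k, j⟩ | ⟨k, j⟩
      · exact ⟨0, fun Q _ => by simp⟩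
      · exact ⟨0, fun Q _ => by simp⟩
      · exact fun Q _ => by simp
    · refine ⟨Pi.single c 1, ?_, fun c' => ?_, fun ε => ?_⟩
      · exact (Set.finite_singleton c).subset Pi.support_single_subset
      · have h1 : ∀ Q : SKOne, (∀ c'', c'' ≠ c' → c''.val Q = c''.val identitySK) →
            c.val Q - c.val identitySK =
              (c'.val Q - c'.val identitySK) * (Pi.single c 1 : CoordName → GInf) c' := by
          intro Q hQ
          rcases eq_or_ne c' c with rfl | h
          · simp
          · rw [Pi.single_eq_of_ne h, hQ c (Ne.symm h)]
            simp
        rcases c' with _ | ⟨k, j⟩ | ⟨k, j⟩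
        · exact ⟨0, fun Q hQ => by rw [Pi.zero_apply, mul_zero, add_zero]; exact h1 Q hQ⟩
        · exact ⟨0, fun Q hQ => by rw [Pi.zero_apply, mul_zero, add_zero]; exact h1 Q hQ⟩
        · exact h1
      · rw [finsum_eq_single _ c fun c' hc' => by rw [Pi.single_eq_of_ne hc', mul_zero],
          Pi.single_eq_same, mul_one]
        exact val_sewnPoint_sub hz hθ ε c
    · obtain rfl : F = fun Q => Ring.inverse (CoordName.a.val Q) := hF
      -- With Δ = a - 1, exactly 1/a - 1 = -Δ + Δ²/a; along the sewing Δ is a left multiple of ε, so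
      -- the last term vanishes there.
      have h1 : ∀ Q : SKOne, Ring.inverse (CoordName.a.val Q) -
          Ring.inverse (CoordName.a.val identitySK) =
          (CoordName.a.val Q - CoordName.a.val identitySK) * (-1) +
            (CoordName.a.val Q - CoordName.a.val identitySK) ^ 2 *
              Ring.inverse (CoordName.a.val Q) := by
        intro Q
        have h2 : CoordName.a.val identitySK = 1 := rfl
        rw [h2, Ring.inverse_one]
        have h3 := mul_inverse (Q.a_even 0) (Q.a_body 0)
        change Q.a 0 * _ = 1 at h3
        change Ring.inverse (Q.a 0) - 1 = (Q.a 0 - 1) * (-1) + (Q.a 0 - 1) ^ 2 * Ring.inverse (Q.a 0)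
        rw [pow_two, mul_assoc, sub_mul _ _ (Ring.inverse _), h3, one_mul]
        generalize Ring.inverse (Q.a 0) = b at *
        have h4 : Q.a 0 * b = 1 := h3
        simp only [sub_mul, mul_sub, mul_one, one_mul, h4]
        noncomm_ring
      refine ⟨Pi.single .a (-1), ?_, fun c' => ?_, fun ε => ?_⟩
      · exact (Set.finite_singleton _).subset Pi.support_single_subset
      · have h3 : ∀ c', c' ≠ CoordName.a → ∀ Q : SKOne,
            (∀ c'', c'' ≠ c' → c''.val Q = c''.val identitySK) →
            Ring.inverse (CoordName.a.val Q) - Ring.inverse (CoordName.a.val identitySK) =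
              (c'.val Q - c'.val identitySK) * (Pi.single .a (-1) : CoordName → GInf) c' := by
          intro c' hc' Q hQ
          rw [hQ _ hc'.symm, Pi.single_eq_of_ne hc']
          simp
        rcases c' with _ | ⟨k, j⟩ | ⟨k, j⟩
        · refine ⟨fun Q => Ring.inverse (CoordName.a.val Q), fun Q _ => ?_⟩
          rw [Pi.single_eq_same]
          exact h1 Q
        · refine ⟨0, fun Q hQ => ?_⟩
          rw [Pi.zero_apply, mul_zero, add_zero]
          exact h3 _ (by simp) Q hQ
        · exact h3 _ (by simp)
      · rw [finsum_eq_single _ .a fun c' hc' => by rw [Pi.single_eq_of_ne hc', mul_zero],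
          Pi.single_eq_same]
        refine (h1 _).trans ?_
        rw [val_sewnPoint_sub hz hθ ε, pow_two, ← mul_assoc (_ * _) (ε : GInf),
          odd_mul_mul_self ε.2]
        simp
  | algebraMap r =>
    refine ⟨0, by simp, fun c' => ?_, fun ε => by simp [Pi.algebraMap_apply]⟩
    rcases c' with _ | ⟨k, j⟩ | ⟨k, j⟩
    · exact ⟨0, fun Q _ => by simp [Pi.algebraMap_apply]⟩
    · exact ⟨0, fun Q _ => by simp [Pi.algebraMap_apply]⟩
    · exact fun Q _ => by simp [Pi.algebraMap_apply]
  | add F G hF hG ihF ihG =>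
    obtain ⟨D, hD⟩ := ihF
    obtain ⟨D', hD'⟩ := ihG
    exact ⟨_, hD.add hD'⟩
  | mul F G hF hG ihF ihG =>
    obtain ⟨D, hD⟩ := ihF
    obtain ⟨D', hD'⟩ := ihG
    exact ⟨_, hD.mul hD'⟩

theorem HasOddDerivAtZero.unique {g : gOdd → GInf} {D D' : GInf} (h : HasOddDerivAtZero g D)
    (h' : HasOddDerivAtZero g D') : D = D' :=
  eq_of_odd_mul fun e he => (h ⟨e, he⟩).symm.trans (h' ⟨e, he⟩)

theorem sewnPoint_zero : sewnPoint z θ hz hθ 0 = identitySK := by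
  have h1 : ∀ c u : GInf, geomA (0 * c) u = 0 := fun c u => by ext; simp [geomA]
  have h2 : ∀ c u : GInf, geomM (0 * c) u = 0 := fun c u => by ext; simp [geomM]
  ext i
  · rfl
  · rfl
  · exact congrFun (h1 _ _) _
  · exact congrFun (h2 _ _) _
  · change 1 + ((0 : gOdd) : GInf) * _ = (1 : GInf)
    simp
  · exact congrFun (h1 _ _) _
  · exact congrFun (h2 _ _) _

theorem finsum_coordName {f : CoordName → GInf} (hf : (Function.support f).Finite) :
    ∑ᶠ c, f c = f .a + (∑ k : Fin 2, ∑ᶠ j, f (.A k j)) + ∑ k : Fin 2, ∑ᶠ j, f (.M k j) := by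
  have hA : ∀ k, Function.Injective (CoordName.A k) := fun k i j h => by injection h
  have hM : ∀ k, Function.Injective (CoordName.M k) := fun k i j h => by injection h
  have huniv : (Set.univ : Set CoordName) = {.a} ∪ (Set.range (CoordName.A 0) ∪
      (Set.range (CoordName.A 1) ∪ (Set.range (CoordName.M 0) ∪ Set.range (CoordName.M 1)))) := by
    ext c
    rcases c with _ | ⟨k, j⟩ | ⟨k, j⟩
    · simp
    · fin_cases k <;> simp
    · fin_cases k <;> simp
  have hfin : ∀ s : Set CoordName, (s ∩ Function.support f).Finite := fun s =>
    hf.subset Set.inter_subset_right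
  rw [← finsum_mem_univ, huniv, finsum_mem_union' _ (hfin _) (hfin _),
    finsum_mem_union' _ (hfin _) (hfin _), finsum_mem_union' _ (hfin _) (hfin _),
    finsum_mem_union' _ (hfin _) (hfin _), finsum_mem_singleton, finsum_mem_range (hA _),
    finsum_mem_range (hA _), finsum_mem_range (hM _), finsum_mem_range (hM _),
    Fin.sum_univ_two, Fin.sum_univ_two]
  · abel
  all_goals
    rw [Set.disjoint_left]
    rintro _ h h'
    simp at h h'
    aesop

end SuperSewing
end

noncomputable section
namespace SuperSewing
open Filter Topology

/-! ## Analytic Grassmann-valued functions -/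

/-- `f` is near `z` a finite sum of analytic functions times constants. -/
inductive GAnalyticAt (z : ℂ) : (ℂ → GInf) → Prop
  | smul {c : ℂ → ℂ} (hc : AnalyticAt ℂ c z) (e : GInf) : GAnalyticAt z fun t => c t • e
  | add {f g : ℂ → GInf} : GAnalyticAt z f → GAnalyticAt z g → GAnalyticAt z fun t => f t + g t
  | congr {f g : ℂ → GInf} : GAnalyticAt z f → f =ᶠ[𝓝 z] g → GAnalyticAt z g

namespace GAnalyticAt

variable {z : ℂ} {f g : ℂ → GInf}

theorem const (e : GInf) : GAnalyticAt z fun _ => e := by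
  simpa using smul (analyticAt_const (v := (1 : ℂ))) e

theorem id : GAnalyticAt z fun t => algebraMap ℂ GInf t := by
  simpa [Algebra.algebraMap_eq_smul_one] using smul (analyticAt_id (𝕜 := ℂ) (z := z)) 1

theorem scalar {c : ℂ → ℂ} (hc : AnalyticAt ℂ c z) :
    GAnalyticAt z fun t => algebraMap ℂ GInf (c t) := by
  simpa [Algebra.algebraMap_eq_smul_one] using smul hc 1

theorem linear (hf : GAnalyticAt z f) (L : GInf →ₗ[ℂ] GInf) : GAnalyticAt z fun t => L (f t) := by
  induction hf with
  | smul hc e => simpa using smul hc (L e)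
  | add _ _ ihf ihg => simpa using add ihf ihg
  | congr _ h ih => exact ih.congr (h.mono fun t ht => by simp only [ht])

theorem const_smul (hf : GAnalyticAt z f) (c : ℂ) : GAnalyticAt z fun t => c • f t :=
  hf.linear (LinearMap.lsmul ℂ GInf c)

theorem const_mul (hf : GAnalyticAt z f) (c : GInf) : GAnalyticAt z fun t => c * f t :=
  hf.linear (LinearMap.mulLeft ℂ c)

theorem mul_const (hf : GAnalyticAt z f) (c : GInf) : GAnalyticAt z fun t => f t * c :=
  hf.linear (LinearMap.mulRight ℂ c)

theorem neg (hf : GAnalyticAt z f) : GAnalyticAt z fun t => -f t := by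
  simpa using hf.const_smul (-1)

theorem sub (hf : GAnalyticAt z f) (hg : GAnalyticAt z g) : GAnalyticAt z fun t => f t - g t := by
  simpa [sub_eq_add_neg] using hf.add hg.neg

theorem smul_fun (hf : GAnalyticAt z f) {c : ℂ → ℂ} (hc : AnalyticAt ℂ c z) :
    GAnalyticAt z fun t => c t • f t := by
  induction hf with
  | smul hd e => simpa [smul_smul] using smul (hc.mul hd) e
  | add _ _ ihf ihg => simpa using add ihf ihg
  | congr _ h ih => exact ih.congr (h.mono fun t ht => by simp only [ht])

theorem mul (hf : GAnalyticAt z f) (hg : GAnalyticAt z g) : GAnalyticAt z fun t => f t * g t := by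
  induction hf with
  | smul hc e => simpa using (hg.const_mul e).smul_fun hc
  | add _ _ ihf ihg => simpa [add_mul] using add ihf ihg
  | congr _ h ih => exact ih.congr (h.mono fun t ht => by simp only [ht])

theorem pow (hf : GAnalyticAt z f) (n : ℕ) : GAnalyticAt z fun t => f t ^ n := by
  induction n with
  | zero => simpa using const 1
  | succ n ih => simpa [pow_succ] using ih.mul hf

theorem sum {ι : Type*} (s : Finset ι) {F : ι → ℂ → GInf} (h : ∀ i ∈ s, GAnalyticAt z (F i)) :
    GAnalyticAt z fun t => ∑ i ∈ s, F i t := by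
  classical
  induction s using Finset.induction_on with
  | empty => simpa using const 0
  | insert a s ha ih =>
    simp only [Finset.sum_insert ha]
    exact (h a (Finset.mem_insert_self _ _)).add
      (ih fun i hi => h i (Finset.mem_insert_of_mem hi))

theorem dual (hf : GAnalyticAt z f) (l : Module.Dual ℂ GInf) : AnalyticAt ℂ (fun t => l (f t)) z := by
  induction hf with
  | smul hc e =>
    simp only [map_smul, smul_eq_mul]
    exact hc.fun_mul analyticAt_const
  | add _ _ ihf ihg =>
    simp only [map_add]
    exact ihf.fun_add ihg
  | congr _ h ih => exact ih.congr (h.mono fun t ht => by simp only [ht])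

theorem body (hf : GAnalyticAt z f) : AnalyticAt ℂ (fun t => body (f t)) z :=
  hf.dual ExteriorAlgebra.algebraMapInv.toLinearMap

theorem soul (hf : GAnalyticAt z f) : GAnalyticAt z fun t => soul (f t) :=
  hf.sub (scalar hf.body)

theorem eventually (hf : GAnalyticAt z f) : ∀ᶠ t in 𝓝 z, GAnalyticAt t f := by
  induction hf with
  | smul hc e => exact hc.eventually_analyticAt.mono fun t ht => smul ht e
  | add _ _ ihf ihg => filter_upwards [ihf, ihg] with t h1 h2 using add h1 h2
  | congr _ h ih => filter_upwards [ih, h.eventually_nhds] with t h1 h2 using h1.congr h2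

theorem comp (hf : GAnalyticAt z f) {κ : ℂ → ℂ} {x : ℂ} (hκ : AnalyticAt ℂ κ x) (hx : κ x = z) :
    GAnalyticAt x fun t => f (κ t) := by
  subst hx
  induction hf with
  | smul hc e => exact smul (hc.comp hκ) e
  | add _ _ ihf ihg => exact add ihf ihg
  | congr _ h ih => exact ih.congr (hκ.continuousAt.eventually h)

/-- Locally the values stay in a finite-dimensional space; this bounds the nilpotency order of their
souls uniformly, which makes Taylor sums and inverses finite sums of analytic functions. -/
theorem exists_span (hf : GAnalyticAt z f) :
    ∃ S : Finset GInf, ∀ᶠ t in 𝓝 z, f t ∈ Submodule.span ℂ (S : Set GInf) := by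
  classical
  induction hf with
  | smul hc e =>
    exact ⟨{e}, Eventually.of_forall fun t => Submodule.smul_mem _ _
      (Submodule.subset_span (by simp))⟩
  | add _ _ ihf ihg =>
    obtain ⟨S, hS⟩ := ihf
    obtain ⟨S', hS'⟩ := ihg
    refine ⟨S ∪ S', ?_⟩
    filter_upwards [hS, hS'] with t h1 h2
    rw [Finset.coe_union, Submodule.span_union]
    exact Submodule.add_mem_sup h1 h2
  | congr _ h ih =>
    obtain ⟨S, hS⟩ := ih
    refine ⟨S, ?_⟩
    filter_upwards [hS, h] with t h1 h2
    rwa [← h2]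

end GAnalyticAt

/-- Souls of even elements are commuting nilpotents, and the exponents of a finite spanning set may
simply be added. -/
theorem exists_pow_soul_eq_zero (S : Finset GInf) (hS : ∀ x ∈ S, x ∈ gEven) :
    ∃ N : ℕ, ∀ x ∈ Submodule.span ℂ (S : Set GInf), soul x ^ N = 0 := by
  classical
  induction S using Finset.induction_on with
  | empty =>
    refine ⟨1, fun x hx => ?_⟩
    rw [Finset.coe_empty, Submodule.span_empty, Submodule.mem_bot] at hx
    simp [hx, soul, body_zero]
  | insert e S _ ih =>
    obtain ⟨N, hN⟩ := ih fun x hx => hS x (Finset.mem_insert_of_mem hx)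
    obtain ⟨K, hK⟩ := isNilpotent_soul (hS e (Finset.mem_insert_self _ _))
    refine ⟨K + N, fun x hx => ?_⟩
    rw [Finset.coe_insert, Submodule.mem_span_insert] at hx
    obtain ⟨c, y, hy, rfl⟩ := hx
    have h1 : soul (c • e) = c • soul e := by
      rw [soul, soul, body_smul, smul_sub, map_mul, ← Algebra.smul_def]
    rw [soul_add, h1]
    refine (Commute.smul_left (even_commute (soul_even (hS e (Finset.mem_insert_self _ _))) _)
      c).add_pow_eq_zero_of_add_le_succ_of_pow_eq_zero ?_ (hN y hy) (Nat.le_succ _)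
    rw [smul_pow, hK, smul_zero]

/-- The projection to the even part. -/
def evenProj : GInf →ₗ[ℂ] GInf := (1 / 2 : ℂ) • (LinearMap.id + parityInv.toLinearMap)

theorem evenProj_mem (x : GInf) : evenProj x ∈ gEven := by
  rw [mem_gEven_iff]
  have : parityInv (parityInv x) = x := CliffordAlgebra.involute_involute x
  simp [evenProj, this, add_comm]

theorem evenProj_even {x : GInf} (hx : x ∈ gEven) : evenProj x = x := by
  simp only [evenProj, LinearMap.smul_apply, LinearMap.add_apply, LinearMap.id_apply,
    AlgHom.toLinearMap_apply, parityInv_even hx, ← two_smul ℂ x, smul_smul]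
  norm_num

namespace GAnalyticAt

variable {z : ℂ} {f g : ℂ → GInf}

theorem exists_soul_pow (hf : GAnalyticAt z f) (he : ∀ᶠ t in 𝓝 z, f t ∈ gEven) :
    ∃ N : ℕ, ∀ᶠ t in 𝓝 z, SuperSewing.soul (f t) ^ N = 0 := by
  classical
  obtain ⟨S, hS⟩ := hf.exists_span
  -- The spanning elements need not be even; since the values are, their even projections span them
  -- as well.
  obtain ⟨N, hN⟩ := exists_pow_soul_eq_zero (S.image evenProj) fun x hx => by
    obtain ⟨y, -, rfl⟩ := Finset.mem_image.mp hx
    exact evenProj_mem y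
  refine ⟨N, ?_⟩
  filter_upwards [hS, he] with t h1 h2
  refine hN _ ?_
  rw [← evenProj_even h2, Finset.coe_image, ← Submodule.map_span]
  exact Submodule.mem_map_of_mem h1

/-- The inverse is b⁻¹ ∑_{k<N} (-soul/b)^k with b the body and N a uniform nilpotency order, hence
again a finite sum of analytic functions. -/
theorem inverse (hf : GAnalyticAt z f) (he : ∀ᶠ t in 𝓝 z, f t ∈ gEven)
    (hb : SuperSewing.body (f z) ≠ 0) : GAnalyticAt z fun t => Ring.inverse (f t) := by
  obtain ⟨N, hN⟩ := hf.exists_soul_pow he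
  have hbi : AnalyticAt ℂ (fun t => (SuperSewing.body (f t))⁻¹) z := hf.body.inv hb
  have hy : GAnalyticAt z fun t => -((SuperSewing.body (f t))⁻¹ • SuperSewing.soul (f t)) :=
    (hf.soul.smul_fun hbi).neg
  refine ((sum (Finset.range N) fun k _ => hy.pow k).smul_fun hbi).congr ?_
  filter_upwards [hN, he, hf.body.continuousAt.eventually_ne hb] with t h1 h2 h3
  set b := SuperSewing.body (f t) with hbdef
  set y := -(b⁻¹ • SuperSewing.soul (f t)) with hydef
  have h4 : f t = b • (1 - y) := by
    rw [hydef, sub_neg_eq_add, smul_add, smul_smul, mul_inv_cancel₀ h3, one_smul,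
      ← Algebra.algebraMap_eq_smul_one]
    exact (body_add_soul _).symm
  have h5 : y ^ N = 0 := by rw [hydef, neg_pow, smul_pow, h1, smul_zero, mul_zero]
  refine (inverse_eq ?_ ?_).symm
  · rw [h4, smul_mul_smul_comm, mul_inv_cancel₀ h3, one_smul, mul_neg_geom_sum, h5, sub_zero]
  · rw [h4, smul_mul_smul_comm, inv_mul_cancel₀ h3, one_smul, geom_sum_mul_neg, h5, sub_zero]

end GAnalyticAt

/-! ## Derivatives and evaluation at even elements -/

/-- The Taylor coefficients of `f`, times factorials. -/
def jet (f : ℂ → GInf) (n : ℕ) (z : ℂ) : GInf :=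
  Classical.epsilon fun v => ∀ l : Module.Dual ℂ GInf, l v = iteratedDeriv n (fun t => l (f t)) z

theorem jet_congr {f g : ℂ → GInf} {z : ℂ} (h : f =ᶠ[𝓝 z] g) (n : ℕ) : jet f n z = jet g n z := by
  have : ∀ l : Module.Dual ℂ GInf, iteratedDeriv n (fun t => l (f t)) z =
      iteratedDeriv n (fun t => l (g t)) z := fun l =>
    Filter.EventuallyEq.iteratedDeriv_eq n (h.mono fun t ht => by simp only [ht])
  simp only [jet, this]

theorem jet_eq {f : ℂ → GInf} {n : ℕ} {z : ℂ} {v : GInf}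
    (h : ∀ l : Module.Dual ℂ GInf, l v = iteratedDeriv n (fun t => l (f t)) z) : jet f n z = v :=
  eq_of_forall_dual fun l => (Classical.epsilon_spec (p := fun v => ∀ l : Module.Dual ℂ GInf,
    l v = iteratedDeriv n (fun t => l (f t)) z) ⟨v, h⟩ l).trans (h l).symm

/-- Existence is the point: the derivatives of all functionals are represented by one element of the
algebra, so the choice in `jet` is meaningful. -/
theorem GAnalyticAt.dual_jet {f : ℂ → GInf} {z : ℂ} (hf : GAnalyticAt z f) (n : ℕ)
    (l : Module.Dual ℂ GInf) : l (jet f n z) = iteratedDeriv n (fun t => l (f t)) z := by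
  have : ∃ v, ∀ l : Module.Dual ℂ GInf, l v = iteratedDeriv n (fun t => l (f t)) z := by
    clear l
    induction hf with
    | @smul c hc e =>
      refine ⟨iteratedDeriv n c z • e, fun l => ?_⟩
      simp only [map_smul, smul_eq_mul]
      rw [iteratedDeriv_mul_const_field]
    | @add f g hf hg ihf ihg =>
      obtain ⟨v, hv⟩ := ihf
      obtain ⟨w, hw⟩ := ihg
      refine ⟨v + w, fun l => ?_⟩
      simp only [map_add]
      rw [hv, hw]
      exact (iteratedDeriv_add (hf.dual l).contDiffAt (hg.dual l).contDiffAt).symm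
    | congr _ h ih =>
      obtain ⟨v, hv⟩ := ih
      refine ⟨v, fun l => (hv l).trans ?_⟩
      exact Filter.EventuallyEq.iteratedDeriv_eq n (h.mono fun t ht => by simp only [ht])
  exact Classical.epsilon_spec this l

theorem jet_zero (f : ℂ → GInf) (z : ℂ) : jet f 0 z = f z := jet_eq fun l => by simp

theorem jet_smul {c : ℂ → ℂ} (e : GInf) (n : ℕ) (z : ℂ) :
    jet (fun t => c t • e) n z = iteratedDeriv n c z • e := jet_eq fun l => by
  simp only [map_smul, smul_eq_mul]
  rw [iteratedDeriv_mul_const_field]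

theorem jet_add {f g : ℂ → GInf} {z : ℂ} (hf : GAnalyticAt z f) (hg : GAnalyticAt z g) (n : ℕ) :
    jet (fun t => f t + g t) n z = jet f n z + jet g n z := jet_eq fun l => by
  simp only [map_add]
  rw [hf.dual_jet, hg.dual_jet]
  exact (iteratedDeriv_add (hf.dual l).contDiffAt (hg.dual l).contDiffAt).symm

theorem jet_linear {f : ℂ → GInf} {z : ℂ} (hf : GAnalyticAt z f) (L : GInf →ₗ[ℂ] GInf) (n : ℕ) :
    jet (fun t => L (f t)) n z = L (jet f n z) := jet_eq fun l => hf.dual_jet n (l ∘ₗ L)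

theorem GAnalyticAt.jet {f : ℂ → GInf} {z : ℂ} (hf : GAnalyticAt z f) (n : ℕ) :
    GAnalyticAt z (jet f n) := by
  induction hf with
  | @smul c hc e =>
    refine (GAnalyticAt.smul (hc.iterated_deriv n) e).congr (Eventually.of_forall fun t => ?_)
    rw [jet_smul, iteratedDeriv_eq_iterate]
  | add hf hg ihf ihg =>
    refine (ihf.add ihg).congr ?_
    filter_upwards [hf.eventually, hg.eventually] with t h1 h2 using (jet_add h1 h2 n).symm
  | congr _ h ih => exact ih.congr (h.eventually_nhds.mono fun t ht => jet_congr ht n)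

theorem GAnalyticAt.hasGDerivAt_jet {f : ℂ → GInf} {z : ℂ} (hf : GAnalyticAt z f) (n : ℕ) :
    HasGDerivAt (SuperSewing.jet f n) (SuperSewing.jet f (n + 1) z) z := by
  intro l
  rw [hf.dual_jet, iteratedDeriv_succ]
  have h : (fun t => l (SuperSewing.jet f n t)) =ᶠ[𝓝 z] iteratedDeriv n fun t => l (f t) :=
    hf.eventually.mono fun t ht => ht.dual_jet n l
  rw [← h.deriv_eq]
  exact ((hf.jet n).dual l).differentiableAt.hasDerivAt

theorem HasGDerivAt.unique {f : ℂ → GInf} {v w : GInf} {z : ℂ} (h : HasGDerivAt f v z)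
    (h' : HasGDerivAt f w z) : v = w := eq_of_forall_dual fun l => (h l).unique (h' l)

theorem jet_one_eq {f : ℂ → GInf} {v : GInf} {z : ℂ} (h : HasGDerivAt f v z) : jet f 1 z = v :=
  jet_eq fun l => by rw [iteratedDeriv_one]; exact (h l).deriv.symm

theorem jet_jet {f : ℂ → GInf} {z : ℂ} (hf : GAnalyticAt z f) (m n : ℕ) :
    jet (jet f m) n z = jet f (m + n) z := by
  induction n generalizing z with
  | zero => rw [jet_zero]; rfl
  | succ n ih =>
    refine HasGDerivAt.unique ((hf.jet m).hasGDerivAt_jet n) fun l => ?_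
    refine (hf.hasGDerivAt_jet (m + n) l).congr_of_eventuallyEq ?_
    exact hf.eventually.mono fun t ht => by simp only [ih ht]

/-- The value at an even element of the analytic function `f`. -/
def gval (f : ℂ → GInf) (w : GInf) : GInf := jetEval (jet f) w

theorem jetEval_eq_sum {D : ℕ → ℂ → GInf} {w : GInf} {N : ℕ} (hN : soul w ^ N = 0) :
    jetEval D w = ∑ n ∈ Finset.range N, ((n.factorial : ℂ)⁻¹) • (soul w ^ n * D n (body w)) := by
  refine finsum_eq_sum_of_support_subset _ fun n hn => ?_
  by_contra h
  refine hn ?_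
  dsimp only
  rw [pow_eq_zero_of_le (by simpa using h) hN, zero_mul, smul_zero]

theorem jetEval_algebraMap (D : ℕ → ℂ → GInf) (t : ℂ) : jetEval D (algebraMap ℂ GInf t) = D 0 t := by
  rw [jetEval_eq_sum (N := 1) (by rw [soul_algebraMap, pow_one])]
  simp [body_algebraMap]

theorem jetEval_congr {D D' : ℕ → ℂ → GInf} {w : GInf} (h : ∀ n, D n (body w) = D' n (body w)) :
    jetEval D w = jetEval D' w := by simp only [jetEval, h]

theorem gval_congr {f g : ℂ → GInf} {w : GInf} (h : f =ᶠ[𝓝 (body w)] g) : gval f w = gval g w :=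
  jetEval_congr fun n => jet_congr h n

theorem gval_algebraMap (f : ℂ → GInf) (t : ℂ) : gval f (algebraMap ℂ GInf t) = f t := by
  rw [gval, jetEval_algebraMap, jet_zero]

theorem jetEval_jetDeriv_jet {f : ℂ → GInf} {w : GInf} (hf : GAnalyticAt (body w) f) :
    jetEval (jetDeriv (jet f)) w = gval (jet f 1) w :=
  jetEval_congr fun n => by rw [jet_jet hf, add_comm]; rfl

section gval

variable {w : GInf} (hw : w ∈ gEven) {f g : ℂ → GInf}
include hw

theorem gval_add (hf : GAnalyticAt (body w) f) (hg : GAnalyticAt (body w) g) :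
    gval (fun t => f t + g t) w = gval f w + gval g w := by
  obtain ⟨N, hN⟩ := isNilpotent_soul hw
  simp only [gval, jetEval_eq_sum hN, jet_add hf hg, mul_add, smul_add, Finset.sum_add_distrib]

/-- The Leibniz rule makes the Taylor series of a product the Cauchy product of the two series; the
even soul passes the constants freely. -/
theorem gval_smul_smul {c d : ℂ → ℂ} (hc : AnalyticAt ℂ c (body w)) (hd : AnalyticAt ℂ d (body w))
    (e e' : GInf) : gval (fun t => (c t * d t) • (e * e')) w =
      gval (fun t => c t • e) w * gval (fun t => d t • e') w := by
  obtain ⟨N, hN⟩ := isNilpotent_soul hw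
  simp only [gval, jetEval_eq_sum hN, jet_smul]
  have hs := soul_even hw
  set s := soul w
  set b := body w
  have hmul : ∀ n, iteratedDeriv n (fun t => c t * d t) b = ∑ i ∈ Finset.range (n + 1),
      n.choose i * iteratedDeriv i c b * iteratedDeriv (n - i) d b := fun n =>
    iteratedDeriv_fun_mul hc.contDiffAt hd.contDiffAt
  let F : ℕ → ℕ → GInf := fun i j => (((i.factorial : ℂ)⁻¹ * iteratedDeriv i c b) *
    ((j.factorial : ℂ)⁻¹ * iteratedDeriv j d b)) • (s ^ (i + j) * (e * e'))
  have h1 : ∀ i j, ((i.factorial : ℂ)⁻¹ • (s ^ i * iteratedDeriv i c b • e)) *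
      ((j.factorial : ℂ)⁻¹ • (s ^ j * iteratedDeriv j d b • e')) = F i j := fun i j => by
    simp only [F, mul_smul_comm, smul_mul_assoc, smul_smul]
    congr 1
    · ring
    · rw [mul_assoc, even_left_comm (even_pow hs j) e, ← mul_assoc, ← pow_add]
  have h2 : ∀ n, (n.factorial : ℂ)⁻¹ • (s ^ n * iteratedDeriv n (fun t => c t * d t) b • (e * e')) =
      ∑ k ∈ Finset.range (n + 1), F k (n - k) := fun n => by
    rw [hmul, mul_smul_comm, smul_smul, Finset.mul_sum, Finset.sum_smul]
    refine Finset.sum_congr rfl fun k hk => ?_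
    have hk' : k ≤ n := by simpa [Nat.lt_succ_iff] using hk
    simp only [F]
    rw [Nat.add_sub_cancel' hk', Nat.cast_choose ℂ hk']
    congr 1
    have := Nat.cast_ne_zero (R := ℂ).mpr n.factorial_ne_zero
    field_simp
  rw [Finset.sum_mul_sum]
  simp only [h1, h2]
  -- The triangle i + j < N is completed to the square of pairs below N; the added terms contain the
  -- soul to a power at least N and vanish.
  rw [Finset.sum_range_diag_flip]
  refine Finset.sum_congr rfl fun i _ => ?_
  refine Finset.sum_subset (Finset.range_subset_range.mpr (Nat.sub_le _ _)) fun j _ hj => ?_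
  have : N ≤ i + j := by
    simp only [Finset.mem_range] at hj
    omega
  simp only [F]
  rw [pow_eq_zero_of_le this hN, zero_mul, smul_zero]

/-- Multiplicativity extends identities between functions of a complex variable to all even
arguments; the superconformal conditions are transported in this way. -/
theorem gval_mul (hf : GAnalyticAt (body w) f) (hg : GAnalyticAt (body w) g) :
    gval (fun t => f t * g t) w = gval f w * gval g w := by
  induction hf with
  | @smul c hc e =>
    induction hg with
    | @smul d hd e' =>
      rw [← gval_smul_smul hw hc hd]
      simp only [smul_mul_smul_comm]
    | @add g g' hg hg' ih ih' =>
      rw [gval_add hw hg hg', mul_add, ← ih, ← ih']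
      simp only [mul_add]
      exact gval_add hw ((GAnalyticAt.smul hc e).mul hg) ((GAnalyticAt.smul hc e).mul hg')
    | congr _ h ih =>
      rw [← gval_congr h, ← ih]
      exact gval_congr (h.mono fun t ht => by simp only [ht])
  | @add f f' hf hf' ih ih' =>
    rw [gval_add hw hf hf', add_mul, ← ih, ← ih']
    simp only [add_mul]
    exact gval_add hw (hf.mul hg) (hf'.mul hg)
  | congr _ h ih =>
    rw [← gval_congr h, ← ih]
    exact gval_congr (h.mono fun t ht => by simp only [ht])

/-- Powers of the soul stand to the left of the derivatives in the Taylor sum, so `L` has to commute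
with left multiplication by even elements. -/
theorem gval_linear (hf : GAnalyticAt (body w) f) (L : GInf →ₗ[ℂ] GInf)
    (hL : ∀ x ∈ gEven, ∀ y, L (x * y) = x * L y) : gval (fun t => L (f t)) w = L (gval f w) := by
  obtain ⟨N, hN⟩ := isNilpotent_soul hw
  simp only [gval, jetEval_eq_sum hN, jet_linear hf, map_sum, map_smul,
    hL _ (even_pow (soul_even hw) _)]

theorem gval_const (e : GInf) : gval (fun _ => e) w = e := by
  obtain ⟨N, hN⟩ := isNilpotent_soul hw
  have h : ∀ n, jet (fun _ => e) n (body w) = if n = 0 then e else 0 := fun n =>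
    jet_eq fun l => by
      rw [iteratedDeriv_const]
      split_ifs <;> simp
  have hN' : soul w ^ (N + 1) = 0 := pow_eq_zero_of_le (Nat.le_succ N) hN
  rw [gval, jetEval_eq_sum hN', Finset.sum_eq_single 0]
  · simp [h]
  · intro n _ hn
    simp [h, hn]
  · simp

theorem gval_id : gval (fun t => algebraMap ℂ GInf t) w = w := by
  obtain ⟨N, hN⟩ := isNilpotent_soul hw
  have h : ∀ n, jet (fun t => algebraMap ℂ GInf t) n (body w) =
      if n = 0 then algebraMap ℂ GInf (body w) else if n = 1 then 1 else 0 := fun n => by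
    simp only [Algebra.algebraMap_eq_smul_one]
    rw [jet_smul]
    rcases n with _ | _ | n
    · simp
    · simp
    · rw [iteratedDeriv_succ']
      have : deriv (fun t : ℂ => t) = fun _ => 1 := by ext t; simp
      rw [this, iteratedDeriv_const]
      simp
  have hN' : soul w ^ (N + 2) = 0 := pow_eq_zero_of_le (by omega) hN
  rw [gval, jetEval_eq_sum hN', Finset.sum_range_succ', Finset.sum_range_succ', Finset.sum_eq_zero]
  · simp only [h]
    simp [add_comm (soul w), body_add_soul]
  · intro n _
    simp [h]

theorem gval_const_mul (hf : GAnalyticAt (body w) f) (c : GInf) :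
    gval (fun t => c * f t) w = c * gval f w :=
  gval_linear hw hf (LinearMap.mulLeft ℂ c) fun x hx y => by
    simp only [LinearMap.mulLeft_apply]
    exact even_left_comm hx c y

theorem gval_smul (hf : GAnalyticAt (body w) f) (c : ℂ) :
    gval (fun t => c • f t) w = c • gval f w :=
  gval_linear hw hf (LinearMap.lsmul ℂ GInf c) fun x _ y => by simp

theorem gval_neg (hf : GAnalyticAt (body w) f) : gval (fun t => -f t) w = -gval f w :=
  gval_linear hw hf (-LinearMap.id) fun x _ y => by simp

theorem gval_sub (hf : GAnalyticAt (body w) f) (hg : GAnalyticAt (body w) g) :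
    gval (fun t => f t - g t) w = gval f w - gval g w := by
  simp only [sub_eq_add_neg]
  rw [gval_add hw hf hg.neg, gval_neg hw hg]

theorem gval_inverse (hf : GAnalyticAt (body w) f) (he : ∀ᶠ t in 𝓝 (body w), f t ∈ gEven)
    (hb : body (f (body w)) ≠ 0) : gval (fun t => Ring.inverse (f t)) w = Ring.inverse (gval f w) := by
  have hi := hf.inverse he hb
  have hne := hf.body.continuousAt.eventually_ne hb
  refine (inverse_eq ?_ ?_).symm
  · rw [← gval_mul hw hf hi, gval_congr (g := fun _ => 1), gval_const hw]
    filter_upwards [he, hne] with t h1 h2 using mul_inverse h1 h2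
  · rw [← gval_mul hw hi hf, gval_congr (g := fun _ => 1), gval_const hw]
    filter_upwards [he, hne] with t h1 h2 using inverse_mul h1 h2

theorem body_gval : body (gval f w) = body (f (body w)) := by
  obtain ⟨N, hN⟩ := isNilpotent_soul hw
  have hN' : soul w ^ (N + 1) = 0 := pow_eq_zero_of_le (Nat.le_succ N) hN
  rw [gval, jetEval_eq_sum hN']
  change ExteriorAlgebra.algebraMapInv _ = _
  rw [map_sum, Finset.sum_eq_single 0]
  · simp only [Nat.factorial_zero, Nat.cast_one, inv_one, one_smul, pow_zero, one_mul, jet_zero]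
    rfl
  · intro n _ hn
    change body _ = 0
    rw [body_smul, body_mul, body_pow, body_soul, zero_pow hn]
    simp
  · simp

end gval

/-- An element outside a subspace is detected by a functional vanishing on the subspace, and the
derivatives of that functional along the function are zero. -/
theorem jet_mem {f : ℂ → GInf} {z : ℂ} (hf : GAnalyticAt z f) (P : Submodule ℂ GInf)
    (h : ∀ᶠ t in 𝓝 z, f t ∈ P) (n : ℕ) : jet f n z ∈ P := by
  by_contra hcon
  obtain ⟨l, hl, hP⟩ := Submodule.exists_le_ker_of_notMem hcon
  refine hl ?_
  rw [hf.dual_jet]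
  have : (fun t => l (f t)) =ᶠ[𝓝 z] fun _ => 0 := h.mono fun t ht => LinearMap.mem_ker.mp (hP ht)
  rw [this.iteratedDeriv_eq, iteratedDeriv_const]
  simp

theorem gval_mem {f : ℂ → GInf} {w : GInf} (hw : w ∈ gEven) (hf : GAnalyticAt (body w) f)
    (P : Submodule ℂ GInf) (hP : ∀ x ∈ gEven, ∀ y ∈ P, x * y ∈ P)
    (h : ∀ᶠ t in 𝓝 (body w), f t ∈ P) : gval f w ∈ P := by
  obtain ⟨N, hN⟩ := isNilpotent_soul hw
  rw [gval, jetEval_eq_sum hN]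
  exact Submodule.sum_mem _ fun n _ => P.smul_mem _ (hP _ (even_pow (soul_even hw) n) _
    (jet_mem hf P h n))

end SuperSewing
end

noncomputable section
namespace SuperSewing
open Filter Topology

/-! ## Derivatives -/

/-- Even increments of square zero act as dual numbers: evaluation there reads off the first
derivative. -/
theorem gval_add_sq_zero {f : ℂ → GInf} (t : ℂ) {s : GInf} (hb : body s = 0)
    (h0 : s * s = 0) : gval f (algebraMap ℂ GInf t + s) = f t + s * jet f 1 t := by
  have h1 : soul (algebraMap ℂ GInf t + s) = s := by
    rw [soul_add, soul_algebraMap, zero_add, soul_eq_self hb]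
  have h2 : body (algebraMap ℂ GInf t + s) = t := by rw [body_add, body_algebraMap, hb, add_zero]
  rw [gval, jetEval_eq_sum (N := 2) (by rw [h1, pow_two, h0]), h1, h2]
  simp [Finset.sum_range_succ, jet_zero]

theorem body_gen_mul_gen (m n : ℕ) : body (gen m * gen n) = 0 := by
  rw [body_mul, body_odd (gen_odd m), zero_mul]

/-- The product rule follows from multiplicativity of evaluation at z + ζ_m ζ_n by comparing the
coefficients of ζ_m ζ_n. -/
theorem jet_one_mul {f g : ℂ → GInf} {z : ℂ} (hf : GAnalyticAt z f) (hg : GAnalyticAt z g) :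
    jet (fun t => f t * g t) 1 z = jet f 1 z * g z + f z * jet g 1 z := by
  refine eq_of_gen_mul_gen_mul fun m n => ?_
  have hs := gen_mul_gen_even m n
  have hs0 := gen_mul_gen_sq m n
  have hb := body_gen_mul_gen m n
  generalize gen m * gen n = s at *
  have hw : algebraMap ℂ GInf z + s ∈ gEven := gEven.add_mem (algebraMap_mem_gEven z) hs
  have hbw : body (algebraMap ℂ GInf z + s) = z := by rw [body_add, body_algebraMap, hb, add_zero]
  have h := gval_mul hw (f := f) (g := g) (by rwa [hbw]) (by rwa [hbw])
  rw [gval_add_sq_zero z hb hs0, gval_add_sq_zero z hb hs0, gval_add_sq_zero z hb hs0, add_mul,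
    mul_add, mul_add, add_assoc, add_right_inj] at h
  rw [h, even_left_comm hs, mul_assoc s, mul_assoc s, even_left_comm hs (jet f 1 z), ← mul_assoc s s,
    hs0, zero_mul, add_zero, mul_add, add_comm]

theorem jet_one_const (e : GInf) (z : ℂ) : jet (fun _ => e) 1 z = 0 :=
  jet_one_eq fun l => by simpa using hasDerivAt_const z (l e)

theorem jet_one_inverse {f : ℂ → GInf} {z : ℂ} (hf : GAnalyticAt z f)
    (he : ∀ᶠ t in 𝓝 z, f t ∈ gEven) (hb : body (f z) ≠ 0) :
    jet (fun t => Ring.inverse (f t)) 1 z = -(jet f 1 z * Ring.inverse (f z) ^ 2) := by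
  have hi := hf.inverse he hb
  have hne := hf.body.continuousAt.eventually_ne hb
  have h := jet_one_mul hf hi
  rw [jet_congr (g := fun _ => 1) (by
    filter_upwards [he, hne] with t h1 h2 using mul_inverse h1 h2), jet_one_const] at h
  have hez := he.self_of_nhds
  have h2 := congrArg (Ring.inverse (f z) * ·) h
  simp only [mul_zero, mul_add, ← mul_assoc, inverse_mul hez hb, one_mul] at h2
  rw [eq_neg_of_add_eq_zero_right h2.symm, pow_two, ← mul_assoc,
    even_comm (inverse_even hez) (jet f 1 z)]

/-! ## Superconformal functions -/

theorem overBody_injective {V V' : Set ℂ} (h : overBody V = overBody V') : V = V' := by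
  ext z
  have := Set.ext_iff.mp h (algebraMap ℂ GInf z, 0)
  simpa [overBody, superspace, algebraMap_mem_gEven, gOdd.zero_mem, body_algebraMap] using this

/-- `h(w,ρ) = (f(w) + ρ ξ(w), ψ(w) + ρ g(w))` is superconformal over `V`, with `g` invertible. -/
structure IsSCData (V : Set ℂ) (h : SPt → SPt) (f ξ ψ g : ℂ → GInf) : Prop where
  isOpen : IsOpen V
  hf : ∀ z ∈ V, GAnalyticAt z f
  hξ : ∀ z ∈ V, GAnalyticAt z ξ
  hψ : ∀ z ∈ V, GAnalyticAt z ψ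
  hg : ∀ z ∈ V, GAnalyticAt z g
  f_even : ∀ z ∈ V, f z ∈ gEven
  ξ_odd : ∀ z ∈ V, ξ z ∈ gOdd
  ψ_odd : ∀ z ∈ V, ψ z ∈ gOdd
  g_even : ∀ z ∈ V, g z ∈ gEven
  eq : ∀ x ∈ overBody V, h x = (gval f x.1 + x.2 * gval ξ x.1, gval ψ x.1 + x.2 * gval g x.1)
  ξ_eq : ∀ z ∈ V, ξ z = g z * ψ z
  g_sq : ∀ z ∈ V, g z ^ 2 = jet f 1 z + ψ z * jet ψ 1 z
  g_body : ∀ z ∈ V, body (g z) ≠ 0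

theorem isJetOn_jet {V : Set ℂ} {f : ℂ → GInf} (hf : ∀ z ∈ V, GAnalyticAt z f) :
    IsJetOn V (jet f) := fun n z hz => (hf z hz).hasGDerivAt_jet n

/-- The conditions at complex points extend to all even arguments because evaluation is
multiplicative. Nonvanishing of the odd derivative is seen at ρ = 0, where the body of g is nonzero.
-/
theorem IsSCData.isSuperconformalOn {V : Set ℂ} {h : SPt → SPt} {f ξ ψ g : ℂ → GInf}
    (H : IsSCData V h f ξ ψ g) : IsSuperconformalOn (overBody V) h := by
  have hV : ∀ z ∈ V, ∀ᶠ t in 𝓝 z, t ∈ V := fun z hz => H.isOpen.mem_nhds hz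
  refine ⟨V, H.isOpen, rfl, jet f, jet ξ, jet ψ, jet g, isJetOn_jet H.hf, isJetOn_jet H.hξ,
    isJetOn_jet H.hψ, isJetOn_jet H.hg, fun z hz => ?_, H.eq, fun x hx => ?_, fun hne => ?_⟩
  · simp only [jet_zero]
    exact ⟨H.f_even z hz, H.ξ_odd z hz, H.ψ_odd z hz, H.g_even z hz⟩
  · obtain ⟨⟨hx1, hx2⟩, hxV⟩ := hx
    have hev := hV _ hxV
    have hf := H.hf _ hxV
    have hψ := H.hψ _ hxV
    have hg := H.hg _ hxV
    rw [jetEval_jetDeriv_jet hf, jetEval_jetDeriv_jet hψ]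
    change gval ξ x.1 = gval g x.1 * gval ψ x.1 ∧ gval g x.1 ^ 2 = _ + gval ψ x.1 * _
    constructor
    · rw [← gval_mul hx1 hg hψ]
      exact gval_congr (hev.mono fun t ht => H.ξ_eq t ht)
    · rw [pow_two, ← gval_mul hx1 hg hg, ← gval_mul hx1 hψ (hψ.jet 1),
        ← gval_add hx1 (hf.jet 1) (hψ.mul (hψ.jet 1))]
      exact gval_congr (hev.mono fun t ht => (pow_two _).symm.trans (H.g_sq t ht))
  · obtain ⟨x, ⟨hx1, hx2⟩, hxV⟩ := hne
    refine ⟨(x.1, 0), ⟨⟨hx1, gOdd.zero_mem⟩, hxV⟩, fun h0 => H.g_body _ hxV ?_⟩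
    rw [zero_mul, add_zero] at h0
    change gval g x.1 = 0 at h0
    rw [← body_gval hx1, h0, body_zero]

theorem IsSCData.mono {V V' : Set ℂ} {h h' : SPt → SPt} {f ξ ψ g : ℂ → GInf}
    (H : IsSCData V h f ξ ψ g) (hV' : IsOpen V') (hVV' : V' ⊆ V)
    (hh : ∀ x ∈ overBody V', h' x = h x) : IsSCData V' h' f ξ ψ g where
  isOpen := hV'
  hf z hz := H.hf z (hVV' hz)
  hξ z hz := H.hξ z (hVV' hz)
  hψ z hz := H.hψ z (hVV' hz)
  hg z hz := H.hg z (hVV' hz)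
  f_even z hz := H.f_even z (hVV' hz)
  ξ_odd z hz := H.ξ_odd z (hVV' hz)
  ψ_odd z hz := H.ψ_odd z (hVV' hz)
  g_even z hz := H.g_even z (hVV' hz)
  eq x hx := (hh x hx).trans (H.eq x ⟨hx.1, hVV' hx.2⟩)
  ξ_eq z hz := H.ξ_eq z (hVV' hz)
  g_sq z hz := H.g_sq z (hVV' hz)
  g_body z hz := H.g_body z (hVV' hz)

theorem odd_left_ideal : ∀ x ∈ gEven, ∀ y ∈ gOdd, x * y ∈ gOdd := fun _ hx _ hy => even_mul_odd hx hy

theorem even_left_ideal : ∀ x ∈ gEven, ∀ y ∈ gEven, x * y ∈ gEven :=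
  fun _ hx _ hy => even_mul_even hx hy

/-! ## Calculations in the algebra over the even elements -/

/-- The central subring, over which all calculations are linear. -/
abbrev Cen : Type := Subring.center GInf

theorem even_exists_smul {x : GInf} (hx : x ∈ gEven) : ∃ a : Cen, x = a • (1 : GInf) := by
  refine ⟨⟨x, Subring.mem_center_iff.mpr fun y => (even_comm hx y).symm⟩, ?_⟩
  rw [Subring.smul_def]
  simp

theorem smul_one_injective {a b : Cen} (h : a • (1 : GInf) = b • (1 : GInf)) : a = b := by
  rw [Subring.smul_def, Subring.smul_def] at h
  simpa using h

/-- The complex numbers as central elements. -/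
def cen : ℂ →+* Cen := (algebraMap ℂ GInf).codRestrict _ fun c =>
  Subring.mem_center_iff.mpr fun y => (Algebra.commutes c y).symm

theorem smul_eq_cen (c : ℂ) (x : GInf) : c • x = cen c • x := by
  rw [Subring.smul_def, Algebra.smul_def]
  rfl

theorem cen_smul_one_eq {a b : Cen} (h : (a • (1 : GInf)) * (b • (1 : GInf)) = 1) : a * b = 1 :=
  smul_one_injective ((show (a * b) • (1 : GInf) = (a • 1) * (b • 1) by
    rw [smul_mul_smul_comm, one_mul]).trans (h.trans (one_smul Cen (1 : GInf)).symm))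

/-- Since (ρξ)² = 0, the geometric series for the inverse stops after the linear term. -/
theorem inverse_add_odd_mul_odd {F P ρ ξ : GInf} (hP : P ∈ gEven) (hF : F ∈ gEven)
    (hFP : F * P = 1) (hρ : ρ ∈ gOdd) (hξ : ξ ∈ gOdd) :
    Ring.inverse (F + ρ * ξ) = P - ρ * (ξ * P ^ 2) := by
  have h1 : (F + ρ * ξ) * (P - ρ * (ξ * P ^ 2)) = 1 := by
    obtain ⟨P, rfl⟩ := even_exists_smul hP
    obtain ⟨F, rfl⟩ := even_exists_smul hF
    have h : F * P = 1 := cen_smul_one_eq hFP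
    have h0 : ρ * (ξ * (ρ * ξ)) = 0 := by
      rw [← mul_assoc, ← mul_assoc, odd_mul_mul_self hρ, zero_mul]
    simp only [pow_two, add_mul, mul_sub, smul_mul_assoc, mul_smul_comm, one_mul, mul_one,
      mul_assoc, h0]
    match_scalars
    · linear_combination h
    · linear_combination -P * h
  refine inverse_eq h1 ?_
  rwa [← even_comm (gEven.add_mem hF (odd_mul_odd hρ hξ))]

/-- Following a map by I or I⁻¹ amounts to κ = i or κ = -i. As (1/f)' = -f'/f², the condition g² =
f' + ψψ' persists precisely because κ² = -1. -/
theorem IsSCData.inverse {V V' : Set ℂ} {h h' : SPt → SPt} {f ξ ψ g : ℂ → GInf}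
    (H : IsSCData V h f ξ ψ g) {κ : ℂ} (hκ : κ * κ = -1) (hV' : IsOpen V') (hVV' : V' ⊆ V)
    (hb : ∀ z ∈ V', body (f z) ≠ 0)
    (hh : ∀ x ∈ overBody V', h' x =
      (Ring.inverse (h x).1, κ • ((h x).2 * Ring.inverse (h x).1))) :
    IsSCData V' h' (fun t => Ring.inverse (f t)) (fun t => -(ξ t * Ring.inverse (f t) ^ 2))
      (fun t => κ • (ψ t * Ring.inverse (f t))) (fun t => κ • (g t * Ring.inverse (f t))) := by
  replace H := H.mono (h' := h) hV' hVV' fun _ _ => rfl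
  have hev : ∀ z ∈ V', ∀ᶠ t in 𝓝 z, t ∈ V' := fun z hz => H.isOpen.mem_nhds hz
  have hfe : ∀ z ∈ V', ∀ᶠ t in 𝓝 z, f t ∈ gEven := fun z hz =>
    (hev z hz).mono fun t ht => H.f_even t ht
  have hi : ∀ z ∈ V', GAnalyticAt z fun t => Ring.inverse (f t) := fun z hz =>
    (H.hf z hz).inverse (hfe z hz) (hb z hz)
  have hκ0 : κ ≠ 0 := by rintro rfl; simp at hκ
  refine ⟨hV', hi, fun z hz => ((H.hξ z hz).mul ((hi z hz).pow 2)).neg,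
    fun z hz => ((H.hψ z hz).mul (hi z hz)).const_smul κ,
    fun z hz => ((H.hg z hz).mul (hi z hz)).const_smul κ,
    fun z hz => inverse_even (H.f_even z hz),
    fun z hz => gOdd.neg_mem (odd_mul_even (H.ξ_odd z hz) (even_pow (inverse_even (H.f_even z hz)) 2)),
    fun z hz => gOdd.smul_mem _ (odd_mul_even (H.ψ_odd z hz) (inverse_even (H.f_even z hz))),
    fun z hz => gEven.smul_mem _ (even_mul_even (H.g_even z hz) (inverse_even (H.f_even z hz))),
    fun x hx => ?_, fun z hz => ?_, fun z hz => ?_, fun z hz => ?_⟩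
  · rw [hh x hx, H.eq x hx]
    obtain ⟨⟨hx1, hx2⟩, hxV⟩ := hx
    have hf := H.hf _ hxV
    have hξ := H.hξ _ hxV
    have hψ := H.hψ _ hxV
    have hg := H.hg _ hxV
    have hif := hi _ hxV
    have hFe : gval f x.1 ∈ gEven := gval_mem hx1 hf gEven even_left_ideal (hfe _ hxV)
    have hξo : gval ξ x.1 ∈ gOdd := gval_mem hx1 hξ gOdd odd_left_ideal
      ((hev _ hxV).mono fun t ht => H.ξ_odd t ht)
    have hψo : gval ψ x.1 ∈ gOdd := gval_mem hx1 hψ gOdd odd_left_ideal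
      ((hev _ hxV).mono fun t ht => H.ψ_odd t ht)
    have hge : gval g x.1 ∈ gEven := gval_mem hx1 hg gEven even_left_ideal
      ((hev _ hxV).mono fun t ht => H.g_even t ht)
    have hξg : gval ξ x.1 = gval g x.1 * gval ψ x.1 := by
      rw [← gval_mul hx1 hg hψ]
      exact gval_congr ((hev _ hxV).mono fun t ht => H.ξ_eq t ht)
    have hFb : body (gval f x.1) ≠ 0 := by rw [body_gval hx1]; exact hb _ hxV
    have hmul := mul_inverse hFe hFb
    have hPe := inverse_even hFe
    simp only [pow_two]
    rw [gval_inverse hx1 hf (hfe _ hxV) (hb _ hxV), gval_neg hx1 (hξ.mul (hif.mul hif)),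
      gval_mul hx1 hξ (hif.mul hif), gval_mul hx1 hif hif, gval_inverse hx1 hf (hfe _ hxV) (hb _ hxV),
      gval_smul hx1 (hψ.mul hif), gval_smul hx1 (hg.mul hif), gval_mul hx1 hψ hif,
      gval_mul hx1 hg hif, gval_inverse hx1 hf (hfe _ hxV) (hb _ hxV),
      inverse_add_odd_mul_odd hPe hFe hmul hx2 hξo, hξg]
    generalize gval ψ x.1 = q at *
    obtain ⟨P, hP⟩ := even_exists_smul hPe
    obtain ⟨G, hG⟩ := even_exists_smul hge
    rw [hP, hG]
    -- Because ξ = gψ, the cross term between ψ and ξ contains ψ twice and vanishes.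
    have h0 : q * (x.2 * q) = 0 := by rw [← mul_assoc, odd_mul_mul_self hψo]
    have h1 : x.2 * (x.2 * q) = 0 := by rw [← mul_assoc, odd_sq _ hx2, zero_mul]
    refine Prod.ext ?_ ?_
    · simp only [pow_two, mul_neg, smul_mul_assoc, mul_smul_comm, one_mul, mul_one,
        sub_eq_add_neg]
    · simp only [pow_two, mul_sub, add_mul, smul_mul_assoc, mul_smul_comm, one_mul, mul_one,
        h0, h1, smul_zero, smul_eq_cen κ]
      module
  · obtain ⟨P, hP⟩ := even_exists_smul (inverse_even (H.f_even z hz))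
    simp only [H.ξ_eq z hz, hP, smul_eq_cen κ]
    obtain ⟨G, hG⟩ := even_exists_smul (H.g_even z hz)
    have hk : cen κ * cen κ = -1 := by rw [← map_mul, hκ, map_neg, map_one]
    simp only [hG, pow_two, smul_mul_assoc, mul_smul_comm, one_mul, mul_one]
    match_scalars
    linear_combination -G * P * P * hk
  · have hk : cen κ * cen κ = -1 := by rw [← map_mul, hκ, map_neg, map_one]
    have hd : jet (fun t => κ • (ψ t * Ring.inverse (f t))) 1 z =
        κ • jet (fun t => ψ t * Ring.inverse (f t)) 1 z :=
      jet_linear ((H.hψ z hz).mul (hi z hz)) (LinearMap.lsmul ℂ GInf κ) 1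
    have hfe' : jet f 1 z ∈ gEven := jet_mem (H.hf z hz) gEven (hfe z hz) 1
    have hψψ := odd_sq _ (H.ψ_odd z hz)
    rw [hd, jet_one_mul (H.hψ z hz) (hi z hz),
      jet_one_inverse (H.hf z hz) (hfe z hz) (hb z hz)]
    have hg := H.g_sq z hz
    obtain ⟨P, hP⟩ := even_exists_smul (inverse_even (H.f_even z hz))
    obtain ⟨X, hX⟩ := even_exists_smul hfe'
    rw [hX] at hg ⊢
    simp only [hP, smul_eq_cen κ]
    have h1 : (cen κ • (g z * P • (1 : GInf))) ^ 2 = (cen κ * cen κ * P * P) • g z ^ 2 := by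
      simp only [pow_two, smul_mul_assoc, mul_smul_comm, mul_one]
      module
    rw [h1, hg]
    simp only [pow_two, smul_mul_assoc, mul_smul_comm, mul_one, mul_add, mul_neg, hψψ,
      smul_zero]
    match_scalars
    · linear_combination P * P * X * hk
    · ring
  · rw [body_smul, body_mul, body_inverse (H.f_even z hz)]
    exact mul_ne_zero hκ0 (mul_ne_zero (H.g_body z hz) (inv_ne_zero (hb z hz)))

/-! ## Jets on open sets -/

/-- An algebraic uniform boundedness principle: on infinitely many independent elements of the set a
functional may be prescribed to take the values 0, 1, 2, …, which are unbounded. -/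
theorem finite_span_of_bounded {S : Set GInf}
    (h : ∀ l : Module.Dual ℂ GInf, ∃ C : ℝ, ∀ x ∈ S, ‖l x‖ ≤ C) :
    FiniteDimensional ℂ (Submodule.span ℂ S) := by
  obtain ⟨b, hbS, hspan, hli⟩ := exists_linearIndependent ℂ S
  rw [← hspan]
  rcases b.finite_or_infinite with hb | hb
  · exact FiniteDimensional.span_of_finite ℂ hb
  · exfalso
    let e := hb.natEmbedding b
    let B := Module.Basis.span hli
    let v : b → ℂ := Function.extend e (fun n : ℕ => (n : ℂ)) 0
    obtain ⟨l, hl⟩ := (B.constr ℂ v).exists_extend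
    have hlv : ∀ n : ℕ, l (e n) = n := fun n => by
      have h1 : l (B (e n)) = v (e n) := by
        rw [← B.constr_basis ℂ v (e n), ← hl]
        rfl
      rw [Module.Basis.span_apply] at h1
      rw [h1]
      exact e.injective.extend_apply _ _ n
    obtain ⟨C, hC⟩ := h l
    obtain ⟨n, hn⟩ := exists_nat_gt C
    have := hC (e n) (hbS (e n).2)
    rw [hlv, Complex.norm_natCast] at this
    linarith

/-- On a compact disc every functional of the function is continuous, hence bounded, so the values
span a finite-dimensional space. In a basis of it the function is a finite sum of holomorphic
coefficients times constants. -/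
theorem IsJetOn.gAnalyticAt {V : Set ℂ} (hV : IsOpen V) {D : ℕ → ℂ → GInf} (h : IsJetOn V D)
    (n : ℕ) {z : ℂ} (hz : z ∈ V) : GAnalyticAt z (D n) := by
  obtain ⟨r, hr, hrV⟩ := Metric.nhds_basis_closedBall.mem_iff.mp (hV.mem_nhds hz)
  have hfin : FiniteDimensional ℂ (Submodule.span ℂ (D n '' Metric.closedBall z r)) := by
    refine finite_span_of_bounded fun l => ?_
    obtain ⟨C, hC⟩ := (isCompact_closedBall z r).exists_bound_of_continuousOn
      (f := fun t => l (D n t)) fun t ht => (h n t (hrV ht) l).continuousAt.continuousWithinAt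
    refine ⟨C, ?_⟩
    rintro _ ⟨t, ht, rfl⟩
    exact hC t ht
  let b := Module.finBasis ℂ (Submodule.span ℂ (D n '' Metric.closedBall z r))
  choose l hl using fun i => (b.coord i).exists_extend
  have hl' : ∀ i t, (ht : t ∈ Metric.closedBall z r) → l i (D n t) =
      b.coord i ⟨D n t, Submodule.subset_span (Set.mem_image_of_mem _ ht)⟩ := fun i t ht => by
    rw [← hl]
    rfl
  have hsum : GAnalyticAt z fun t => ∑ i, l i (D n t) • (b i : GInf) := by
    refine GAnalyticAt.sum _ fun i _ => GAnalyticAt.smul ?_ _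
    have hdiff : DifferentiableOn ℂ (fun t => l i (D n t)) V := fun t ht =>
      (h n t ht (l i)).differentiableAt.differentiableWithinAt
    exact hdiff.analyticAt (hV.mem_nhds hz)
  refine hsum.congr ?_
  filter_upwards [Metric.closedBall_mem_nhds z hr] with t ht
  simp only [hl' _ t ht]
  have h2 := congrArg Subtype.val
    (b.sum_repr ⟨D n t, Submodule.subset_span (Set.mem_image_of_mem _ ht)⟩)
  rwa [Submodule.coe_sum] at h2

theorem IsJetOn.jet_eq {V : Set ℂ} (hV : IsOpen V) {D : ℕ → ℂ → GInf} (h : IsJetOn V D)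
    (n : ℕ) {z : ℂ} (hz : z ∈ V) : jet (D 0) n z = D n z := by
  induction n generalizing z with
  | zero => exact jet_zero _ _
  | succ n ih =>
    refine HasGDerivAt.unique ((h.gAnalyticAt hV 0 hz).hasGDerivAt_jet n) fun l => ?_
    refine (h n z hz l).congr_of_eventuallyEq ?_
    filter_upwards [hV.mem_nhds hz] with t ht
    rw [ih ht]

/-- The converse of `IsSCData.isSuperconformalOn`, up to the invertibility of `g`. -/
theorem IsSuperconformalOn.exists_data {V : Set ℂ} {h : SPt → SPt}
    (H : IsSuperconformalOn (overBody V) h) : IsOpen V ∧ ∃ f ξ ψ g : ℂ → GInf,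
      (∀ z ∈ V, GAnalyticAt z f ∧ GAnalyticAt z ξ ∧ GAnalyticAt z ψ ∧ GAnalyticAt z g) ∧
      (∀ z ∈ V, f z ∈ gEven ∧ ξ z ∈ gOdd ∧ ψ z ∈ gOdd ∧ g z ∈ gEven) ∧
      (∀ x ∈ overBody V, h x =
        (gval f x.1 + x.2 * gval ξ x.1, gval ψ x.1 + x.2 * gval g x.1)) ∧
      ∀ z ∈ V, ξ z = g z * ψ z ∧ g z ^ 2 = jet f 1 z + ψ z * jet ψ 1 z := by
  obtain ⟨V', hV', hVV', f, ξ, ψ, g, hf, hξ, hψ, hg, hpar, heq, hsc, -⟩ := H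
  obtain rfl := overBody_injective hVV'
  have hval : ∀ D, IsJetOn V D → ∀ w, body w ∈ V → jetEval D w = gval (D 0) w := fun D hD w hw =>
    jetEval_congr fun n => (hD.jet_eq hV' n hw).symm
  refine ⟨hV', f 0, ξ 0, ψ 0, g 0, fun z hz => ⟨hf.gAnalyticAt hV' 0 hz, hξ.gAnalyticAt hV' 0 hz,
    hψ.gAnalyticAt hV' 0 hz, hg.gAnalyticAt hV' 0 hz⟩, hpar, fun x hx => ?_, fun z hz => ?_⟩
  · rw [heq x hx, hval f hf _ hx.2, hval ξ hξ _ hx.2, hval ψ hψ _ hx.2, hval g hg _ hx.2]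
  · have hx : (algebraMap ℂ GInf z, (0 : GInf)) ∈ overBody V :=
      ⟨⟨algebraMap_mem_gEven z, gOdd.zero_mem⟩, by rwa [body_algebraMap]⟩
    have := hsc _ hx
    simp only [jetEval_algebraMap, jetDeriv] at this
    rw [hf.jet_eq hV' 1 hz, hψ.jet_eq hV' 1 hz]
    exact this

end SuperSewing
end

noncomputable section
namespace SuperSewing
open Filter Topology

/-! ## Elementary superconformal functions -/

theorem jet_one_id (z : ℂ) : jet (fun t => algebraMap ℂ GInf t) 1 z = 1 :=
  jet_one_eq fun l => by
    simpa [Algebra.algebraMap_eq_smul_one] using (hasDerivAt_id z).mul_const (l 1)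

theorem jet_one_const_mul {f : ℂ → GInf} {z : ℂ} (hf : GAnalyticAt z f) (c : GInf) :
    jet (fun t => c * f t) 1 z = c * jet f 1 z := jet_linear hf (LinearMap.mulLeft ℂ c) 1

theorem jet_one_sub {f g : ℂ → GInf} {z : ℂ} (hf : GAnalyticAt z f) (hg : GAnalyticAt z g) :
    jet (fun t => f t - g t) 1 z = jet f 1 z - jet g 1 z := by
  have h := jet_linear hg (-LinearMap.id) 1
  simp only [LinearMap.neg_apply, LinearMap.id_apply] at h
  simp only [sub_eq_add_neg]
  rw [jet_add hf hg.neg, h]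

/-- With f = w + ea, ψ = eb and g = 1 + ec, products of two perturbation terms contain e twice. The
condition g² = f' + ψψ' reduces to ea' = 2ec, and ξ = gψ reduces to ξ = ψ; no equation restricts b.
-/
theorem isSCData_perturbation {V : Set ℂ} (hV : IsOpen V) {e : GInf} (he : e ∈ gOdd)
    {h : SPt → SPt} {a b c : ℂ → GInf} (ha : ∀ z ∈ V, GAnalyticAt z a)
    (hb : ∀ z ∈ V, GAnalyticAt z b) (hc : ∀ z ∈ V, GAnalyticAt z c)
    (hao : ∀ z ∈ V, a z ∈ gOdd) (hbe : ∀ z ∈ V, b z ∈ gEven) (hco : ∀ z ∈ V, c z ∈ gOdd)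
    (hjet : ∀ z ∈ V, jet a 1 z = 2 * c z)
    (heq : ∀ x ∈ overBody V, h x = (x.1 + e * gval a x.1 + x.2 * (e * gval b x.1),
      x.2 + e * gval b x.1 + x.2 * (e * gval c x.1))) :
    IsSCData V h (fun t => algebraMap ℂ GInf t + e * a t) (fun t => e * b t) (fun t => e * b t)
      (fun t => 1 + e * c t) where
  isOpen := hV
  hf z hz := GAnalyticAt.id.add ((ha z hz).const_mul e)
  hξ z hz := (hb z hz).const_mul e
  hψ z hz := (hb z hz).const_mul e
  hg z hz := (GAnalyticAt.const 1).add ((hc z hz).const_mul e)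
  f_even z hz := gEven.add_mem (algebraMap_mem_gEven z) (odd_mul_odd he (hao z hz))
  ξ_odd z hz := odd_mul_even he (hbe z hz)
  ψ_odd z hz := odd_mul_even he (hbe z hz)
  g_even z hz := gEven.add_mem one_mem_gEven (odd_mul_odd he (hco z hz))
  eq x hx := by
    have hw := hx.1.1
    have h1 := ha _ hx.2
    have h2 := hb _ hx.2
    have h3 := hc _ hx.2
    rw [heq x hx, gval_add hw GAnalyticAt.id (h1.const_mul e), gval_id hw, gval_const_mul hw h1,
      gval_const_mul hw h2, gval_add hw (GAnalyticAt.const 1) (h3.const_mul e), gval_const hw,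
      gval_const_mul hw h3]
    refine Prod.ext rfl ?_
    dsimp only
    rw [mul_add, mul_one]
    abel
  ξ_eq z _ := by
    rw [add_mul, one_mul, ← mul_assoc, odd_mul_mul_self he, zero_mul, add_zero]
  g_sq z hz := by
    rw [jet_add GAnalyticAt.id ((ha z hz).const_mul e), jet_one_id, jet_one_const_mul (ha z hz),
      jet_one_const_mul (hb z hz), hjet z hz, ← mul_assoc (e * b z), odd_mul_mul_self he, zero_mul,
      add_zero, pow_two, add_mul, mul_add, mul_add, ← mul_assoc (e * c z), odd_mul_mul_self he]
    simp only [one_mul, mul_one, zero_mul, add_zero]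
    rw [two_mul, mul_add, add_assoc]
  g_body z _ := by
    rw [body_add, body_one, body_mul, body_odd he, zero_mul, add_zero]
    exact one_ne_zero

theorem isSCData_superShift {V : Set ℂ} (hV : IsOpen V) {z θ : GInf} (hz : z ∈ gEven)
    (hθ : θ ∈ gOdd) : IsSCData V (superShift z θ) (fun t => algebraMap ℂ GInf t - z)
      (fun _ => -θ) (fun _ => -θ) (fun _ => 1) where
  isOpen := hV
  hf _ _ := GAnalyticAt.id.sub (GAnalyticAt.const z)
  hξ _ _ := GAnalyticAt.const _
  hψ _ _ := GAnalyticAt.const _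
  hg _ _ := GAnalyticAt.const _
  f_even t _ := gEven.sub_mem (algebraMap_mem_gEven t) hz
  ξ_odd _ _ := gOdd.neg_mem hθ
  ψ_odd _ _ := gOdd.neg_mem hθ
  g_even _ _ := one_mem_gEven
  eq x hx := by
    have hw := hx.1.1
    rw [gval_sub hw GAnalyticAt.id (GAnalyticAt.const z), gval_id hw, gval_const hw, gval_const hw,
      gval_const hw, superShift, mul_one, mul_neg]
    refine Prod.ext ?_ ?_ <;> dsimp only <;> abel
  ξ_eq _ _ := by rw [one_mul]
  g_sq t _ := by
    rw [jet_one_sub GAnalyticAt.id (GAnalyticAt.const z), jet_one_id, jet_one_const, jet_one_const,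
      mul_zero, sub_zero, add_zero, one_pow]
  g_body _ _ := by rw [body_one]; exact one_ne_zero

theorem gAnalyticAt_inverse_id {t : ℂ} (ht : t ≠ 0) :
    GAnalyticAt t fun t => Ring.inverse (algebraMap ℂ GInf t) :=
  GAnalyticAt.id.inverse (Eventually.of_forall algebraMap_mem_gEven) (by rwa [body_algebraMap])

theorem gval_inverse_id {w : GInf} (hw : w ∈ gEven) (hb : body w ≠ 0) :
    gval (fun t => Ring.inverse (algebraMap ℂ GInf t)) w = Ring.inverse w := by
  rw [gval_inverse hw GAnalyticAt.id (Eventually.of_forall algebraMap_mem_gEven)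
    (by rwa [body_algebraMap]), gval_id hw]

/-- `IsSCData.inverse` handles an inversion after a map; here it comes before the shift, as the
source chart at infinity requires. -/
theorem isSCData_superShift_inversion {V : Set ℂ} (hV : IsOpen V) (h0 : (0 : ℂ) ∉ V) {z θ : GInf}
    (hz : z ∈ gEven) (hθ : θ ∈ gOdd) : IsSCData V (fun x => superShift z θ (inversion x))
      (fun t => Ring.inverse (algebraMap ℂ GInf t) - z)
      (fun t => -(Complex.I • (Ring.inverse (algebraMap ℂ GInf t) * θ))) (fun _ => -θ)
      (fun t => Complex.I • Ring.inverse (algebraMap ℂ GInf t)) :=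
  have hV0 : ∀ t ∈ V, t ≠ 0 := fun t ht h => h0 (h ▸ ht)
  have hi : ∀ t ∈ V, GAnalyticAt t fun t => Ring.inverse (algebraMap ℂ GInf t) := fun t ht =>
    gAnalyticAt_inverse_id (hV0 t ht)
  { isOpen := hV
    hf := fun t ht => (hi t ht).sub (GAnalyticAt.const z)
    hξ := fun t ht => (((hi t ht).mul_const θ).const_smul _).neg
    hψ := fun _ _ => GAnalyticAt.const _
    hg := fun t ht => (hi t ht).const_smul _
    f_even := fun t _ => gEven.sub_mem (inverse_even (algebraMap_mem_gEven t)) hz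
    ξ_odd := fun t _ => gOdd.neg_mem (gOdd.smul_mem _
      (even_mul_odd (inverse_even (algebraMap_mem_gEven t)) hθ))
    ψ_odd := fun _ _ => gOdd.neg_mem hθ
    g_even := fun t _ => gEven.smul_mem _ (inverse_even (algebraMap_mem_gEven t))
    eq := fun x hx => by
      have hw := hx.1.1
      have h1 := hi _ hx.2
      rw [gval_sub hw h1 (GAnalyticAt.const z), gval_neg hw ((h1.mul_const θ).const_smul _),
        gval_smul hw (h1.mul_const θ), gval_mul hw h1 (GAnalyticAt.const θ), gval_smul hw h1,
        gval_inverse_id hw (hV0 _ hx.2), gval_const hw, gval_const hw, gval_const hw, superShift,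
        inversion]
      refine Prod.ext ?_ ?_
      · simp only [smul_mul_assoc, mul_neg, mul_smul_comm, mul_assoc]
        abel
      · simp only [mul_smul_comm]
        abel
    ξ_eq := fun _ _ => by rw [mul_neg, smul_mul_assoc]
    g_sq := fun t ht => by
      rw [jet_one_sub (hi t ht) (GAnalyticAt.const z), jet_one_inverse GAnalyticAt.id
        (Eventually.of_forall algebraMap_mem_gEven) (by rw [body_algebraMap]; exact hV0 t ht),
        jet_one_id, jet_one_const, jet_one_const, mul_zero, sub_zero, add_zero, one_mul, smul_pow,
        Complex.I_sq, neg_one_smul]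
    g_body := fun t ht => by
      rw [body_smul, body_inverse (algebraMap_mem_gEven t), body_algebraMap]
      exact mul_ne_zero Complex.I_ne_zero (inv_ne_zero (hV0 t ht)) }

/-! ## The correction map -/

section correction

variable (z : GInfˣ) (θ : GInf)

/-- In the chart about zero the superconformal map which, together with a shift, trivializes the
sewn surface. -/
def corrSouth (e : GInf) (x : SPt) : SPt :=
  -- The summand z⁻¹ cancels 1/(w - z) at w = 0, so that the puncture (0,0) stays fixed; the shift
  -- on the cap compensates for it.
  (x.1 + e * (2 * θ * (Ring.inverse (x.1 - z) + (z⁻¹ : GInfˣ))) +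
      x.2 * (e * (Ring.inverse (x.1 - z) + (z⁻¹ : GInfˣ))),
    x.2 + e * (Ring.inverse (x.1 - z) + (z⁻¹ : GInfˣ)) +
      x.2 * (e * -(θ * Ring.inverse (x.1 - z) ^ 2)))

/-- The same map in the chart about infinity. -/
def corrNorth (e : GInf) (x : SPt) : SPt :=
  (x.1 + e * -(2 * θ * (z⁻¹ : GInfˣ) ^ 3 * (Ring.inverse (1 - z * x.1) - 1 - z * x.1)) +
      x.2 * (e * (-Complex.I • ((z⁻¹ : GInfˣ) ^ 2 * (Ring.inverse (1 - z * x.1) - 1)))),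
    x.2 + e * (-Complex.I • ((z⁻¹ : GInfˣ) ^ 2 * (Ring.inverse (1 - z * x.1) - 1))) +
      x.2 * (e * -(θ * (z⁻¹ : GInfˣ) ^ 2 * (Ring.inverse (1 - z * x.1) ^ 2 - 1))))

variable {z θ} (hz : (z : GInf) ∈ gEven) (hθ : θ ∈ gOdd)
theorem two_mul_odd {θ : GInf} (hθ : θ ∈ gOdd) : 2 * θ ∈ gOdd := by rw [two_mul]; exact gOdd.add_mem hθ hθ

include hz hθ

/-- With P = 1/(w - z) one has P' = -P², so a = 2θ(P + z⁻¹) and c = -θP² satisfy the condition a' =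
2c of `isSCData_perturbation`. -/
theorem exists_isSCData_corrSouth {e : GInf} (he : e ∈ gOdd) {V : Set ℂ} (hV : IsOpen V)
    (hVz : body z ∉ V) : ∃ f ξ ψ g, IsSCData V (corrSouth z θ e) f ξ ψ g ∧
      (∀ t ∈ V, body (f t) = t) := by
  have hne : ∀ t ∈ V, t - body z ≠ 0 := fun t ht h => hVz (sub_eq_zero.mp h ▸ ht)
  have hzi := units_inv_even hz
  have hd : ∀ t : ℂ, GAnalyticAt t fun t => algebraMap ℂ GInf t - z := fun t =>
    GAnalyticAt.id.sub (GAnalyticAt.const _)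
  have hde : ∀ t : ℂ, algebraMap ℂ GInf t - z ∈ gEven := fun t =>
    gEven.sub_mem (algebraMap_mem_gEven t) hz
  have hdb : ∀ t ∈ V, body (algebraMap ℂ GInf t - z) ≠ 0 := fun t ht => by
    rw [body_sub, body_algebraMap]; exact hne t ht
  have hP : ∀ t ∈ V, GAnalyticAt t fun t => Ring.inverse (algebraMap ℂ GInf t - z) := fun t ht =>
    (hd t).inverse (Eventually.of_forall hde) (hdb t ht)
  have hPe : ∀ t : ℂ, Ring.inverse (algebraMap ℂ GInf t - z) ∈ gEven := fun t =>
    inverse_even (hde t)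
  have hPv : ∀ x ∈ overBody V,
      gval (fun t => Ring.inverse (algebraMap ℂ GInf t - z)) x.1 = Ring.inverse (x.1 - z) :=
    fun x hx => by
      rw [gval_inverse hx.1.1 (hd _) (Eventually.of_forall hde) (hdb _ hx.2),
        gval_sub hx.1.1 GAnalyticAt.id (GAnalyticAt.const _), gval_id hx.1.1, gval_const hx.1.1]
  refine ⟨_, _, _, _, isSCData_perturbation hV he
    (a := fun t => 2 * θ * (Ring.inverse (algebraMap ℂ GInf t - z) + (z⁻¹ : GInfˣ)))
    (b := fun t => Ring.inverse (algebraMap ℂ GInf t - z) + (z⁻¹ : GInfˣ))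
    (c := fun t => -(θ * Ring.inverse (algebraMap ℂ GInf t - z) ^ 2))
    (fun t ht => ((hP t ht).add (GAnalyticAt.const _)).const_mul _)
    (fun t ht => (hP t ht).add (GAnalyticAt.const _))
    (fun t ht => (((hP t ht).pow 2).const_mul _).neg)
    (fun t _ => odd_mul_even (two_mul_odd hθ) (gEven.add_mem (hPe t) hzi))
    (fun t _ => gEven.add_mem (hPe t) hzi)
    (fun t _ => gOdd.neg_mem (odd_mul_even hθ (even_pow (hPe t) 2)))
    (fun t ht => ?_) (fun x hx => ?_), fun t ht => ?_⟩
  · rw [jet_one_const_mul ((hP t ht).add (GAnalyticAt.const _)),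
      jet_add (hP t ht) (GAnalyticAt.const _), jet_one_const, jet_one_inverse (hd t)
      (Eventually.of_forall hde) (hdb t ht), jet_one_sub GAnalyticAt.id (GAnalyticAt.const _),
      jet_one_id, jet_one_const, sub_zero, one_mul, add_zero, mul_neg, mul_neg, mul_assoc]
  · have hw := hx.1.1
    have h1 := hP _ hx.2
    rw [gval_const_mul hw (h1.add (GAnalyticAt.const _)), gval_add hw h1 (GAnalyticAt.const _),
      gval_neg hw ((h1.pow 2).const_mul θ), gval_const_mul hw (h1.pow 2)]
    simp only [pow_two]
    rw [gval_mul hw h1 h1, gval_const hw, hPv x hx, corrSouth]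
    simp only [pow_two]
  · rw [body_add, body_algebraMap, body_mul, body_odd he, zero_mul, add_zero]

theorem exists_isSCData_corrNorth {e : GInf} (he : e ∈ gOdd) {V : Set ℂ} (hV : IsOpen V)
    (hVz : ∀ t ∈ V, body z * t ≠ 1) : ∃ f ξ ψ g, IsSCData V (corrNorth z θ e) f ξ ψ g ∧
      (∀ t ∈ V, body (f t) = t) := by
  have hzi := units_inv_even hz
  have hm : ∀ t : ℂ, GAnalyticAt t fun t => z * algebraMap ℂ GInf t := fun t =>
    GAnalyticAt.id.const_mul _
  have h1a : ∀ t : ℂ, GAnalyticAt t fun _ => (1 : GInf) := fun t => GAnalyticAt.const _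
  have hme : ∀ t : ℂ, z * algebraMap ℂ GInf t ∈ gEven := fun t =>
    even_mul_even hz (algebraMap_mem_gEven t)
  have hd : ∀ t : ℂ, GAnalyticAt t fun t => 1 - z * algebraMap ℂ GInf t := fun t =>
    (h1a t).sub (hm t)
  have hde : ∀ t : ℂ, 1 - z * algebraMap ℂ GInf t ∈ gEven := fun t =>
    gEven.sub_mem one_mem_gEven (hme t)
  have hdb : ∀ t ∈ V, body (1 - z * algebraMap ℂ GInf t) ≠ 0 := fun t ht => by
    rw [body_sub, body_one, body_mul, body_algebraMap]
    exact sub_ne_zero.mpr (hVz t ht).symm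
  have hS : ∀ t ∈ V, GAnalyticAt t fun t => Ring.inverse (1 - z * algebraMap ℂ GInf t) :=
    fun t ht => (hd t).inverse (Eventually.of_forall hde) (hdb t ht)
  have hSe : ∀ t : ℂ, Ring.inverse (1 - z * algebraMap ℂ GInf t) ∈ gEven := fun t =>
    inverse_even (hde t)
  have hmv : ∀ x ∈ overBody V, gval (fun t => z * algebraMap ℂ GInf t) x.1 = z * x.1 :=
    fun x hx => by rw [gval_const_mul hx.1.1 GAnalyticAt.id, gval_id hx.1.1]
  have hSv : ∀ x ∈ overBody V,
      gval (fun t => Ring.inverse (1 - z * algebraMap ℂ GInf t)) x.1 = Ring.inverse (1 - z * x.1) :=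
    fun x hx => by
      rw [gval_inverse hx.1.1 (hd _) (Eventually.of_forall hde) (hdb _ hx.2),
        gval_sub hx.1.1 (h1a _) (hm _), gval_const hx.1.1, hmv x hx]
  refine ⟨_, _, _, _, isSCData_perturbation hV he
    (a := fun t => -(2 * θ * (z⁻¹ : GInfˣ) ^ 3 *
      (Ring.inverse (1 - z * algebraMap ℂ GInf t) - 1 - z * algebraMap ℂ GInf t)))
    (b := fun t => -Complex.I • ((z⁻¹ : GInfˣ) ^ 2 *
      (Ring.inverse (1 - z * algebraMap ℂ GInf t) - 1)))
    (c := fun t => -(θ * (z⁻¹ : GInfˣ) ^ 2 * (Ring.inverse (1 - z * algebraMap ℂ GInf t) ^ 2 - 1)))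
    (fun t ht => ((((hS t ht).sub (h1a t)).sub (hm t)).const_mul _).neg)
    (fun t ht => (((hS t ht).sub (h1a t)).const_mul _).const_smul _)
    (fun t ht => ((((hS t ht).pow 2).sub (h1a t)).const_mul _).neg)
    (fun t _ => gOdd.neg_mem (odd_mul_even (odd_mul_even (two_mul_odd hθ) (even_pow hzi 3))
      (gEven.sub_mem (gEven.sub_mem (hSe t) one_mem_gEven) (hme t))))
    (fun t _ => gEven.smul_mem _ (even_mul_even (even_pow hzi 2)
      (gEven.sub_mem (hSe t) one_mem_gEven)))
    (fun t _ => gOdd.neg_mem (odd_mul_even (odd_mul_even hθ (even_pow hzi 2))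
      (gEven.sub_mem (even_pow (hSe t) 2) one_mem_gEven)))
    (fun t ht => ?_) (fun x hx => ?_), fun t ht => ?_⟩
  · have h := (hS t ht).sub (h1a t)
    have h2 := jet_linear ((h.sub (hm t)).const_mul (2 * θ * (z⁻¹ : GInfˣ) ^ 3)) (-LinearMap.id) 1
    simp only [LinearMap.neg_apply, LinearMap.id_apply] at h2
    rw [h2, jet_one_const_mul (h.sub (hm t)), jet_one_sub h (hm t), jet_one_sub (hS t ht) (h1a t),
      jet_one_const, jet_one_inverse (hd t) (Eventually.of_forall hde) (hdb t ht),
      jet_one_sub (h1a t) (hm t), jet_one_const, jet_one_const_mul GAnalyticAt.id, jet_one_id]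
    obtain ⟨S, hS⟩ := even_exists_smul (hSe t)
    obtain ⟨y, hy⟩ := even_exists_smul hzi
    obtain ⟨Z, hZ⟩ := even_exists_smul hz
    have h1 : y * Z = 1 := cen_smul_one_eq (by rw [← hy, ← hZ, Units.inv_mul])
    rw [hS, hy, hZ]
    simp only [pow_succ, pow_zero, two_mul, mul_sub, mul_neg, mul_smul_comm,
      mul_one, zero_sub, sub_zero]
    match_scalars
    linear_combination (2 * y ^ 2 - 2 * y ^ 2 * S ^ 2) * h1
  · have hw := hx.1.1
    have h1 := hS _ hx.2
    have h2 := h1.sub (h1a _)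
    have h3 := h2.sub (hm _)
    have h4 := (h1.pow 2).sub (h1a _)
    rw [gval_neg hw (h3.const_mul _), gval_const_mul hw h3, gval_sub hw h2 (hm _),
      gval_smul hw (h2.const_mul _), gval_const_mul hw h2, gval_sub hw h1 (h1a _),
      gval_neg hw (h4.const_mul _), gval_const_mul hw h4, gval_sub hw (h1.pow 2) (h1a _)]
    simp only [pow_two]
    rw [gval_mul hw h1 h1, gval_const hw, hSv x hx, hmv x hx, corrNorth]
    simp only [pow_two]
  · rw [body_add, body_algebraMap, body_mul, body_odd he, zero_mul, add_zero]

end correction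

end SuperSewing
end

noncomputable section
namespace SuperSewing
open Filter Topology

/-! ## Algebra of the correction map -/

/-- An odd `e` can be moved past `c` up to the involution, so the elements annihilated by `e` from
the left form a left ideal. Terms already carrying `e` may therefore be computed modulo this ideal.
-/
theorem odd_mul_left_congr {e x y : GInf} (he : e ∈ gOdd) (h : e * x = e * y) (c : GInf) :
    e * (c * x) = e * (c * y) := by
  have h1 : e * c = parityInv c * e := by
    rw [mul_odd _ he]
    exact congrArg (e * ·) (CliffordAlgebra.involute_involute c).symm
  rw [← mul_assoc, h1, mul_assoc, h, ← mul_assoc, ← h1, mul_assoc]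

theorem odd_mul_inverse_congr {e x y : GInf} (he : e ∈ gOdd) (hx : x ∈ gEven) (hy : y ∈ gEven)
    (hxb : body x ≠ 0) (hyb : body y ≠ 0) (h : e * x = e * y) :
    e * Ring.inverse x = e * Ring.inverse y := by
  have h1 := odd_mul_left_congr he (congrArg (· * Ring.inverse y) h |> fun h => by
    simpa only [mul_assoc] using h) (Ring.inverse x)
  rw [mul_inverse hy hyb, mul_one, ← mul_assoc (Ring.inverse x), inverse_mul hx hxb, one_mul] at h1
  exact h1.symm

theorem odd_mul_sq_congr {e x y : GInf} (he : e ∈ gOdd) (h : e * x = e * y) :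
    e * x ^ 2 = e * y ^ 2 := by
  rw [pow_two, pow_two, odd_mul_left_congr he h, ← mul_assoc, h, mul_assoc]

theorem odd_anticomm_assoc {x y : GInf} (hx : x ∈ gOdd) (hy : y ∈ gOdd) (u : GInf) :
    x * (y * u) = -(y * (x * u)) := by
  rw [← mul_assoc, odd_anticomm x y hx hy, neg_mul, mul_assoc]

theorem odd_mul_self_assoc {x : GInf} (hx : x ∈ gOdd) (u : GInf) : x * (x * u) = 0 := by
  rw [← mul_assoc, odd_sq x hx, zero_mul]

theorem odd_sandwich {e : GInf} (he : e ∈ gOdd) (x y : GInf) : e * (x * (e * y)) = 0 := by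
  rw [← mul_assoc, ← mul_assoc, odd_mul_mul_self he, zero_mul]

/-- Two perturbations of the identity by opposite multiples of an odd element are inverse. -/
theorem perturbation_neg {e w ρ a b c a' b' c' : GInf} (he : e ∈ gOdd) (ha : e * a' = e * a)
    (hb : e * b' = e * b) (hc : e * c' = e * c) :
    ((w + e * a + ρ * (e * b)) + -e * a' + (ρ + e * b + ρ * (e * c)) * (-e * b'),
      (ρ + e * b + ρ * (e * c)) + -e * b' + (ρ + e * b + ρ * (e * c)) * (-e * c')) = (w, ρ) := by
  simp only [neg_mul, ha, hb, hc, mul_neg, add_mul, mul_assoc, odd_sandwich he, mul_zero]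
  refine Prod.ext ?_ ?_ <;> dsimp only <;> abel

section correction

variable {z : GInfˣ} {θ : GInf}

theorem corrSouth_mem (hz : (z : GInf) ∈ gEven) (hθ : θ ∈ gOdd) {e : GInf} (he : e ∈ gOdd)
    {x : SPt} (hx : x ∈ superspace) : corrSouth z θ e x ∈ superspace := by
  have h1 : Ring.inverse (x.1 - z) ∈ gEven := inverse_even (gEven.sub_mem hx.1 hz)
  have h2 := gEven.add_mem h1 (units_inv_even hz)
  have h3 := odd_mul_even he h2
  exact ⟨gEven.add_mem (gEven.add_mem hx.1 (odd_mul_odd he (odd_mul_even (two_mul_odd hθ) h2)))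
    (odd_mul_odd hx.2 h3), gOdd.add_mem (gOdd.add_mem hx.2 h3) (odd_mul_even hx.2
      (odd_mul_odd he (gOdd.neg_mem (odd_mul_even hθ (even_pow h1 2)))))⟩

theorem corrNorth_mem (hz : (z : GInf) ∈ gEven) (hθ : θ ∈ gOdd) {e : GInf} (he : e ∈ gOdd)
    {x : SPt} (hx : x ∈ superspace) : corrNorth z θ e x ∈ superspace := by
  have h0 := even_mul_even hz hx.1
  have h1 : Ring.inverse (1 - z * x.1) ∈ gEven := inverse_even (gEven.sub_mem one_mem_gEven h0)
  have hi := units_inv_even hz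
  have h2 := odd_mul_even he (gEven.smul_mem (-Complex.I) (even_mul_even (even_pow hi 2)
    (gEven.sub_mem h1 one_mem_gEven)))
  exact ⟨gEven.add_mem (gEven.add_mem hx.1 (odd_mul_odd he (gOdd.neg_mem
      (odd_mul_even (odd_mul_even (two_mul_odd hθ) (even_pow hi 3))
        (gEven.sub_mem (gEven.sub_mem h1 one_mem_gEven) h0))))) (odd_mul_odd hx.2 h2),
    gOdd.add_mem (gOdd.add_mem hx.2 h2) (odd_mul_even hx.2 (odd_mul_odd he (gOdd.neg_mem
      (odd_mul_even (odd_mul_even hθ (even_pow hi 2))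
        (gEven.sub_mem (even_pow h1 2) one_mem_gEven)))))⟩

theorem body_corrSouth {e : GInf} (he : e ∈ gOdd) (x : SPt) :
    body (corrSouth z θ e x).1 = body x.1 := by
  simp [corrSouth, body_add, body_mul, body_odd he]

theorem body_corrNorth {e : GInf} (he : e ∈ gOdd) (x : SPt) :
    body (corrNorth z θ e x).1 = body x.1 := by
  simp only [corrNorth, body_add, body_mul, body_odd he, zero_mul, mul_zero, add_zero]

/-- The coefficients of the second map are evaluated at the moved point, but the displacement
cancels after multiplication by `e`; to first order, opposite perturbations are inverse. -/
theorem corrSouth_neg (hz : (z : GInf) ∈ gEven) (hθ : θ ∈ gOdd) {e : GInf} (he : e ∈ gOdd)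
    {x : SPt} (hx : x ∈ superspace) (hb : body x.1 ≠ body z) :
    corrSouth z θ (-e) (corrSouth z θ e x) = x := by
  have h1 : e * Ring.inverse ((corrSouth z θ e x).1 - z) = e * Ring.inverse (x.1 - z) := by
    refine odd_mul_inverse_congr he (gEven.sub_mem (corrSouth_mem hz hθ he hx).1 hz)
      (gEven.sub_mem hx.1 hz) ?_ ?_ ?_
    · rw [body_sub, body_corrSouth he]; exact sub_ne_zero.mpr hb
    · rw [body_sub]; exact sub_ne_zero.mpr hb
    · simp only [corrSouth, mul_sub, mul_add, odd_mul_self_assoc he, odd_sandwich he, add_zero]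
  have h2 : e * (Ring.inverse ((corrSouth z θ e x).1 - z) + (z⁻¹ : GInfˣ)) =
      e * (Ring.inverse (x.1 - z) + (z⁻¹ : GInfˣ)) := by rw [mul_add, h1, mul_add]
  refine perturbation_neg (w := x.1) (ρ := x.2) he (odd_mul_left_congr he h2 _) h2 ?_
  rw [mul_neg, mul_neg, odd_mul_left_congr he (odd_mul_sq_congr he h1)]

theorem corrNorth_neg (hz : (z : GInf) ∈ gEven) (hθ : θ ∈ gOdd) {e : GInf} (he : e ∈ gOdd)
    {x : SPt} (hx : x ∈ superspace) (hb : body z * body x.1 ≠ 1) :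
    corrNorth z θ (-e) (corrNorth z θ e x) = x := by
  have h0 : e * (z * (corrNorth z θ e x).1) = e * (z * x.1) := by
    refine odd_mul_left_congr he ?_ _
    simp only [corrNorth, mul_add, odd_mul_self_assoc he, odd_sandwich he, add_zero]
  have h1 : e * Ring.inverse (1 - z * (corrNorth z θ e x).1) = e * Ring.inverse (1 - z * x.1) := by
    refine odd_mul_inverse_congr he
      (gEven.sub_mem one_mem_gEven (even_mul_even hz (corrNorth_mem hz hθ he hx).1))
      (gEven.sub_mem one_mem_gEven (even_mul_even hz hx.1)) ?_ ?_ ?_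
    · rw [body_sub, body_mul, body_corrNorth he, body_one]; exact sub_ne_zero.mpr hb.symm
    · rw [body_sub, body_mul, body_one]; exact sub_ne_zero.mpr hb.symm
    · rw [mul_sub, mul_sub, h0]
  refine perturbation_neg (w := x.1) (ρ := x.2) he ?_ ?_ ?_
  · rw [mul_neg, mul_neg]
    congr 1
    refine odd_mul_left_congr he ?_ _
    rw [mul_sub, mul_sub, h1, h0, mul_sub, mul_sub]
  · rw [mul_smul_comm, mul_smul_comm]
    congr 1
    refine odd_mul_left_congr he ?_ _
    rw [mul_sub, h1, mul_sub]
  · rw [mul_neg, mul_neg]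
    congr 1
    refine odd_mul_left_congr he ?_ _
    rw [mul_sub, mul_sub, odd_mul_sq_congr he h1]

theorem cen_I : cen Complex.I * cen Complex.I = -1 := by
  rw [← map_mul, Complex.I_mul_I, map_neg, map_one]

/-- The two descriptions of the correction map agree. -/
theorem corrNorth_inversionInv (hz : (z : GInf) ∈ gEven) (hθ : θ ∈ gOdd) {e : GInf} (he : e ∈ gOdd)
    {x : SPt} (hx : x ∈ superspace) (h0 : body x.1 ≠ 0) (hb : body x.1 ≠ body z) :
    corrNorth z θ e (inversionInv x) = inversionInv (corrSouth z θ e x) := by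
  obtain ⟨w, ρ⟩ := x
  obtain ⟨hw, hρ⟩ : w ∈ gEven ∧ ρ ∈ gOdd := hx
  dsimp only at h0 hb
  have hie := inverse_even hw
  have hiw := inverse_mul hw h0
  have hde := gEven.sub_mem hw hz
  have hdb : body (w - z) ≠ 0 := by rw [body_sub]; exact sub_ne_zero.mpr hb
  have hPe := inverse_even hde
  have hPd := inverse_mul hde hdb
  -- The function 1/(1 - zx) of the chart at infinity in finite terms: with x = 1/w it equals w/(w -
  -- z) = 1 + z/(w - z).
  have hs : Ring.inverse (1 - z * Ring.inverse w) = 1 + z * Ring.inverse (w - z) := by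
    have h2 : (1 + z * Ring.inverse (w - z)) * (1 - z * Ring.inverse w) = 1 := by
      obtain ⟨X, hX⟩ := even_exists_smul hie
      obtain ⟨P, hP⟩ := even_exists_smul hPe
      obtain ⟨Z, hZ⟩ := even_exists_smul hz
      obtain ⟨W, hW⟩ := even_exists_smul hw
      rw [hX, hW] at hiw
      rw [hP, hW, hZ, ← sub_smul] at hPd
      have e1 : X * W = 1 := cen_smul_one_eq hiw
      have e2 : P * (W - Z) = 1 := cen_smul_one_eq hPd
      rw [hX, hP, hZ]
      simp only [mul_sub, mul_smul_comm, mul_one]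
      match_scalars
      linear_combination Z * X * e2 - Z * P * e1
    refine inverse_eq ?_ h2
    rw [even_comm (gEven.sub_mem one_mem_gEven (even_mul_even hz hie)), h2]
  have hzi := units_inv_even hz
  have hzz : ((z⁻¹ : GInfˣ) : GInf) * z = 1 := Units.inv_mul z
  have hinv : Ring.inverse (corrSouth z θ e (w, ρ)).1 = Ring.inverse w -
      (e * (2 * θ * (Ring.inverse (w - z) + (z⁻¹ : GInfˣ))) +
        ρ * (e * (Ring.inverse (w - z) + (z⁻¹ : GInfˣ)))) * Ring.inverse w ^ 2 := by
    have h := inverse_add_odd_mul_odd (ρ := e)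
      (ξ := 2 * θ * (Ring.inverse (w - z) + (z⁻¹ : GInfˣ)) -
        ρ * (Ring.inverse (w - z) + (z⁻¹ : GInfˣ))) hie hw (mul_inverse hw h0) he
      (gOdd.sub_mem (odd_mul_even (two_mul_odd hθ) (gEven.add_mem hPe hzi))
        (odd_mul_even hρ (gEven.add_mem hPe hzi)))
    -- Moving ρ past e writes the whole even perturbation as e times an odd element, the form in
    -- which the inverse was computed.
    have h3 : e * (2 * θ * (Ring.inverse (w - z) + (z⁻¹ : GInfˣ)) -
        ρ * (Ring.inverse (w - z) + (z⁻¹ : GInfˣ))) =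
        e * (2 * θ * (Ring.inverse (w - z) + (z⁻¹ : GInfˣ))) +
        ρ * (e * (Ring.inverse (w - z) + (z⁻¹ : GInfˣ))) := by
      rw [mul_sub, odd_anticomm_assoc he hρ, sub_neg_eq_add]
    rw [← mul_assoc, h3, ← add_assoc] at h
    exact h
  have a1 := odd_sq e he
  have a2 := odd_sq ρ hρ
  have b1 := odd_mul_self_assoc he
  have b2 := odd_mul_self_assoc hρ
  have c1 := odd_anticomm ρ e hρ he
  have c2 := odd_anticomm_assoc hρ he
  have c4 := odd_anticomm_assoc hθ he
  have c5 := odd_anticomm θ ρ hθ hρ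
  rw [inversionInv, inversionInv, hinv]
  simp only [corrNorth, corrSouth, hs]
  obtain ⟨X, hX⟩ := even_exists_smul hie
  obtain ⟨P, hP⟩ := even_exists_smul hPe
  obtain ⟨Z, hZ⟩ := even_exists_smul hz
  obtain ⟨W, hW⟩ := even_exists_smul hw
  obtain ⟨y, hy⟩ := even_exists_smul hzi
  rw [hX, hW] at hiw
  rw [hP, hW, hZ, ← sub_smul] at hPd
  rw [hy, hZ] at hzz
  have e1 : X * W = 1 := cen_smul_one_eq hiw
  have e2 : P * (W - Z) = 1 := cen_smul_one_eq hPd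
  have e3 : y * Z = 1 := cen_smul_one_eq hzz
  have e4 := cen_I
  -- Partial fractions: 1/(w - z) - 1/w = z/(w(w - z)), and then the same divided by z.
  have e5 : P - X = Z * X * P := by linear_combination -P * e1 + X * e2
  have e6 : y * P - y * X = X * P := by linear_combination y * e5 + X * P * e3
  rw [hX, hP, hZ, hy]
  simp only [pow_succ, pow_zero, mul_one, mul_add, add_mul, mul_sub, mul_neg, neg_mul,
    mul_smul_comm, smul_mul_assoc, mul_assoc, two_mul, smul_eq_cen Complex.I,
    smul_eq_cen (-Complex.I), map_neg, b1, b2, c1, c2, c4, c5, a2, smul_zero, mul_zero, smul_neg, neg_zero]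
  refine Prod.ext ?_ ?_
  · dsimp only
    match_scalars
    · ring
    · linear_combination -2 * y ^ 2 * (P - X) * e3 + (-2 * y - 2 * X) * e6
    · linear_combination -y ^ 2 * X * P * Z * e4 + y * X * P * e3 + X * e6
  · dsimp only
    match_scalars
    · ring
    · linear_combination -cen Complex.I * y * P * e3 - cen Complex.I * e6
    · linear_combination cen Complex.I * X * (-2 * y * P - P ^ 2 * (y * Z + 1)) * e3 -
        2 * cen Complex.I * X * e6

/-- The coordinate at infinity of `(0, M(ε, 3/2))`. -/
def capCoord (e : GInf) (x : SPt) : SPt :=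
  (x.1 + Complex.I • (x.2 * (e * x.1 ^ 2)), -(Complex.I • (e * x.1 ^ 2)) - x.2)

theorem capCoord_mem {e : GInf} (he : e ∈ gOdd) {x : SPt} (hx : x ∈ superspace) :
    capCoord e x ∈ superspace := by
  have h := odd_mul_even he (even_pow hx.1 2)
  exact ⟨gEven.add_mem hx.1 (gEven.smul_mem _ (odd_mul_odd hx.2 h)),
    gOdd.sub_mem (gOdd.neg_mem (gOdd.smul_mem _ h)) hx.2⟩

theorem body_capCoord {e : GInf} (he : e ∈ gOdd) (x : SPt) :
    body (capCoord e x).1 = body x.1 := by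
  simp only [capCoord, body_add, body_smul, body_mul, body_odd he, zero_mul, mul_zero, add_zero]

/-- The map reverses the sign of φ and thereby the sign of its own perturbation, so it is an
involution; no separate inverse is needed. -/
theorem capCoord_capCoord {e : GInf} (he : e ∈ gOdd) {x : SPt} (hx : x ∈ superspace) :
    capCoord e (capCoord e x) = x := by
  obtain ⟨y, φ⟩ := x
  obtain ⟨hy, hφ⟩ : y ∈ gEven ∧ φ ∈ gOdd := hx
  have a1 := odd_sq e he
  have b1 := odd_mul_self_assoc he
  have c1 := odd_anticomm φ e hφ he
  have c2 := odd_anticomm_assoc hφ he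
  have a2 := odd_sq φ hφ
  obtain ⟨y, rfl⟩ := even_exists_smul hy
  simp only [capCoord, pow_two, mul_one, mul_add, add_mul, sub_mul, mul_neg, neg_mul,
    mul_smul_comm, smul_mul_assoc, smul_eq_cen Complex.I, mul_assoc, one_mul, b1, c1, c2, a1, a2,
    smul_zero, mul_zero, smul_neg, neg_zero]
  refine Prod.ext ?_ ?_
  · dsimp only
    module
  · dsimp only
    module

theorem inversion_mem {x : SPt} (hx : x ∈ superspace) : inversion x ∈ superspace :=
  ⟨inverse_even hx.1, gOdd.smul_mem _ (odd_mul_even hx.2 (inverse_even hx.1))⟩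

theorem inversionInv_mem {x : SPt} (hx : x ∈ superspace) : inversionInv x ∈ superspace :=
  ⟨inverse_even hx.1, gOdd.neg_mem (gOdd.smul_mem _ (odd_mul_even hx.2 (inverse_even hx.1)))⟩

theorem body_inversion {x : SPt} (hx : x ∈ superspace) :
    body (inversion x).1 = (body x.1)⁻¹ := body_inverse hx.1

theorem body_inversionInv {x : SPt} (hx : x ∈ superspace) :
    body (inversionInv x).1 = (body x.1)⁻¹ := body_inverse hx.1

theorem inverse_inverse' {x : GInf} (hx : x ∈ gEven) (h : body x ≠ 0) :
    Ring.inverse (Ring.inverse x) = x := inverse_eq (inverse_mul hx h) (mul_inverse hx h)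

theorem inversion_inversionInv {x : SPt} (hx : x ∈ superspace) (h : body x.1 ≠ 0) :
    inversion (inversionInv x) = x := by
  rw [inversion, inversionInv]
  refine Prod.ext (inverse_inverse' hx.1 h) ?_
  dsimp only
  rw [inverse_inverse' hx.1 h, neg_mul, smul_mul_assoc, mul_assoc, inverse_mul hx.1 h, mul_one,
    smul_neg, smul_smul, Complex.I_mul_I, neg_one_smul, neg_neg]

theorem inversionInv_inversion {x : SPt} (hx : x ∈ superspace) (h : body x.1 ≠ 0) :
    inversionInv (inversion x) = x := by
  rw [inversion, inversionInv]
  refine Prod.ext (inverse_inverse' hx.1 h) ?_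
  dsimp only
  rw [inverse_inverse' hx.1 h, smul_mul_assoc, mul_assoc, inverse_mul hx.1 h, mul_one,
    smul_smul, Complex.I_mul_I, neg_one_smul, neg_neg]

theorem superShift_mem {c γ : GInf} (hc : c ∈ gEven) (hγ : γ ∈ gOdd) {x : SPt}
    (hx : x ∈ superspace) : superShift c γ x ∈ superspace :=
  ⟨gEven.sub_mem (gEven.sub_mem hx.1 hc) (odd_mul_odd hx.2 hγ), gOdd.sub_mem hx.2 hγ⟩

theorem body_superShift (c : GInf) {γ : GInf} (hγ : γ ∈ gOdd) (x : SPt) :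
    body (superShift c γ x).1 = body x.1 - body c := by
  simp only [superShift, body_sub, body_mul, body_odd hγ, mul_zero, sub_zero]

theorem superShift_neg {c γ : GInf} (hγ : γ ∈ gOdd) (x : SPt) :
    superShift (-c) (-γ) (superShift c γ x) = x := by
  simp only [superShift, sub_mul, mul_neg, odd_sq γ hγ]
  refine Prod.ext ?_ ?_ <;> dsimp only <;> abel

/-- The even part of the shift on the second piece of the sewn surface. -/
def capShiftEven (z : GInfˣ) (θ e : GInf) : GInf := -z + θ * e * (z⁻¹ : GInfˣ)

/-- The odd part of the shift on the second piece of the sewn surface. -/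
def capShiftOdd (z : GInfˣ) (θ e : GInf) : GInf := -θ - e * (z⁻¹ : GInfˣ)

/-- The correction map and the shift are compatible with the identification of the super-annuli. -/
theorem corrSouth_eq_superShift (hz : (z : GInf) ∈ gEven) (hθ : θ ∈ gOdd) {e : GInf}
    (he : e ∈ gOdd) {x : SPt} (hx : x ∈ superspace) (hb : body x.1 ≠ body z) :
    corrSouth z θ e x = superShift (capShiftEven z θ e) (capShiftOdd z θ e)
      (inversion (capCoord e (inversion (superShift z θ x)))) := by
  obtain ⟨w, ρ⟩ := x
  obtain ⟨hw, hρ⟩ : w ∈ gEven ∧ ρ ∈ gOdd := hx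
  dsimp only at hb
  have hde := gEven.sub_mem hw hz
  have hdb : body (w - z) ≠ 0 := by rw [body_sub]; exact sub_ne_zero.mpr hb
  have hPe := inverse_even hde
  have hPd := inverse_mul hde hdb
  have hzi := units_inv_even hz
  have a1 := odd_sq e he
  have a2 := odd_sq ρ hρ
  have a3 := odd_sq θ hθ
  have b1 := odd_mul_self_assoc he
  have b2 := odd_mul_self_assoc hρ
  have b3 := odd_mul_self_assoc hθ
  have c1 := odd_anticomm ρ e hρ he
  have c2 := odd_anticomm_assoc hρ he
  have c3 := odd_anticomm θ e hθ he
  have c4 := odd_anticomm_assoc hθ he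
  have c5 := odd_anticomm θ ρ hθ hρ
  have c6 := odd_anticomm_assoc hθ hρ
  -- Between two inversions the cap coordinate becomes (t,τ) ↦ (t + τε/t, τ + ε/t); the sign of φ in
  -- `capCoord` cancels the sign that I ∘ I produces.
  have key : ∀ t τ : GInf, t ∈ gEven → τ ∈ gOdd → body t ≠ 0 →
      inversion (capCoord e (inversion (t, τ))) =
        (t + τ * e * Ring.inverse t, τ + e * Ring.inverse t) := by
    intro t τ ht hτ hb
    have hie := inverse_even ht
    have hmul := inverse_mul ht hb
    have c1 := odd_anticomm τ e hτ he
    have c2 := odd_anticomm_assoc hτ he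
    have a2 := odd_sq τ hτ
    have b2 := odd_mul_self_assoc hτ
    have h1 : Ring.inverse (capCoord e (inversion (t, τ))).1 = t + τ * e * Ring.inverse t := by
      have h := inverse_add_odd_mul_odd (P := t) (F := Ring.inverse t) (ρ := τ)
        (ξ := -(e * Ring.inverse t ^ 3)) ht hie hmul hτ
        (gOdd.neg_mem (odd_mul_even he (even_pow hie 3)))
      have e1 : (capCoord e (inversion (t, τ))).1 =
          Ring.inverse t + τ * -(e * Ring.inverse t ^ 3) := by
        simp only [capCoord, inversion]
        obtain ⟨X, hX⟩ := even_exists_smul hie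
        rw [hX]
        simp only [pow_succ, pow_zero, mul_one, mul_neg, mul_smul_comm, smul_mul_assoc,
          smul_eq_cen Complex.I]
        match_scalars
        · ring
        · linear_combination X ^ 3 * cen_I
      rw [e1, h]
      obtain ⟨X, hX⟩ := even_exists_smul hie
      obtain ⟨T, hT⟩ := even_exists_smul ht
      rw [hX, hT] at hmul
      have e2 : X * T = 1 := cen_smul_one_eq hmul
      rw [hX, hT]
      simp only [pow_succ, pow_zero, mul_one, mul_neg, mul_smul_comm]
      match_scalars
      · ring
      · linear_combination X * (X * T + 1) * e2
    refine Prod.ext h1 ?_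
    rw [inversion, h1]
    simp only [capCoord, inversion]
    obtain ⟨X, hX⟩ := even_exists_smul hie
    obtain ⟨T, hT⟩ := even_exists_smul ht
    rw [hX, hT] at hmul
    have e2 : X * T = 1 := cen_smul_one_eq hmul
    rw [hX, hT]
    simp only [pow_succ, pow_zero, mul_one, mul_add, sub_mul, mul_neg, neg_mul,
      mul_smul_comm, smul_mul_assoc, smul_eq_cen Complex.I, b1, c1, c2, a2,
      smul_zero, mul_zero, smul_neg, neg_zero]
    match_scalars
    · linear_combination -X ^ 2 * T * cen_I + X * e2
    · linear_combination -X * T * cen_I + e2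
  have hte := superShift_mem hz hθ (x := (w, ρ)) ⟨hw, hρ⟩
  have hbs := body_superShift z hθ (w, ρ)
  have ht := key (superShift z θ (w, ρ)).1 (superShift z θ (w, ρ)).2 hte.1 hte.2
    (by rw [hbs]; exact sub_ne_zero.mpr hb)
  -- The denominator is w - z - ρθ, whose inverse differs from 1/(w - z) by the term ρθ/(w - z)².
  have hinv : Ring.inverse (superShift z θ (w, ρ)).1 =
      Ring.inverse (w - z) + ρ * (θ * Ring.inverse (w - z) ^ 2) := by
    have h := inverse_add_odd_mul_odd (ρ := ρ) (ξ := -θ) hPe hde (mul_inverse hde hdb) hρ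
      (gOdd.neg_mem hθ)
    rw [mul_neg, ← sub_eq_add_neg, neg_mul, mul_neg, sub_neg_eq_add] at h
    exact h
  rw [Prod.mk.eta] at ht
  rw [ht, hinv]
  simp only [superShift, corrSouth, capShiftEven, capShiftOdd]
  obtain ⟨P, hP⟩ := even_exists_smul hPe
  obtain ⟨Z, hZ⟩ := even_exists_smul hz
  obtain ⟨W, hW⟩ := even_exists_smul hw
  obtain ⟨y, hy⟩ := even_exists_smul hzi
  rw [hP, hW, hZ, ← sub_smul] at hPd
  have e2 : P * (W - Z) = 1 := cen_smul_one_eq hPd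
  rw [hP, hZ, hy]
  simp only [pow_succ, pow_zero, mul_one, mul_add, add_mul, mul_sub, sub_mul, mul_neg, neg_mul,
    mul_smul_comm, smul_mul_assoc, mul_assoc, two_mul, 
    b1, b2, c1, c2, c3, c6, a1, a3, smul_zero, mul_zero, smul_neg, neg_zero]
  refine Prod.ext ?_ ?_
  · dsimp only
    module
  · dsimp only
    module

end correction

end SuperSewing
end

noncomputable section
namespace SuperSewing
open Filter Topology

/-! ## Charts of the super-Riemann sphere -/

theorem southChart.mem {p : SSphere} {x : SPt} (h : southChart p x) : x ∈ superspace := by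
  obtain ⟨h1, h2, -⟩ := h
  exact ⟨h1, h2⟩

theorem northChart.mem {p : SSphere} {x : SPt} (h : northChart p x) : x ∈ superspace := by
  rcases h with ⟨x, hx, -, rfl⟩ | ⟨h1, h2, -, -⟩
  · exact inversionInv_mem hx.mem
  · exact ⟨h1, h2⟩

theorem exists_southChart {x : SPt} (hx : x ∈ superspace) : ∃ p, southChart p x :=
  ⟨SSphere.south x.1 x.2 hx.1 hx.2, hx.1, hx.2, rfl⟩

theorem southChart.unique {p : SSphere} {x x' : SPt} (h : southChart p x) (h' : southChart p x') :
    x = x' := by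
  obtain ⟨h1, h2, rfl⟩ := h
  obtain ⟨h3, h4, h5⟩ := h'
  cases x
  cases x'
  cases h5
  rfl

theorem southChart.point_unique {p p' : SSphere} {x : SPt} (h : southChart p x)
    (h' : southChart p' x) : p = p' := by
  obtain ⟨h1, h2, rfl⟩ := h
  obtain ⟨h3, h4, rfl⟩ := h'
  rfl

theorem southChart.north {p : SSphere} {x : SPt} (h : southChart p x) (hb : body x.1 ≠ 0) :
    northChart p (inversionInv x) := Or.inl ⟨x, h, hb, rfl⟩

theorem southChart.transition {p : SSphere} {x y : SPt} (h : southChart p x) (h' : northChart p y) :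
    body x.1 ≠ 0 ∧ body y.1 ≠ 0 ∧ y = inversionInv x ∧ x = inversion y := by
  rcases h' with ⟨x', hx', hb, rfl⟩ | ⟨h1, h2, h3, rfl⟩
  · obtain rfl := h.unique hx'
    refine ⟨hb, ?_, rfl, (inversion_inversionInv h.mem hb).symm⟩
    rw [body_inversionInv h.mem]
    exact inv_ne_zero hb
  · obtain ⟨_, _, h⟩ := h
    cases h

theorem northChart.south {p : SSphere} {y : SPt} (h : northChart p y) (hb : body y.1 ≠ 0) :
    southChart p (inversion y) := by
  rcases h with ⟨x, hx, hb', rfl⟩ | ⟨h1, h2, h3, rfl⟩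
  · rwa [inversion_inversionInv hx.mem hb']
  · exact absurd h3 hb

theorem exists_northChart {y : SPt} (hy : y ∈ superspace) : ∃ p, northChart p y := by
  by_cases hb : body y.1 = 0
  · exact ⟨SSphere.infinity y.1 y.2 hy.1 hy.2 hb, Or.inr ⟨hy.1, hy.2, hb, rfl⟩⟩
  · obtain ⟨p, hp⟩ := exists_southChart (inversion_mem hy)
    refine ⟨p, ?_⟩
    have := hp.north (by rw [body_inversion hy]; exact inv_ne_zero hb)
    rwa [inversionInv_inversion hy hb] at this

theorem northChart.unique {p : SSphere} {y y' : SPt} (h : northChart p y) (h' : northChart p y') :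
    y = y' := by
  by_cases hb : body y.1 = 0
  · rcases h with ⟨x, hx, hb', rfl⟩ | ⟨h1, h2, h3, rfl⟩
    · rw [body_inversionInv hx.mem] at hb
      exact absurd hb (inv_ne_zero hb')
    · rcases h' with ⟨x, ⟨_, _, h⟩, -, rfl⟩ | ⟨h1', h2', h3', h⟩
      · cases h
      · cases y
        cases y'
        cases h
        rfl
  · rw [((h.south hb).transition h').2.2.1, inversionInv_inversion h.mem hb]

theorem northChart.point_unique {p p' : SSphere} {y : SPt} (h : northChart p y)
    (h' : northChart p' y) : p = p' := by
  by_cases hb : body y.1 = 0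
  · rcases h with ⟨x, hx, hb', rfl⟩ | ⟨h1, h2, h3, rfl⟩
    · rw [body_inversionInv hx.mem] at hb
      exact absurd hb (inv_ne_zero hb')
    · rcases h' with ⟨x, hx, hb', rfl⟩ | ⟨h1', h2', h3', rfl⟩
      · rw [body_inversionInv hx.mem] at hb
        exact absurd hb (inv_ne_zero hb')
      · rfl
  · exact (h.south hb).point_unique (h'.south hb)

theorem exists_south_or_north (p : SSphere) :
    (∃ x, southChart p x) ∨ ∃ y, northChart p y ∧ body y.1 = 0 := by
  cases p with
  | south w ρ hw hρ => exact Or.inl ⟨(w, ρ), hw, hρ, rfl⟩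
  | infinity x φ hx hφ h0 => exact Or.inr ⟨(x, φ), Or.inr ⟨hx, hφ, h0, rfl⟩, h0⟩

/-! ## Superconformal maps of parts of the sphere -/

/-- `Φ` is superconformal on `U` in the charts `c`, `c'`. -/
def IsSuperconformalIn (U : Set SSphere) (Φ : SSphere → SSphere) (c c' : SSphere → SPt → Prop) :
    Prop :=
  ∃ h, IsSuperconformalOn {x | ∃ p ∈ U, ∃ y, c p x ∧ c' (Φ p) y} h ∧
    ∀ p ∈ U, ∀ x y, c p x → c' (Φ p) y → y = h x

theorem IsSCData.isSuperconformalIn {U : Set SSphere} {Φ : SSphere → SSphere}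
    {c c' : SSphere → SPt → Prop} {V : Set ℂ} {h : SPt → SPt} {f ξ ψ g : ℂ → GInf}
    (H : IsSCData V h f ξ ψ g)
    (h1 : ∀ p ∈ U, ∀ x y, c p x → c' (Φ p) y → x ∈ overBody V ∧ y = h x)
    (h2 : ∀ x ∈ overBody V, ∃ p ∈ U, ∃ y, c p x ∧ c' (Φ p) y) : IsSuperconformalIn U Φ c c' := by
  have hU : {x | ∃ p ∈ U, ∃ y, c p x ∧ c' (Φ p) y} = overBody V := by
    ext x
    exact ⟨fun ⟨p, hp, y, hx, hy⟩ => (h1 p hp x y hx hy).1, h2 x⟩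
  refine ⟨h, ?_, fun p hp x y hx hy => (h1 p hp x y hx hy).2⟩
  rw [hU]
  exact H.isSuperconformalOn

theorem isOpen_outside (z : ℂ) (r : ℝ) : IsOpen {t : ℂ | r < ‖t - z‖} :=
  isOpen_lt continuous_const (by fun_prop)

/-- This is the condition r < |t⁻¹ - z| with the denominator cleared, so that t = 0, the body of the
points at infinity, is included. -/
theorem isOpen_outside_north (z : ℂ) (r : ℝ) : IsOpen {t : ℂ | r * ‖t‖ < ‖1 - z * t‖} :=
  isOpen_lt (by fun_prop) (by fun_prop)

theorem outside_north_iff {z t : ℂ} (r : ℝ) (ht : t ≠ 0) :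
    r * ‖t‖ < ‖1 - z * t‖ ↔ r < ‖t⁻¹ - z‖ := by
  have h : 1 - z * t = (t⁻¹ - z) * t := by rw [sub_mul, inv_mul_cancel₀ ht]
  rw [h, norm_mul, mul_lt_mul_iff_left₀ (norm_pos_iff.mpr ht)]

/-- The points outside the closed ball of radius `r` about `z`. -/
def outside (z : ℂ) (r : ℝ) : Set SSphere := {p | ∀ x, southChart p x → r < ‖body x.1 - z‖}

theorem northChart.mem_outside_iff {p : SSphere} {y : SPt} (h : northChart p y) {z : ℂ} {r : ℝ} :
    p ∈ outside z r ↔ r * ‖body y.1‖ < ‖1 - z * body y.1‖ := by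
  by_cases hb : body y.1 = 0
  · simp only [hb, norm_zero, mul_zero, sub_zero, norm_one, zero_lt_one, iff_true]
    intro x hx
    exact absurd hb (hx.transition h).2.1
  · rw [outside_north_iff r hb, ← body_inversion h.mem]
    exact ⟨fun hp => hp _ (h.south hb), fun hr x hx => by rwa [hx.unique (h.south hb)]⟩

theorem southChart.mem_outside_iff {p : SSphere} {x : SPt} (h : southChart p x) {z : ℂ} {r : ℝ} :
    p ∈ outside z r ↔ r < ‖body x.1 - z‖ :=
  ⟨fun hp => hp x h, fun hr x' hx' => by rwa [hx'.unique h]⟩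

section correction

variable {z : GInfˣ} {θ : GInf} (hz : (z : GInf) ∈ gEven) (hθ : θ ∈ gOdd)

/-- The correction map on the sphere (meaningless over the body of `z`). -/
def corrSphere (e : gOdd) : SSphere → SSphere
  | .south w ρ hw hρ => .south _ _ (corrSouth_mem hz hθ e.2 (x := (w, ρ)) ⟨hw, hρ⟩).1
      (corrSouth_mem hz hθ e.2 (x := (w, ρ)) ⟨hw, hρ⟩).2
  | .infinity x φ hx hφ h0 => .infinity _ _ (corrNorth_mem hz hθ e.2 (x := (x, φ)) ⟨hx, hφ⟩).1
      (corrNorth_mem hz hθ e.2 (x := (x, φ)) ⟨hx, hφ⟩).2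
      ((body_corrNorth e.2 _).trans h0)

theorem southChart.corr {p : SSphere} {x : SPt} (h : southChart p x) (e : gOdd) :
    southChart (corrSphere hz hθ e p) (corrSouth z θ e x) := by
  obtain ⟨h1, h2, rfl⟩ := h
  exact ⟨_, _, rfl⟩

theorem northChart.corr {p : SSphere} {y : SPt} (h : northChart p y) (e : gOdd)
    (hb : body z * body y.1 ≠ 1) : northChart (corrSphere hz hθ e p) (corrNorth z θ e y) := by
  rcases h with ⟨x, hx, hb', rfl⟩ | ⟨h1, h2, h3, rfl⟩
  · have hxz : body x.1 ≠ body z := fun hxz => hb (by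
      rw [body_inversionInv hx.mem, hxz, mul_inv_cancel₀ (body_unit z)])
    rw [corrNorth_inversionInv hz hθ e.2 hx.mem hb' hxz]
    exact (hx.corr hz hθ e).north (by rwa [body_corrSouth e.2])
  · exact Or.inr ⟨_, _, _, rfl⟩

theorem corrSphere_mem_outside {p : SSphere} {r : ℝ} (e : gOdd) (hp : p ∈ outside (body z) r) :
    corrSphere hz hθ e p ∈ outside (body z) r := by
  rcases exists_south_or_north p with ⟨x, hx⟩ | ⟨y, hy, hb⟩
  · rw [hx.mem_outside_iff] at hp
    rwa [(hx.corr hz hθ e).mem_outside_iff, body_corrSouth e.2]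
  · rw [(hy.corr hz hθ e (by simp [hb])).mem_outside_iff, body_corrNorth e.2, hb]
    simp

theorem corrSphere_neg {p : SSphere} {r : ℝ} (hr : 0 ≤ r) (e : gOdd)
    (hp : p ∈ outside (body z) r) : corrSphere hz hθ (-e) (corrSphere hz hθ e p) = p := by
  rcases exists_south_or_north p with ⟨x, hx⟩ | ⟨y, hy, hb⟩
  · refine ((hx.corr hz hθ e).corr hz hθ (-e)).point_unique ?_
    rw [hx.mem_outside_iff] at hp
    have := corrSouth_neg hz hθ e.2 hx.mem
      (fun h => by rw [h, sub_self, norm_zero] at hp; exact absurd hp (not_lt.mpr hr))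
    change southChart p (corrSouth z θ (-(e : GInf)) _)
    rwa [this]
  · refine ((hy.corr hz hθ e (by simp [hb])).corr hz hθ (-e)
      (by rw [body_corrNorth e.2]; simp [hb])).point_unique ?_
    have := corrNorth_neg hz hθ e.2 hy.mem (by simp [hb])
    change northChart p (corrNorth z θ (-(e : GInf)) _)
    rwa [this]

theorem neg_I_mul_neg_I : -Complex.I * -Complex.I = -1 := by rw [neg_mul_neg, Complex.I_mul_I]

/-- For equal charts the explicit expression applies. For mixed charts an inversion follows it, and
the points whose image has body zero drop out of the domain. -/
theorem isSuperconformalIn_corrSphere {r : ℝ} (hr : 0 ≤ r) (e : gOdd) {c c' : SSphere → SPt → Prop}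
    (hc : c ∈ superSphere.atlas) (hc' : c' ∈ superSphere.atlas) :
    IsSuperconformalIn (outside (body z) r) (corrSphere hz hθ e) c c' := by
  have hzn : ∀ t ∈ {t : ℂ | r * ‖t‖ < ‖1 - body z * t‖}, body z * t ≠ 1 := fun t ht h => by
    rw [Set.mem_ofPred_eq, h, sub_self, norm_zero] at ht
    exact absurd ht (not_lt.mpr (mul_nonneg hr (norm_nonneg t)))
  have hzs : body z ∉ {t : ℂ | r < ‖t - body z‖} := fun h => by
    rw [Set.mem_ofPred_eq, sub_self, norm_zero] at h
    exact absurd h (not_lt.mpr hr)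
  obtain ⟨fs, ξs, ψs, gs, Hs, hbs⟩ := exists_isSCData_corrSouth hz hθ e.2
    (isOpen_outside (body z) r) hzs
  obtain ⟨fn, ξn, ψn, gn, Hn, hbn⟩ := exists_isSCData_corrNorth hz hθ e.2
    (isOpen_outside_north (body z) r) hzn
  have hne : IsOpen {t : ℂ | t ≠ 0} := isOpen_ne
  rcases hc with rfl | hc <;> rcases hc' with rfl | hc'
  · refine Hs.isSuperconformalIn (fun p hp x y hx hy => ⟨⟨hx.mem, hx.mem_outside_iff.mp hp⟩,
      hy.unique (hx.corr hz hθ e)⟩) fun x hx => ?_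
    obtain ⟨p, hp⟩ := exists_southChart hx.1
    exact ⟨p, hp.mem_outside_iff.mpr hx.2, _, hp, hp.corr hz hθ e⟩
  · rw [Set.mem_singleton_iff] at hc'
    subst hc'
    refine (Hs.inverse neg_I_mul_neg_I (V' := {t | r < ‖t - body z‖} ∩ {t | t ≠ 0})
      (h' := fun x => inversionInv (corrSouth z θ e x)) (Hs.isOpen.inter hne)
      Set.inter_subset_left (fun t ht => by rw [hbs t ht.1]; exact ht.2)
      (fun x _ => by rw [inversionInv, neg_smul])).isSuperconformalIn
      (fun p hp x y hx hy => ?_) fun x hx => ?_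
    · have h := (hx.corr hz hθ e).transition hy
      have h1 := h.1
      rw [body_corrSouth e.2] at h1
      exact ⟨⟨hx.mem, hx.mem_outside_iff.mp hp, h1⟩, h.2.2.1⟩
    · obtain ⟨p, hp⟩ := exists_southChart hx.1
      exact ⟨p, hp.mem_outside_iff.mpr hx.2.1, _, hp, (hp.corr hz hθ e).north
        (by rw [body_corrSouth e.2]; exact hx.2.2)⟩
  · rw [Set.mem_singleton_iff] at hc
    subst hc
    refine (Hn.inverse Complex.I_mul_I (V' := {t | r * ‖t‖ < ‖1 - body z * t‖} ∩ {t | t ≠ 0})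
      (h' := fun x => inversion (corrNorth z θ e x)) (Hn.isOpen.inter hne)
      Set.inter_subset_left (fun t ht => by rw [hbn t ht.1]; exact ht.2)
      (fun x _ => rfl)).isSuperconformalIn
      (fun p hp x y hx hy => ?_) fun x hx => ?_
    · have hp' := hx.mem_outside_iff.mp hp
      have h := hy.transition (hx.corr hz hθ e (hzn _ hp'))
      have h1 := h.2.1
      rw [body_corrNorth e.2] at h1
      exact ⟨⟨hx.mem, hp', h1⟩, h.2.2.2⟩
    · obtain ⟨p, hp⟩ := exists_northChart hx.1
      exact ⟨p, hp.mem_outside_iff.mpr hx.2.1, _, hp, (hp.corr hz hθ e (hzn _ hx.2.1)).south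
        (by rw [body_corrNorth e.2]; exact hx.2.2)⟩
  · rw [Set.mem_singleton_iff] at hc hc'
    subst hc hc'
    refine Hn.isSuperconformalIn (fun p hp x y hx hy => ⟨⟨hx.mem, hx.mem_outside_iff.mp hp⟩,
      hy.unique (hx.corr hz hθ e (hzn _ (hx.mem_outside_iff.mp hp)))⟩) fun x hx => ?_
    obtain ⟨p, hp⟩ := exists_northChart hx.1
    exact ⟨p, hp.mem_outside_iff.mpr hx.2, _, hp, hp.corr hz hθ e (hzn _ hx.2)⟩

end correction

section shift

variable {c γ : GInf} (hc : c ∈ gEven) (hγ : γ ∈ gOdd)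

/-- A shift on the sphere without the points at infinity. -/
def shiftSphere : SSphere → SSphere
  | .south w ρ hw hρ => .south _ _ (superShift_mem hc hγ (x := (w, ρ)) ⟨hw, hρ⟩).1
      (superShift_mem hc hγ (x := (w, ρ)) ⟨hw, hρ⟩).2
  -- A default value: only finite points are ever shifted.
  | .infinity x φ hx hφ h0 => .infinity x φ hx hφ h0

theorem southChart.shift {p : SSphere} {x : SPt} (h : southChart p x) :
    southChart (shiftSphere hc hγ p) (superShift c γ x) := by
  obtain ⟨h1, h2, rfl⟩ := h
  exact ⟨_, _, rfl⟩

/-- The points of the finite part over the ball of radius `r` about `a`. -/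
def inside (a : ℂ) (r : ℝ) : Set SSphere := {p | ∃ x, southChart p x ∧ ‖body x.1 - a‖ < r}

theorem southChart.mem_inside_iff {p : SSphere} {x : SPt} (h : southChart p x) {a : ℂ} {r : ℝ} :
    p ∈ inside a r ↔ ‖body x.1 - a‖ < r :=
  ⟨fun ⟨x', hx', h'⟩ => by rwa [h.unique hx'], fun hr => ⟨x, h, hr⟩⟩

theorem shiftSphere_neg {p : SSphere} {a : ℂ} {r : ℝ} (hp : p ∈ inside a r)
    (hc' : -c ∈ gEven) (hγ' : -γ ∈ gOdd) : shiftSphere hc' hγ' (shiftSphere hc hγ p) = p := by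
  obtain ⟨x, hx, -⟩ := hp
  refine ((hx.shift hc hγ).shift hc' hγ').point_unique ?_
  rwa [superShift_neg hγ]

theorem shiftSphere_mem_inside {p : SSphere} {a b : ℂ} {r : ℝ} (hp : p ∈ inside a r)
    (hab : b = a - body c) : shiftSphere hc hγ p ∈ inside b r := by
  obtain ⟨x, hx, h⟩ := hp
  rw [(hx.shift hc hγ).mem_inside_iff, body_superShift c hγ, hab, sub_sub_sub_cancel_right]
  exact h

theorem isOpen_inside_north (a : ℂ) (r : ℝ) : IsOpen {t : ℂ | t ≠ 0 ∧ ‖t⁻¹ - a‖ < r} := by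
  rw [isOpen_iff_mem_nhds]
  rintro t ⟨ht, h⟩
  have hcont : ContinuousAt (fun t : ℂ => ‖t⁻¹ - a‖) t :=
    ((continuousAt_inv₀ ht).sub continuousAt_const).norm
  exact Filter.inter_mem (isOpen_ne.mem_nhds ht) (hcont.eventually_lt_const h)

theorem isSuperconformalIn_shiftSphere {a : ℂ} {r : ℝ} {k k' : SSphere → SPt → Prop}
    (hk : k ∈ superSphere.atlas) (hk' : k' ∈ superSphere.atlas) :
    IsSuperconformalIn (inside a r) (shiftSphere hc hγ) k k' := by
  have hV : IsOpen {t : ℂ | ‖t - a‖ < r} := isOpen_lt (by fun_prop) continuous_const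
  have Hs := isSCData_superShift hV hc hγ
  have Hn := isSCData_superShift_inversion (isOpen_inside_north a r) (fun h => h.1 rfl) hc hγ
  have hne : IsOpen {t : ℂ | t ≠ body c} := isOpen_ne
  have hci : IsOpen {t : ℂ | t ≠ 0 ∧ t⁻¹ ≠ body c} := by
    rw [isOpen_iff_mem_nhds]
    rintro t ⟨ht, h⟩
    exact Filter.inter_mem (isOpen_ne.mem_nhds ht) ((continuousAt_inv₀ ht).eventually_ne h)
  rcases hk with rfl | hk <;> rcases hk' with rfl | hk'
  · refine Hs.isSuperconformalIn (fun p hp x y hx hy => ⟨⟨hx.mem, hx.mem_inside_iff.mp hp⟩,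
      hy.unique (hx.shift hc hγ)⟩) fun x hx => ?_
    obtain ⟨p, hp⟩ := exists_southChart hx.1
    exact ⟨p, hp.mem_inside_iff.mpr hx.2, _, hp, hp.shift hc hγ⟩
  · rw [Set.mem_singleton_iff] at hk'
    subst hk'
    refine (Hs.inverse neg_I_mul_neg_I (V' := {t | ‖t - a‖ < r} ∩ {t | t ≠ body c})
      (h' := fun x => inversionInv (superShift c γ x)) (Hs.isOpen.inter hne)
      Set.inter_subset_left (fun t ht => by
        rw [body_sub, body_algebraMap]; exact sub_ne_zero.mpr ht.2)
      (fun x _ => by rw [inversionInv, neg_smul])).isSuperconformalIn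
      (fun p hp x y hx hy => ?_) fun x hx => ?_
    · have h := (hx.shift hc hγ).transition hy
      have h1 := h.1
      rw [body_superShift c hγ] at h1
      exact ⟨⟨hx.mem, hx.mem_inside_iff.mp hp, sub_ne_zero.mp h1⟩, h.2.2.1⟩
    · obtain ⟨p, hp⟩ := exists_southChart hx.1
      exact ⟨p, hp.mem_inside_iff.mpr hx.2.1, _, hp, (hp.shift hc hγ).north
        (by rw [body_superShift c hγ]; exact sub_ne_zero.mpr hx.2.2)⟩
  · rw [Set.mem_singleton_iff] at hk
    subst hk
    refine Hn.isSuperconformalIn (fun p hp x y hx hy => ?_) fun x hx => ?_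
    · obtain ⟨x', hx', hr⟩ := hp
      obtain ⟨-, h0, -, rfl⟩ := hx'.transition hx
      rw [body_inversion hx.mem] at hr
      exact ⟨⟨hx.mem, h0, hr⟩, hy.unique (hx'.shift hc hγ)⟩
    · obtain ⟨p, hp⟩ := exists_northChart hx.1
      have hs := hp.south hx.2.1
      exact ⟨p, hs.mem_inside_iff.mpr (by rw [body_inversion hx.1]; exact hx.2.2), _, hp,
        hs.shift hc hγ⟩
  · rw [Set.mem_singleton_iff] at hk hk'
    subst hk hk'
    refine (Hn.inverse neg_I_mul_neg_I
      (V' := {t | t ≠ 0 ∧ ‖t⁻¹ - a‖ < r} ∩ {t | t ≠ 0 ∧ t⁻¹ ≠ body c})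
      (h' := fun x => inversionInv (superShift c γ (inversion x))) (Hn.isOpen.inter hci)
      Set.inter_subset_left (fun t ht => by
        rw [body_sub, body_inverse (algebraMap_mem_gEven t), body_algebraMap]
        exact sub_ne_zero.mpr ht.2.2)
      (fun x _ => by rw [inversionInv, neg_smul])).isSuperconformalIn
      (fun p hp x y hx hy => ?_) fun x hx => ?_
    · obtain ⟨x', hx', hr⟩ := hp
      obtain ⟨-, h0, -, rfl⟩ := hx'.transition hx
      have h := (hx'.shift hc hγ).transition hy
      have h1 := h.1
      rw [body_superShift c hγ, body_inversion hx.mem] at h1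
      rw [body_inversion hx.mem] at hr
      exact ⟨⟨hx.mem, ⟨h0, hr⟩, h0, sub_ne_zero.mp h1⟩, h.2.2.1⟩
    · obtain ⟨p, hp⟩ := exists_northChart hx.1
      have hs := hp.south hx.2.1.1
      refine ⟨p, hs.mem_inside_iff.mpr (by rw [body_inversion hx.1]; exact hx.2.1.2), _, hp,
        (hs.shift hc hγ).north ?_⟩
      rw [body_superShift c hγ, body_inversion hx.1]
      exact sub_ne_zero.mpr hx.2.2.2

end shift

end SuperSewing
end

noncomputable section
namespace SuperSewing
open Filter Topology

/-! ## Local coordinates of the surfaces to be sewn -/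

theorem hasETildeValue_zero (x : SPt) : HasETildeValue 0 0 x x := by
  have h := hasETildeValue_of_sq_zero (e := 0) (A := 0) (M := 0) (w := x.1) (a := 0) (m := 0)
    (a' := 0) (fun _ => by simp) (fun _ => ⟨0, by simp⟩) (fun _ => ⟨0, by simp⟩) x.2
    (by rw [alphaSeries_zero]; exact hasSeriesValue_zero _)
    (by
      have : muSeries 0 = 0 := by ext k; simp only [muSeries, PowerSeries.coeff_mk]; split_ifs <;> rfl
      rw [this]; exact hasSeriesValue_zero _)
    (by rw [alphaSeries_zero, dX_zero]; exact hasSeriesValue_zero _)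
  simpa using h

theorem hasETildeValue_zero_iff {x y : SPt} : HasETildeValue 0 0 x y ↔ y = x :=
  ⟨fun h => h.unique (hasETildeValue_zero x), fun h => h ▸ hasETildeValue_zero x⟩

/-- Here α = 0 and μ = -iεx², so Ẽ at (x, -φ) is (x - φμ, μ - φ). -/
theorem hasETildeValue_tau_iff (ε : gOdd) {x y : SPt} :
    HasETildeValue 0 (fun j => -(Complex.I • M₃₂ ε j)) (x.1, -x.2) y ↔ y = capCoord ε x := by
  have h0 : (fun j => -(Complex.I • M₃₂ (ε : GInf) j)) = M₃₂ (-(Complex.I • (ε : GInf))) := by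
    funext j
    rcases eq_or_ne j 2 with rfl | hj
    · simp [M₃₂]
    · simp [M₃₂, hj]
  have h : HasETildeValue 0 (fun j => -(Complex.I • M₃₂ ε j)) (x.1, -x.2) (capCoord ε x) := by
    rw [h0]
    have h := hasETildeValue_of_sq_zero (e := -(Complex.I • (ε : GInf))) (A := 0)
      (M := M₃₂ (-(Complex.I • (ε : GInf)))) (w := x.1) (a := 0)
      (m := -(Complex.I • (ε : GInf)) * x.1 ^ 2) (a' := 0)
      (odd_mul_mul_self (gOdd.neg_mem (gOdd.smul_mem _ ε.2))) (fun _ => ⟨0, by simp⟩)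
      (fun j => by
        rcases eq_or_ne j 2 with rfl | hj
        · exact ⟨1, by simp [M₃₂]⟩
        · exact ⟨0, by simp [M₃₂, hj]⟩) (-x.2)
      (by rw [alphaSeries_zero]; exact hasSeriesValue_zero _)
      (by rw [muSeries_M₃₂]; exact hasSeriesValue_monomial _ _ _)
      (by rw [alphaSeries_zero, dX_zero]; exact hasSeriesValue_zero _)
    simpa [capCoord, sub_eq_add_neg] using h
  exact ⟨fun h' => h'.unique h, fun h' => h' ▸ h⟩

section sewing

variable {z : GInfˣ} {θ : GInf} (hz : (z : GInf) ∈ gEven) (hθ : θ ∈ gOdd) (ε : gOdd)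

/-- The three-punctured sphere with given radii. -/
abbrev pants (R : Fin 3 → ℝ) : TubedSurface 2 := SKSucc.canonical (n := 1) (pantsSK z θ hz hθ) R

/-- The one-punctured sphere with given radius. -/
abbrev cap (R' : ℝ) : TubedSurface 0 := SKZero.canonical (tauSK ε) R'

theorem pants_coord_zero {R : Fin 3 → ℝ} {p : SSphere} {y : SPt} :
    (pants hz hθ R).coord 0 p y ↔ ∃ x, northChart p x ∧ ‖body x.1‖ < (R 0)⁻¹ ∧ y = (x.1, -x.2) := by
  change coordAtInfinity 0 0 (R 0) p y ↔ _
  have h : (fun j => -(Complex.I • (0 : ℕ+ → GInf) j)) = 0 := by funext j; simp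
  simp only [coordAtInfinity, h, hasETildeValue_zero_iff]

theorem pants_coord_one {R : Fin 3 → ℝ} {p : SSphere} {y : SPt} :
    (pants hz hθ R).coord 1 p y ↔
      ∃ x, southChart p x ∧ ‖body x.1 - body z‖ < R 1 ∧ y = superShift z θ x := by
  change coordAtPoint z θ 1 0 0 (R 1) p y ↔ _
  simp only [coordAtPoint, hasETildeValue_zero_iff, one_pow, one_mul, exists_eq_left]

theorem pants_coord_two {R : Fin 3 → ℝ} {p : SSphere} {y : SPt} :
    (pants hz hθ R).coord 2 p y ↔ southChart p y ∧ ‖body y.1‖ < R 2 := by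
  change coordAtPoint 0 0 1 0 0 (R 2) p y ↔ _
  simp only [coordAtPoint, hasETildeValue_zero_iff, one_pow, one_mul, exists_eq_left, superShift,
    mul_zero, sub_zero, body_zero]
  exact ⟨fun ⟨x, h1, h2, h3⟩ => h3 ▸ ⟨h1, h2⟩, fun ⟨h1, h2⟩ => ⟨y, h1, h2, rfl⟩⟩

theorem cap_coord_zero {R' : ℝ} {q : SSphere} {y : SPt} :
    (cap ε R').coord 0 q y ↔ ∃ x, northChart q x ∧ ‖body x.1‖ < R'⁻¹ ∧ y = capCoord ε x := by
  change coordAtInfinity 0 (M₃₂ ε) R' q y ↔ _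
  simp only [coordAtInfinity, hasETildeValue_tau_iff]

/-- Radii which fit. -/
structure AreRadii (R : Fin 3 → ℝ) (R' r₁ r₂ : ℝ) : Prop where
  pos : 0 < R'
  lt₂ : R' < r₂
  lt : r₂ < r₁
  lt₁ : r₁ < R 1

variable {R : Fin 3 → ℝ} {R' r r₁ r₂ : ℝ}

/-- The closed balls must lie in the images of the local coordinates; testing the real points r₁ and
1/r₂ on their boundaries gives the strict inequalities with the radii of the domains. -/
theorem areRadii_of_canSew (hR' : 0 < R')
    (h : CanSew (pants hz hθ R) 0 (cap ε R') r r₁ r₂) : AreRadii R R' r₁ r₂ := by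
  obtain ⟨h2, hr2, hr1, hc1, hc2, -, -⟩ := h
  have hr2' : 0 < r₂⁻¹ := inv_pos.mpr h2
  refine ⟨hR', ?_, hr2.trans hr1, ?_⟩
  · obtain ⟨q, hq⟩ := hc2 (algebraMap ℂ GInf (r₂⁻¹ : ℝ), 0)
      ⟨algebraMap_mem_gEven _, gOdd.zero_mem⟩ (by
        rw [body_algebraMap, Complex.norm_real, Real.norm_of_nonneg hr2'.le])
    obtain ⟨x, hx, hlt, heq⟩ := (cap_coord_zero ε).mp hq
    have hb := congrArg (fun y : SPt => body y.1) heq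
    simp only [body_capCoord ε.2, body_algebraMap] at hb
    rw [← hb, Complex.norm_real, Real.norm_of_nonneg hr2'.le] at hlt
    exact (inv_lt_inv₀ h2 hR').mp hlt
  · have hr1' : 0 < r₁ := by linarith
    obtain ⟨p, hp⟩ := hc1 (algebraMap ℂ GInf r₁, 0)
      ⟨algebraMap_mem_gEven _, gOdd.zero_mem⟩ (by
        rw [body_algebraMap, Complex.norm_real, Real.norm_of_nonneg hr1'.le])
    obtain ⟨x, hx, hlt, heq⟩ := (pants_coord_one hz hθ).mp hp
    have hb := congrArg (fun y : SPt => body y.1) heq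
    simp only [body_superShift _ hθ, body_algebraMap] at hb
    rwa [← hb, Complex.norm_real, Real.norm_of_nonneg hr1'.le] at hlt

theorem pants_ball_iff {s : ℝ} (hs : s < R 1) (p : SSphere) :
    (¬ ∃ x, (pants hz hθ R).coord 1 p x ∧ ‖body x.1‖ ≤ s) ↔ p ∈ outside (body z) s := by
  constructor
  · intro h x hx
    by_contra hle
    rw [not_lt] at hle
    refine h ⟨_, (pants_coord_one hz hθ).mpr ⟨x, hx, hle.trans_lt hs, rfl⟩, ?_⟩
    rwa [body_superShift _ hθ]
  · rintro h ⟨y, hy, hle⟩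
    obtain ⟨x, hx, -, rfl⟩ := (pants_coord_one hz hθ).mp hy
    rw [body_superShift _ hθ] at hle
    exact absurd (h x hx) (not_lt.mpr hle)

theorem cap_ball_iff {s : ℝ} (hR' : 0 < R') (hs : R' < s) (q : SSphere) :
    (¬ ∃ y, (cap ε R').coord 0 q y ∧ ‖body y.1‖ ≤ s⁻¹) ↔ q ∈ inside 0 s := by
  have hs0 : 0 < s := hR'.trans hs
  have hlt : s⁻¹ < R'⁻¹ := (inv_lt_inv₀ hs0 hR').mpr hs
  constructor
  · intro h
    rcases exists_south_or_north q with ⟨x, hx⟩ | ⟨y, hy, hb⟩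
    · refine ⟨x, hx, ?_⟩
      rw [sub_zero]
      by_contra hle
      rw [not_lt] at hle
      have hb : body x.1 ≠ 0 := norm_pos_iff.mp (hs0.trans_le hle)
      have hle' : ‖body (inversionInv x).1‖ ≤ s⁻¹ := by
        rw [body_inversionInv hx.mem, norm_inv]
        exact inv_anti₀ hs0 hle
      refine h ⟨_, (cap_coord_zero ε).mpr ⟨_, hx.north hb, hle'.trans_lt hlt, rfl⟩, ?_⟩
      rwa [body_capCoord ε.2]
    · refine absurd ⟨_, (cap_coord_zero ε).mpr ⟨y, hy, ?_, rfl⟩, ?_⟩ h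
      · rw [hb, norm_zero]; exact inv_pos.mpr hR'
      · rw [body_capCoord ε.2, hb, norm_zero]; exact (inv_pos.mpr hs0).le
  · rintro ⟨x, hx, hxs⟩ ⟨y, hy, hle⟩
    obtain ⟨x', hx', -, rfl⟩ := (cap_coord_zero ε).mp hy
    obtain ⟨h0, -, rfl, -⟩ := hx.transition hx'
    rw [body_capCoord ε.2, body_inversionInv hx.mem, norm_inv,
      inv_le_inv₀ (norm_pos_iff.mpr h0) hs0] at hle
    rw [sub_zero] at hxs
    exact absurd hxs (not_lt.mpr hle)

theorem capShiftEven_mem (hz : (z : GInf) ∈ gEven) (hθ : θ ∈ gOdd) (ε : gOdd) :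
    capShiftEven z θ ε ∈ gEven :=
  gEven.add_mem (gEven.neg_mem hz) (even_mul_even (odd_mul_odd hθ ε.2) (units_inv_even hz))

theorem capShiftOdd_mem (hz : (z : GInf) ∈ gEven) (hθ : θ ∈ gOdd) (ε : gOdd) :
    capShiftOdd z θ ε ∈ gOdd :=
  gOdd.sub_mem (gOdd.neg_mem hθ) (odd_mul_even ε.2 (units_inv_even hz))

theorem body_capShiftEven (hθ : θ ∈ gOdd) (ε : gOdd) :
    body (capShiftEven z θ ε) = -body z := by
  rw [capShiftEven, body_add, body_neg, body_mul, body_mul, body_odd hθ, zero_mul, zero_mul,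
    add_zero]

/-- The shift of the second piece. -/
abbrev capShift : SSphere → SSphere :=
  shiftSphere (capShiftEven_mem hz hθ ε) (capShiftOdd_mem hz hθ ε)

/-- The inverse of `capShift`. -/
abbrev capShiftInv : SSphere → SSphere :=
  shiftSphere (gEven.neg_mem (capShiftEven_mem hz hθ ε)) (gOdd.neg_mem (capShiftOdd_mem hz hθ ε))

theorem capShift_mem_inside {q : SSphere} {s : ℝ} (hq : q ∈ inside 0 s) :
    capShift hz hθ ε q ∈ inside (body z) s :=
  shiftSphere_mem_inside _ _ hq (by rw [body_capShiftEven hθ]; simp)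

theorem capShiftInv_mem_inside {q : SSphere} {s : ℝ} (hq : q ∈ inside (body z) s) :
    capShiftInv hz hθ ε q ∈ inside 0 s :=
  shiftSphere_mem_inside _ _ hq (by rw [body_neg, body_capShiftEven hθ]; simp)

theorem capShiftInv_capShift {q : SSphere} {s : ℝ} (hq : q ∈ inside 0 s) :
    capShiftInv hz hθ ε (capShift hz hθ ε q) = q := shiftSphere_neg _ _ hq _ _

theorem capShift_capShiftInv {q : SSphere} {s : ℝ} (hq : q ∈ inside (body z) s) :
    capShift hz hθ ε (capShiftInv hz hθ ε q) = q := by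
  have h := shiftSphere_neg (gEven.neg_mem (capShiftEven_mem hz hθ ε))
    (gOdd.neg_mem (capShiftOdd_mem hz hθ ε)) hq
    (by rw [neg_neg]; exact capShiftEven_mem hz hθ ε)
    (by rw [neg_neg]; exact capShiftOdd_mem hz hθ ε)
  simpa only [neg_neg] using h

/-- Points are glued exactly when their images on the sphere agree. One direction is
`corrSouth_eq_superShift`. Conversely, from equal images the shift can be undone, and the two
removed balls bound the body from both sides, so the point lies in the annulus. -/
theorem sewnRel_iff (hR : AreRadii R R' r₁ r₂)
    (p : sewnPart₁ (pants hz hθ R) 0 r₂) (q : sewnPart₂ (cap ε R') r₁) :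
    sewnRel (pants hz hθ R) 0 (cap ε R') r₁ r₂ (Sum.inl p) (Sum.inr q) ↔
      corrSphere hz hθ ε p.1 = capShift hz hθ ε q.1 := by
  obtain ⟨p, hp⟩ := p
  obtain ⟨q, hq⟩ := q
  have hp' := (pants_ball_iff hz hθ (hR.lt.trans hR.lt₁) p).mp hp
  have hq' := (cap_ball_iff ε hR.pos (hR.lt₂.trans hR.lt) q).mp hq
  have h2 : 0 < r₂ := hR.pos.trans hR.lt₂
  constructor
  · rintro ⟨t, ht, hr2, hr1, hIt⟩
    obtain ⟨x, hx, hlt, rfl⟩ := (pants_coord_one hz hθ).mp ht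
    obtain ⟨y, hy, -, hcy⟩ := (cap_coord_zero ε).mp hIt
    have hsx := superShift_mem hz hθ hx.mem
    have hb0 : body (superShift z θ x).1 ≠ 0 := norm_pos_iff.mp (h2.trans hr2)
    have hyc : y = capCoord ε (inversion (superShift z θ x)) := by
      rw [hcy, capCoord_capCoord ε.2 hy.mem]
    have hyb : body y.1 ≠ 0 := by
      rw [hyc, body_capCoord ε.2, body_inversion hsx]
      exact inv_ne_zero hb0
    have hqs := hy.south hyb
    refine (hx.corr hz hθ ε).point_unique ?_
    rw [body_superShift _ hθ] at hb0
    rw [corrSouth_eq_superShift hz hθ ε.2 hx.mem (sub_ne_zero.mp hb0), ← hyc]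
    exact hqs.shift _ _
  · intro h
    obtain ⟨x', hx', hxr⟩ := hq'
    have hs := hx'.shift (capShiftEven_mem hz hθ ε) (capShiftOdd_mem hz hθ ε)
    change southChart (capShift hz hθ ε q) _ at hs
    rw [← h] at hs
    rcases exists_south_or_north p with ⟨x, hx⟩ | ⟨y, hy, hb⟩
    · have hr2 := hp' x hx
      have hbz : body x.1 ≠ body z := fun hbz => by
        rw [hbz, sub_self, norm_zero] at hr2
        exact absurd hr2 (not_lt.mpr h2.le)
      have hsx := superShift_mem hz hθ hx.mem
      have hsb := body_superShift z hθ x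
      have hsb0 : body (superShift z θ x).1 ≠ 0 := by rw [hsb]; exact sub_ne_zero.mpr hbz
      have heq := hs.unique (hx.corr hz hθ ε)
      rw [corrSouth_eq_superShift hz hθ ε.2 hx.mem hbz] at heq
      have heq2 := congrArg (superShift (-capShiftEven z θ ε) (-capShiftOdd z θ ε)) heq
      rw [superShift_neg (capShiftOdd_mem hz hθ ε), superShift_neg (capShiftOdd_mem hz hθ ε)] at heq2
      have hcm := capCoord_mem ε.2 (inversion_mem hsx)
      have hcb : body (capCoord ε (inversion (superShift z θ x))).1 = (body x.1 - body z)⁻¹ := by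
        rw [body_capCoord ε.2, body_inversion hsx, hsb]
      have hcb0 : body (capCoord ε (inversion (superShift z θ x))).1 ≠ 0 := by
        rw [hcb]; exact inv_ne_zero (sub_ne_zero.mpr hbz)
      have hx'b : body x'.1 = body x.1 - body z := by
        rw [heq2, body_inversion hcm, hcb, inv_inv]
      rw [sub_zero, hx'b] at hxr
      refine ⟨superShift z θ x, (pants_coord_one hz hθ).mpr ⟨x, hx, hxr.trans hR.lt₁, rfl⟩,
        by rwa [hsb], by rwa [hsb], (cap_coord_zero ε).mpr
          ⟨capCoord ε (inversion (superShift z θ x)), ?_, ?_, ?_⟩⟩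
      · have hn := hx'.north (by rw [hx'b]; exact sub_ne_zero.mpr hbz)
        rwa [heq2, inversionInv_inversion hcm hcb0] at hn
      · rw [hcb, norm_inv]
        exact (inv_lt_inv₀ (h2.trans hr2) hR.pos).mpr (hR.lt₂.trans hr2)
      · rw [capCoord_capCoord ε.2 (inversion_mem hsx)]
    -- A point at infinity is sent to infinity by the correction map, whereas shifted points are
    -- finite.
    · have := (hs.transition (hy.corr hz hθ ε (by simp [hb]))).2.1
      rw [body_corrNorth ε.2] at this
      exact absurd hb this

/-! ## The sewn surface is a sphere -/

/-- The sewn surface as a sphere. -/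
def sewnMap (hR : AreRadii R R' r₁ r₂) :
    SewnCarrier (pants hz hθ R) 0 (cap ε R') r₁ r₂ → SSphere :=
  Quot.lift (Sum.elim (fun p => corrSphere hz hθ ε p.1) fun q => capShift hz hθ ε q.1) fun a b h => by
    rcases a with p | q <;> rcases b with p' | q'
    · exact h.elim
    · exact (sewnRel_iff hz hθ ε hR p q').mp h
    · exact h.elim
    · exact h.elim

/-- Within a piece the explicit inverses give injectivity, and across the pieces `sewnRel_iff` does.
Every point is reached because r₂ < r₁ makes the image regions overlap. -/
theorem sewnMap_bijective (hR : AreRadii R R' r₁ r₂) :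
    Function.Bijective (sewnMap hz hθ ε hR) := by
  have h2 : 0 < r₂ := hR.pos.trans hR.lt₂
  have hmem : ∀ p : sewnPart₁ (pants hz hθ R) 0 r₂, p.1 ∈ outside (body z) r₂ := fun p =>
    (pants_ball_iff hz hθ (hR.lt.trans hR.lt₁) p.1).mp p.2
  have hmem' : ∀ q : sewnPart₂ (cap ε R') r₁, q.1 ∈ inside 0 r₁ := fun q =>
    (cap_ball_iff ε hR.pos (hR.lt₂.trans hR.lt) q.1).mp q.2
  have hglue : ∀ p q, corrSphere hz hθ ε p.1 = capShift hz hθ ε q.1 →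
      Quot.mk (sewnRel (pants hz hθ R) 0 (cap ε R') r₁ r₂) (Sum.inl p) = Quot.mk _ (Sum.inr q) :=
    fun p q h => Quot.sound ((sewnRel_iff hz hθ ε hR p q).mpr h)
  constructor
  · rintro ⟨a⟩ ⟨b⟩ h
    rcases a with p | q <;> rcases b with p' | q'
    · refine congrArg _ (congrArg Sum.inl (Subtype.ext ?_))
      have := congrArg (corrSphere hz hθ (-ε)) h
      change corrSphere hz hθ (-ε) (corrSphere hz hθ ε p.1) =
        corrSphere hz hθ (-ε) (corrSphere hz hθ ε p'.1) at this
      rwa [corrSphere_neg hz hθ h2.le ε (hmem p), corrSphere_neg hz hθ h2.le ε (hmem p')] at this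
    · exact hglue p q' h
    · exact (hglue p' q h.symm).symm
    · refine congrArg _ (congrArg Sum.inr (Subtype.ext ?_))
      have := congrArg (capShiftInv hz hθ ε) h
      change capShiftInv hz hθ ε (capShift hz hθ ε q.1) =
        capShiftInv hz hθ ε (capShift hz hθ ε q'.1) at this
      rwa [capShiftInv_capShift hz hθ ε (hmem' q), capShiftInv_capShift hz hθ ε (hmem' q')] at this
  · intro p
    by_cases hp : p ∈ outside (body z) r₂
    · refine ⟨Quot.mk _ (Sum.inl ⟨corrSphere hz hθ (-ε) p,
        (pants_ball_iff hz hθ (hR.lt.trans hR.lt₁) _).mpr (corrSphere_mem_outside hz hθ _ hp)⟩), ?_⟩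
      have := corrSphere_neg hz hθ h2.le (-ε) hp
      rwa [neg_neg] at this
    · have hin : p ∈ inside (body z) r₁ := by
        simp only [outside, Set.mem_ofPred_eq, not_forall, not_lt] at hp
        obtain ⟨x, hx, hle⟩ := hp
        exact ⟨x, hx, hle.trans_lt hR.lt⟩
      exact ⟨Quot.mk _ (Sum.inr ⟨capShiftInv hz hθ ε p, (cap_ball_iff ε hR.pos
        (hR.lt₂.trans hR.lt) _).mpr (capShiftInv_mem_inside hz hθ ε hin)⟩),
        capShift_capShiftInv hz hθ ε hin⟩

/-- The sewn surface as a sphere. -/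
def sewnEquiv (hR : AreRadii R R' r₁ r₂) :
    SewnCarrier (pants hz hθ R) 0 (cap ε R') r₁ r₂ ≃ SSphere :=
  Equiv.ofBijective _ (sewnMap_bijective hz hθ ε hR)

theorem exists_inl_of_mem_outside (hR : AreRadii R R' r₁ r₂) {p : SSphere}
    (hp : p ∈ outside (body z) r₂) : ∃ p₁ : sewnPart₁ (pants hz hθ R) 0 r₂, p₁.1 = p :=
  ⟨⟨p, (pants_ball_iff hz hθ (hR.lt.trans hR.lt₁) p).mpr hp⟩, rfl⟩

theorem exists_inr_of_mem_inside (hR : AreRadii R R' r₁ r₂) {q : SSphere}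
    (hq : q ∈ inside 0 r₁) : ∃ q₁ : sewnPart₂ (cap ε R') r₁, q₁.1 = q :=
  ⟨⟨q, (cap_ball_iff ε hR.pos (hR.lt₂.trans hR.lt) q).mpr hq⟩, rfl⟩

theorem sewnEquiv_isSuperconformalMap (hR : AreRadii R R' r₁ r₂) :
    IsSuperconformalMap (sewn (pants hz hθ R) 0 (cap ε R') r r₁ r₂).toSuperSurface superSphere
      (sewnEquiv hz hθ ε hR) := by
  have h2 : 0 < r₂ := hR.pos.trans hR.lt₂
  rintro α (⟨c, hc, rfl⟩ | ⟨c, hc, rfl⟩) β hβ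
  · obtain ⟨h, h1, h3⟩ := isSuperconformalIn_corrSphere hz hθ h2.le ε hc hβ
    refine ⟨h, ?_, ?_⟩
    · convert h1 using 2
      ext x
      constructor
      · rintro ⟨_, y, ⟨p, rfl, hx⟩, hy⟩
        exact ⟨p.1, (pants_ball_iff hz hθ (hR.lt.trans hR.lt₁) p.1).mp p.2, y, hx, hy⟩
      · rintro ⟨p, hp, y, hx, hy⟩
        obtain ⟨p₁, rfl⟩ := exists_inl_of_mem_outside hz hθ hR hp
        exact ⟨_, y, ⟨p₁, rfl, hx⟩, hy⟩
    · rintro _ x y ⟨p, rfl, hx⟩ hy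
      exact h3 p.1 ((pants_ball_iff hz hθ (hR.lt.trans hR.lt₁) p.1).mp p.2) x y hx hy
  · obtain ⟨h, h1, h3⟩ := isSuperconformalIn_shiftSphere (capShiftEven_mem hz hθ ε)
      (capShiftOdd_mem hz hθ ε) (a := 0) (r := r₁) hc hβ
    refine ⟨h, ?_, ?_⟩
    · convert h1 using 2
      ext x
      constructor
      · rintro ⟨_, y, ⟨q, rfl, hx⟩, hy⟩
        exact ⟨q.1, (cap_ball_iff ε hR.pos (hR.lt₂.trans hR.lt) q.1).mp q.2, y, hx, hy⟩
      · rintro ⟨q, hq, y, hx, hy⟩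
        obtain ⟨q₁, rfl⟩ := exists_inr_of_mem_inside ε hR hq
        exact ⟨_, y, ⟨q₁, rfl, hx⟩, hy⟩
    · rintro _ x y ⟨q, rfl, hx⟩ hy
      exact h3 q.1 ((cap_ball_iff ε hR.pos (hR.lt₂.trans hR.lt) q.1).mp q.2) x y hx hy

theorem sewnEquiv_symm_isSuperconformalMap (hR : AreRadii R R' r₁ r₂) :
    IsSuperconformalMap superSphere (sewn (pants hz hθ R) 0 (cap ε R') r r₁ r₂).toSuperSurface
      (sewnEquiv hz hθ ε hR).symm := by
  have h2 : 0 < r₂ := hR.pos.trans hR.lt₂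
  have hpush₁ : ∀ c p y, pushChart₁ (pants hz hθ R) 0 (cap ε R') r₁ r₂ c
      ((sewnEquiv hz hθ ε hR).symm p) y ↔
      p ∈ outside (body z) r₂ ∧ c (corrSphere hz hθ (-ε) p) y := by
    intro c p y
    constructor
    · rintro ⟨p₁, hp₁, hy⟩
      have hm := (pants_ball_iff hz hθ (hR.lt.trans hR.lt₁) p₁.1).mp p₁.2
      obtain rfl : p = corrSphere hz hθ ε p₁.1 := (Equiv.symm_apply_eq _).mp hp₁
      exact ⟨corrSphere_mem_outside hz hθ ε hm, by rwa [corrSphere_neg hz hθ h2.le ε hm]⟩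
    · rintro ⟨hp, hy⟩
      obtain ⟨p₁, hp₁⟩ := exists_inl_of_mem_outside hz hθ hR (corrSphere_mem_outside hz hθ (-ε) hp)
      refine ⟨p₁, (Equiv.symm_apply_eq _).mpr ?_, by rwa [hp₁]⟩
      change p = corrSphere hz hθ ε p₁.1
      have := corrSphere_neg hz hθ h2.le (-ε) hp
      rw [neg_neg] at this
      rw [hp₁, this]
  have hpush₂ : ∀ c p y, pushChart₂ (pants hz hθ R) 0 (cap ε R') r₁ r₂ c
      ((sewnEquiv hz hθ ε hR).symm p) y ↔
      p ∈ inside (body z) r₁ ∧ c (capShiftInv hz hθ ε p) y := by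
    intro c p y
    constructor
    · rintro ⟨q₁, hq₁, hy⟩
      have hm := (cap_ball_iff ε hR.pos (hR.lt₂.trans hR.lt) q₁.1).mp q₁.2
      obtain rfl : p = capShift hz hθ ε q₁.1 := (Equiv.symm_apply_eq _).mp hq₁
      exact ⟨capShift_mem_inside hz hθ ε hm, by rwa [capShiftInv_capShift hz hθ ε hm]⟩
    · rintro ⟨hp, hy⟩
      obtain ⟨q₁, hq₁⟩ := exists_inr_of_mem_inside ε hR (capShiftInv_mem_inside hz hθ ε hp)
      refine ⟨q₁, (Equiv.symm_apply_eq _).mpr ?_, by rwa [hq₁]⟩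
      change p = capShift hz hθ ε q₁.1
      rw [hq₁, capShift_capShiftInv hz hθ ε hp]
  rintro α hα β (⟨c, hc, rfl⟩ | ⟨c, hc, rfl⟩)
  · obtain ⟨h, h1, h3⟩ := isSuperconformalIn_corrSphere hz hθ h2.le (-ε) hα hc
    refine ⟨h, ?_, fun p x y hx hy =>
      h3 p ((hpush₁ c p y).mp hy).1 x y hx ((hpush₁ c p y).mp hy).2⟩
    convert h1 using 2
    ext x
    exact ⟨fun ⟨p, y, hx, hy⟩ => ⟨p, ((hpush₁ c p y).mp hy).1, y, hx, ((hpush₁ c p y).mp hy).2⟩,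
      fun ⟨p, hp, y, hx, hy⟩ => ⟨p, y, hx, (hpush₁ c p y).mpr ⟨hp, hy⟩⟩⟩
  · obtain ⟨h, h1, h3⟩ := isSuperconformalIn_shiftSphere
      (gEven.neg_mem (capShiftEven_mem hz hθ ε)) (gOdd.neg_mem (capShiftOdd_mem hz hθ ε))
      (a := body z) (r := r₁) hα hc
    refine ⟨h, ?_, fun p x y hx hy =>
      h3 p ((hpush₂ c p y).mp hy).1 x y hx ((hpush₂ c p y).mp hy).2⟩
    convert h1 using 2
    ext x
    exact ⟨fun ⟨p, y, hx, hy⟩ => ⟨p, ((hpush₂ c p y).mp hy).1, y, hx, ((hpush₂ c p y).mp hy).2⟩,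
      fun ⟨p, hp, y, hx, hy⟩ => ⟨p, y, hx, (hpush₂ c p y).mpr ⟨hp, hy⟩⟩⟩

end sewing

end SuperSewing
end

noncomputable section
namespace SuperSewing
open Filter Topology

/-! ## Existence of the sewing -/

theorem two_mul_cen_half : 2 * cen (1 / 2) = 1 := by
  have : (2 : Cen) = cen 2 := (map_ofNat cen 2).symm
  rw [this, ← map_mul]
  norm_num

variable {z : GInfˣ} {θ : GInf} (hz : (z : GInf) ∈ gEven) (hθ : θ ∈ gOdd) (ε : gOdd)

/-- The transported coordinate at infinity is the inverse correction map followed by φ ↦ -φ. The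
closed form of the geometric data turns the claim into polynomial identities, coefficient by
coefficient. -/
theorem hasETildeValue_sewnPoint_infinity {x : SPt} (hx : x ∈ superspace)
    (hb : ‖body z * body x.1‖ < 1) :
    HasETildeValue (sewnPoint z θ hz hθ ε).A₀
      (fun j => -(Complex.I • (sewnPoint z θ hz hθ ε).M₀ j)) (x.1, -x.2)
      ((corrNorth z θ (-ε) x).1, -(corrNorth z θ (-ε) x).2) := by
  have hM : (fun j => -(Complex.I • (sewnPoint z θ hz hθ ε).M₀ j)) =
      geomM (ε * -(Complex.I • (z⁻¹ : GInfˣ) ^ 2)) z := by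
    funext j
    simp [sewnPoint, geomM]
  rw [hM]
  refine Eq.subst (motive := fun v => HasETildeValue _ _ (x.1, -x.2) v) ?_
    (hasETildeValue_geom (odd_mul_mul_self ε.2) ⟨2 * θ * (z⁻¹ : GInfˣ) ^ 3, rfl⟩ ⟨_, rfl⟩ hz
    hx.1 hb (-x.2))
  have hse : Ring.inverse (1 - z * x.1) ∈ gEven :=
    inverse_even (gEven.sub_mem one_mem_gEven (even_mul_even hz hx.1))
  obtain ⟨w, ρ⟩ := x
  dsimp only [corrNorth] at hse hb ⊢
  obtain ⟨S, hS⟩ := even_exists_smul hse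
  obtain ⟨y, hy⟩ := even_exists_smul (units_inv_even hz)
  obtain ⟨Z, hZ⟩ := even_exists_smul hz
  obtain ⟨W, hW⟩ := even_exists_smul hx.1
  have h1 : y * Z = 1 := cen_smul_one_eq (by rw [← hy, ← hZ, Units.inv_mul])
  dsimp only at hW
  rw [hS, hy, hZ, hW]
  simp only [pow_succ, pow_zero, two_mul, mul_add, mul_sub, mul_neg, neg_mul,
    mul_smul_comm, mul_one, smul_eq_cen (1 / 2), smul_eq_cen Complex.I,
    smul_eq_cen (-Complex.I), map_neg]
  refine Prod.ext ?_ ?_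
  · dsimp only
    match_scalars <;> ring
  · dsimp only
    match_scalars
    · ring
    · ring
    · linear_combination (1 - S ^ 2) * y ^ 3 * Z * two_mul_cen_half + (1 - S ^ 2) * y ^ 2 * h1

theorem hasETildeValue_sewnPoint_zero {x : SPt} (hx : x ∈ superspace)
    (hb : ‖body x.1‖ < ‖body z‖) :
    ∃ v, HasETildeValue ((sewnPoint z θ hz hθ ε).A 0) ((sewnPoint z θ hz hθ ε).M 0) x v ∧
      corrSouth z θ (-ε) x =
        ((sewnPoint z θ hz hθ ε).a 0 ^ 2 * v.1, (sewnPoint z θ hz hθ ε).a 0 * v.2) := by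
  have hzb := body_unit z
  have hzi := units_inv_even hz
  have hbi : body ((z⁻¹ : GInfˣ) : GInf) = (body z)⁻¹ := by
    rw [← Ring.inverse_unit, body_inverse hz]
  refine ⟨_, hasETildeValue_geom (odd_mul_mul_self ε.2) ⟨2 * θ * (z⁻¹ : GInfˣ), rfl⟩ ⟨_, rfl⟩
    hzi hx.1 (by
      rw [hbi, norm_mul, norm_inv, inv_mul_lt_one₀ (norm_pos_iff.mpr hzb)]
      exact hb) x.2, ?_⟩
  have hde := gEven.sub_mem hx.1 hz
  have hdb : body (x.1 - z) ≠ 0 := fun h => by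
    rw [body_sub, sub_eq_zero] at h
    rw [h] at hb
    exact lt_irrefl _ hb
  obtain ⟨w, ρ⟩ := x
  have hρ : ρ ∈ gOdd := hx.2
  dsimp only at hde hdb hb ⊢
  have hPe := inverse_even hde
  have hPd := inverse_mul hde hdb
  -- The sum of the geometric series at zero: 1/(1 - w/z) = -z/(w - z).
  have hs : Ring.inverse (1 - (z⁻¹ : GInfˣ) * w) = -(z * Ring.inverse (w - z)) := by
    have h2 : -(z * Ring.inverse (w - z)) * (1 - (z⁻¹ : GInfˣ) * w) = 1 := by
      have e1 : (1 : GInf) - (z⁻¹ : GInfˣ) * w = -((z⁻¹ : GInfˣ) * (w - z)) := by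
        rw [mul_sub, Units.inv_mul, neg_sub]
      rw [e1, neg_mul_neg, mul_assoc, even_left_comm hzi, hPd, mul_one, Units.mul_inv]
    refine inverse_eq ?_ h2
    rw [even_comm (gEven.sub_mem one_mem_gEven (even_mul_even hzi hx.1)), h2]
  rw [hs]
  dsimp only [corrSouth, sewnPoint]
  have b1 := odd_mul_self_assoc ε.2
  have c1 := odd_anticomm ρ ε hρ ε.2
  have c2 := odd_anticomm_assoc hρ ε.2
  have c3 := odd_anticomm θ ε hθ ε.2
  have c4 := odd_anticomm_assoc hθ ε.2
  have c5 := odd_anticomm θ ρ hθ hρ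
  have c6 := odd_anticomm_assoc hθ hρ
  generalize (ε : GInf) = e at *
  obtain ⟨P, hP⟩ := even_exists_smul hPe
  obtain ⟨y, hy⟩ := even_exists_smul hzi
  obtain ⟨Z, hZ⟩ := even_exists_smul hz
  obtain ⟨W, hW⟩ := even_exists_smul hx.1
  have h1 : y * Z = 1 := cen_smul_one_eq (by rw [← hy, ← hZ, Units.inv_mul])
  dsimp only at hW
  rw [hP, hy, hZ, hW]
  simp only [pow_succ, pow_zero, two_mul, mul_add, add_mul, mul_sub, mul_neg, neg_mul, smul_mul_assoc,
    mul_smul_comm, one_mul, mul_one, smul_eq_cen (1 / 2), mul_assoc, b1, c1, c2, c3, c4, c5, c6,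
    neg_zero, smul_zero, smul_neg, add_zero]
  refine Prod.ext ?_ ?_
  · dsimp only
    match_scalars
    · ring
    · linear_combination 2 * P * h1
    · linear_combination -P * h1
  · dsimp only
    match_scalars
    · ring
    · linear_combination P * h1
    · linear_combination (P ^ 2 * y ^ 2 * Z ^ 2 - y ^ 2) * two_mul_cen_half +
        P ^ 2 * (y * Z + 1) * h1

theorem sewnPoint_coord_zero {R : Fin 2 → ℝ} (hR : R 0 = ‖body z‖) {p : SSphere} {y : SPt} :
    ((sewnPoint z θ hz hθ ε).canonical R).coord 0 p y ↔ ∃ x, northChart p x ∧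
      ‖body x.1‖ < ‖body z‖⁻¹ ∧ y = ((corrNorth z θ (-ε) x).1, -(corrNorth z θ (-ε) x).2) := by
  have hz0 := norm_pos_iff.mpr (body_unit z)
  have h : ∀ x, northChart p x → ‖body x.1‖ < ‖body z‖⁻¹ → ‖body z * body x.1‖ < 1 :=
    fun x _ hx => by
      rw [norm_mul]
      calc _ < ‖body z‖ * ‖body z‖⁻¹ := by gcongr
        _ = 1 := mul_inv_cancel₀ hz0.ne'
  change coordAtInfinity _ _ (R 0) p y ↔ _
  rw [hR]
  constructor
  · rintro ⟨x, hx, hxb, hy⟩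
    exact ⟨x, hx, hxb, hy.unique (hasETildeValue_sewnPoint_infinity hz hθ ε hx.mem (h x hx hxb))⟩
  · rintro ⟨x, hx, hxb, rfl⟩
    exact ⟨x, hx, hxb, hasETildeValue_sewnPoint_infinity hz hθ ε hx.mem (h x hx hxb)⟩

theorem superShift_zero (x : SPt) : superShift 0 0 x = x := by simp [superShift]

theorem sewnPoint_coord_one {R : Fin 2 → ℝ} (hR : R 1 = ‖body z‖) {p : SSphere} {y : SPt} :
    ((sewnPoint z θ hz hθ ε).canonical R).coord 1 p y ↔ ∃ x, southChart p x ∧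
      ‖body x.1‖ < ‖body z‖ ∧ y = corrSouth z θ (-ε) x := by
  change coordAtPoint 0 0 _ _ _ (R 1) p y ↔ _
  rw [hR]
  simp only [coordAtPoint, superShift_zero, body_zero, sub_zero]
  constructor
  · rintro ⟨x, hx, hxb, v, hv, hy⟩
    obtain ⟨v', hv', h⟩ := hasETildeValue_sewnPoint_zero hz hθ ε hx.mem hxb
    obtain rfl := hv.unique hv'
    exact ⟨x, hx, hxb, hy.trans h.symm⟩
  · rintro ⟨x, hx, hxb, rfl⟩
    obtain ⟨v', hv', h⟩ := hasETildeValue_sewnPoint_zero hz hθ ε hx.mem hxb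
    exact ⟨x, hx, hxb, v', hv', h⟩

include hz hθ in
theorem corrNorth_injective {x x' : SPt} (hx : x ∈ superspace) (hx' : x' ∈ superspace)
    (hb : ‖body x.1‖ < ‖body z‖⁻¹) (hb' : ‖body x'.1‖ < ‖body z‖⁻¹)
    (h : corrNorth z θ (-ε) x = corrNorth z θ (-ε) x') : x = x' := by
  have hne : ∀ t : ℂ, ‖t‖ < ‖body z‖⁻¹ → body z * t ≠ 1 := fun t ht h => by
    have := congrArg norm h
    rw [norm_mul, norm_one] at this
    rw [eq_inv_of_mul_eq_one_right this] at ht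
    exact lt_irrefl _ ht
  have := congrArg (corrNorth z θ (- -ε)) h
  rwa [corrNorth_neg hz hθ (gOdd.neg_mem ε.2) hx (hne _ hb),
    corrNorth_neg hz hθ (gOdd.neg_mem ε.2) hx' (hne _ hb')] at this

include hz hθ in
theorem corrSouth_injective {x x' : SPt} (hx : x ∈ superspace) (hx' : x' ∈ superspace)
    (hb : body x.1 ≠ body z) (hb' : body x'.1 ≠ body z)
    (h : corrSouth z θ (-ε) x = corrSouth z θ (-ε) x') : x = x' := by
  have := congrArg (corrSouth z θ (- -ε)) h
  rwa [corrSouth_neg hz hθ (gOdd.neg_mem ε.2) hx hb,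
    corrSouth_neg hz hθ (gOdd.neg_mem ε.2) hx' hb'] at this

theorem ne_of_norm_lt {z t : ℂ} (h : ‖t‖ < ‖z‖) : t ≠ z := fun h' => by
  rw [h'] at h
  exact lt_irrefl _ h

/-- The discs reach up to the pole of the correction map: radius |z_B| about zero, and radius
1/|z_B| in the chart at infinity. On them the map is invertible, so the coordinates are one-to-one.
-/
theorem represents_sewnPoint : SK.Represents (n := 1) (sewnPoint z θ hz hθ ε)
    ((sewnPoint z θ hz hθ ε).canonical fun _ => ‖body z‖) := by
  have hz0 := norm_pos_iff.mpr (body_unit z)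
  refine ⟨fun _ => ‖body z‖, fun _ => hz0, ⟨?_, ?_⟩, fun k => ?_, rfl⟩
  · rintro p ⟨x, hx, hb⟩
    exact ⟨_, (sewnPoint_coord_zero (R := fun _ => ‖body z‖) hz hθ ε rfl).mpr ⟨x, hx, hb, rfl⟩⟩
  · intro p p' y h h'
    obtain ⟨x, hx, hb, rfl⟩ := (sewnPoint_coord_zero (R := fun _ => ‖body z‖) hz hθ ε rfl).mp h
    obtain ⟨x', hx', hb', heq⟩ := (sewnPoint_coord_zero (R := fun _ => ‖body z‖) hz hθ ε rfl).mp h'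
    obtain ⟨h1, h2⟩ := Prod.mk.inj heq
    obtain rfl := corrNorth_injective hz hθ ε hx.mem hx'.mem hb hb' (Prod.ext h1 (neg_injective h2))
    exact hx.point_unique hx'
  · obtain rfl : k = 0 := Subsingleton.elim (α := Fin 1) _ _
    refine ⟨?_, ?_⟩
    · rintro p ⟨x, hx, hb⟩
      change ‖body x.1 - body 0‖ < _ at hb
      rw [body_zero, sub_zero] at hb
      exact ⟨_, (sewnPoint_coord_one (R := fun _ => ‖body z‖) hz hθ ε rfl).mpr ⟨x, hx, hb, rfl⟩⟩
    · intro p p' y h h'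
      obtain ⟨x, hx, hb, rfl⟩ := (sewnPoint_coord_one (R := fun _ => ‖body z‖) hz hθ ε rfl).mp h
      obtain ⟨x', hx', hb', heq⟩ := (sewnPoint_coord_one (R := fun _ => ‖body z‖) hz hθ ε rfl).mp h'
      obtain rfl := corrSouth_injective hz hθ ε hx.mem hx'.mem (ne_of_norm_lt hb)
        (ne_of_norm_lt hb') heq
      exact hx.point_unique hx'

theorem represents_pants {R : Fin 3 → ℝ} (hR : ∀ k, 0 < R k) :
    SK.Represents (n := 2) (pantsSK z θ hz hθ) (pants hz hθ R) := by
  refine ⟨R, hR, ⟨?_, ?_⟩, fun k => ?_, rfl⟩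
  · rintro p ⟨x, hx, hb⟩
    exact ⟨_, (pants_coord_zero hz hθ (R := R)).mpr ⟨x, hx, hb, rfl⟩⟩
  · intro p p' y h h'
    obtain ⟨x, hx, hb, rfl⟩ := (pants_coord_zero hz hθ (R := R)).mp h
    obtain ⟨x', hx', hb', heq⟩ := (pants_coord_zero hz hθ (R := R)).mp h'
    obtain ⟨h1, h2⟩ := Prod.mk.inj heq
    obtain rfl : x = x' := Prod.ext h1 (neg_injective h2)
    exact hx.point_unique hx'
  · fin_cases k
    · refine ⟨?_, ?_⟩
      · rintro p ⟨x, hx, hb⟩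
        exact ⟨_, (pants_coord_one hz hθ (R := R)).mpr ⟨x, hx, hb, rfl⟩⟩
      · intro p p' y h h'
        obtain ⟨x, hx, hb, rfl⟩ := (pants_coord_one hz hθ (R := R)).mp h
        obtain ⟨x', hx', hb', heq⟩ := (pants_coord_one hz hθ (R := R)).mp h'
        have := congrArg (superShift (-(z : GInf)) (-θ)) heq
        rw [superShift_neg hθ, superShift_neg hθ] at this
        subst this
        exact hx.point_unique hx'
    · refine ⟨?_, ?_⟩
      · rintro p ⟨x, hx, hb⟩
        change ‖body x.1 - body 0‖ < _ at hb
        rw [body_zero, sub_zero] at hb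
        exact ⟨_, (pants_coord_two hz hθ (R := R)).mpr ⟨hx, hb⟩⟩
      · intro p p' y h h'
        exact ((pants_coord_two hz hθ (R := R)).mp h).1.point_unique
          ((pants_coord_two hz hθ (R := R)).mp h').1

theorem represents_cap {R' : ℝ} (hR' : 0 < R') :
    SK.Represents (n := 0) (tauSK ε) (cap ε R') := by
  refine ⟨R', hR', ⟨?_, ?_⟩, rfl⟩
  · rintro p ⟨x, hx, hb⟩
    exact ⟨_, (cap_coord_zero ε).mpr ⟨x, hx, hb, rfl⟩⟩
  · intro p p' y h h'
    obtain ⟨x, hx, hb, rfl⟩ := (cap_coord_zero (R' := R') ε).mp h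
    obtain ⟨x', hx', hb', heq⟩ := (cap_coord_zero (R' := R') ε).mp h'
    have := congrArg (capCoord ε) heq
    rw [capCoord_capCoord ε.2 hx.mem, capCoord_capCoord ε.2 hx'.mem] at this
    subst this
    exact hx.point_unique hx'

theorem sewn_coord_zero {m n : ℕ} (C₁ : TubedSurface (m + 1)) (C₂ : TubedSurface n) (r r₁ r₂ : ℝ)
    (s : SewnCarrier C₁ 0 C₂ r₁ r₂) (x : SPt) : (sewn C₁ 0 C₂ r r₁ r₂).coord 0 s x ↔
      ∃ p : sewnPart₁ C₁ 0 r₂, s = Quot.mk _ (Sum.inl p) ∧ C₁.coord 0 p.1 x ∧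
        ¬ ∃ x', C₁.coord 1 p.1 x' ∧ ‖body x'.1‖ ≤ r := by
  simp [sewn, pushChart₁]

/-- Puncture 1 of the first sphere is consumed and the cap contributes none, so number 1 on the sewn
surface is number 2 on the first sphere. -/
theorem sewn_coord_one (C₁ : TubedSurface 2) (C₂ : TubedSurface 0) (r r₁ r₂ : ℝ)
    (s : SewnCarrier C₁ 0 C₂ r₁ r₂) (x : SPt) : (sewn C₁ 0 C₂ r r₁ r₂).coord 1 s x ↔
      ∃ p : sewnPart₁ C₁ 0 r₂, s = Quot.mk _ (Sum.inl p) ∧ C₁.coord 2 p.1 x ∧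
        ¬ ∃ x', C₁.coord 1 p.1 x' ∧ ‖body x'.1‖ ≤ r :=
  Iff.rfl

theorem isTauSewing_sewnPoint : IsTauSewing z θ hz hθ ε (sewnPoint z θ hz hθ ε) := by
  have hz0 := norm_pos_iff.mpr (body_unit z)
  set ζ := ‖body z‖ with hζ
  -- The chain ζ/8 < ζ/4 < ζ/2 < 3ζ/4 < ζ serves as R' < r₂ < r < r₁ < R; the puncture 0, at
  -- distance ζ from z, stays outside the ball of radius r = ζ/2.
  have hR : AreRadii (fun _ => ζ) (ζ / 8) (3 * ζ / 4) (ζ / 4) :=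
    ⟨by positivity, by linarith, by linarith, by linarith⟩
  refine ⟨pants hz hθ fun _ => ζ, cap ε (ζ / 8), (sewnPoint z θ hz hθ ε).canonical fun _ => ζ,
    represents_pants hz hθ fun _ => hz0, represents_cap ε (by positivity),
    represents_sewnPoint hz hθ ε, ζ / 2, 3 * ζ / 4, ζ / 4,
    ⟨by positivity, by linarith, by linarith, fun x hx hb => ?_, fun y hy hb => ?_,
      fun k hk p hp => ?_, fun k hk => absurd (Subsingleton.elim (α := Fin 1) k 0) hk⟩,
    sewnEquiv hz hθ ε hR, sewnEquiv_isSuperconformalMap hz hθ ε hR,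
    sewnEquiv_symm_isSuperconformalMap hz hθ ε hR, fun k => ?_⟩
  · obtain ⟨p, hp⟩ := exists_southChart (superShift_mem (gEven.neg_mem hz) (gOdd.neg_mem hθ) hx)
    refine ⟨p, (pants_coord_one hz hθ).mpr ⟨_, hp, ?_, ?_⟩⟩
    · rw [body_superShift _ (gOdd.neg_mem hθ), body_neg, sub_neg_eq_add, add_sub_cancel_right]
      linarith
    · have := superShift_neg (c := -(z : GInf)) (gOdd.neg_mem hθ) x
      rw [neg_neg, neg_neg] at this
      exact this.symm
  · obtain ⟨q, hq⟩ := exists_northChart (capCoord_mem ε.2 hy)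
    refine ⟨q, (cap_coord_zero ε).mpr ⟨_, hq, ?_, (capCoord_capCoord ε.2 hy).symm⟩⟩
    rw [body_capCoord ε.2]
    exact hb.trans_lt ((inv_lt_inv₀ (by positivity) (by positivity)).mpr (by linarith))
  · rintro ⟨x, hx, hb⟩
    obtain ⟨x, hx', -, rfl⟩ := (pants_coord_one hz hθ).mp hx
    fin_cases k
    · obtain ⟨y, hy, -, heq⟩ := (pants_coord_zero hz hθ).mp hp
      refine (hx'.transition hy).2.1 ?_
      rw [← (Prod.mk.inj heq).1, body_zero]
    · exact hk rfl
    · obtain ⟨hp', -⟩ := (pants_coord_two hz hθ).mp hp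
      obtain rfl := hx'.unique hp'
      rw [body_superShift _ hθ, body_zero, zero_sub, norm_neg] at hb
      linarith
  · have hout : ∀ p x, southChart p x → ζ / 2 < ‖body x.1 - body z‖ →
        p ∈ outside (body z) (ζ / 2) := fun p x h => h.mem_outside_iff.mpr
    obtain rfl | rfl : k = 0 ∨ k = 1 := by fin_cases k <;> simp
    -- For |x| < 1/(2ζ) one has |zx| < 1/2, which keeps the point outside the ball of radius ζ/2
    -- about z and away from the pole.
    · refine ⟨(2 * ζ)⁻¹, by positivity, fun x hx hb => ?_⟩
      have hx' : (x.1, -x.2) ∈ superspace := ⟨hx.1, gOdd.neg_mem hx.2⟩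
      obtain ⟨p, hp⟩ := exists_northChart hx'
      have hlt : (2 * ζ)⁻¹ < ζ⁻¹ := (inv_lt_inv₀ (by positivity) hz0).mpr (by linarith)
      have hxz : ‖body z * body x.1‖ < 1 / 2 := by
        rw [norm_mul]
        calc _ < ζ * (2 * ζ)⁻¹ := by gcongr
          _ = 1 / 2 := by field_simp
      have hpo : p ∈ outside (body z) (ζ / 2) := by
        rw [hp.mem_outside_iff]
        have h1 : ζ / 2 * ‖body x.1‖ < 1 / 2 := by
          rw [norm_mul] at hxz
          nlinarith [norm_nonneg (body x.1)]
        have h2 := norm_sub_norm_le 1 (body z * body x.1)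
        rw [norm_one] at h2
        dsimp only
        linarith
      have hpo' : p ∈ outside (body z) (ζ / 4) := fun y hy => by
        have := hpo y hy
        linarith
      obtain ⟨p₁, rfl⟩ := exists_inl_of_mem_outside hz hθ hR hpo'
      refine ⟨_, (sewn_coord_zero _ _ _ _ _ _ _).mpr ⟨p₁, rfl, (pants_coord_zero hz hθ).mpr
        ⟨_, hp, hb.trans hlt, ?_⟩, (pants_ball_iff hz hθ (by linarith) _).mpr hpo⟩,
        (sewnPoint_coord_zero hz hθ ε rfl).mpr ⟨_, hp.corr hz hθ ε ?_, ?_, ?_⟩⟩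
      · simp
      · intro h
        dsimp only at h
        rw [h, norm_one] at hxz
        linarith
      · rw [body_corrNorth ε.2]
        exact hb.trans hlt
      · rw [corrNorth_neg hz hθ ε.2 hx']
        · simp
        · intro h
          dsimp only at h
          rw [h, norm_one] at hxz
          linarith
    -- If |w| < ζ/2, then |w - z| > ζ/2 by the triangle inequality.
    · refine ⟨ζ / 2, by positivity, fun x hx hb => ?_⟩
      obtain ⟨p, hp⟩ := exists_southChart hx
      have hpo : p ∈ outside (body z) (ζ / 2) := by
        rw [hp.mem_outside_iff]
        have h2 := norm_sub_norm_le (body z) (body x.1)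
        rw [norm_sub_rev] at h2
        linarith
      have hpo' : p ∈ outside (body z) (ζ / 4) := fun y hy => by
        have := hpo y hy
        linarith
      obtain ⟨p₁, rfl⟩ := exists_inl_of_mem_outside hz hθ hR hpo'
      refine ⟨_, (sewn_coord_one _ _ _ _ _ _ _).mpr ⟨p₁, rfl, (pants_coord_two hz hθ).mpr
        ⟨hp, by linarith⟩, (pants_ball_iff hz hθ (by linarith) _).mpr hpo⟩,
        (sewnPoint_coord_one hz hθ ε rfl).mpr ⟨_, hp.corr hz hθ ε, ?_, ?_⟩⟩
      · rw [body_corrSouth ε.2]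
        linarith
      · rw [corrSouth_neg hz hθ ε.2 hx (ne_of_norm_lt (by linarith))]

end SuperSewing
end

noncomputable section
namespace SuperSewing
open Filter Topology

/-! ## Local coordinates determine their data -/

/-- `superDer` in terms of the power series `α`, `μ`. -/
def seriesDer (α μ : PowerSeries GInf) (u : PowerSeries GInf × PowerSeries GInf) :
    PowerSeries GInf × PowerSeries GInf :=
  (α * dX u.1 + μ * u.2, α * dX u.2 + (1 / 2 : ℂ) • (dX α * u.2) + μ * dX u.1)

theorem dX_sub (p q : PowerSeries GInf) : dX (p - q) = dX p - dX q := by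
  ext k
  simp [dX, smul_sub]

/-- Bilinearity in the coefficients and the argument; it allows iterates of two derivations to be
compared one factor at a time. -/
theorem seriesDer_sub (α μ α' μ' : PowerSeries GInf) (u u' : PowerSeries GInf × PowerSeries GInf) :
    seriesDer α μ u - seriesDer α' μ' u' =
      seriesDer α μ (u - u') + seriesDer (α - α') (μ - μ') u' := by
  simp only [seriesDer, Prod.fst_sub, Prod.snd_sub, dX_sub, mul_sub, sub_mul, smul_sub]
  refine Prod.ext ?_ ?_
  · simp only [Prod.fst_sub, Prod.fst_add]
    abel
  · simp only [Prod.snd_sub, Prod.snd_add]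
    abel

/-- `p + φ q` has order at least `n`, where `x^d` has order `2d` and `φ x^d` has order `2d + 1`. -/
def HasOrder (n : ℕ) (u : PowerSeries GInf × PowerSeries GInf) : Prop :=
  ∀ d, (2 * d < n → PowerSeries.coeff d u.1 = 0) ∧ (2 * d + 1 < n → PowerSeries.coeff d u.2 = 0)

theorem HasOrder.mono {m n : ℕ} {u : PowerSeries GInf × PowerSeries GInf} (h : HasOrder n u)
    (hmn : m ≤ n) : HasOrder m u :=
  fun d => ⟨fun hd => (h d).1 (by omega), fun hd => (h d).2 (by omega)⟩

theorem HasOrder.add {n : ℕ} {u v : PowerSeries GInf × PowerSeries GInf} (h : HasOrder n u)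
    (h' : HasOrder n v) : HasOrder n (u + v) := fun d =>
  ⟨fun hd => by rw [Prod.fst_add, map_add, (h d).1 hd, (h' d).1 hd, add_zero],
    fun hd => by rw [Prod.snd_add, map_add, (h d).2 hd, (h' d).2 hd, add_zero]⟩

theorem coeff_mul_eq_zero {p q : PowerSeries GInf} {d : ℕ} (h : ∀ i j, i + j = d →
    PowerSeries.coeff i p = 0 ∨ PowerSeries.coeff j q = 0) : PowerSeries.coeff d (p * q) = 0 := by
  rw [PowerSeries.coeff_mul]
  refine Finset.sum_eq_zero fun ij hij => ?_
  rcases h _ _ (Finset.HasAntidiagonal.mem_antidiagonal.mp hij) with h | h <;> simp [h]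

theorem coeff_dX_eq_zero {p : PowerSeries GInf} {d : ℕ} (h : PowerSeries.coeff (d + 1) p = 0) :
    PowerSeries.coeff d (dX p) = 0 := by rw [dX, PowerSeries.coeff_mk, h, smul_zero]

/-- In this grading L_j raises the order by 2j and G_{j-1/2} by 2j - 1, so coefficients vanishing up
to weight k give a derivation raising the order by at least k. -/
theorem HasOrder.seriesDer {n k : ℕ} {α μ : PowerSeries GInf}
    {u : PowerSeries GInf × PowerSeries GInf}
    (hα : ∀ d, 2 * d < k + 2 → PowerSeries.coeff d α = 0)
    (hμ : ∀ d, 2 * d < k + 1 → PowerSeries.coeff d μ = 0) (h : HasOrder n u) :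
    HasOrder (n + k) (seriesDer α μ u) := by
  refine fun d => ⟨fun hd => ?_, fun hd => ?_⟩
  · simp only [SuperSewing.seriesDer, map_add]
    rw [coeff_mul_eq_zero fun i j hij => ?_, coeff_mul_eq_zero fun i j hij => ?_, add_zero]
    · by_cases hi : 2 * i < k + 1
      · exact Or.inl (hμ i hi)
      · exact Or.inr ((h j).2 (by omega))
    · by_cases hi : 2 * i < k + 2
      · exact Or.inl (hα i hi)
      · exact Or.inr (coeff_dX_eq_zero ((h (j + 1)).1 (by omega)))
  · simp only [SuperSewing.seriesDer, map_add, PowerSeries.coeff_smul]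
    rw [coeff_mul_eq_zero fun i j hij => ?_, coeff_mul_eq_zero fun i j hij => ?_,
      coeff_mul_eq_zero fun i j hij => ?_, smul_zero, add_zero, add_zero]
    · by_cases hi : 2 * i < k + 1
      · exact Or.inl (hμ i hi)
      · exact Or.inr (coeff_dX_eq_zero ((h (j + 1)).1 (by omega)))
    · by_cases hi : 2 * (i + 1) < k + 2
      · exact Or.inl (coeff_dX_eq_zero (hα _ hi))
      · exact Or.inr ((h j).2 (by omega))
    · by_cases hi : 2 * i < k + 2
      · exact Or.inl (hα i hi)
      · exact Or.inr (coeff_dX_eq_zero ((h (j + 1)).2 (by omega)))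

theorem coeff_alphaSeries (A : ℕ+ → GInf) (j : ℕ+) :
    PowerSeries.coeff (j + 1 : ℕ) (alphaSeries A) = A j := by
  have hj := j.pos
  rw [alphaSeries, PowerSeries.coeff_mk, dif_pos (by omega)]
  congr 1

theorem coeff_alphaSeries_of_lt (A : ℕ+ → GInf) {d : ℕ} (hd : d < 2) :
    PowerSeries.coeff d (alphaSeries A) = 0 := by
  rw [alphaSeries, PowerSeries.coeff_mk, dif_neg (by omega)]

theorem coeff_muSeries (M : ℕ+ → GInf) (j : ℕ+) : PowerSeries.coeff (j : ℕ) (muSeries M) = M j := by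
  rw [muSeries, PowerSeries.coeff_mk, dif_pos j.pos]
  congr 1

theorem coeff_muSeries_zero (M : ℕ+ → GInf) : PowerSeries.coeff 0 (muSeries M) = 0 := by
  rw [muSeries, PowerSeries.coeff_mk, dif_neg (by omega)]

section

variable {A M A' M' : ℕ+ → GInf} {n : ℕ} {u : PowerSeries GInf × PowerSeries GInf}

theorem HasOrder.superDer (h : HasOrder n u) : HasOrder (n + 1) (superDer A M u) :=
  HasOrder.seriesDer (fun d hd => coeff_alphaSeries_of_lt A (by omega)) (fun d hd => by
    obtain rfl : d = 0 := by omega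
    exact coeff_muSeries_zero M) h

theorem HasOrder.superDer_iterate (h : HasOrder n u) (k : ℕ) :
    HasOrder (n + k) ((SuperSewing.superDer A M)^[k] u) := by
  induction k with
  | zero => exact h
  | succ k ih =>
    rw [Function.iterate_succ_apply']
    exact ih.superDer

/-- In each term of the telescoped difference one factor is the difference of the derivations,
raising the order by K, and each of the other k factors raises it by at least 1. -/
theorem HasOrder.superDer_iterate_sub {K : ℕ} (h : HasOrder n u)
    (hα : ∀ d, 2 * d < K + 2 → PowerSeries.coeff d (alphaSeries A - alphaSeries A') = 0)
    (hμ : ∀ d, 2 * d < K + 1 → PowerSeries.coeff d (muSeries M - muSeries M') = 0) (k : ℕ) :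
    HasOrder (n + k + K) ((SuperSewing.superDer A M)^[k + 1] u -
      (SuperSewing.superDer A' M')^[k + 1] u) := by
  have hsub : ∀ v v', SuperSewing.superDer A M v - SuperSewing.superDer A' M' v' =
      SuperSewing.superDer A M (v - v') + SuperSewing.seriesDer (alphaSeries A - alphaSeries A')
        (muSeries M - muSeries M') v' := fun v v' => seriesDer_sub _ _ _ _ _ _
  induction k with
  | zero =>
    rw [Function.iterate_one, Function.iterate_one, hsub, sub_self, superDer_zero, zero_add]
    exact HasOrder.seriesDer hα hμ h
  | succ k ih =>
    rw [Function.iterate_succ_apply', Function.iterate_succ_apply' _ (k + 1), hsub]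
    refine (ih.superDer.mono (by omega)).add ?_
    exact HasOrder.seriesDer hα hμ (h.superDer_iterate (k + 1))

/-- Isolates the linear term of an exponential series when the constant term and all higher terms
are known to agree. -/
theorem finsum_eq_of_two_le {f f' : ℕ → GInf} {N : ℕ} (hf : ∀ k, N ≤ k → f k = 0)
    (hf' : ∀ k, N ≤ k → f' k = 0) (h0 : f 0 = f' 0) (h : ∀ k, f (k + 2) = f' (k + 2))
    (hs : ∑ᶠ k, f k = ∑ᶠ k, f' k) : f 1 = f' 1 := by
  have hfin : ∀ g : ℕ → GInf, (∀ k, N ≤ k → g k = 0) → (Function.support g).Finite := fun g hg =>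
    (Set.finite_lt_nat N).subset fun k hk => by
      by_contra hlt
      exact hk (hg k (not_lt.mp hlt))
  have h1 := finsum_sub_distrib (hfin f hf) (hfin f' hf')
  rw [hs, sub_self, finsum_eq_single _ 1 fun k hk => ?_] at h1
  · exact sub_eq_zero.mp h1
  · rcases k with _ | _ | k
    · rw [h0, sub_self]
    · exact absurd rfl hk
    · rw [h, sub_self]

theorem coeff_superDer_fst_eq {K d : ℕ} (h : HasOrder n u)
    (hα : ∀ d, 2 * d < K + 2 → PowerSeries.coeff d (alphaSeries A - alphaSeries A') = 0)
    (hμ : ∀ d, 2 * d < K + 1 → PowerSeries.coeff d (muSeries M - muSeries M') = 0)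
    (hd : 2 * d ≤ n + K)
    (he : PowerSeries.coeff d (expSuperDer A M u).1 = PowerSeries.coeff d (expSuperDer A' M' u).1) :
    PowerSeries.coeff d (superDer A M u).1 = PowerSeries.coeff d (superDer A' M' u).1 := by
  simp only [expSuperDer, PowerSeries.coeff_mk] at he
  have := finsum_eq_of_two_le (N := 2 * d + 1)
    (f := fun k => ((Nat.factorial k : ℂ)⁻¹) • PowerSeries.coeff d ((superDer A M)^[k] u).1)
    (f' := fun k => ((Nat.factorial k : ℂ)⁻¹) • PowerSeries.coeff d ((superDer A' M')^[k] u).1)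
    (fun k hk => by rw [((h.superDer_iterate k) d).1 (by omega), smul_zero])
    (fun k hk => by rw [((h.superDer_iterate k) d).1 (by omega), smul_zero]) rfl
    (fun k => by
      have := ((h.superDer_iterate_sub hα hμ (k + 1)) d).1 (by omega)
      rw [Prod.fst_sub, map_sub, sub_eq_zero] at this
      rw [this]) he
  simpa using this

theorem coeff_superDer_snd_eq {K d : ℕ} (h : HasOrder n u)
    (hα : ∀ d, 2 * d < K + 2 → PowerSeries.coeff d (alphaSeries A - alphaSeries A') = 0)
    (hμ : ∀ d, 2 * d < K + 1 → PowerSeries.coeff d (muSeries M - muSeries M') = 0)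
    (hd : 2 * d + 1 ≤ n + K)
    (he : PowerSeries.coeff d (expSuperDer A M u).2 = PowerSeries.coeff d (expSuperDer A' M' u).2) :
    PowerSeries.coeff d (superDer A M u).2 = PowerSeries.coeff d (superDer A' M' u).2 := by
  simp only [expSuperDer, PowerSeries.coeff_mk] at he
  have := finsum_eq_of_two_le (N := 2 * d + 2)
    (f := fun k => ((Nat.factorial k : ℂ)⁻¹) • PowerSeries.coeff d ((superDer A M)^[k] u).2)
    (f' := fun k => ((Nat.factorial k : ℂ)⁻¹) • PowerSeries.coeff d ((superDer A' M')^[k] u).2)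
    (fun k hk => by rw [((h.superDer_iterate k) d).2 (by omega), smul_zero])
    (fun k hk => by rw [((h.superDer_iterate k) d).2 (by omega), smul_zero]) rfl
    (fun k => by
      have := ((h.superDer_iterate_sub hα hμ (k + 1)) d).2 (by omega)
      rw [Prod.snd_sub, map_sub, sub_eq_zero] at this
      rw [this]) he
  simpa using this

theorem coeff_expSuperDer_fst (h : HasOrder n u) {d : ℕ} (hd : 2 * d ≤ n) :
    PowerSeries.coeff d (expSuperDer A M u).1 = PowerSeries.coeff d u.1 := by
  rw [expSuperDer, PowerSeries.coeff_mk, finsum_eq_single _ 0 fun k hk => ?_]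
  · simp
  · rw [((h.superDer_iterate k) d).1 (by omega), smul_zero]

theorem coeff_expSuperDer_snd (h : HasOrder n u) {d : ℕ} (hd : 2 * d + 1 ≤ n) :
    PowerSeries.coeff d (expSuperDer A M u).2 = PowerSeries.coeff d u.2 := by
  rw [expSuperDer, PowerSeries.coeff_mk, finsum_eq_single _ 0 fun k hk => ?_]
  · simp
  · rw [((h.superDer_iterate k) d).2 (by omega), smul_zero]

end

theorem hasOrder_odd : HasOrder 1 ((0, 1) : PowerSeries GInf × PowerSeries GInf) :=
  fun d => ⟨fun _ => map_zero _, fun hd => by omega⟩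

theorem hasOrder_even : HasOrder 2 ((PowerSeries.X, 0) : PowerSeries GInf × PowerSeries GInf) :=
  fun d => ⟨fun hd => by
    obtain rfl : d = 0 := by omega
    exact PowerSeries.coeff_zero_X, fun _ => map_zero _⟩

theorem coeff_eTildeOdd_fst (A M : ℕ+ → GInf) : PowerSeries.coeff 0 (eTildeOdd A M).1 = 0 :=
  (coeff_expSuperDer_fst hasOrder_odd (by omega)).trans (map_zero _)

theorem coeff_eTildeOdd_snd (A M : ℕ+ → GInf) : PowerSeries.coeff 0 (eTildeOdd A M).2 = 1 :=
  (coeff_expSuperDer_snd hasOrder_odd (by omega)).trans PowerSeries.coeff_zero_one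

theorem coeff_zero_eTildeEven_fst (A M : ℕ+ → GInf) : PowerSeries.coeff 0 (eTildeEven A M).1 = 0 :=
  (coeff_expSuperDer_fst hasOrder_even (by omega)).trans PowerSeries.coeff_zero_X

theorem coeff_one_eTildeEven_fst (A M : ℕ+ → GInf) : PowerSeries.coeff 1 (eTildeEven A M).1 = 1 :=
  (coeff_expSuperDer_fst hasOrder_even (by omega)).trans PowerSeries.coeff_one_X

theorem coeff_eTildeEven_snd (A M : ℕ+ → GInf) : PowerSeries.coeff 0 (eTildeEven A M).2 = 0 :=
  (coeff_expSuperDer_snd hasOrder_even (by omega)).trans (map_zero _)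

/-- Induction in the order M_{1/2}, A_1, M_{3/2}, A_2, …: once the data of lower weight agree, the
next one enters the corresponding coefficient of exp(T)·φ only through the linear term T φ = μ +
φα'/2. -/
theorem eq_of_eTildeOdd_eq {A M A' M' : ℕ+ → GInf} (h : eTildeOdd A M = eTildeOdd A' M') :
    A = A' ∧ M = M' := by
  have hT : ∀ A M : ℕ+ → GInf, superDer A M (0, 1) =
      (muSeries M, (1 / 2 : ℂ) • dX (alphaSeries A)) := fun A M => by
    simp [superDer, dX_zero, dX_one]
  have key : ∀ j : ℕ+, A j = A' j ∧ M j = M' j := by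
    intro j
    induction j using PNat.strongInductionOn with
    | _ j ih =>
      have hα : ∀ d, d ≤ (j : ℕ) → PowerSeries.coeff d (alphaSeries A - alphaSeries A') = 0 := by
        intro d hd
        rw [map_sub]
        by_cases hd2 : d < 2
        · rw [coeff_alphaSeries_of_lt _ hd2, coeff_alphaSeries_of_lt _ hd2, sub_zero]
        · obtain ⟨i, rfl⟩ : ∃ i : ℕ+, (i : ℕ) + 1 = d := ⟨⟨d - 1, by omega⟩, by simp; omega⟩
          rw [coeff_alphaSeries, coeff_alphaSeries, (ih i (by
            rw [← PNat.coe_lt_coe]; omega)).1, sub_self]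
      have hμ : ∀ d, d < (j : ℕ) → PowerSeries.coeff d (muSeries M - muSeries M') = 0 := by
        intro d hd
        rw [map_sub]
        rcases Nat.eq_zero_or_pos d with rfl | hd0
        · rw [coeff_muSeries_zero, coeff_muSeries_zero, sub_zero]
        · obtain ⟨i, rfl⟩ : ∃ i : ℕ+, (i : ℕ) = d := ⟨⟨d, hd0⟩, rfl⟩
          rw [coeff_muSeries, coeff_muSeries, (ih i (by
            rw [← PNat.coe_lt_coe]; omega)).2, sub_self]
      have hj := j.pos
      have hM : M j = M' j := by
        -- K is the weight of G_{j-1/2}; all data of smaller weight are known to agree.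
        have := coeff_superDer_fst_eq (K := 2 * j - 1) (d := j) hasOrder_odd
          (fun d hd => hα d (by omega)) (fun d hd => hμ d (by omega)) (by omega)
          (congrArg (PowerSeries.coeff (j : ℕ)) (congrArg Prod.fst h))
        rwa [hT, hT, coeff_muSeries, coeff_muSeries] at this
      refine ⟨?_, hM⟩
      -- K is the weight of L_j; the agreement of M_{j-1/2} just obtained is needed.
      have := coeff_superDer_snd_eq (K := 2 * j) (d := j) (M := M) (M' := M') hasOrder_odd
        (fun d hd => hα d (by omega)) (fun d hd => by
          rcases lt_or_eq_of_le (show d ≤ (j : ℕ) by omega) with hlt | rfl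
          · exact hμ d hlt
          · rw [map_sub, coeff_muSeries, coeff_muSeries, hM, sub_self]) (by omega)
        (congrArg (PowerSeries.coeff (j : ℕ)) (congrArg Prod.snd h))
      rw [hT, hT] at this
      simp only [PowerSeries.coeff_smul, dX, PowerSeries.coeff_mk, smul_smul] at this
      rw [coeff_alphaSeries, coeff_alphaSeries] at this
      refine smul_right_injective GInf (mul_ne_zero (by norm_num) ?_) this
      exact Nat.cast_ne_zero.mpr (Nat.succ_ne_zero _)
  exact ⟨funext fun j => (key j).1, funext fun j => (key j).2⟩

/-- Nothing is assumed at t = 0. With the value d 0 put there, the series represents the function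
near 0; continuity forces d 0 = 0, and the power series of the zero function vanishes. -/
theorem eq_zero_of_hasSum_zero {d : ℕ → ℂ} {s : ℝ} (hs : 0 < s)
    (h : ∀ t : ℂ, t ≠ 0 → ‖t‖ < s → HasSum (fun k => t ^ k * d k) 0) : d = 0 := by
  classical
  let f : ℂ → ℂ := fun t => if t = 0 then d 0 else 0
  have hp : HasFPowerSeriesAt f (FormalMultilinearSeries.ofScalars ℂ d) 0 := by
    rw [hasFPowerSeriesAt_iff]
    filter_upwards [Metric.ball_mem_nhds (0 : ℂ) hs] with t ht
    rw [mem_ball_zero_iff] at ht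
    simp only [FormalMultilinearSeries.coeff_ofScalars, zero_add, smul_eq_mul]
    by_cases h0 : t = 0
    · subst h0
      have h1 := hasSum_single (f := fun n => (0 : ℂ) ^ n * d n) 0 fun n hn => by simp [hn]
      simpa [f] using h1
    · simp only [f, if_neg h0]
      exact h t h0 ht
  have hc := hp.analyticAt.continuousAt
  have h0 : d 0 = 0 := by
    have h1 : Tendsto f (𝓝[≠] 0) (𝓝 (f 0)) := hc.tendsto.mono_left nhdsWithin_le_nhds
    have h2 : Tendsto f (𝓝[≠] 0) (𝓝 0) := by
      refine tendsto_const_nhds.congr' ?_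
      filter_upwards [self_mem_nhdsWithin] with t ht
      exact (if_neg ht).symm
    have := tendsto_nhds_unique h1 h2
    simpa [f] using this
  have hf : f = 0 := by
    funext t
    simp [f, h0]
  rw [hf] at hp
  have := hp.eq_zero
  funext n
  have h3 := congrArg (fun p => FormalMultilinearSeries.coeff p n) this
  rw [FormalMultilinearSeries.coeff_ofScalars] at h3
  exact h3

theorem series_eq_of_values {p q : PowerSeries GInf} {s : ℝ} (hs : 0 < s)
    (h : ∀ t : ℂ, t ≠ 0 → ‖t‖ < s → ∃ S, HasSeriesValue p (algebraMap ℂ GInf t) S ∧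
      HasSeriesValue q (algebraMap ℂ GInf t) S) : p = q := by
  ext k
  refine eq_of_forall_dual fun l => ?_
  have := eq_zero_of_hasSum_zero (d := fun k => l (PowerSeries.coeff k p) - l (PowerSeries.coeff k q))
    hs fun t h0 ht => by
      obtain ⟨S, h1, h2⟩ := h t h0 ht
      have h4 : ∀ (x : GInf) (k : ℕ), x * algebraMap ℂ GInf t ^ k = t ^ k • x := fun x k => by
        rw [← map_pow, ← Algebra.commutes, Algebra.smul_def]
      have h5 : ∀ p : PowerSeries GInf, (fun k => l (PowerSeries.coeff k p * algebraMap ℂ GInf t ^ k)) =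
          fun k => t ^ k * l (PowerSeries.coeff k p) := fun p => by
        funext k
        rw [h4, map_smul, smul_eq_mul]
      have h3 := ((h5 p) ▸ h1 l).sub ((h5 q) ▸ h2 l)
      rw [sub_self] at h3
      simpa only [mul_sub] using h3
  exact sub_eq_zero.mp (congrFun this k)

/-- The odd part of a local coordinate determines the data. -/
theorem data_eq_of_values {a a' : GInf} (ha : a ∈ gEven) (ha' : a' ∈ gEven) (hb : body a ≠ 0)
    {A M A' M' : ℕ+ → GInf} {s : ℝ} (hs : 0 < s)
    (h : ∀ t : ℂ, t ≠ 0 → ‖t‖ < s → ∀ φ ∈ gOdd, ∃ v v',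
      HasETildeValue A M (algebraMap ℂ GInf t, φ) v ∧
      HasETildeValue A' M' (algebraMap ℂ GInf t, φ) v' ∧ a * v.2 = a' * v'.2) :
    a = a' ∧ A = A' ∧ M = M' := by
  have key : ∀ t : ℂ, t ≠ 0 → ‖t‖ < s →
      (∃ S, HasSeriesValue (PowerSeries.C a * (eTildeOdd A M).1) (algebraMap ℂ GInf t) S ∧
        HasSeriesValue (PowerSeries.C a' * (eTildeOdd A' M').1) (algebraMap ℂ GInf t) S) ∧
      ∃ S, HasSeriesValue (PowerSeries.C a * (eTildeOdd A M).2) (algebraMap ℂ GInf t) S ∧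
        HasSeriesValue (PowerSeries.C a' * (eTildeOdd A' M').2) (algebraMap ℂ GInf t) S := by
    intro t h0 ht
    obtain ⟨_, _, ⟨_, _, ψ, g, -, -, hψ, hg, rfl⟩, ⟨_, _, ψ', g', -, -, hψ', hg', rfl⟩, h1⟩ :=
      h t h0 ht 0 gOdd.zero_mem
    simp only [zero_mul, add_zero] at h1
    -- The series values ψ and g do not depend on φ, so letting φ run through all odd elements
    -- separates them.
    have h2 : a * g = a' * g' := by
      refine eq_of_odd_mul fun φ hφ => ?_
      obtain ⟨_, _, ⟨_, _, ψ₂, g₂, -, -, hψ₂, hg₂, rfl⟩, ⟨_, _, ψ₂', g₂', -, -, hψ₂', hg₂', rfl⟩, h3⟩ :=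
        h t h0 ht φ hφ
      obtain rfl := hψ.unique hψ₂
      obtain rfl := hψ'.unique hψ₂'
      obtain rfl := hg.unique hg₂
      obtain rfl := hg'.unique hg₂'
      simp only [mul_add, h1, add_right_inj] at h3
      rwa [even_left_comm ha, even_left_comm ha'] 
    exact ⟨⟨a * ψ, hψ.C_mul a, h1 ▸ hψ'.C_mul a'⟩, ⟨a * g, hg.C_mul a, h2 ▸ hg'.C_mul a'⟩⟩
  have h1 := series_eq_of_values hs fun t h0 ht => (key t h0 ht).1
  have h2 := series_eq_of_values hs fun t h0 ht => (key t h0 ht).2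
  -- The coefficient of φ in Ẽ¹ has constant term 1, so a is read off at degree zero.
  have h3 : a = a' := by
    have := congrArg (PowerSeries.coeff 0) h2
    simpa [PowerSeries.coeff_C_mul, coeff_eTildeOdd_snd] using this
  subst h3
  have hinj : ∀ p q : PowerSeries GInf, PowerSeries.C a * p = PowerSeries.C a * q → p = q := by
    intro p q hpq
    ext k
    have := congrArg (PowerSeries.coeff k) hpq
    rw [PowerSeries.coeff_C_mul, PowerSeries.coeff_C_mul] at this
    exact ((isUnit_iff_body ha).mpr hb).mul_left_cancel this
  exact ⟨rfl, eq_of_eTildeOdd_eq (Prod.ext (hinj _ _ h1) (hinj _ _ h2))⟩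

end SuperSewing
end

noncomputable section
namespace SuperSewing
open Filter Topology

/-! ## Composition, factorization and Liouville's theorem -/

namespace GAnalyticAt

theorem gval_comp {z : ℂ} {f u : ℂ → GInf} (hf : GAnalyticAt (SuperSewing.body (u z)) f)
    (hu : GAnalyticAt z u) (he : ∀ᶠ t in 𝓝 z, u t ∈ gEven) :
    GAnalyticAt z fun t => gval f (u t) := by
  obtain ⟨N, hN⟩ := hu.exists_soul_pow he
  have h : GAnalyticAt z fun t => ∑ n ∈ Finset.range N, ((n.factorial : ℂ)⁻¹) •
      (SuperSewing.soul (u t) ^ n * SuperSewing.jet f n (SuperSewing.body (u t))) :=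
    sum _ fun n _ => ((hu.soul.pow n).mul ((hf.jet n).comp hu.body rfl)).const_smul _
  refine h.congr ?_
  filter_upwards [hN] with t ht
  exact (jetEval_eq_sum ht).symm

/-- Division by t reduces to the scalar case, where the difference quotient of an analytic function
extends analytically over 0. -/
theorem exists_factor {f : ℂ → GInf} (hf : GAnalyticAt 0 f) :
    ∃ m, GAnalyticAt 0 m ∧ m 0 = SuperSewing.jet f 1 0 ∧
      ∀ᶠ t in 𝓝 0, f t = f 0 + algebraMap ℂ GInf t * m t := by
  suffices h : ∃ m, GAnalyticAt 0 m ∧ ∀ᶠ t in 𝓝 0, f t = f 0 + algebraMap ℂ GInf t * m t by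
    obtain ⟨m, hm, h⟩ := h
    refine ⟨m, hm, ?_, h⟩
    rw [jet_congr h, jet_add (const _) (id.mul hm), jet_one_const, jet_one_mul id hm, jet_one_id,
      map_zero, zero_mul, zero_add, add_zero, one_mul]
  induction hf with
  | @smul c hc e =>
    obtain ⟨p, hp⟩ := hc
    have hd : AnalyticAt ℂ (dslope c 0) 0 := (hp.has_fpower_series_dslope_fslope).analyticAt
    refine ⟨fun t => dslope c 0 t • e, smul hd e, Eventually.of_forall fun t => ?_⟩
    have := sub_smul_dslope c 0 t
    rw [sub_zero, smul_eq_mul] at this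
    rw [← Algebra.smul_def, smul_smul, this, sub_smul, add_sub_cancel]
  | @add f g _ _ ihf ihg =>
    obtain ⟨m, hm, h⟩ := ihf
    obtain ⟨n, hn, h'⟩ := ihg
    refine ⟨_, hm.add hn, ?_⟩
    filter_upwards [h, h'] with t h1 h2
    rw [h1, h2, mul_add]
    abel
  | congr _ h ih =>
    obtain ⟨m, hm, h'⟩ := ih
    refine ⟨m, hm, ?_⟩
    filter_upwards [h, h'] with t h1 h2
    rw [← h1, h2, h.self_of_nhds]

/-- The value of a function in terms of its difference quotient at `0`. -/
theorem exists_gval_factor {f : ℂ → GInf} (hf : GAnalyticAt 0 f) :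
    ∃ m, GAnalyticAt 0 m ∧ m 0 = SuperSewing.jet f 1 0 ∧
      ∀ᶠ t in 𝓝 (0 : ℂ), ∀ w ∈ gEven, SuperSewing.body w = t → gval f w = f 0 + w * gval m w := by
  obtain ⟨m, hm, h0, h⟩ := hf.exists_factor
  refine ⟨m, hm, h0, ?_⟩
  filter_upwards [h.eventually_nhds, hm.eventually] with t h1 h2 w hw hb
  subst hb
  rw [gval_congr h1, gval_add hw (const _) (id.mul h2), gval_const hw, gval_mul hw id h2, gval_id hw]

/-- Liouville's theorem for each functional: the value of n at 0 is the limit at infinity. -/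
theorem eq_of_eventually_inv {f n : ℂ → GInf} (hf : ∀ t, GAnalyticAt t f) (hn : GAnalyticAt 0 n)
    (h : ∀ᶠ t in 𝓝[≠] (0 : ℂ), f t⁻¹ = n t) (t : ℂ) : f t = n 0 := by
  refine eq_of_forall_dual fun l => ?_
  have hd : Differentiable ℂ fun t => l (f t) := fun t => ((hf t).dual l).differentiableAt
  refine hd.apply_eq_of_tendsto_cocompact t ?_
  rw [← Metric.cobounded_eq_cocompact]
  have h1 : Tendsto (fun t => l (n t)) (𝓝[≠] 0) (𝓝 (l (n 0))) :=
    ((hn.dual l).continuousAt.tendsto).mono_left nhdsWithin_le_nhds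
  have h2 : Tendsto (fun t => l (f t⁻¹)) (𝓝[≠] 0) (𝓝 (l (n 0))) :=
    h1.congr' (h.mono fun t ht => congrArg l ht.symm)
  have h3 := h2.comp (tendsto_inv₀_cobounded' (α := ℂ))
  refine h3.congr fun t => ?_
  simp

end GAnalyticAt

/-! ## Chart expressions of superconformal maps -/

theorem IsSuperconformalMap.exists_form {S T : SuperSurface} {F : S.Carrier → T.Carrier}
    (hF : IsSuperconformalMap S T F) {α : S.Carrier → SPt → Prop} (hα : α ∈ S.atlas)
    {β : T.Carrier → SPt → Prop} (hβ : β ∈ T.atlas) :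
    ∃ (V : Set ℂ) (f ξ ψ g : ℂ → GInf), IsOpen V ∧
      (∀ z ∈ V, GAnalyticAt z f ∧ GAnalyticAt z ξ ∧ GAnalyticAt z ψ ∧ GAnalyticAt z g) ∧
      (∀ x ∈ overBody V, ∃ s y, α s x ∧ β (F s) y) ∧
      ∀ s x y, α s x → β (F s) y → x ∈ overBody V ∧
        y = (gval f x.1 + x.2 * gval ξ x.1, gval ψ x.1 + x.2 * gval g x.1) := by
  obtain ⟨h, h1, h2⟩ := hF α hα β hβ
  have h1' := h1
  obtain ⟨V, -, hV, -⟩ := h1'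
  rw [hV] at h1
  obtain ⟨hVo, f, ξ, ψ, g, han, -, heq, -⟩ := h1.exists_data
  refine ⟨V, f, ξ, ψ, g, hVo, han, fun x hx => ?_, fun s x y hx hy => ?_⟩
  · rw [← hV] at hx
    exact hx
  · have hxV : x ∈ overBody V := by
      rw [← hV]
      exact ⟨s, y, hx, hy⟩
    exact ⟨hxV, (h2 s x y hx hy).trans (heq x hxV)⟩

/-! ## Values of local coordinates near `0` -/

theorem HasSeriesValue.of_sq_zero {p : PowerSeries GInf} {w S : GInf} (h : HasSeriesValue p w S)
    (h0 : w * w = 0) : S = PowerSeries.coeff 0 p + PowerSeries.coeff 1 p * w := by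
  refine h.unique fun l => ?_
  have := hasSum_sum_of_ne_finset_zero (s := Finset.range 2) (L := .unconditional ℕ)
    (f := fun k => l (PowerSeries.coeff k p * w ^ k)) fun k hk => by
      obtain ⟨j, rfl⟩ := Nat.exists_eq_add_of_le (not_lt.mp fun h => hk (Finset.mem_range.mpr h))
      rw [pow_add, pow_two, h0, zero_mul, mul_zero, map_zero]
  simpa [Finset.sum_range_succ] using this

theorem HasETildeValue.at_zero {A M : ℕ+ → GInf} {φ : GInf} {v : SPt}
    (h : HasETildeValue A M (0, φ) v) : v = (0, φ) := by
  obtain ⟨f, ξ, ψ, g, hf, hξ, hψ, hg, rfl⟩ := h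
  rw [hf.of_sq_zero (mul_zero _), hξ.of_sq_zero (mul_zero _), hψ.of_sq_zero (mul_zero _),
    hg.of_sq_zero (mul_zero _), coeff_zero_eTildeEven_fst, coeff_eTildeEven_snd,
    coeff_eTildeOdd_fst, coeff_eTildeOdd_snd]
  simp

theorem HasETildeValue.fst_of_sq_zero {A M : ℕ+ → GInf} {x v : SPt} (h : HasETildeValue A M x v)
    (hx : x.1 ∈ gEven) (h0 : x.1 * x.1 = 0) (h1 : x.2 * x.1 = 0) : v.1 = x.1 := by
  obtain ⟨f, ξ, ψ, g, hf, hξ, -, -, rfl⟩ := h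
  dsimp only
  rw [hf.of_sq_zero h0, hξ.of_sq_zero h0, coeff_zero_eTildeEven_fst, coeff_one_eTildeEven_fst,
    coeff_eTildeEven_snd, zero_add, zero_add, one_mul, ← even_comm hx, ← mul_assoc, h1, zero_mul,
    add_zero]

end SuperSewing
end

noncomputable section
namespace SuperSewing
open Filter Topology

/-! ## Isomorphisms of the sewn surface with a canonical sphere -/

section

variable {z : GInfˣ} {θ : GInf} (hz : (z : GInf) ∈ gEven) (hθ : θ ∈ gOdd) (ε : gOdd)
  {R : Fin 3 → ℝ} {R' r r₁ r₂ : ℝ}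

/-- The sewn surface is superconformally equivalent, by `F`, to the canonical sphere of `Q`. -/
structure IsSewingIso (r : ℝ) (Q : SKOne) (R₃ : Fin 2 → ℝ)
    (F : SewnCarrier (pants hz hθ R) 0 (cap ε R') r₁ r₂ ≃ SSphere) : Prop where
  pos : ∀ k, 0 < R₃ k
  coord₀ : IsCoordOn (coordAtInfinity Q.A₀ Q.M₀ (R₃ 0)) (ballAtInfinity (R₃ 0))
  coord₁ : IsCoordOn (coordAtPoint 0 0 (Q.a 0) (Q.A 0) (Q.M 0) (R₃ 1)) (ballAtPoint 0 (R₃ 1))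
  map : IsSuperconformalMap (sewn (pants hz hθ R) 0 (cap ε R') r r₁ r₂).toSuperSurface superSphere F
  symm : IsSuperconformalMap superSphere
    (sewn (pants hz hθ R) 0 (cap ε R') r r₁ r₂).toSuperSurface F.symm
  -- The coordinate of the first sphere at infinity is its chart followed by φ ↦ -φ, which accounts
  -- for the sign in the second component.
  germ₀ : ∃ s : ℝ, 0 < s ∧ ∀ x ∈ superspace, ‖body x.1‖ < s →
    ∃ p : sewnPart₁ (pants hz hθ R) 0 r₂, northChart p.1 x ∧
      coordAtInfinity Q.A₀ Q.M₀ (R₃ 0) (F (Quot.mk _ (Sum.inl p))) (x.1, -x.2)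
  germ₁ : ∃ s : ℝ, 0 < s ∧ ∀ x ∈ superspace, ‖body x.1‖ < s →
    ∃ p : sewnPart₁ (pants hz hθ R) 0 r₂, southChart p.1 x ∧
      coordAtPoint 0 0 (Q.a 0) (Q.A 0) (Q.M 0) (R₃ 1) (F (Quot.mk _ (Sum.inl p))) x

variable {Q : SKOne} {R₃ : Fin 2 → ℝ}
  {F : SewnCarrier (pants hz hθ R) 0 (cap ε R') r₁ r₂ ≃ SSphere}

theorem exists_isSewingIso (h : IsTauSewing z θ hz hθ ε Q) :
    ∃ (R : Fin 3 → ℝ) (R' r r₁ r₂ : ℝ) (R₃ : Fin 2 → ℝ)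
      (F : SewnCarrier (pants hz hθ R) 0 (cap ε R') r₁ r₂ ≃ SSphere),
      AreRadii R R' r₁ r₂ ∧ IsSewingIso hz hθ ε r Q R₃ F := by
  obtain ⟨_, _, _, ⟨R, hRpos, -, -, rfl⟩, ⟨R', hR', -, rfl⟩, ⟨R₃, hR₃, h0, h1, rfl⟩, r, r₁, r₂, hc,
    F, hF, hF', hg⟩ := h
  refine ⟨R, R', r, r₁, r₂, R₃, F, areRadii_of_canSew hz hθ ε hR' hc, hR₃, h0, h1 0, hF, hF', ?_, ?_⟩
  · obtain ⟨s, hs, h⟩ := hg 0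
    refine ⟨s, hs, fun x hx hb => ?_⟩
    obtain ⟨p, hp, hp'⟩ := h (x.1, -x.2) ⟨hx.1, gOdd.neg_mem hx.2⟩ hb
    obtain ⟨p₁, rfl, hp₁, -⟩ := (sewn_coord_zero _ _ _ _ _ _ _).mp hp
    obtain ⟨y, hy, -, heq⟩ := (pants_coord_zero hz hθ).mp hp₁
    obtain ⟨e1, e2⟩ := Prod.mk.inj heq
    obtain rfl : x = y := Prod.ext e1 (neg_injective e2)
    exact ⟨p₁, hy, hp'⟩
  · obtain ⟨s, hs, h⟩ := hg 1
    refine ⟨s, hs, fun x hx hb => ?_⟩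
    obtain ⟨p, hp, hp'⟩ := h x hx hb
    obtain ⟨p₁, rfl, hp₁, -⟩ := (sewn_coord_one _ _ _ _ _ _ _).mp hp
    exact ⟨p₁, ((pants_coord_two hz hθ).mp hp₁).1, hp'⟩

theorem sewnEquiv_symm_of_outside (hR : AreRadii R R' r₁ r₂) {p : SSphere}
    {p₁ : sewnPart₁ (pants hz hθ R) 0 r₂} (h : corrSphere hz hθ (-ε) p = p₁.1) :
    p ∈ outside (body z) r₂ → (sewnEquiv hz hθ ε hR).symm p = Quot.mk _ (Sum.inl p₁) := by
  intro hp
  refine (Equiv.symm_apply_eq _).mpr ?_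
  change p = corrSphere hz hθ ε p₁.1
  have := corrSphere_neg hz hθ (hR.pos.trans hR.lt₂).le (-ε) hp
  rw [neg_neg] at this
  rw [← h, this]

theorem sewnEquiv_symm_of_inside (hR : AreRadii R R' r₁ r₂) {p : SSphere}
    {q₁ : sewnPart₂ (cap ε R') r₁} (h : capShiftInv hz hθ ε p = q₁.1) :
    p ∈ inside (body z) r₁ → (sewnEquiv hz hθ ε hR).symm p = Quot.mk _ (Sum.inr q₁) := by
  intro hp
  refine (Equiv.symm_apply_eq _).mpr ?_
  change p = capShift hz hθ ε q₁.1
  rw [← h, capShift_capShiftInv hz hθ ε hp]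

namespace IsSewingIso

variable {hz hθ ε}

/-- Both local coordinates at infinity are normalized, so equality of germs forces the map to be
tangent to the identity. The derivative of ψ at 0 remains free, since the data at infinity may
contain M_{1/2}. -/
theorem north_form (H : IsSewingIso hz hθ ε r Q R₃ F) : ∃ (V : Set ℂ) (f ξ ψ g : ℂ → GInf),
    IsOpen V ∧ 0 ∈ V ∧
    (∀ t ∈ V, GAnalyticAt t f ∧ GAnalyticAt t ξ ∧ GAnalyticAt t ψ ∧ GAnalyticAt t g) ∧
    (∀ p : sewnPart₁ (pants hz hθ R) 0 r₂, ∀ x, northChart p.1 x → body x.1 ∈ V →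
      northChart (F (Quot.mk _ (Sum.inl p)))
        (gval f x.1 + x.2 * gval ξ x.1, gval ψ x.1 + x.2 * gval g x.1)) ∧
    f 0 = 0 ∧ jet f 1 0 = 1 ∧ ξ 0 = 0 ∧ ψ 0 = 0 ∧ g 0 = 1 := by
  obtain ⟨V, f, ξ, ψ, g, hV, han, hex, hform⟩ := H.map.exists_form
    (α := pushChart₁ (pants hz hθ R) 0 (cap ε R') r₁ r₂ northChart) (β := northChart)
    (Or.inl ⟨northChart, Or.inr rfl, rfl⟩) (Or.inr rfl)
  have hval : ∀ p : sewnPart₁ (pants hz hθ R) 0 r₂, ∀ x, northChart p.1 x → body x.1 ∈ V →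
      northChart (F (Quot.mk _ (Sum.inl p)))
        (gval f x.1 + x.2 * gval ξ x.1, gval ψ x.1 + x.2 * gval g x.1) := by
    intro p x hx hb
    obtain ⟨s, y, ⟨p', rfl, hp'⟩, hy⟩ := hex x ⟨hx.mem, hb⟩
    obtain rfl : p = p' := Subtype.ext (hx.point_unique hp')
    have := (hform _ x y ⟨p, rfl, hx⟩ hy).2
    rwa [this] at hy
  obtain ⟨s, hs, hg⟩ := H.germ₀
  have hR₃ : 0 < (R₃ 0)⁻¹ := inv_pos.mpr (H.pos 0)
  have key : ∀ x ∈ superspace, ‖body x.1‖ < s → body x.1 ∈ V ∧ ∃ p : sewnPart₁ (pants hz hθ R) 0 r₂,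
      coordAtInfinity Q.A₀ Q.M₀ (R₃ 0) (F (Quot.mk _ (Sum.inl p))) (x.1, -x.2) ∧
      northChart (F (Quot.mk _ (Sum.inl p)))
        (gval f x.1 + x.2 * gval ξ x.1, gval ψ x.1 + x.2 * gval g x.1) := by
    intro x hx hb
    obtain ⟨p, hp, hc⟩ := hg x hx hb
    have hc' := hc
    obtain ⟨y, hy, -, -⟩ := hc'
    have h := hform _ x y ⟨p, rfl, hp⟩ hy
    exact ⟨h.1.2, p, hc, h.2 ▸ hy⟩
  have h0V : (0 : ℂ) ∈ V := by
    have := (key (0, 0) ⟨gEven.zero_mem, gOdd.zero_mem⟩ (by rwa [body_zero, norm_zero])).1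
    rwa [body_zero] at this
  have hat0 : ∀ k : ℂ → GInf, gval k 0 = k 0 := fun k => by
    simpa using gval_algebraMap k 0
  -- On the fibre over 0 the map Ẽ is the identity, so injectivity of the coordinate identifies the
  -- image point; varying φ separates the component functions.
  have hφ : ∀ φ ∈ gOdd, f 0 + φ * ξ 0 = 0 ∧ ψ 0 + φ * g 0 = φ := by
    intro φ hφ
    have hx : ((0 : GInf), φ) ∈ superspace := ⟨gEven.zero_mem, hφ⟩
    obtain ⟨-, p, hc, hn⟩ := key (0, φ) hx (by rwa [body_zero, norm_zero])
    obtain ⟨q, hq⟩ := exists_northChart hx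
    obtain ⟨y, hy⟩ := H.coord₀.1 q ⟨_, hq, by rwa [body_zero, norm_zero]⟩
    have hy' := hy
    obtain ⟨x', hx', -, hE⟩ := hy'
    obtain rfl := hq.unique hx'
    obtain rfl := hE.at_zero
    obtain rfl := H.coord₀.2 _ _ _ hc hy
    simp only [hat0] at hn
    exact Prod.mk.inj (hn.unique hq)
  have hf0 : f 0 = 0 := by simpa using (hφ 0 gOdd.zero_mem).1
  have hψ0 : ψ 0 = 0 := by simpa using (hφ 0 gOdd.zero_mem).2
  refine ⟨V, f, ξ, ψ, g, hV, h0V, han, hval, hf0, ?_, ?_, hψ0, ?_⟩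
  -- At ν = ζ_m ζ_n, of square zero, only the linear term of Ẽ matters, and its coefficient is 1.
  · refine eq_of_gen_mul_gen_mul fun m n => ?_
    have hs' := gen_mul_gen_even m n
    have hs0 := gen_mul_gen_sq m n
    have hb := body_gen_mul_gen m n
    generalize gen m * gen n = ν at *
    obtain ⟨-, p, ⟨y, hy, -, hE⟩, hn⟩ := key (ν, 0) ⟨hs', gOdd.zero_mem⟩ (by rwa [hb, norm_zero])
    have hgv : ∀ k : ℂ → GInf, gval k ν = k 0 + ν * jet k 1 0 := fun k => by
      simpa using gval_add_sq_zero (f := k) 0 hb hs0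
    simp only [hgv, hf0, hψ0, zero_add, zero_mul, add_zero] at hn
    obtain rfl := hn.unique hy
    have hmem := hy.mem
    have hsq : ∀ a b : GInf, ν * a * (ν * b) = 0 := fun a b => by
      rw [mul_assoc, even_left_comm hs' a, ← mul_assoc, hs0, zero_mul]
    have := hE.fst_of_sq_zero hmem.1 (hsq _ _) (by
      dsimp only
      rw [neg_mul, hsq, neg_zero])
    rw [mul_one]
    exact this.symm
  · refine eq_of_odd_mul fun φ h => ?_
    have := (hφ φ h).1
    rwa [hf0, zero_add, ← mul_zero φ] at this
  · refine eq_of_odd_mul fun φ h => ?_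
    have := (hφ φ h).2
    rwa [hψ0, zero_add, ← mul_one φ, mul_assoc, one_mul] at this

/-- The chart expression of the inverse near infinity sends body 0 to body 0, so all points over
infinity come from points over infinity. Hence finite points have finite images, as `exists_south`
records. -/
theorem exists_of_north (H : IsSewingIso hz hθ ε r Q R₃ F) {q : SSphere} {y : SPt}
    (hq : northChart q y) (hb : body y.1 = 0) : ∃ (p : sewnPart₁ (pants hz hθ R) 0 r₂) (x : SPt),
      F (Quot.mk _ (Sum.inl p)) = q ∧ northChart p.1 x ∧ body x.1 = 0 := by
  obtain ⟨V, f, ξ, ψ, g, hV, h0V, -, hval, hf0, -, -, hψ0, -⟩ := H.north_form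
  obtain ⟨V', f', ξ', ψ', g', hV', han, hex, hform⟩ := H.symm.exists_form (α := northChart)
    (β := pushChart₁ (pants hz hθ R) 0 (cap ε R') r₁ r₂ northChart) (Or.inr rfl)
    (Or.inl ⟨northChart, Or.inr rfl, rfl⟩)
  obtain ⟨s, hs, hg⟩ := H.germ₀
  have h00 : ((0 : GInf), (0 : GInf)) ∈ superspace := ⟨gEven.zero_mem, gOdd.zero_mem⟩
  obtain ⟨p, hp, -⟩ := hg (0, 0) h00 (by rwa [body_zero, norm_zero])
  have hat0 : ∀ k : ℂ → GInf, gval k 0 = k 0 := fun k => by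
    simpa using gval_algebraMap k 0
  have hn := hval p (0, 0) hp (by rwa [body_zero])
  simp only [hat0, hf0, hψ0, zero_mul, add_zero] at hn
  have h := hform _ (0, 0) (0, 0) hn ⟨p, F.symm_apply_apply _, hp⟩
  have h0V' : (0 : ℂ) ∈ V' := by
    have := h.1.2
    rwa [body_zero] at this
  have hf0' : f' 0 = 0 := by
    have := (Prod.mk.inj h.2).1
    simpa [hat0] using this.symm
  obtain ⟨q', x, hq', hx⟩ := hex y ⟨hq.mem, by rwa [hb]⟩
  obtain rfl := hq.point_unique hq'
  have hx' := (hform _ y x hq hx).2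
  obtain ⟨p', hp', hpx⟩ := hx
  refine ⟨p', x, by rw [← hp', F.apply_symm_apply], hpx, ?_⟩
  rw [hx']
  dsimp only
  rw [body_add, body_mul, body_odd hq.mem.2, zero_mul, add_zero, body_gval hq.mem.1, hb, hf0', body_zero]

theorem exists_south (H : IsSewingIso hz hθ ε r Q R₃ F) (hR : AreRadii R R' r₁ r₂) {p : SSphere}
    {x : SPt} (hx : southChart p x) :
    ∃ y, southChart (F ((sewnEquiv hz hθ ε hR).symm p)) y := by
  rcases exists_south_or_north (F ((sewnEquiv hz hθ ε hR).symm p)) with h | ⟨y, hy, hb⟩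
  · exact h
  · exfalso
    obtain ⟨p₁, x', he, hx', hb'⟩ := H.exists_of_north hy hb
    have h1 := (Equiv.symm_apply_eq _).mp (F.injective he).symm
    have h2 : p = corrSphere hz hθ ε p₁.1 := h1
    have h3 := hx'.corr hz hθ ε (by simp [hb'])
    rw [← h2] at h3
    refine (hx.transition h3).2.1 ?_
    rw [body_corrNorth ε.2, hb']

end IsSewingIso

end

end SuperSewing
end

noncomputable section
namespace SuperSewing
open Filter Topology

/-! ## The isomorphism is unique -/

theorem GAnalyticAt.chart_comp {V : Set ℂ} {f ξ : ℂ → GInf} {t : ℂ}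
    (han : ∀ z ∈ V, GAnalyticAt z f ∧ GAnalyticAt z ξ) {X Φ : ℂ → GInf} (hX : GAnalyticAt t X)
    (hΦ : GAnalyticAt t Φ) (he : ∀ᶠ t' in 𝓝 t, X t' ∈ gEven) (hV : SuperSewing.body (X t) ∈ V) :
    GAnalyticAt t fun t' => gval f (X t') + Φ t' * gval ξ (X t') :=
  (GAnalyticAt.gval_comp (han _ hV).1 hX he).add
    (hΦ.mul (GAnalyticAt.gval_comp (han _ hV).2 hX he))

section

variable {z : GInfˣ} {θ : GInf}

theorem algebraMap_mem_superspace (t : ℂ) {ρ : GInf} (hρ : ρ ∈ gOdd) :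
    (algebraMap ℂ GInf t, ρ) ∈ superspace := ⟨algebraMap_mem_gEven t, hρ⟩

theorem gAnalyticAt_corrSouth (hz : (z : GInf) ∈ gEven) (hθ : θ ∈ gOdd) {e ρ : GInf} (he : e ∈ gOdd)
    (hρ : ρ ∈ gOdd) {t : ℂ} (ht : t ≠ body z) :
    GAnalyticAt t (fun t' => (corrSouth z θ e (algebraMap ℂ GInf t', ρ)).1) ∧
      GAnalyticAt t (fun t' => (corrSouth z θ e (algebraMap ℂ GInf t', ρ)).2) := by
  have hV : IsOpen {t : ℂ | t ≠ body z} := isOpen_ne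
  obtain ⟨f, ξ, ψ, g, H, -⟩ := exists_isSCData_corrSouth hz hθ he hV (fun h => h rfl)
  have heq : ∀ᶠ t' in 𝓝 t, (f t' + ρ * ξ t', ψ t' + ρ * g t') =
      corrSouth z θ e (algebraMap ℂ GInf t', ρ) := by
    filter_upwards [hV.mem_nhds ht] with t' ht'
    have := H.eq (algebraMap ℂ GInf t', ρ) ⟨algebraMap_mem_superspace t' hρ, by
      rwa [body_algebraMap]⟩
    simpa only [gval_algebraMap] using this.symm
  exact ⟨((H.hf t ht).add ((H.hξ t ht).const_mul ρ)).congr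
      (heq.mono fun t' h => congrArg Prod.fst h),
    ((H.hψ t ht).add ((H.hg t ht).const_mul ρ)).congr (heq.mono fun t' h => congrArg Prod.snd h)⟩

theorem inversionInv_algebraMap_inv {t : ℂ} (ht : t ≠ 0) (ρ : GInf) :
    inversionInv (algebraMap ℂ GInf t⁻¹, ρ) =
      (algebraMap ℂ GInf t, algebraMap ℂ GInf t * -(Complex.I • ρ)) := by
  have h : Ring.inverse (algebraMap ℂ GInf t⁻¹) = algebraMap ℂ GInf t :=
    inverse_eq (by rw [← map_mul, inv_mul_cancel₀ ht, map_one])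
      (by rw [← map_mul, mul_inv_cancel₀ ht, map_one])
  rw [inversionInv, h]
  refine Prod.ext rfl ?_
  dsimp only
  rw [mul_neg, mul_smul_comm, Algebra.commutes]

/-- Factors of `corrNorth` along the image of a south section. -/
def northFactor (z : GInfˣ) (θ e ρ : GInf) (t : ℂ) : SPt :=
  (1 + e * -(2 * θ * (z⁻¹ : GInfˣ) ^ 3 * (z * (Ring.inverse (1 - z * algebraMap ℂ GInf t) - 1))) +
      -(Complex.I • ρ) * (e * (-Complex.I • ((z⁻¹ : GInfˣ) ^ 2 *
        (algebraMap ℂ GInf t * (z * Ring.inverse (1 - z * algebraMap ℂ GInf t)))))),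
    -(Complex.I • ρ) + e * (-Complex.I • ((z⁻¹ : GInfˣ) ^ 2 *
        (z * Ring.inverse (1 - z * algebraMap ℂ GInf t)))) +
      -(Complex.I • ρ) * (e * -(θ * (z⁻¹ : GInfˣ) ^ 2 *
        (Ring.inverse (1 - z * algebraMap ℂ GInf t) ^ 2 - 1))))

/-- Seen from infinity, the line w = 1/t with fixed ρ has both components divisible by t, and so
does its image. The explicit quotients extend to t = 0, where inversion would not. -/
theorem corrNorth_eq_northFactor (hz : (z : GInf) ∈ gEven) (e ρ : GInf) {t : ℂ}
    (ht : body z * t ≠ 1) :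
    corrNorth z θ e (algebraMap ℂ GInf t, algebraMap ℂ GInf t * -(Complex.I • ρ)) =
      (algebraMap ℂ GInf t * (northFactor z θ e ρ t).1,
        algebraMap ℂ GInf t * (northFactor z θ e ρ t).2) := by
  have hte := algebraMap_mem_gEven t
  have hde : 1 - z * algebraMap ℂ GInf t ∈ gEven :=
    gEven.sub_mem one_mem_gEven (even_mul_even hz hte)
  have hSd := inverse_mul hde (by
    rw [body_sub, body_one, body_mul, body_algebraMap]
    exact sub_ne_zero.mpr ht.symm)
  have hSe := inverse_even hde
  simp only [corrNorth, northFactor]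
  obtain ⟨T, hT⟩ := even_exists_smul hte
  obtain ⟨S, hS⟩ := even_exists_smul hSe
  obtain ⟨Z, hZ⟩ := even_exists_smul hz
  obtain ⟨y, hy⟩ := even_exists_smul (units_inv_even hz)
  rw [hS, hT, hZ] at hSd
  have h1 : S * (1 - Z * T) = 1 := by
    refine cen_smul_one_eq (Eq.trans ?_ hSd)
    rw [sub_smul, one_smul, smul_mul_smul_comm Z, one_mul]
  rw [hS, hT, hZ, hy]
  simp only [pow_succ, pow_zero, one_mul, mul_add, mul_sub, mul_neg, neg_mul, mul_one,
    smul_mul_assoc, mul_smul_comm, smul_eq_cen Complex.I, smul_eq_cen (-Complex.I),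
    map_neg]
  refine Prod.ext ?_ ?_
  · dsimp only
    match_scalars
    · ring
    · linear_combination -y ^ 3 * h1
    · linear_combination cen Complex.I ^ 2 * y ^ 2 * T * h1
  · dsimp only
    match_scalars
    · ring
    · linear_combination -cen Complex.I * y ^ 2 * h1
    · ring

theorem gAnalyticAt_northFactor (hz : (z : GInf) ∈ gEven) (e ρ : GInf) :
    GAnalyticAt 0 (fun t => (northFactor z θ e ρ t).1) ∧
      GAnalyticAt 0 (fun t => (northFactor z θ e ρ t).2) := by
  have hm : GAnalyticAt 0 fun t => z * algebraMap ℂ GInf t := GAnalyticAt.id.const_mul _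
  have h1 : GAnalyticAt 0 fun _ => (1 : GInf) := GAnalyticAt.const _
  have hS : GAnalyticAt 0 fun t => Ring.inverse (1 - z * algebraMap ℂ GInf t) :=
    (h1.sub hm).inverse (Eventually.of_forall fun t => gEven.sub_mem one_mem_gEven
      (even_mul_even hz (algebraMap_mem_gEven t))) (by simp [body_one])
  exact ⟨(h1.add ((((hS.sub h1).const_mul _).const_mul _).neg.const_mul e)).add
      ((((((GAnalyticAt.id.mul (hS.const_mul _)).const_mul _).const_smul _).const_mul e).const_mul _)),
    ((GAnalyticAt.const _).add ((((hS.const_mul _).const_mul _).const_smul _).const_mul e)).add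
      (((((hS.pow 2).sub h1).const_mul _).neg.const_mul e).const_mul _)⟩

theorem northFactor_zero (e ρ : GInf) : northFactor z θ e ρ 0 =
    (1, -(Complex.I • ρ) - Complex.I • (e * (z⁻¹ : GInfˣ))) := by
  have h : ((z⁻¹ : GInfˣ) : GInf) * ((z⁻¹ : GInfˣ) * z) = (z⁻¹ : GInfˣ) := by
    rw [Units.inv_mul, mul_one]
  simp [northFactor, pow_two, mul_assoc, sub_eq_add_neg]

end

end SuperSewing
end

/-! ### The self-map of the sphere along lines: entire functions and their limits at infinity. -/

noncomputable section
namespace SuperSewing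
open Filter Topology

theorem GAnalyticAt.of_form {A B : Type} {F : A → B} {α : A → SPt → Prop}
    {β : B → SPt → Prop} {V : Set ℂ} {f ξ ψ g : ℂ → GInf}
    (han : ∀ z ∈ V, GAnalyticAt z f ∧ GAnalyticAt z ξ ∧ GAnalyticAt z ψ ∧ GAnalyticAt z g)
    (hform : ∀ s x y, α s x → β (F s) y → x ∈ overBody V ∧
        y = (gval f x.1 + x.2 * gval ξ x.1, gval ψ x.1 + x.2 * gval g x.1))
    {u Y : ℂ → SPt} {t : ℂ} (hu₁ : GAnalyticAt t fun t' => (u t').1)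
    (hu₂ : GAnalyticAt t fun t' => (u t').2)
    (h : ∀ᶠ t' in 𝓝 t, ∃ s, α s (u t') ∧ β (F s) (Y t')) :
    GAnalyticAt t (fun t' => (Y t').1) ∧ GAnalyticAt t (fun t' => (Y t').2) := by
  have h' : ∀ᶠ t' in 𝓝 t, u t' ∈ overBody V ∧ Y t' = (gval f (u t').1 + (u t').2 * gval ξ (u t').1,
      gval ψ (u t').1 + (u t').2 * gval g (u t').1) := by
    filter_upwards [h] with t' ht'
    obtain ⟨s, h1, h2⟩ := ht'
    exact hform s _ _ h1 h2
  have he : ∀ᶠ t' in 𝓝 t, (u t').1 ∈ gEven := h'.mono fun t' ht' => ht'.1.1.1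
  have hV := h'.self_of_nhds.1.2
  exact ⟨(GAnalyticAt.chart_comp (fun w hw => ⟨(han w hw).1, (han w hw).2.1⟩) hu₁ hu₂ he hV).congr
      (h'.mono fun t' ht' => congrArg Prod.fst ht'.2.symm),
    (GAnalyticAt.chart_comp (fun w hw => (han w hw).2.2) hu₁ hu₂ he hV).congr
      (h'.mono fun t' ht' => congrArg Prod.snd ht'.2.symm)⟩

namespace IsSewingIso

variable {z : GInfˣ} {θ : GInf} {hz : (z : GInf) ∈ gEven} {hθ : θ ∈ gOdd} {ε : gOdd}
  {R : Fin 3 → ℝ} {R' r r₁ r₂ : ℝ} {Q : SKOne} {R₃ : Fin 2 → ℝ}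
  {F : SewnCarrier (pants hz hθ R) 0 (cap ε R') r₁ r₂ ≃ SSphere}

theorem exists_inl (hR : AreRadii R R' r₁ r₂) {p : SSphere} (hp : p ∈ outside (body z) r₂) :
    ∃ p₁ : sewnPart₁ (pants hz hθ R) 0 r₂, corrSphere hz hθ (-ε) p = p₁.1 ∧
      (sewnEquiv hz hθ ε hR).symm p = Quot.mk _ (Sum.inl p₁) := by
  obtain ⟨p₁, h⟩ := exists_inl_of_mem_outside hz hθ hR (corrSphere_mem_outside hz hθ (-ε) hp)
  exact ⟨p₁, h.symm, sewnEquiv_symm_of_outside hz hθ ε hR h.symm hp⟩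

/-- The two pieces of the sewn surface cover the finite plane. On one the line is pulled back by the
inverse correction map, on the other by the inverse shift, and both are analytic in t; so the image
is entire. -/
theorem gAnalyticAt_south (H : IsSewingIso hz hθ ε r Q R₃ F) (hR : AreRadii R R' r₁ r₂) {ρ : GInf}
    (hρ : ρ ∈ gOdd) {Y : ℂ → SPt} (hY : ∀ t p, southChart p (algebraMap ℂ GInf t, ρ) →
      southChart (F ((sewnEquiv hz hθ ε hR).symm p)) (Y t)) (t : ℂ) :
    GAnalyticAt t (fun t' => (Y t').1) ∧ GAnalyticAt t (fun t' => (Y t').2) := by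
  have h2 : 0 < r₂ := hR.pos.trans hR.lt₂
  by_cases ht : r₂ < ‖t - body z‖
  · obtain ⟨V, f, ξ, ψ, g, -, han, -, hform⟩ := H.map.exists_form
      (α := pushChart₁ (pants hz hθ R) 0 (cap ε R') r₁ r₂ southChart) (β := southChart)
      (Or.inl ⟨southChart, Or.inl rfl, rfl⟩) (Or.inl rfl)
    have htz : t ≠ body z := fun h => by
      rw [h, sub_self, norm_zero] at ht
      exact absurd ht (not_lt.mpr h2.le)
    have hc := gAnalyticAt_corrSouth hz hθ (gOdd.neg_mem ε.2) hρ htz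
    refine GAnalyticAt.of_form (F := F) (β := southChart)
      (α := pushChart₁ (pants hz hθ R) 0 (cap ε R') r₁ r₂ southChart) han hform hc.1 hc.2 ?_
    filter_upwards [(isOpen_outside (body z) r₂).mem_nhds ht] with t' ht'
    obtain ⟨p, hp⟩ := exists_southChart (algebraMap_mem_superspace t' hρ)
    obtain ⟨p₁, h1, h3⟩ := exists_inl (ε := ε) (hθ := hθ) hR
      (hp.mem_outside_iff.mpr (by rw [body_algebraMap]; exact ht'))
    have h4 := hY t' p hp
    rw [h3] at h4
    have h5 := hp.corr hz hθ (-ε)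
    rw [h1] at h5
    exact ⟨_, ⟨p₁, rfl, h5⟩, h4⟩
  · have ht1 : ‖t - body z‖ < r₁ := (not_lt.mp ht).trans_lt hR.lt
    obtain ⟨V, f, ξ, ψ, g, -, han, -, hform⟩ := H.map.exists_form
      (α := pushChart₂ (pants hz hθ R) 0 (cap ε R') r₁ r₂ southChart) (β := southChart)
      (Or.inr ⟨southChart, Or.inl rfl, rfl⟩) (Or.inl rfl)
    refine GAnalyticAt.of_form (F := F) (β := southChart)
      (α := pushChart₂ (pants hz hθ R) 0 (cap ε R') r₁ r₂ southChart) han hform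
      (u := fun t' => superShift (-capShiftEven z θ ε) (-capShiftOdd z θ ε) (algebraMap ℂ GInf t', ρ))
      ((GAnalyticAt.id.sub (GAnalyticAt.const _)).sub
        (GAnalyticAt.const (ρ * -capShiftOdd z θ ε)))
      (GAnalyticAt.const (ρ - -capShiftOdd z θ ε)) ?_
    have hV : IsOpen {t : ℂ | ‖t - body z‖ < r₁} := isOpen_lt (by fun_prop) continuous_const
    filter_upwards [hV.mem_nhds ht1] with t' ht'
    obtain ⟨p, hp⟩ := exists_southChart (algebraMap_mem_superspace t' hρ)
    have hin : p ∈ inside (body z) r₁ :=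
      hp.mem_inside_iff.mpr (by rw [body_algebraMap]; exact ht')
    obtain ⟨q₁, h1⟩ := exists_inr_of_mem_inside ε hR (capShiftInv_mem_inside hz hθ ε hin)
    have h4 := hY t' p hp
    rw [sewnEquiv_symm_of_inside hz hθ ε hR h1.symm hin] at h4
    have h5 := hp.shift (gEven.neg_mem (capShiftEven_mem hz hθ ε))
      (gOdd.neg_mem (capShiftOdd_mem hz hθ ε))
    change southChart (capShiftInv hz hθ ε p) _ at h5
    rw [← h1] at h5
    exact ⟨_, ⟨q₁, rfl, h5⟩, h4⟩

/-- Tangency to the identity at infinity gives image (tM₁, tM₂) in that chart with M₁(0) = 1; after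
inversion the components are 1/t + m and n. The constant K is chosen before ρ, so it can later be
evaluated at ρ = 0. -/
theorem exists_at_infinity (H : IsSewingIso hz hθ ε r Q R₃ F) (hR : AreRadii R R' r₁ r₂) :
    ∃ K : GInf, ∀ ρ ∈ gOdd, ∀ Y : ℂ → SPt, (∀ t p, southChart p (algebraMap ℂ GInf t, ρ) →
      southChart (F ((sewnEquiv hz hθ ε hR).symm p)) (Y t)) →
      ∃ m n, GAnalyticAt 0 m ∧ GAnalyticAt 0 n ∧ n 0 = K + ρ ∧
        ∀ᶠ t in 𝓝[≠] (0 : ℂ), Y t⁻¹ = (algebraMap ℂ GInf t⁻¹ + m t, n t) := by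
  obtain ⟨V, f, ξ, ψ, g, hV, h0V, han, hval, hf0, hf1, hξ0, hψ0, hg0⟩ := H.north_form
  obtain ⟨hf, hξ, hψ, hg⟩ := han 0 h0V
  obtain ⟨mf, hmf, hmf0, hmf'⟩ := hf.exists_gval_factor
  obtain ⟨mξ, hmξ, -, hmξ'⟩ := hξ.exists_gval_factor
  obtain ⟨mψ, hmψ, -, hmψ'⟩ := hψ.exists_gval_factor
  -- The first summand is i times the derivative of ψ at 0; the second is what the inverse
  -- correction map adds to the odd coordinate at infinity.
  refine ⟨Complex.I • mψ 0 - ε * (z⁻¹ : GInfˣ), fun ρ hρ Y hY => ?_⟩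
  obtain ⟨hN1, hN2⟩ := gAnalyticAt_northFactor (θ := θ) hz (-(ε : GInf)) ρ
  have hN0 := northFactor_zero (z := z) (θ := θ) (-(ε : GInf)) ρ
  set N := northFactor z θ (-(ε : GInf)) ρ with hN
  set X : ℂ → GInf := fun t => algebraMap ℂ GInf t * (N t).1 with hX
  set Φ : ℂ → GInf := fun t => algebraMap ℂ GInf t * (N t).2 with hΦ
  have hXa : GAnalyticAt 0 X := GAnalyticAt.id.mul hN1
  have hΦa : GAnalyticAt 0 Φ := GAnalyticAt.id.mul hN2
  have hX0 : X 0 = 0 := by simp [hX]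
  have hΦ0 : Φ 0 = 0 := by simp [hΦ]
  have hz1 : ∀ᶠ t in 𝓝 (0 : ℂ), body z * t ≠ 1 :=
    (continuous_const.mul continuous_id).continuousAt.eventually_ne (by simp)
  have hcorr : ∀ᶠ t in 𝓝 (0 : ℂ), corrNorth z θ (-ε)
      (algebraMap ℂ GInf t, algebraMap ℂ GInf t * -(Complex.I • ρ)) = (X t, Φ t) :=
    hz1.mono fun t ht => corrNorth_eq_northFactor hz _ _ ht
  have hsp : ∀ t : ℂ, (algebraMap ℂ GInf t, algebraMap ℂ GInf t * -(Complex.I • ρ)) ∈ superspace :=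
    fun t => algebraMap_mem_superspace t (even_mul_odd (algebraMap_mem_gEven t)
      (gOdd.neg_mem (gOdd.smul_mem _ hρ)))
  have hXΦ : ∀ᶠ t in 𝓝 (0 : ℂ), (X t, Φ t) ∈ superspace ∧ body (X t) = t := by
    filter_upwards [hcorr] with t ht
    have h1 := corrNorth_mem hz hθ (gOdd.neg_mem ε.2) (hsp t)
    have h2 := body_corrNorth (z := z) (θ := θ) (gOdd.neg_mem ε.2)
      (algebraMap ℂ GInf t, algebraMap ℂ GInf t * -(Complex.I • ρ))
    rw [ht] at h1 h2
    exact ⟨h1, h2.trans (body_algebraMap t)⟩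
  have hXe : ∀ᶠ t in 𝓝 (0 : ℂ), X t ∈ gEven := hXΦ.mono fun t ht => ht.1.1
  have hcomp : ∀ k : ℂ → GInf, GAnalyticAt 0 k → GAnalyticAt 0 fun t => gval k (X t) := fun k hk =>
    GAnalyticAt.gval_comp (by rwa [hX0, body_zero]) hXa hXe
  have hat0 : ∀ k : ℂ → GInf, gval k (X 0) = k 0 := fun k => by
    rw [hX0]
    simpa using gval_algebraMap k 0
  set M₁ : ℂ → GInf := fun t => (N t).1 * gval mf (X t) + Φ t * ((N t).1 * gval mξ (X t)) with hM₁
  set M₂ : ℂ → GInf := fun t => (N t).1 * gval mψ (X t) + (N t).2 * gval g (X t) with hM₂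
  have hM₁a : GAnalyticAt 0 M₁ :=
    (hN1.mul (hcomp _ hmf)).add (hΦa.mul (hN1.mul (hcomp _ hmξ)))
  have hM₂a : GAnalyticAt 0 M₂ := (hN1.mul (hcomp _ hmψ)).add (hN2.mul (hcomp _ hg))
  have hM₁0 : M₁ 0 = 1 := by
    simp only [hM₁, hat0, hΦ0, hN0, hmf0, hf1, zero_mul, add_zero, one_mul]
  have hM₂0 : Complex.I • M₂ 0 = Complex.I • mψ 0 - ε * (z⁻¹ : GInfˣ) + ρ := by
    simp only [hM₂, hat0, hN0, hg0, one_mul, mul_one, neg_mul, smul_add, smul_sub, smul_neg,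
      smul_smul, Complex.I_mul_I, neg_smul, one_smul]
    abel
  -- the coordinates at infinity of the image
  have himg : ∀ᶠ t in 𝓝[≠] (0 : ℂ), algebraMap ℂ GInf t * M₁ t ∈ gEven ∧
      body (algebraMap ℂ GInf t * M₁ t) ≠ 0 ∧
      Y t⁻¹ = inversion (algebraMap ℂ GInf t * M₁ t, algebraMap ℂ GInf t * M₂ t) := by
    have hout := (isOpen_outside_north (body z) r₂).mem_nhds (show (0 : ℂ) ∈ _ by simp)
    filter_upwards [self_mem_nhdsWithin, nhdsWithin_le_nhds hz1, nhdsWithin_le_nhds hcorr,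
      nhdsWithin_le_nhds hXΦ, nhdsWithin_le_nhds hmf', nhdsWithin_le_nhds hmξ',
      nhdsWithin_le_nhds hmψ', nhdsWithin_le_nhds hout, nhdsWithin_le_nhds (hV.mem_nhds h0V)]
      with t ht0 htz htc htX h1 h2 h3 hto htV
    rw [Set.mem_compl_singleton_iff] at ht0
    obtain ⟨p, hp⟩ := exists_southChart (algebraMap_mem_superspace t⁻¹ hρ)
    have hpn := hp.north (by rw [body_algebraMap]; exact inv_ne_zero ht0)
    rw [inversionInv_algebraMap_inv ht0] at hpn
    obtain ⟨p₁, hp₁, hsymm⟩ := exists_inl (ε := ε) (hθ := hθ) hR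
      (hpn.mem_outside_iff.mpr (by rw [body_algebraMap]; exact hto))
    have hpc := hpn.corr hz hθ (-ε) (by rw [body_algebraMap]; exact htz)
    rw [hp₁] at hpc
    have hpc' : northChart p₁.1 (X t, Φ t) := by
      rw [← htc]
      exact hpc
    have himage := hval p₁ _ hpc' (by
      dsimp only
      rw [htX.2]
      exact htV)
    dsimp only at himage
    have hXt := htX.1.1
    rw [h1 _ hXt htX.2, h2 _ hXt htX.2, h3 _ hXt htX.2, hf0, hξ0, hψ0, zero_add, zero_add,
      zero_add] at himage
    have e1 : X t * gval mf (X t) + Φ t * (X t * gval mξ (X t)) = algebraMap ℂ GInf t * M₁ t := by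
      simp only [hM₁, hX, mul_add, mul_assoc]
      rw [even_left_comm (algebraMap_mem_gEven t) (Φ t)]
    have e2 : X t * gval mψ (X t) + Φ t * gval g (X t) = algebraMap ℂ GInf t * M₂ t := by
      simp only [hM₂, hX, hΦ, mul_add, mul_assoc]
    rw [e1, e2] at himage
    have hs := hY t⁻¹ p hp
    rw [hsymm] at hs
    obtain ⟨-, hb, -, h4⟩ := hs.transition himage
    exact ⟨himage.mem.1, hb, h4⟩
  -- For t ≠ 0 the product tM₁(t) is even and the complex factor can be removed; at t = 0 the value
  -- is 1.
  have hM₁e : ∀ᶠ t in 𝓝 (0 : ℂ), M₁ t ∈ gEven := by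
    have h0 : M₁ 0 ∈ gEven := hM₁0 ▸ one_mem_gEven
    rw [eventually_nhdsWithin_iff] at himg
    filter_upwards [himg] with t ht
    by_cases ht0 : t = 0
    · rw [ht0]
      exact h0
    · have h1 := (ht ht0).1
      rw [← Algebra.smul_def] at h1
      exact (Submodule.smul_mem_iff _ ht0).mp h1
  have hb0 : body (M₁ 0) ≠ 0 := by rw [hM₁0, body_one]; exact one_ne_zero
  have hm1 := hM₁a.inverse hM₁e hb0
  obtain ⟨m, hm, -, hm'⟩ := hm1.exists_factor
  have h1i : Ring.inverse (M₁ 0) = 1 := by rw [hM₁0, Ring.inverse_one]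
  refine ⟨m, fun t => Complex.I • (M₂ t * Ring.inverse (M₁ t)), hm,
    (hM₂a.mul hm1).const_smul _, ?_, ?_⟩
  · dsimp only
    rw [h1i, mul_one, hM₂0]
  · filter_upwards [self_mem_nhdsWithin, himg, nhdsWithin_le_nhds hM₁e, nhdsWithin_le_nhds hm',
      nhdsWithin_le_nhds (hM₁a.body.continuousAt.eventually_ne hb0)] with t ht0 h1 h2 h3 h4
    rw [Set.mem_compl_singleton_iff] at ht0
    have hT : algebraMap ℂ GInf t⁻¹ * algebraMap ℂ GInf t = 1 := by
      rw [← map_mul, inv_mul_cancel₀ ht0, map_one]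
    have hTe := algebraMap_mem_gEven t
    have hTe' := algebraMap_mem_gEven t⁻¹
    have hinv : Ring.inverse (algebraMap ℂ GInf t * M₁ t) =
        algebraMap ℂ GInf t⁻¹ * Ring.inverse (M₁ t) := by
      have h5 : algebraMap ℂ GInf t⁻¹ * Ring.inverse (M₁ t) * (algebraMap ℂ GInf t * M₁ t) = 1 := by
        rw [mul_assoc, even_left_comm hTe, inverse_mul h2 h4, mul_one, hT]
      refine inverse_eq ?_ h5
      rw [even_comm h1.1, h5]
    rw [h1.2.2, inversion]
    dsimp only
    rw [hinv]
    refine Prod.ext ?_ ?_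
    · dsimp only
      rw [h3, h1i, mul_add, mul_one, ← mul_assoc, hT, one_mul]
    · dsimp only
      rw [mul_assoc, even_left_comm hTe', ← mul_assoc, even_comm hTe, hT, one_mul]

end IsSewingIso

end SuperSewing
end

/-! ### Rigidity of the self-map and uniqueness of the sewn data. -/

noncomputable section
namespace SuperSewing
open Filter Topology

section

variable {z : GInfˣ} {θ : GInf} {hz : (z : GInf) ∈ gEven} {hθ : θ ∈ gOdd} {ε : gOdd}
  {R : Fin 3 → ℝ} {R' r r₁ r₂ : ℝ} {Q : SKOne} {R₃ : Fin 2 → ℝ}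
  {F : SewnCarrier (pants hz hθ R) 0 (cap ε R') r₁ r₂ ≃ SSphere}

theorem corrSouth_zero_fst (e ρ : GInf) :
    (corrSouth z θ e (0, ρ)).1 = 0 ∧ (corrSouth z θ e (0, 0)).2 = 0 := by
  have h : Ring.inverse (0 - (z : GInf)) + (z⁻¹ : GInfˣ) = 0 := by
    have : Ring.inverse (0 - (z : GInf)) = -(z⁻¹ : GInfˣ) :=
      inverse_eq (by rw [zero_sub, neg_mul_neg, Units.mul_inv])
        (by rw [zero_sub, neg_mul_neg, Units.inv_mul])
    rw [this, neg_add_cancel]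
  rw [zero_sub] at h
  simp [corrSouth, h]

namespace IsSewingIso

theorem symm_eq_inl (hR : AreRadii R R' r₁ r₂) {p : SSphere} {x y : SPt}
    {p₁ : sewnPart₁ (pants hz hθ R) 0 r₂} (hp : southChart p x) (h₁ : southChart p₁.1 y)
    (h : corrSouth z θ (-ε) x = y) :
    (sewnEquiv hz hθ ε hR).symm p = Quot.mk _ (Sum.inl p₁) := by
  subst h
  have hc := hp.corr hz hθ (-ε)
  have ho := (h₁.mem_outside_iff.mp ((pants_ball_iff hz hθ (hR.lt.trans hR.lt₁) p₁.1).mp p₁.2))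
  rw [body_corrSouth (gOdd.neg_mem ε.2)] at ho
  exact sewnEquiv_symm_of_outside hz hθ ε hR (hc.point_unique h₁) (hp.mem_outside_iff.mpr ho)

/-- Over w = 0 the local coordinate of Q is ρ ↦ aρ, so equality of germs sends the fibre over 0 to
itself and the puncture (0,0) to itself. -/
theorem value_zero (H : IsSewingIso hz hθ ε r Q R₃ F) (hR : AreRadii R R' r₁ r₂) {p : SSphere}
    {ρ : GInf} (hp : southChart p (0, ρ)) : ∃ φ, southChart (F ((sewnEquiv hz hθ ε hR).symm p)) (0, φ) ∧
      (ρ = 0 → φ = 0) := by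
  obtain ⟨s, hs, hg⟩ := H.germ₁
  have hx := corrSouth_mem hz hθ (gOdd.neg_mem ε.2) hp.mem
  have h1 := (corrSouth_zero_fst (z := z) (θ := θ) (-(ε : GInf)) ρ).1
  obtain ⟨p₁, hp₁, hc⟩ := hg _ hx (by rwa [h1, body_zero, norm_zero])
  rw [symm_eq_inl hR hp hp₁ rfl]
  set φ := Ring.inverse (Q.a 0) * (corrSouth z θ (-ε) (0, ρ)).2 with hφ
  have hxφ : ((0 : GInf), φ) ∈ superspace :=
    ⟨gEven.zero_mem, even_mul_odd (inverse_even (Q.a_even 0)) hx.2⟩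
  obtain ⟨q, hq⟩ := exists_southChart hxφ
  obtain ⟨y, hy⟩ := H.coord₁.1 q ⟨_, hq, by
    rw [sub_self, norm_zero]
    exact H.pos 1⟩
  have hy' := hy
  obtain ⟨x', hx', -, v, hE, hyv⟩ := hy'
  obtain rfl := hq.unique hx'
  rw [superShift_zero] at hE
  obtain rfl := hE.at_zero
  have : y = corrSouth z θ (-ε) (0, ρ) := by
    rw [hyv]
    refine Prod.ext ?_ ?_
    · dsimp only
      rw [mul_zero, h1]
    · dsimp only
      rw [hφ, ← mul_assoc, mul_inverse (Q.a_even 0) (Q.a_body 0), one_mul]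
  rw [this] at hy
  rw [H.coord₁.2 _ _ _ hc hy]
  refine ⟨φ, hq, ?_⟩
  rintro rfl
  rw [hφ, (corrSouth_zero_fst (z := z) (θ := θ) (-(ε : GInf)) 0).2, mul_zero]

/-- By Liouville the image of (t, ρ) is (t + const, K + ρ). The fibre over 0 is preserved, so the
first constant vanishes; the puncture (0,0) is fixed, so K = 0. Complex t suffice, because power
series are determined by their values there. -/
theorem eq_self (H : IsSewingIso hz hθ ε r Q R₃ F) (hR : AreRadii R R' r₁ r₂) {p : SSphere}
    {t : ℂ} {ρ : GInf} (hp : southChart p (algebraMap ℂ GInf t, ρ)) :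
    F ((sewnEquiv hz hθ ε hR).symm p) = p := by
  have hex : ∀ ρ ∈ gOdd, ∃ Y : ℂ → SPt, ∀ t p, southChart p (algebraMap ℂ GInf t, ρ) →
      southChart (F ((sewnEquiv hz hθ ε hR).symm p)) (Y t) := by
    intro ρ hρ
    choose q hq using fun t => exists_southChart (algebraMap_mem_superspace t hρ)
    choose Y hY using fun t => H.exists_south hR (hq t)
    exact ⟨Y, fun t p hp => (hp.point_unique (hq t)) ▸ hY t⟩
  obtain ⟨K, hK⟩ := H.exists_at_infinity hR
  have key : ∀ ρ ∈ gOdd, ∀ Y : ℂ → SPt, (∀ t p, southChart p (algebraMap ℂ GInf t, ρ) →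
      southChart (F ((sewnEquiv hz hθ ε hR).symm p)) (Y t)) →
      ∀ t, Y t = (algebraMap ℂ GInf t, K + ρ) := by
    intro ρ hρ Y hY t
    obtain ⟨m, n, hm, hn, hn0, h⟩ := hK ρ hρ Y hY
    have han := H.gAnalyticAt_south hR hρ hY
    have h2 := GAnalyticAt.eq_of_eventually_inv (fun t => (han t).2) hn
      (h.mono fun t ht => by rw [ht])
    have h1 := GAnalyticAt.eq_of_eventually_inv (f := fun t => (Y t).1 - algebraMap ℂ GInf t)
      (fun t => (han t).1.sub GAnalyticAt.id) hm
      (h.mono fun t ht => by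
        rw [ht, add_sub_cancel_left])
    obtain ⟨q, hq⟩ := exists_southChart (algebraMap_mem_superspace 0 hρ)
    have hq0 := hY 0 q hq
    rw [map_zero] at hq
    obtain ⟨φ, hφ, -⟩ := H.value_zero hR hq
    have hY0 := hφ.unique hq0
    have hm0 : m 0 = 0 := by
      rw [← h1 0, ← hY0]
      simp
    refine Prod.ext ?_ ?_
    · exact sub_eq_zero.mp ((h1 t).trans hm0)
    · exact (h2 t).trans hn0
  have hK0 : K = 0 := by
    obtain ⟨Y, hY⟩ := hex 0 gOdd.zero_mem
    obtain ⟨q, hq⟩ := exists_southChart (algebraMap_mem_superspace 0 gOdd.zero_mem)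
    have hq0 := hY 0 q hq
    rw [map_zero] at hq
    obtain ⟨φ, hφ, h0⟩ := H.value_zero hR hq
    have hY0 := hφ.unique hq0
    rw [key 0 gOdd.zero_mem Y hY 0, h0 rfl] at hY0
    simpa using (Prod.mk.inj hY0).2.symm
  obtain ⟨Y, hY⟩ := hex ρ hp.mem.2
  have h := hY t p hp
  rw [key ρ hp.mem.2 Y hY t, hK0, zero_add] at h
  exact h.point_unique hp

/-- Since the self-map is the identity at these points, the coordinate of Q there is the transported
one, the inverse correction map, as it is for `sewnPoint`; the values determine the data. -/
theorem data_zero (H : IsSewingIso hz hθ ε r Q R₃ F) (hR : AreRadii R R' r₁ r₂) :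
    Q.a 0 = (sewnPoint z θ hz hθ ε).a 0 ∧ Q.A 0 = (sewnPoint z θ hz hθ ε).A 0 ∧
      Q.M 0 = (sewnPoint z θ hz hθ ε).M 0 := by
  obtain ⟨s, hs, hg⟩ := H.germ₁
  refine data_eq_of_values (Q.a_even 0) ((sewnPoint z θ hz hθ ε).a_even 0) (Q.a_body 0)
    (s := min s ‖body z‖) (lt_min hs (norm_pos_iff.mpr (body_unit z))) fun t _ ht φ hφ => ?_
  have hts := algebraMap_mem_superspace t hφ
  have hb : body (algebraMap ℂ GInf t) = t := body_algebraMap t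
  have hcb := body_corrSouth (z := z) (θ := θ) (gOdd.neg_mem ε.2) (algebraMap ℂ GInf t, φ)
  obtain ⟨p, hp⟩ := exists_southChart hts
  obtain ⟨p₁, hp₁, hc⟩ := hg _ (corrSouth_mem hz hθ (gOdd.neg_mem ε.2) hts) (by
    rw [hcb, hb]
    exact ht.trans_le (min_le_left _ _))
  rw [← symm_eq_inl hR hp hp₁ rfl, H.eq_self hR hp] at hc
  obtain ⟨y, hy, -, v, hv, heq⟩ := hc
  obtain rfl := hp.unique hy
  rw [superShift_zero] at hv
  obtain ⟨v', hv', heq'⟩ := hasETildeValue_sewnPoint_zero hz hθ ε hts (by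
    dsimp only
    rw [hb]
    exact ht.trans_le (min_le_right _ _))
  exact ⟨v, v', hv, hv', (Prod.mk.inj (heq.symm.trans heq')).2⟩

theorem data_infinity (H : IsSewingIso hz hθ ε r Q R₃ F) (hR : AreRadii R R' r₁ r₂) :
    Q.A₀ = (sewnPoint z θ hz hθ ε).A₀ ∧ Q.M₀ = (sewnPoint z θ hz hθ ε).M₀ := by
  obtain ⟨s, hs, hg⟩ := H.germ₀
  have hz0 := norm_pos_iff.mpr (body_unit z)
  have h := data_eq_of_values (A := Q.A₀) (M := fun j => -(Complex.I • Q.M₀ j))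
    (A' := (sewnPoint z θ hz hθ ε).A₀) (M' := fun j => -(Complex.I • (sewnPoint z θ hz hθ ε).M₀ j))
    one_mem_gEven one_mem_gEven (by rw [body_one]; exact one_ne_zero)
    (s := min s ‖body z‖⁻¹) (lt_min hs (inv_pos.mpr hz0)) fun t ht0 ht φ hφ => by
      have hφ' : -(Complex.I • -(Complex.I • φ)) = -φ := by
        rw [smul_neg, smul_smul, Complex.I_mul_I, neg_one_smul, neg_neg]
      have hρ : Complex.I • -φ ∈ gOdd := gOdd.smul_mem _ (gOdd.neg_mem hφ)
      have hts := algebraMap_mem_superspace t (gOdd.neg_mem hφ)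
      have hb : body (algebraMap ℂ GInf t) = t := body_algebraMap t
      have hzt : ‖body z * body (algebraMap ℂ GInf t)‖ < 1 := by
        rw [hb, norm_mul]
        calc _ < ‖body z‖ * ‖body z‖⁻¹ := by
              gcongr
              exact ht.trans_le (min_le_right _ _)
          _ = 1 := mul_inv_cancel₀ hz0.ne'
      have hzt' : body z * body (algebraMap ℂ GInf t) ≠ 1 := fun h => by
        rw [h, norm_one] at hzt
        exact lt_irrefl _ hzt
      have hcb := body_corrNorth (z := z) (θ := θ) (gOdd.neg_mem ε.2) (algebraMap ℂ GInf t, -φ)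
      obtain ⟨p, hp⟩ := exists_northChart hts
      have hps := hp.south (by rw [hb]; exact ht0)
      have hinv : (inversion (algebraMap ℂ GInf t, -φ)).1 = algebraMap ℂ GInf t⁻¹ :=
        inverse_eq (by rw [← map_mul, mul_inv_cancel₀ ht0, map_one])
          (by rw [← map_mul, inv_mul_cancel₀ ht0, map_one])
      obtain ⟨p₁, hp₁, hc⟩ := hg _ (corrNorth_mem hz hθ (gOdd.neg_mem ε.2) hts) (by
        rw [hcb, hb]
        exact ht.trans_le (min_le_left _ _))
      have hpc := hp.corr hz hθ (-ε) hzt'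
      have hp₁' := hpc.point_unique hp₁
      have hout : p ∈ outside (body z) r₂ := by
        have := (hp₁.mem_outside_iff.mp
          ((pants_ball_iff hz hθ (hR.lt.trans hR.lt₁) p₁.1).mp p₁.2))
        rw [hcb] at this
        exact hp.mem_outside_iff.mpr this
      have hself := H.eq_self hR (p := p) (t := t⁻¹)
        (ρ := (inversion (algebraMap ℂ GInf t, -φ)).2) (by rw [← hinv]; exact hps)
      rw [sewnEquiv_symm_of_outside hz hθ ε hR hp₁' hout] at hself
      rw [hself] at hc
      obtain ⟨y, hy, -, hE⟩ := hc
      obtain rfl := hp.unique hy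
      have hE' := hasETildeValue_sewnPoint_infinity hz hθ ε hts hzt
      simp only [neg_neg] at hE hE'
      exact ⟨_, _, hE, hE', rfl⟩
  refine ⟨h.2.1, funext fun j => ?_⟩
  exact smul_right_injective GInf Complex.I_ne_zero (neg_injective (congrFun h.2.2 j))

end IsSewingIso

theorem eq_sewnPoint_of_isTauSewing (h : IsTauSewing z θ hz hθ ε Q) :
    Q = sewnPoint z θ hz hθ ε := by
  obtain ⟨R, R', r, r₁, r₂, R₃, F, hR, H⟩ := exists_isSewingIso hz hθ ε h
  obtain ⟨ha, hA, hM⟩ := H.data_zero hR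
  obtain ⟨hA₀, hM₀⟩ := H.data_infinity hR
  have h1 : ∀ k : Fin 1, k = 0 := fun k => Subsingleton.elim _ _
  refine SKSucc.ext (funext fun i => i.elim0) (funext fun i => i.elim0) hA₀ hM₀
    (funext fun k => ?_) (funext fun k => ?_) (funext fun k => ?_)
  · rw [h1 k, ha]
  · rw [h1 k, hA]
  · rw [h1 k, hM]

end

theorem tauSewing_eq (z : GInfˣ) (θ : GInf) (hz : (z : GInf) ∈ gEven) (hθ : θ ∈ gOdd) (ε : gOdd) :
    tauSewing z θ hz hθ ε = sewnPoint z θ hz hθ ε :=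
  eq_sewnPoint_of_isTauSewing (Classical.epsilon_spec (p := IsTauSewing z θ hz hθ ε)
    ⟨_, isTauSewing_sewnPoint hz hθ ε⟩)

end SuperSewing
end

/-! ### The functional as an odd tangent vector, and its formula. -/

noncomputable section
namespace SuperSewing

variable {z : GInfˣ} {θ : GInf} {hz : (z : GInf) ∈ gEven} {hθ : θ ∈ gOdd} {F : SDOne}
  {D : CoordName → GInf}

namespace IsGradient

theorem hasOddDerivAtZero (h : IsGradient z θ hz hθ F D) :
    HasOddDerivAtZero (fun ε => F.1 (tauSewing z θ hz hθ ε)) (∑ᶠ c, coordSpeed z θ c * D c) := by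
  intro ε
  dsimp only
  rw [tauSewing_eq, tauSewing_eq, sewnPoint_zero]
  exact h.deriv ε

theorem calG_eq (h : IsGradient z θ hz hθ F D) :
    calG z θ hz hθ F = ∑ᶠ c, coordSpeed z θ c * D c :=
  HasOddDerivAtZero.unique (Classical.epsilon_spec ⟨_, h.hasOddDerivAtZero⟩) h.hasOddDerivAtZero

theorem partialA₀_eq (h : IsGradient z θ hz hθ F D) : partialA₀ identitySK F = D .a :=
  HasPartialAt.unique (c := .a) (Classical.epsilon_spec ⟨_, h.partial_at .a⟩) (h.partial_at .a)

theorem partialA_eq (h : IsGradient z θ hz hθ F D) (k : Fin 2) (j : ℕ+) :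
    partialA k j identitySK F = D (.A k j) :=
  HasPartialAt.unique (c := .A k j) (Classical.epsilon_spec ⟨_, h.partial_at (.A k j)⟩)
    (h.partial_at (.A k j))

theorem partialM_eq (h : IsGradient z θ hz hθ F D) (k : Fin 2) (j : ℕ+) :
    partialM k j identitySK F = D (.M k j) :=
  HasPartialAt.unique (c := .M k j) (Classical.epsilon_spec ⟨_, h.partial_at (.M k j)⟩)
    (h.partial_at (.M k j))

theorem finite_A (h : IsGradient z θ hz hθ F D) (k : Fin 2) :
    (Function.support fun j => D (.A k j)).Finite :=
  h.finite.preimage (f := CoordName.A k) fun i _ j _ h => by injection h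

theorem finite_M (h : IsGradient z θ hz hθ F D) (k : Fin 2) :
    (Function.support fun j => D (.M k j)).Finite :=
  h.finite.preimage (f := CoordName.M k) fun i _ j _ h => by injection h

theorem calG_formula (h : IsGradient z θ hz hθ F D) : calG z θ hz hθ F =
    (∑ k : Fin 2, ∑ᶠ j : ℕ+,
      ((z ^ (-(2 * (k : ℤ) - 1) * (j : ℤ) - 2 + k) : GInfˣ) : GInf) *
        partialM k j identitySK F) +
    2 * θ * (((z ^ (-2 : ℤ) : GInfˣ) : GInf) * ((1 / 2 : ℂ) • partialA₀ identitySK F) +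
      ∑ k : Fin 2, ∑ᶠ j : ℕ+,
        ((z ^ (-(2 * (k : ℤ) - 1) * (j : ℤ) - 2) : GInfˣ) : GInf) *
          partialA k j identitySK F) := by
  have ha : coordSpeed z θ .a * D .a =
      2 * θ * (((z ^ (-2 : ℤ) : GInfˣ) : GInf) * ((1 / 2 : ℂ) • D .a)) := by
    change θ * _ * D .a = _
    rw [mul_smul_comm, mul_smul_comm, two_mul, add_mul, ← two_smul ℂ, smul_smul, mul_assoc]
    norm_num
  have hA : ∀ k : Fin 2, ∑ᶠ j, coordSpeed z θ (.A k j) * D (.A k j) = 2 * θ * ∑ᶠ j : ℕ+,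
      ((z ^ (-(2 * (k : ℤ) - 1) * (j : ℤ) - 2) : GInfˣ) : GInf) * D (.A k j) := fun k => by
    rw [mul_finsum' _ _ ((h.finite_A k).subset fun j hj hj' => hj (by simp [hj']))]
    exact finsum_congr fun j => mul_assoc _ _ _
  rw [h.calG_eq, finsum_coordName (support_mul_finite h.finite _), ha]
  simp only [hA, h.partialA₀_eq, h.partialA_eq, h.partialM_eq]
  rw [← Finset.mul_sum, ← mul_add, add_comm]
  rfl

end IsGradient

theorem calG_add (F G : SDOne) :
    calG z θ hz hθ (F + G) = calG z θ hz hθ F + calG z θ hz hθ G := by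
  obtain ⟨D, hD⟩ := exists_isGradient (hz := hz) (hθ := hθ) F
  obtain ⟨D', hD'⟩ := exists_isGradient (hz := hz) (hθ := hθ) G
  rw [hD.calG_eq, hD'.calG_eq, (hD.add hD').calG_eq,
    ← finsum_add_distrib (support_mul_finite hD.finite _) (support_mul_finite hD'.finite _)]
  exact finsum_congr fun c => mul_add _ _ _

theorem calG_spec (F : SDOne) :
    HasOddDerivAtZero (fun ε => F.1 (tauSewing z θ hz hθ ε)) (calG z θ hz hθ F) := by
  obtain ⟨D, hD⟩ := exists_isGradient (hz := hz) (hθ := hθ) F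
  rw [hD.calG_eq]
  exact hD.hasOddDerivAtZero

theorem calG_smul (c : ℂ) (F : SDOne) : calG z θ hz hθ (c • F) = c • calG z θ hz hθ F := by
  refine (calG_spec (c • F)).unique fun ε => ?_
  have h := calG_spec (hz := hz) (hθ := hθ) F ε
  dsimp only at h
  change c • F.1 _ - c • F.1 _ = _
  rw [← smul_sub, h, mul_smul_comm]

theorem calG_mul_const (F : SDOne) (c : GInf) :
    calG z θ hz hθ (F * SDOne.const c) = calG z θ hz hθ F * c := by
  refine (calG_spec (F * SDOne.const c)).unique fun ε => ?_
  have h := calG_spec (hz := hz) (hθ := hθ) F ε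
  dsimp only at h
  change F.1 _ * c - F.1 _ * c = _
  rw [← sub_mul, h, mul_assoc]

/-- Bringing ε to the left of F(e) produces the involution, and the product of the two increments
vanishes because it contains ε twice. -/
theorem calG_mul (F G : SDOne) : calG z θ hz hθ (F * G) =
    calG z θ hz hθ F * G.1 identitySK + parityInv (F.1 identitySK) * calG z θ hz hθ G := by
  refine (calG_spec (F * G)).unique fun ε => ?_
  have h := calG_spec (hz := hz) (hθ := hθ) F ε
  have h' := calG_spec (hz := hz) (hθ := hθ) G ε
  have h0 : tauSewing z θ hz hθ 0 = identitySK := by rw [tauSewing_eq, sewnPoint_zero]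
  dsimp only at h h'
  rw [h0] at h h'
  change F.1 _ * G.1 _ - F.1 (tauSewing z θ hz hθ 0) * G.1 (tauSewing z θ hz hθ 0) = _
  rw [h0, eq_add_of_sub_eq h, eq_add_of_sub_eq h', add_mul, mul_add, mul_add,
    ← mul_assoc (_ * _) (ε : GInf), odd_mul_mul_self ε.2, zero_mul, zero_add, ← mul_assoc (F.1 identitySK), mul_odd _ ε.2, mul_add,
    mul_assoc, mul_assoc]
  abel

/-- The functional is purely odd: its even component is zero, and on homogeneous functions the
involution is the Koszul sign. -/
theorem calG_mem_tangentSpace : calG z θ hz hθ ∈ tangentSpace identitySK := by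
  refine ⟨0, calG z θ hz hθ, ⟨⟨⟨fun _ _ => (add_zero 0).symm, fun c _ => (smul_zero c).symm⟩,
    fun _ c => (zero_mul c).symm⟩, fun F G => ?_⟩,
    ⟨⟨⟨calG_add, calG_smul⟩, calG_mul_const⟩, fun p F G hF => ?_⟩, (zero_add _).symm⟩
  · simp
  · rw [calG_mul]
    congr 2
    have h := hF identitySK
    fin_cases p
    · rw [parityInv_even h]
      exact (by simp : (-1 : GInf) ^ 0 * F.1 identitySK = F.1 identitySK).symm
    · rw [parityInv_odd h]
      exact (by simp : (-1 : GInf) ^ 1 * F.1 identitySK = -F.1 identitySK).symm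

end SuperSewing
end

theorem mainTheorem11 (z : GInfˣ) (θ : GInf) (hz : (z : GInf) ∈ gEven) (hθ : θ ∈ gOdd) :
    -- the sewn surface exists and is a unique point of `SK(1)`
    (∀ ε : gOdd, ∃! Q : SKOne, IsTauSewing z θ hz hθ ε Q) ∧
    -- the derivative defining `𝒢_e(z,θ)` exists and is unique
    (∀ F : SDOne, ∃! D : GInf, HasOddDerivAtZero (fun ε => F.1 (tauSewing z θ hz hθ ε)) D) ∧
    -- `𝒢_e(z,θ)` is a supermeromorphic tangent vector at `e`
    calG z θ hz hθ ∈ tangentSpace identitySK ∧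
    -- the partial derivatives at `e` exist, are unique, and only finitely many are nonzero
    (∀ F : SDOne, (∃! D, HasEvenPartialAt identitySK F CoordName.a D) ∧
      ∀ k : Fin 2,
        (∀ j : ℕ+, (∃! D, HasEvenPartialAt identitySK F (CoordName.A k j) D) ∧
          ∃! D, HasOddPartialAt identitySK F (CoordName.M k j) D) ∧
        {j : ℕ+ | partialA k j identitySK F ≠ 0}.Finite ∧
        {j : ℕ+ | partialM k j identitySK F ≠ 0}.Finite) ∧
    -- the formula
    ∀ F : SDOne, calG z θ hz hθ F =
      (∑ k : Fin 2, ∑ᶠ j : ℕ+,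
        ((z ^ (-(2 * (k : ℤ) - 1) * (j : ℤ) - 2 + k) : GInfˣ) : GInf) *
          partialM k j identitySK F) +
      2 * θ * (((z ^ (-2 : ℤ) : GInfˣ) : GInf) * ((1 / 2 : ℂ) • partialA₀ identitySK F) +
        ∑ k : Fin 2, ∑ᶠ j : ℕ+,
          ((z ^ (-(2 * (k : ℤ) - 1) * (j : ℤ) - 2) : GInfˣ) : GInf) *
            partialA k j identitySK F) := by
  refine ⟨fun ε => ⟨_, isTauSewing_sewnPoint hz hθ ε, fun Q hQ => eq_sewnPoint_of_isTauSewing hQ⟩,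
    fun F => ⟨_, calG_spec F, fun D hD => hD.unique (calG_spec F)⟩, calG_mem_tangentSpace,
    fun F => ?_, fun F => ?_⟩
  · obtain ⟨D, hD⟩ := exists_isGradient (hz := hz) (hθ := hθ) F
    refine ⟨⟨_, hD.partial_at .a, fun D' h => HasPartialAt.unique (c := .a) h (hD.partial_at .a)⟩,
      fun k => ⟨fun j => ⟨⟨_, hD.partial_at (.A k j),
        fun D' h => HasPartialAt.unique (c := .A k j) h (hD.partial_at (.A k j))⟩,
        ⟨_, hD.partial_at (.M k j),
          fun D' h => HasPartialAt.unique (c := .M k j) h (hD.partial_at (.M k j))⟩⟩, ?_, ?_⟩⟩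
    · simp only [hD.partialA_eq]
      exact hD.finite_A k
    · simp only [hD.partialM_eq]
      exact hD.finite_M k
  · obtain ⟨D, hD⟩ := exists_isGradient (hz := hz) (hθ := hθ) F
    exact hD.calG_formula
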